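/- **Theorem (Isotropic local law).** Let $p=p_n\in[0,1]$ satisfy $\log n\ll np\ll n$ as $n\to\infty$. Fix $\kappa,\varepsilon\in(0,1)$, a constant $\mathfrak C>0$, and a sequence $(s_n)_{n\ge1}$ of positive numbers with $s_n\to0$ and $s_n\ge n^{-1+\varepsilon}$ for all $n\geq 1$. Let $$m(z)=\frac1{2\pi}\int_{-2}^{2}\frac{\sqrt{4-x^2}}{z-x}\,dx$$ be the Stieltjes transform of the semicircle law, put $\mathcal R(z,W):=(z-W)^{-1}$ for a real symmetric matrix $W$ and $\Im z>0$, and set $$\widetilde{\mathbb H}_\kappa=\Big\{z\in\mathbb C:\ \Im z>0,\ |\Re z|\le\kappa^{-1},\ |\Re z+ 2|\ge\kappa,\ |\Re z-2|\ge\kappa,\ s_n\vee\big((np)\wedge n^{\varepsilon}\big)^{-\mathfrak C}\le\Im z\le\kappa^{-1}\Big\},$$ $$\mathcal U_n=\{u\in\mathbb R^n:\ \|u\|_2=1,\ \|u\|_1\le s_n\,np\}.$$ Let $\nu_d,\nu_o$ be probability laws on $\mathbb R$, not depending on $n$, both with mean zero, $\nu_o$ with unit variance, whose log-Laplace transforms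 $\Lambda_d,\Lambda_o$ satisfy $\sup_{\theta\ne0}\theta^{-2}\max\{\Lambda_d(\theta),\Lambda_o(\theta)\}<\infty$, and such that the limits $\alpha=\lim_{\theta\to+\infty}2\Lambda_d(\theta)/\theta^2$ and $\beta=\lim_{\theta\to+\infty}2\Lambda_o(\theta)/\theta^2$ exist and $\beta\ge\limsup_{\theta\to-\infty}2\Lambda_o(\theta)/\theta^2$. For each $n$, let $G=(G_{i,j})$ and $\Xi=(\xi_{i,j})$ be random real symmetric $n\times n$ matrices such that all the variables $G_{i,j},\xi_{i,j}$, $i\le j$, are jointly independent, $G_{i,i}\sim\nu_d$, $G_{i,j}\sim\nu_o$ for $i<j$, and $\xi_{i,j}\sim\mathrm{Ber}(p)$. Let $X$ be the matrix with entries $X_{i,j}=G_{i,j}\xi_{i,j}/\sqrt{np}$. Then $$\lim_{n\to\infty}\ \sup_{z\in\widetilde{\mathbb H}_\kappa}\ \sup_{u\in\mathcal U_n}\ \big|\mathbb E\langle u,\mathcal R(z,X)u\rangle-m(z)\big|=0,$$ where the supremum over an empty set is $0$. Moreover, the same holds with $X$ replaced by $\mathrm{Adj}_o/\sqrt{np}$,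 where $\mathrm{Adj}_o=\mathrm{Adj}-\mathbb E\,\mathrm{Adj}$ and $\mathrm{Adj}$ is the adjacency matrix of an Erdős–Rényi graph: the random symmetric $n\times n$ matrix with zero diagonal and i.i.d. $\mathrm{Ber}(p)$ entries above the diagonal. -/

import Mathlib

open MeasureTheory ProbabilityTheory Filter Topology Asymptotics
open scoped ENNReal

namespace SparseWigner

/-- Positions on and above the diagonal of an `n × n` matrix. -/
abbrev UpperIdx (n : ℕ) : Type := {q : Fin n × Fin n // q.1 ≤ q.2}

/-- Positions strictly above the diagonal of an `n × n` matrix. -/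
abbrev StrictUpperIdx (n : ℕ) : Type := {q : Fin n × Fin n // q.1 < q.2}

/-- A law on `ℝ` is sub-Gaussian: its Laplace transform is finite and its log-Laplace transform
`Λ` satisfies `sup_{θ ≠ 0} Λ(θ) / θ² < ∞`. -/
structure IsSubGaussianLaw (ν : Measure ℝ) : Prop where
  integrable_exp : ∀ θ : ℝ, Integrable (fun x : ℝ => Real.exp (θ * x)) ν
  bddAbove : ∃ C : ℝ, ∀ θ : ℝ, θ ≠ 0 → cgf id ν θ / θ ^ 2 ≤ C

/-- The assumption on the law `νd` of the diagonal entries and the law `νo` of the off-diagonal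
entries of the weight matrix: both are centred, `νo` has unit variance, both are sub-Gaussian, the
limits `α = lim_{θ → ∞} 2 Λ_d(θ) / θ²` and `β = lim_{θ → ∞} 2 Λ_o(θ) / θ²` exist, and
`β ≥ limsup_{θ → -∞} 2 Λ_o(θ) / θ²`. -/
structure EntryAssumption (νd νo : Measure ℝ) : Prop where
  mean_diag : ∫ x, x ∂νd = 0
  mean_off : ∫ x, x ∂νo = 0
  variance_off : variance id νo = 1
  subGaussian_diag : IsSubGaussianLaw νd
  subGaussian_off : IsSubGaussianLaw νo
  limit_diag : ∃ α : ℝ, Tendsto (fun θ : ℝ => 2 * cgf id νd θ / θ ^ 2) atTop (𝓝 α)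
  limit_off : ∃ β : ℝ, Tendsto (fun θ : ℝ => 2 * cgf id νo θ / θ ^ 2) atTop (𝓝 β) ∧
    limsup (fun θ : ℝ => 2 * cgf id νo θ / θ ^ 2) atBot ≤ β

/-- `G` is a symmetric random weight matrix with diagonal law `νd` and off-diagonal law `νo`, `Ξ` is
a symmetric random matrix with `Ber(p)` entries, and all the entries of `G` and `Ξ` on and above the
diagonal are jointly independent. -/
structure IsSparseModel {n : ℕ} {Ω : Type*} [MeasurableSpace Ω] (P : Measure Ω)
    (νd νo : Measure ℝ) (p : unitInterval) (G Ξ : Ω → Matrix (Fin n) (Fin n) ℝ) : Prop where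
  symm_G : ∀ ω, (G ω).IsSymm
  symm_Ξ : ∀ ω, (Ξ ω).IsSymm
  law_diag : ∀ i, HasLaw (fun ω => G ω i i) νd P
  law_off : ∀ i j, i < j → HasLaw (fun ω => G ω i j) νo P
  law_Ξ : ∀ i j, i ≤ j → HasLaw (fun ω => Ξ ω i j) (bernoulliMeasure (1 : ℝ) 0 p) P
  indep : iIndepFun (Sum.elim
    (fun (q : UpperIdx n) (ω : Ω) => G ω q.1.1 q.1.2)
    (fun (q : UpperIdx n) (ω : Ω) => Ξ ω q.1.1 q.1.2)) P

/-- The sparse Wigner matrix `X = (G ∘ Ξ) / √(np)`, with `∘` the entrywise product. -/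
noncomputable def sparseWigner {n : ℕ} (p : ℝ) (G Ξ : Matrix (Fin n) (Fin n) ℝ) :
    Matrix (Fin n) (Fin n) ℝ :=
  (Real.sqrt (n * p))⁻¹ • Matrix.hadamard G Ξ

/-- `A` is the adjacency matrix of an Erdős–Rényi graph on `n` vertices with parameter `p`. -/
structure IsErdosRenyi {n : ℕ} {Ω : Type*} [MeasurableSpace Ω] (P : Measure Ω)
    (p : unitInterval) (A : Ω → Matrix (Fin n) (Fin n) ℝ) : Prop where
  symm : ∀ ω, (A ω).IsSymm
  diag : ∀ ω i, A ω i i = 0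
  law : ∀ i j, i < j → HasLaw (fun ω => A ω i j) (bernoulliMeasure (1 : ℝ) 0 p) P
  indep : iIndepFun (fun (q : StrictUpperIdx n) (ω : Ω) => A ω q.1.1 q.1.2) P

/-- The centred random matrix `A - 𝔼 A`. -/
noncomputable def centred {n : ℕ} {Ω : Type*} [MeasurableSpace Ω] (P : Measure Ω)
    (A : Ω → Matrix (Fin n) (Fin n) ℝ) (ω : Ω) : Matrix (Fin n) (Fin n) ℝ :=
  Matrix.of fun i j => A ω i j - ∫ ω', A ω' i j ∂P

/-- The Stieltjes transform of the semicircle law,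
`m(z) = (2π)⁻¹ ∫_{-2}^{2} √(4 - x²) / (z - x) dx`. -/
noncomputable def semicircleStieltjes (z : ℂ) : ℂ :=
  (1 / (2 * (Real.pi : ℂ))) * ∫ x in (-2 : ℝ)..2, (Real.sqrt (4 - x ^ 2) : ℂ) / (z - (x : ℂ))

/-- The resolvent `R(z, W) = (z - W)⁻¹` of a real matrix. -/
noncomputable def resolventMatrix {n : ℕ} (z : ℂ) (W : Matrix (Fin n) (Fin n) ℝ) :
    Matrix (Fin n) (Fin n) ℂ :=
  (z • (1 : Matrix (Fin n) (Fin n) ℂ) - W.map (fun x : ℝ => (x : ℂ)))⁻¹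

/-- The quadratic form `⟨u, R(z, W) u⟩` at a real vector `u`. -/
noncomputable def resolventForm {n : ℕ} (z : ℂ) (W : Matrix (Fin n) (Fin n) ℝ)
    (u : EuclideanSpace ℝ (Fin n)) : ℂ :=
  ∑ i, ∑ j, (u i : ℂ) * resolventMatrix z W i j * (u j : ℂ)

/-- The part of the upper half plane whose real parts are bounded by `κ⁻¹` and `κ`-away
from `±2`. -/
def halfPlane (κ : ℝ) : Set ℂ :=
  {z | 0 < z.im ∧ |z.re| ≤ κ⁻¹ ∧ κ ≤ |z.re + 2| ∧ κ ≤ |z.re - 2|}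

/-- The spectral domain: `z ∈ halfPlane κ` with
`s_n ∨ ((np) ∧ n^ε)^(-c) ≤ Im z ≤ κ⁻¹`. Here `sn` and `p` are the values at `n`. -/
def spectralDomain (κ ε c : ℝ) (n : ℕ) (p sn : ℝ) : Set ℂ :=
  {z | z ∈ halfPlane κ ∧ max sn ((min (n * p) ((n : ℝ) ^ ε)) ^ (-c)) ≤ z.im ∧ z.im ≤ κ⁻¹}

/-- Unit vectors `u ∈ ℝⁿ` with `‖u‖₁ ≤ s_n n p`. -/
def testVectors (n : ℕ) (p sn : ℝ) : Set (EuclideanSpace ℝ (Fin n)) :=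
  {u | ‖u‖ = 1 ∧ ∑ i, |u i| ≤ sn * (n * p)}

/-- `sup_z sup_u |𝔼 ⟨u, R(z, W) u⟩ - m(z)|` over the spectral domain and the test vectors, as an
extended nonnegative real (so the supremum over an empty set is `0`). -/
noncomputable def isotropicError (κ ε c : ℝ) {n : ℕ} (p sn : ℝ) {Ω : Type*} [MeasurableSpace Ω]
    (P : Measure Ω) (W : Ω → Matrix (Fin n) (Fin n) ℝ) : ℝ≥0∞ :=
  ⨆ z ∈ spectralDomain κ ε c n p sn, ⨆ u ∈ testVectors n p sn,
    ‖(∫ ω, resolventForm z (W ω) u ∂P) - semicircleStieltjes z‖ₑ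

end SparseWigner

/-! Write `R` for the resolvent, `η = Im z`, `g` for the normalised trace of `R`, and `δ =
(np)^(-1/2)` for the scale of a matrix entry. Let `t` be a small negative power of `min(np, n^ε)`,
chosen so that `δ ≤ t^4` and `1/(nη) ≤ t^8`. The quadratic form splits into diagonal entries, with
`𝔼 R_ii = m(z) + O(t)` (`exists_integral_resolvent_diag_sub_le`), and off-diagonal entries, with `|𝔼
R_ij| = O(δ^4 + δ/n)` (`exists_integral_resolvent_offdiag_le`). As `‖u‖₁ ≤ s_n np` and, by
Cauchy–Schwarz, `‖u‖₁² ≤ n`, the off-diagonal entries contribute `O(s_n² + δ)`, which tends to zero.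

Diagonal entries. Schur's formula reads `R_ii (z - g - E_i) = 1`, where the error `E_i` consists of
a linear and a quadratic form in row `i`, which is independent of the minor. Rosenthal-type moment
bounds, proved by adding one index at a time, together with the Ward identity make `E_i` small.
Averaging over `i` gives `g (z - g) ≈ 1`, an equation with the two roots `m` and `1/m`. In the bulk
the root `1/m` is excluded by the sign of `Im g`. Outside the bulk it is excluded by `|g| ≤ 1`,
which is propagated down from large `η`. Boundedness of all moments of the entries of `R` is proved
by induction on the scale: `Controlled κ K J` concerns `η ≥ t^J`, and going to `J + 1` costs a
factor `1/t` a priori, which the powers of `t^8` from the moment bounds more than repay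
(`Controlled.succ`). All of this is done for matrices with some entries switched off, so that minors
belong to the same class.

Off-diagonal entries. A bound on the modulus of `R_ij` would be too weak, so the expectation must be
exploited. Attach a deterministic sign to each entry and regard `𝔼 R_ij` as a function of the signs.
Flipping the signs of row `u` conjugates the matrix by a diagonal sign matrix, so `𝔼 R_ij` changes
sign exactly when `u` is `i` or `j`. It is therefore controlled by the differences across the single
edges `(i, k)`, and each such difference is again odd, now at `k` and `j`. Iterating produces walks
started at `i`. The entries are centred and a difference under reflection has no second-order term,
so each edge is a third-order effect of size `𝔼|x|^3 ~ δ/n`. Four free steps give `(n · δ/n)^4 =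
δ^4`. A walk that hits `j` stops with one factor `δ/n` not compensated by a choice of vertex.

For the Erdős–Rényi graph the entries have variance `p (1 - p)`. The matrix is `√(1 - p)` times a
normalised one, and the dilation is absorbed by the stability of the equation for `m`. -/

namespace SparseWigner

/-! ### Deterministic resolvent identities and bounds. -/

section Resolvent

variable {n : ℕ} {W W' : Matrix (Fin n) (Fin n) ℝ} {z z' : ℂ}

/-- The matrix `z - W`. -/
noncomputable def shifted (z : ℂ) (W : Matrix (Fin n) (Fin n) ℝ) : Matrix (Fin n) (Fin n) ℂ :=
  z • (1 : Matrix (Fin n) (Fin n) ℂ) - W.map (fun x : ℝ => (x : ℂ))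

lemma shifted_apply (z : ℂ) (W : Matrix (Fin n) (Fin n) ℝ) (i j : Fin n) :
    shifted z W i j = (if i = j then z else 0) - (W i j : ℂ) := by
  simp [shifted, Matrix.one_apply]

lemma resolventMatrix_eq (z : ℂ) (W : Matrix (Fin n) (Fin n) ℝ) :
    resolventMatrix z W = (shifted z W)⁻¹ := rfl

lemma shifted_transpose (hW : W.IsSymm) : (shifted z W).transpose = shifted z W := by
  ext i j
  simp only [Matrix.transpose_apply, shifted_apply, hW.apply i j, eq_comm (a := i)]

/-- The numerical range of `z - W` has imaginary part `Im z`. -/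
lemma im_quadratic_shifted (hW : W.IsSymm) (v : Fin n → ℂ) :
    (∑ i, ∑ j, star (v i) * shifted z W i j * v j).im = z.im * ∑ i, ‖v i‖ ^ 2 := by
  have hreal : (∑ i, ∑ j, star (v i) * (W i j : ℂ) * v j).im = 0 := by
    rw [← Complex.conj_eq_iff_im, map_sum]
    simp_rw [map_sum]
    rw [Finset.sum_comm]
    refine Finset.sum_congr rfl fun i _ => Finset.sum_congr rfl fun j _ => ?_
    simp [hW.apply i j]
    ring
  have hsplit : (∑ i, ∑ j, star (v i) * shifted z W i j * v j)
      = z * ((∑ i, ‖v i‖ ^ 2 : ℝ) : ℂ) - ∑ i, ∑ j, star (v i) * (W i j : ℂ) * v j := by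
    push_cast
    rw [Finset.mul_sum, ← Finset.sum_sub_distrib]
    refine Finset.sum_congr rfl fun i _ => ?_
    simp only [shifted_apply, mul_sub, sub_mul, Finset.sum_sub_distrib]
    congr 1
    simp only [mul_ite, mul_zero, ite_mul, zero_mul, Finset.sum_ite_eq, Finset.mem_univ, if_true]
    rw [← Complex.conj_mul']
    simp
    ring
  rw [hsplit, Complex.sub_im, hreal, Complex.im_mul_ofReal, sub_zero]

/-- A null vector would annihilate the quadratic form, whose imaginary part is `Im z` times its
squared norm. -/
lemma isUnit_det_shifted (hW : W.IsSymm) (hz : 0 < z.im) : IsUnit (shifted z W).det := by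
  rw [isUnit_iff_ne_zero]
  intro h
  obtain ⟨v, hv, hAv⟩ := Matrix.exists_mulVec_eq_zero_iff.mpr h
  have h1 := im_quadratic_shifted (z := z) hW v
  have h2 : (∑ i, ∑ j, star (v i) * shifted z W i j * v j) = 0 := by
    refine Finset.sum_eq_zero fun i _ => ?_
    have := congrFun hAv i
    simp only [Matrix.mulVec, dotProduct, Pi.zero_apply] at this
    simp_rw [mul_assoc]
    rw [← Finset.mul_sum, this, mul_zero]
  rw [h2, Complex.zero_im] at h1
  have h3 : ∑ i, ‖v i‖ ^ 2 = 0 := by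
    rcases mul_eq_zero.mp h1.symm with h | h
    · exact absurd h hz.ne'
    · exact h
  apply hv
  funext i
  have := (Finset.sum_eq_zero_iff_of_nonneg (fun i _ => by positivity)).mp h3 i (Finset.mem_univ i)
  simpa using this

lemma resolvent_mul_shifted (hW : W.IsSymm) (hz : 0 < z.im) :
    resolventMatrix z W * shifted z W = 1 :=
  Matrix.nonsing_inv_mul _ (isUnit_det_shifted hW hz)

lemma shifted_mul_resolvent (hW : W.IsSymm) (hz : 0 < z.im) :
    shifted z W * resolventMatrix z W = 1 :=
  Matrix.mul_nonsing_inv _ (isUnit_det_shifted hW hz)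

lemma resolvent_symm (hW : W.IsSymm) (i j : Fin n) :
    resolventMatrix z W i j = resolventMatrix z W j i := by
  have : (resolventMatrix z W).transpose = resolventMatrix z W := by
    rw [resolventMatrix_eq, Matrix.transpose_nonsing_inv, shifted_transpose hW]
  exact congrFun (congrFun this j) i

lemma resolvent_sub_resolvent (hW : W.IsSymm) (hW' : W'.IsSymm) (hz : 0 < z.im) :
    resolventMatrix z W - resolventMatrix z W' =
      resolventMatrix z W * (W - W').map (fun x : ℝ => (x : ℂ)) * resolventMatrix z W' := by
  have : (W - W').map (fun x : ℝ => (x : ℂ)) = shifted z W' - shifted z W := by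
    ext i j; simp [shifted]
  rw [this, Matrix.mul_sub, Matrix.sub_mul, resolvent_mul_shifted hW hz, Matrix.mul_assoc,
    shifted_mul_resolvent hW' hz, Matrix.one_mul, Matrix.mul_one]

lemma resolvent_sub_resolvent_spectral (hW : W.IsSymm) (hz : 0 < z.im) (hz' : 0 < z'.im) :
    resolventMatrix z' W - resolventMatrix z W =
      (z - z') • (resolventMatrix z' W * resolventMatrix z W) := by
  have : shifted z W - shifted z' W = (z - z') • (1 : Matrix (Fin n) (Fin n) ℂ) := by
    simp [shifted, sub_smul]
  have h : resolventMatrix z' W * (shifted z W - shifted z' W) * resolventMatrix z W =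
      (z - z') • (resolventMatrix z' W * resolventMatrix z W) := by
    rw [this]; simp
  rw [← h, Matrix.mul_sub, Matrix.sub_mul, resolvent_mul_shifted hW hz', Matrix.mul_assoc,
    shifted_mul_resolvent hW hz, Matrix.one_mul, Matrix.mul_one]

/-- Ward identity. -/
lemma resolvent_ward (hW : W.IsSymm) (hz : 0 < z.im) (k : Fin n) :
    (resolventMatrix z W k k).im = - (z.im * ∑ l, ‖resolventMatrix z W k l‖ ^ 2) := by
  have h1 := shifted_mul_resolvent hW hz
  -- The numerical range is tested on the `k`-th column of the resolvent. Since `z - W` sends it to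
  -- the `k`-th basis vector, the form collapses to the conjugate of `R_kk`.
  have h := im_quadratic_shifted (z := z) hW (fun i => resolventMatrix z W i k)
  have h2 : ∑ i, ∑ j, star (resolventMatrix z W i k) * shifted z W i j * resolventMatrix z W j k
      = star (resolventMatrix z W k k) := by
    have : ∀ i, ∑ j, star (resolventMatrix z W i k) * shifted z W i j * resolventMatrix z W j k
        = star (resolventMatrix z W i k) * (if i = k then 1 else 0) := by
      intro i
      have := congrFun (congrFun h1 i) k
      rw [Matrix.mul_apply, Matrix.one_apply] at this
      simp_rw [mul_assoc]
      rw [← Finset.mul_sum, this]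
    simp_rw [this]
    simp
  rw [h2] at h
  have h3 : ∑ i, ‖resolventMatrix z W i k‖ ^ 2 = ∑ l, ‖resolventMatrix z W k l‖ ^ 2 :=
    Finset.sum_congr rfl fun i _ => by rw [resolvent_symm hW]
  rw [h3] at h
  have h4 : (star (resolventMatrix z W k k)).im = -(resolventMatrix z W k k).im := by simp
  linarith

lemma sum_norm_sq_resolvent_le (hW : W.IsSymm) (hz : 0 < z.im) (k : Fin n) :
    ∑ l, ‖resolventMatrix z W k l‖ ^ 2 ≤ ‖resolventMatrix z W k k‖ / z.im := by
  rw [le_div_iff₀ hz]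
  have h := resolvent_ward hW hz k
  have := Complex.abs_im_le_norm (resolventMatrix z W k k)
  have := neg_abs_le (resolventMatrix z W k k).im
  linarith

lemma resolvent_diag_im_nonpos (hW : W.IsSymm) (hz : 0 < z.im) (k : Fin n) :
    (resolventMatrix z W k k).im ≤ 0 := by
  rw [resolvent_ward hW hz k]
  have : 0 ≤ z.im * ∑ l, ‖resolventMatrix z W k l‖ ^ 2 := by positivity
  linarith

lemma norm_resolvent_diag_le (hW : W.IsSymm) (hz : 0 < z.im) (k : Fin n) :
    ‖resolventMatrix z W k k‖ ≤ 1 / z.im := by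
  have h1 := sum_norm_sq_resolvent_le hW hz k
  have h2 : ‖resolventMatrix z W k k‖ ^ 2 ≤ ∑ l, ‖resolventMatrix z W k l‖ ^ 2 :=
    Finset.single_le_sum (f := fun l => ‖resolventMatrix z W k l‖ ^ 2)
      (fun i _ => by positivity) (Finset.mem_univ k)
  rcases (norm_nonneg (resolventMatrix z W k k)).eq_or_lt with h | h
  · rw [← h]; positivity
  · have h3 := h2.trans h1
    rw [sq, div_eq_mul_one_div] at h3
    exact le_of_mul_le_mul_left h3 h

lemma norm_resolvent_le (hW : W.IsSymm) (hz : 0 < z.im) (k l : Fin n) :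
    ‖resolventMatrix z W k l‖ ≤ 1 / z.im := by
  have h1 := sum_norm_sq_resolvent_le hW hz k
  have h2 : ‖resolventMatrix z W k l‖ ^ 2 ≤ ∑ l, ‖resolventMatrix z W k l‖ ^ 2 :=
    Finset.single_le_sum (f := fun l => ‖resolventMatrix z W k l‖ ^ 2)
      (fun i _ => by positivity) (Finset.mem_univ l)
  have h3 : ‖resolventMatrix z W k k‖ / z.im ≤ (1 / z.im) ^ 2 := by
    rw [sq, div_eq_mul_one_div]
    exact mul_le_mul_of_nonneg_right (norm_resolvent_diag_le hW hz k) (by positivity)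
  exact le_of_sq_le_sq (h2.trans (h1.trans h3)) (by positivity)

/-- The resolvent is bounded by `1 / Im z` as an operator. -/
lemma sum_norm_sq_vecMul_resolvent_le (hW : W.IsSymm) (hz : 0 < z.im) (a : Fin n → ℂ) :
    ∑ l, ‖∑ m, a m * resolventMatrix z W m l‖ ^ 2 ≤ (∑ m, ‖a m‖ ^ 2) / z.im ^ 2 := by
  set y : Fin n → ℂ := fun l => ∑ m, a m * resolventMatrix z W m l with hy
  -- Testing on `y = R a` replaces the spectral theorem: `Im z ‖y‖² = Im ⟨y, a⟩`, and a weighted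
  -- arithmetic-geometric mean inequality concludes.
  have h := im_quadratic_shifted (z := z) hW y
  have h2 : ∀ i, ∑ j, star (y i) * shifted z W i j * y j = star (y i) * a i := by
    intro i
    simp_rw [mul_assoc]
    rw [← Finset.mul_sum]
    congr 1
    have : ∀ j, shifted z W i j * y j
        = ∑ m, a m * (shifted z W i j * resolventMatrix z W j m) := by
      intro j
      simp only [hy, Finset.mul_sum]
      refine Finset.sum_congr rfl fun m _ => ?_
      rw [resolvent_symm hW m j]; ring
    simp_rw [this]
    rw [Finset.sum_comm]
    simp_rw [← Finset.mul_sum]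
    have h3 : ∀ m, ∑ j, shifted z W i j * resolventMatrix z W j m = if i = m then 1 else 0 := by
      intro m
      rw [← Matrix.mul_apply, shifted_mul_resolvent hW hz, Matrix.one_apply]
    simp [h3]
  simp_rw [h2] at h
  rw [Complex.im_sum] at h
  have h4 : ∑ i, (star (y i) * a i).im
      ≤ ∑ i, (‖a i‖ ^ 2 / (2 * z.im) + z.im / 2 * ‖y i‖ ^ 2) := by
    refine Finset.sum_le_sum fun i _ => ?_
    have h5 : (star (y i) * a i).im ≤ ‖y i‖ * ‖a i‖ := by
      refine (le_abs_self _).trans ((Complex.abs_im_le_norm _).trans ?_)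
      simp
    have h6 : ‖y i‖ * ‖a i‖ ≤ ‖a i‖ ^ 2 / (2 * z.im) + z.im / 2 * ‖y i‖ ^ 2 := by
      have : ‖a i‖ ^ 2 / (2 * z.im) + z.im / 2 * ‖y i‖ ^ 2 - ‖y i‖ * ‖a i‖
          = (‖a i‖ - z.im * ‖y i‖) ^ 2 / (2 * z.im) := by field_simp; ring
      have h7 : 0 ≤ (‖a i‖ - z.im * ‖y i‖) ^ 2 / (2 * z.im) := by positivity
      linarith
    exact h5.trans h6
  rw [Finset.sum_add_distrib, ← Finset.sum_div, ← Finset.mul_sum, h] at h4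
  rw [le_div_iff₀ (by positivity)]
  have h8 : z.im / 2 * ∑ i, ‖y i‖ ^ 2 ≤ (∑ i, ‖a i‖ ^ 2) / (2 * z.im) := by linarith
  rw [le_div_iff₀ (by positivity)] at h8
  nlinarith

/-- Comparison of the resolvents at two points of the same vertical line. -/
lemma norm_resolvent_sub_le (hW : W.IsSymm) (hz' : 0 < z'.im) (hre : z'.re = z.re)
    (hle : z'.im ≤ z.im) (k l : Fin n) :
    ‖resolventMatrix z' W k l - resolventMatrix z W k l‖ ≤ (z.im - z'.im) / z'.im *
      ((-(resolventMatrix z W k k).im + -(resolventMatrix z W l l).im) / 2) := by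
  have hz : 0 < z.im := hz'.trans_le hle
  set R := resolventMatrix z W with hR
  set R' := resolventMatrix z' W with hR'
  have h1 : R' - R = (z - z') • (R' * R) := resolvent_sub_resolvent_spectral hW hz hz'
  have h1' : R - R' = (z' - z) • (R * R') := resolvent_sub_resolvent_spectral hW hz' hz
  have h1'' : R' = R + (z - z') • (R * R') := by
    rw [← neg_sub z' z, neg_smul, ← h1']; abel
  -- In this expansion the outer factors are all resolvents at the upper point `z`, so the Ward
  -- identity there bounds their rows; only the operator bound `1 / Im z'` is needed for `R'`.
  have h2 : R' - R = (z - z') • (R * R) + ((z - z') * (z - z')) • (R * R' * R) := by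
    rw [h1]
    conv_lhs => rw [h1'']
    rw [Matrix.add_mul, smul_add, Matrix.smul_mul, smul_smul]
  have hnorm : ‖z - z'‖ = z.im - z'.im := by
    have : z - z' = ((z.im - z'.im : ℝ) : ℂ) * Complex.I := by
      apply Complex.ext <;> simp [hre]
    rw [this, norm_mul, Complex.norm_I, mul_one, Complex.norm_real, Real.norm_eq_abs,
      abs_of_nonneg (by linarith)]
  have e := congrFun (congrFun h2 k) l
  simp only [Matrix.sub_apply, Matrix.add_apply, Matrix.smul_apply, smul_eq_mul] at e
  have hk : ∑ j, ‖R k j‖ ^ 2 ≤ -(R k k).im / z.im := by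
    rw [hR, resolvent_ward hW hz k, neg_neg, mul_div_cancel_left₀ _ hz.ne']
  have hl : ∑ j, ‖R l j‖ ^ 2 ≤ -(R l l).im / z.im := by
    rw [hR, resolvent_ward hW hz l, neg_neg, mul_div_cancel_left₀ _ hz.ne']
  set p := -(R k k).im
  set q := -(R l l).im
  have b1 : ‖(R * R) k l‖ ≤ (p + q) / 2 / z.im := by
    rw [Matrix.mul_apply]
    calc ‖∑ j, R k j * R j l‖ ≤ ∑ j, (‖R k j‖ ^ 2 / 2 + ‖R l j‖ ^ 2 / 2) := by
          refine (norm_sum_le _ _).trans (Finset.sum_le_sum fun j _ => ?_)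
          rw [norm_mul, hR, resolvent_symm hW j l]
          nlinarith [sq_nonneg (‖resolventMatrix z W k j‖ - ‖resolventMatrix z W l j‖)]
      _ ≤ (p + q) / 2 / z.im := by
          rw [Finset.sum_add_distrib, ← Finset.sum_div, ← Finset.sum_div]
          have : (p + q) / 2 / z.im = p / z.im / 2 + q / z.im / 2 := by ring
          rw [this]; linarith
  have b2 : ‖(R * R' * R) k l‖ ≤ (p + q) / 2 / z.im / z'.im := by
    rw [Matrix.mul_apply]
    have h5 := sum_norm_sq_vecMul_resolvent_le (z := z') hW hz' (fun m => R k m)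
    simp_rw [← hR', ← Matrix.mul_apply] at h5
    calc ‖∑ j, (R * R') k j * R j l‖
        ≤ ∑ j, (z'.im / 2 * ‖(R * R') k j‖ ^ 2 + ‖R l j‖ ^ 2 / (2 * z'.im)) := by
          refine (norm_sum_le _ _).trans (Finset.sum_le_sum fun j _ => ?_)
          rw [norm_mul, hR, resolvent_symm hW j l, ← hR]
          have : z'.im / 2 * ‖(R * R') k j‖ ^ 2 + ‖R l j‖ ^ 2 / (2 * z'.im)
            - ‖(R * R') k j‖ * ‖R l j‖ = (z'.im * ‖(R * R') k j‖ - ‖R l j‖) ^ 2 / (2 * z'.im) := by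
              field_simp; ring
          have h7 : 0 ≤ (z'.im * ‖(R * R') k j‖ - ‖R l j‖) ^ 2 / (2 * z'.im) := by positivity
          linarith
      _ = z'.im / 2 * ∑ j, ‖(R * R') k j‖ ^ 2 + (∑ j, ‖R l j‖ ^ 2) / (2 * z'.im) := by
          rw [Finset.sum_add_distrib, ← Finset.mul_sum, ← Finset.sum_div]
      _ ≤ z'.im / 2 * (p / z.im / z'.im ^ 2) + (q / z.im) / (2 * z'.im) := by
          gcongr
          exact h5.trans (by gcongr)
      _ = (p + q) / 2 / z.im / z'.im := by field_simp
  have hd : 0 ≤ z.im - z'.im := by linarith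
  rw [e]
  calc ‖(z - z') * (R * R) k l + (z - z') * (z - z') * (R * R' * R) k l‖
      ≤ (z.im - z'.im) * ((p + q) / 2 / z.im)
        + (z.im - z'.im) * (z.im - z'.im) * ((p + q) / 2 / z.im / z'.im) := by
        refine (norm_add_le _ _).trans ?_
        rw [norm_mul, norm_mul, norm_mul, hnorm]
        gcongr
    _ = (z.im - z'.im) / z'.im * ((p + q) / 2) := by field_simp; ring

/-- Lowering the spectral parameter costs at most the ratio of the heights. This is how the
induction over scales goes down. -/
lemma norm_resolvent_le_of_im_le (hW : W.IsSymm) (hz' : 0 < z'.im) (hre : z'.re = z.re)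
    (hle : z'.im ≤ z.im) (k l : Fin n) :
    ‖resolventMatrix z' W k l‖ ≤ ‖resolventMatrix z W k l‖ + z.im / z'.im *
      (‖resolventMatrix z W k k‖ + ‖resolventMatrix z W l l‖) := by
  have h := norm_resolvent_sub_le hW hz' hre hle k l
  have h1 := norm_sub_norm_le (resolventMatrix z' W k l) (resolventMatrix z W k l)
  have h2 : (z.im - z'.im) / z'.im *
      ((-(resolventMatrix z W k k).im + -(resolventMatrix z W l l).im) / 2) ≤ z.im / z'.im *
      (‖resolventMatrix z W k k‖ + ‖resolventMatrix z W l l‖) := by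
    have hz : 0 < z.im := hz'.trans_le hle
    have hk := (neg_le_abs _).trans (Complex.abs_im_le_norm (resolventMatrix z W k k))
    have hl := (neg_le_abs _).trans (Complex.abs_im_le_norm (resolventMatrix z W l l))
    have hk0 := resolvent_diag_im_nonpos hW hz k
    have hl0 := resolvent_diag_im_nonpos hW hz l
    refine mul_le_mul ?_ (by linarith) (by linarith) (by positivity)
    gcongr
    linarith
  linarith

/-- The matrix `W` with the `i`-th row and the `i`-th column replaced by zero. -/
def removeRow (i : Fin n) (W : Matrix (Fin n) (Fin n) ℝ) : Matrix (Fin n) (Fin n) ℝ :=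
  Matrix.of fun k l => if k = i ∨ l = i then 0 else W k l

lemma removeRow_isSymm (hW : W.IsSymm) (i : Fin n) : (removeRow i W).IsSymm := by
  ext k l
  simp only [Matrix.transpose_apply, removeRow, Matrix.of_apply, hW.apply k l, or_comm]

lemma resolvent_row_of_zero (hW : W.IsSymm) (hz : 0 < z.im) {i : Fin n} (hi : ∀ j, W i j = 0)
    (j : Fin n) : resolventMatrix z W i j = if i = j then 1 / z else 0 := by
  have hz0 : z ≠ 0 := by rintro rfl; simp at hz
  have h := congrFun (congrFun (shifted_mul_resolvent hW hz) i) j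
  rw [Matrix.mul_apply, Matrix.one_apply] at h
  simp only [shifted_apply, hi, Complex.ofReal_zero, sub_zero, ite_mul, zero_mul,
    Finset.sum_ite_eq, Finset.mem_univ, if_true] at h
  split_ifs at h ⊢ with hij
  · rw [eq_div_iff hz0, mul_comm, h]
  · exact (mul_eq_zero.mp h).resolve_left hz0

/-- The linear form `∑_{k ≠ i} W_{ik} R'_{kj}`, with `R'` the resolvent of `removeRow i W`. -/
noncomputable def rowForm (z : ℂ) (W : Matrix (Fin n) (Fin n) ℝ) (i j : Fin n) : ℂ :=
  ∑ k ∈ Finset.univ.erase i, (W i k : ℂ) * resolventMatrix z (removeRow i W) k j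

lemma removeRow_row (i j : Fin n) : removeRow i W i j = 0 := by simp [removeRow]

/-- The difference of the two matrices lives on row and column `i`. In the decoupled resolvent `R'`
one has `R'_ij = 0` for `j ≠ i`, so in the resolvent identity only the terms through row `i`
survive. -/
lemma resolvent_eq_removeRow_add (hW : W.IsSymm) (hz : 0 < z.im) {i j : Fin n} (hj : j ≠ i)
    (k : Fin n) : resolventMatrix z W k j =
      resolventMatrix z (removeRow i W) k j + resolventMatrix z W k i * rowForm z W i j := by
  have hW' := removeRow_isSymm hW i
  have h := congrFun (congrFun (resolvent_sub_resolvent hW hW' hz) k) j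
  rw [Matrix.sub_apply, sub_eq_iff_eq_add'] at h
  rw [h, Matrix.mul_assoc, Matrix.mul_apply]
  congr 1
  have hR : resolventMatrix z (removeRow i W) i j = 0 := by
    rw [resolvent_row_of_zero hW' hz (fun j => removeRow_row i j), if_neg hj.symm]
  rw [Finset.sum_eq_single i]
  · congr 1
    rw [Matrix.mul_apply, rowForm, ← Finset.add_sum_erase _ _ (Finset.mem_univ i), hR, mul_zero,
      zero_add]
    refine Finset.sum_congr rfl fun b _ => ?_
    simp [removeRow]
  · intro a _ ha
    rw [Matrix.mul_apply, Finset.sum_eq_zero, mul_zero]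
    intro b _
    by_cases hb : b = i
    · rw [hb, hR, mul_zero]
    · simp [removeRow, ha, hb]
  · simp

lemma resolvent_offdiag_eq (hW : W.IsSymm) (hz : 0 < z.im) {i j : Fin n} (hj : j ≠ i) :
    resolventMatrix z W i j = resolventMatrix z W i i * rowForm z W i j := by
  rw [resolvent_eq_removeRow_add hW hz hj i, resolvent_row_of_zero (removeRow_isSymm hW i) hz
    (fun j => removeRow_row i j), if_neg hj.symm, zero_add]

/-- Schur's complement formula. -/
lemma resolvent_diag_mul_schur (hW : W.IsSymm) (hz : 0 < z.im) (i : Fin n) :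
    resolventMatrix z W i i *
      (z - W i i - ∑ j ∈ Finset.univ.erase i, rowForm z W i j * (W i j : ℂ)) = 1 := by
  have h := congrFun (congrFun (resolvent_mul_shifted hW hz) i) i
  rw [Matrix.mul_apply, Matrix.one_apply_eq, ← Finset.add_sum_erase _ _ (Finset.mem_univ i),
    shifted_apply, if_pos rfl] at h
  rw [← h, mul_sub, Finset.mul_sum, sub_eq_add_neg, ← Finset.sum_neg_distrib]
  congr 1
  refine Finset.sum_congr rfl fun j hj => ?_
  have hj' := Finset.ne_of_mem_erase hj
  rw [resolvent_offdiag_eq hW hz hj', shifted_apply, if_neg hj', hW.apply i j]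
  ring

lemma resolvent_diag_ne_zero (hW : W.IsSymm) (hz : 0 < z.im) (i : Fin n) :
    resolventMatrix z W i i ≠ 0 := by
  intro h
  have := resolvent_diag_mul_schur hW hz i
  rw [h, zero_mul] at this
  exact zero_ne_one this

/-- Removing a row and a column changes the trace of the resolvent by at most `3 / Im z`. -/
lemma norm_trace_resolvent_removeRow_sub_le (hW : W.IsSymm) (hz : 0 < z.im) (i : Fin n) :
    ‖∑ k, resolventMatrix z W k k - ∑ k, resolventMatrix z (removeRow i W) k k‖ ≤ 3 / z.im := by
  have hne := resolvent_diag_ne_zero hW hz i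
  rw [← Finset.sum_sub_distrib, ← Finset.add_sum_erase _ _ (Finset.mem_univ i)]
  have h1 : ‖resolventMatrix z W i i - resolventMatrix z (removeRow i W) i i‖
      ≤ 1 / z.im + 1 / z.im :=
    (norm_sub_le _ _).trans (add_le_add (norm_resolvent_le hW hz i i)
      (norm_resolvent_le (removeRow_isSymm hW i) hz i i))
  -- For `k ≠ i` the difference is `R_ik² / R_ii`, and the Ward identity bounds the sum of these by
  -- `1 / Im z`. The index `i` itself accounts for the other two units.
  have h2 : ‖∑ k ∈ Finset.univ.erase i,
      (resolventMatrix z W k k - resolventMatrix z (removeRow i W) k k)‖ ≤ 1 / z.im := by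
    calc _ ≤ ∑ k ∈ Finset.univ.erase i,
          ‖resolventMatrix z W i k‖ ^ 2 / ‖resolventMatrix z W i i‖ := by
          refine (norm_sum_le _ _).trans (Finset.sum_le_sum fun k hk => ?_)
          have hk' := Finset.ne_of_mem_erase hk
          rw [resolvent_eq_removeRow_add hW hz hk' k, add_sub_cancel_left, norm_mul,
            resolvent_symm hW k i]
          have : rowForm z W i k = resolventMatrix z W i k / resolventMatrix z W i i := by
            rw [eq_div_iff hne, mul_comm, ← resolvent_offdiag_eq hW hz hk']
          rw [this, norm_div]
          exact le_of_eq (by ring)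
      _ ≤ ∑ k, ‖resolventMatrix z W i k‖ ^ 2 / ‖resolventMatrix z W i i‖ :=
          Finset.sum_le_sum_of_subset_of_nonneg (Finset.subset_univ _)
            (fun _ _ _ => by positivity)
      _ ≤ 1 / z.im := by
          rw [← Finset.sum_div, div_le_iff₀ (norm_pos_iff.mpr hne)]
          exact (sum_norm_sq_resolvent_le hW hz i).trans (le_of_eq (by ring))
  calc _ ≤ (1 / z.im + 1 / z.im) + 1 / z.im := (norm_add_le _ _).trans (add_le_add h1 h2)
    _ = 3 / z.im := by ring

end Resolvent


/-! ### The semicircle transform and the stability of its quadratic equation. -/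

section Semicircle

/-- The Fourier-type coefficients `∫_0^π 4 sin θ sin (kθ) / (z - 2 cos θ) dθ`. -/
noncomputable def semicircleCoeff (z : ℂ) (k : ℕ) : ℂ :=
  ∫ θ in (0 : ℝ)..Real.pi, ((4 * Real.sin θ * Real.sin (k * θ) : ℝ) : ℂ) / (z - (2 * Real.cos θ : ℝ))

lemma sub_ofReal_ne_zero {z : ℂ} (hz : 0 < z.im) (x : ℝ) : z - (x : ℂ) ≠ 0 := by
  intro h
  have := congrArg Complex.im h
  simp at this
  linarith

lemma intervalIntegrable_semicircleCoeff {z : ℂ} (hz : 0 < z.im) (k : ℕ) :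
    IntervalIntegrable (fun θ : ℝ => ((4 * Real.sin θ * Real.sin (k * θ) : ℝ) : ℂ) /
      (z - (2 * Real.cos θ : ℝ))) volume 0 Real.pi := by
  apply Continuous.intervalIntegrable
  refine Continuous.div (by fun_prop) (by fun_prop) fun θ => sub_ofReal_ne_zero hz _

lemma integral_sin_mul_sin (k : ℕ) (hk : 1 ≤ k) :
    ∫ θ in (0 : ℝ)..Real.pi, 4 * Real.sin θ * Real.sin (k * θ) = if k = 1 then 2 * Real.pi else 0 := by
  have h : ∀ θ : ℝ, 4 * Real.sin θ * Real.sin (k * θ)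
      = 2 * Real.cos (((k : ℝ) - 1) * θ) - 2 * Real.cos (((k : ℝ) + 1) * θ) := by
    intro θ
    rw [sub_mul, add_mul, one_mul, Real.cos_sub, Real.cos_add]; ring
  simp_rw [h]
  have hcos : ∀ a : ℤ, a ≠ 0 → ∫ θ in (0 : ℝ)..Real.pi, 2 * Real.cos ((a : ℝ) * θ) = 0 := by
    intro a ha
    rw [intervalIntegral.integral_const_mul, intervalIntegral.integral_comp_mul_left
      (fun x => Real.cos x) (by exact_mod_cast ha : (a : ℝ) ≠ 0), integral_cos]
    simp [Real.sin_int_mul_pi]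
  rw [intervalIntegral.integral_sub
    (Continuous.intervalIntegrable (by fun_prop) _ _) (Continuous.intervalIntegrable (by fun_prop) _ _)]
  have h2 := hcos (k + 1) (by omega)
  push_cast at h2
  rw [h2, sub_zero]
  split_ifs with h1
  · subst h1; simp; ring
  · have h3 := hcos (k - 1) (by omega)
    push_cast at h3
    exact h3

/-- The identity `sin((k+2)θ) + sin(kθ) = 2 cos θ sin((k+1)θ)` cancels the denominator `z - 2 cos
θ`; orthogonality of the sines then leaves only the case `k = 0`. -/
lemma semicircleCoeff_rec {z : ℂ} (hz : 0 < z.im) (k : ℕ) :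
    z * semicircleCoeff z (k + 1) - semicircleCoeff z (k + 2) - semicircleCoeff z k
      = if k = 0 then 2 * (Real.pi : ℂ) else 0 := by
  have hi := fun k => intervalIntegrable_semicircleCoeff hz k
  rw [semicircleCoeff, semicircleCoeff, semicircleCoeff, ← intervalIntegral.integral_const_mul,
    ← intervalIntegral.integral_sub ((hi _).const_mul z) (hi _),
    ← intervalIntegral.integral_sub (((hi _).const_mul z).sub (hi _)) (hi _)]
  have h : ∀ θ : ℝ, z * (((4 * Real.sin θ * Real.sin ((k + 1 : ℕ) * θ) : ℝ) : ℂ) /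
      (z - (2 * Real.cos θ : ℝ))) - ((4 * Real.sin θ * Real.sin ((k + 2 : ℕ) * θ) : ℝ) : ℂ) /
      (z - (2 * Real.cos θ : ℝ)) - ((4 * Real.sin θ * Real.sin (k * θ) : ℝ) : ℂ) /
      (z - (2 * Real.cos θ : ℝ)) = ((4 * Real.sin θ * Real.sin ((k + 1 : ℕ) * θ) : ℝ) : ℂ) := by
    intro θ
    have hne := sub_ofReal_ne_zero hz (2 * Real.cos θ)
    have htrig : Real.sin ((k + 2 : ℕ) * θ) + Real.sin (k * θ)
        = 2 * Real.cos θ * Real.sin ((k + 1 : ℕ) * θ) := by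
      have e1 : ((k + 2 : ℕ) : ℝ) * θ = ((k + 1 : ℕ) : ℝ) * θ + θ := by push_cast; ring
      have e2 : (k : ℝ) * θ = ((k + 1 : ℕ) : ℝ) * θ - θ := by push_cast; ring
      rw [e1, e2, Real.sin_add, Real.sin_sub]; ring
    have e3 : Real.sin ((k + 2 : ℕ) * θ)
        = 2 * Real.cos θ * Real.sin ((k + 1 : ℕ) * θ) - Real.sin (k * θ) := by linarith
    rw [e3, mul_div_assoc', ← sub_div, ← sub_div, div_eq_iff hne]
    push_cast
    ring
  simp_rw [h]
  rw [intervalIntegral.integral_ofReal, integral_sin_mul_sin (k + 1) (by omega)]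
  rcases Nat.eq_zero_or_pos k with h | h
  · simp [h]
  · have : k ≠ 0 := by omega
    simp [this]

lemma norm_semicircleCoeff_le {z : ℂ} (hz : 0 < z.im) (k : ℕ) :
    ‖semicircleCoeff z k‖ ≤ 4 / z.im * Real.pi := by
  have := intervalIntegral.norm_integral_le_of_norm_le_const (a := 0) (b := Real.pi) (C := 4 / z.im)
    (f := fun θ : ℝ => ((4 * Real.sin θ * Real.sin (k * θ) : ℝ) : ℂ) / (z - (2 * Real.cos θ : ℝ)))
    (fun θ _ => by
      rw [norm_div, Complex.norm_real, Real.norm_eq_abs]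
      have h1 : |4 * Real.sin θ * Real.sin (k * θ)| ≤ 4 := by
        rw [abs_mul, abs_mul, abs_of_pos (by norm_num : (0 : ℝ) < 4)]
        have a := Real.abs_sin_le_one θ
        have b := Real.abs_sin_le_one (k * θ)
        nlinarith [abs_nonneg (Real.sin θ), abs_nonneg (Real.sin (k * θ))]
      have h2 : z.im ≤ ‖z - ((2 * Real.cos θ : ℝ) : ℂ)‖ := by
        refine le_trans (le_trans (le_of_eq ?_) (le_abs_self _)) (Complex.abs_im_le_norm _)
        simp
      gcongr)
  simpa [semicircleCoeff, abs_of_pos Real.pi_pos] using this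

/-- Substitute `x = 2 cos θ`, which turns the density into `4 sin² θ`. -/
lemma semicircleStieltjes_eq_coeff {z : ℂ} (hz : 0 < z.im) :
    semicircleStieltjes z = 1 / (2 * (Real.pi : ℂ)) * semicircleCoeff z 1 := by
  rw [semicircleStieltjes, semicircleCoeff]
  congr 1
  have hsub := intervalIntegral.integral_deriv_smul_comp (a := Real.pi) (b := 0)
    (f := fun θ : ℝ => 2 * Real.cos θ) (f' := fun θ : ℝ => 2 * (- Real.sin θ))
    (g := fun x : ℝ => (Real.sqrt (4 - x ^ 2) : ℂ) / (z - (x : ℂ)))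
    (fun θ _ => (Real.hasDerivAt_cos θ).const_mul 2) (by fun_prop)
    (Continuous.div (by fun_prop) (by fun_prop) fun x => sub_ofReal_ne_zero hz x)
  simp only [Real.cos_pi, Real.cos_zero] at hsub
  norm_num only at hsub
  rw [← hsub, intervalIntegral.integral_symm, ← intervalIntegral.integral_neg]
  refine intervalIntegral.integral_congr fun θ hθ => ?_
  rw [Set.uIcc_of_le Real.pi_pos.le] at hθ
  have hs : 0 ≤ Real.sin θ := Real.sin_nonneg_of_mem_Icc hθ
  have h4 : Real.sqrt (4 - (2 * Real.cos θ) ^ 2) = 2 * Real.sin θ := by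
    rw [show 4 - (2 * Real.cos θ) ^ 2 = (2 * Real.sin θ) ^ 2 by
      have := Real.sin_sq_add_cos_sq θ; nlinarith]
    exact Real.sqrt_sq (by positivity)
  simp only [Function.comp, h4, Complex.real_smul, Nat.cast_one, one_mul]
  push_cast
  ring

/-- The semicircle Stieltjes transform inverts `w ↦ w + w⁻¹` on the unit disc. -/
lemma semicircleStieltjes_eq_of_quadratic {z w : ℂ} (hz : 0 < z.im) (hw : ‖w‖ < 1)
    (hq : w ^ 2 - z * w + 1 = 0) : semicircleStieltjes z = w := by
  have hw0 : w ≠ 0 := by rintro rfl; simp at hq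
  set a := semicircleCoeff z with ha
  have h0 : a 0 = 0 := by simp [ha, semicircleCoeff]
  have hz' : z = w + w⁻¹ := by field_simp; linear_combination -hq
  have hrec : ∀ k, a (k + 3) - w * a (k + 2) = w⁻¹ * (a (k + 2) - w * a (k + 1)) := by
    intro k
    have := semicircleCoeff_rec hz (k + 1)
    rw [← ha, if_neg (Nat.succ_ne_zero k), hz'] at this
    have hww : w⁻¹ * w = 1 := inv_mul_cancel₀ hw0
    linear_combination -this + a (k + 1) * hww
  have hpow : ∀ k, a (k + 2) - w * a (k + 1) = w⁻¹ ^ k * (a 2 - w * a 1) := by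
    intro k
    induction k with
    | zero => simp
    | succ k ih => rw [hrec, ih, pow_succ]; ring
  -- The recurrence has the modes `w^k` and `w^(-k)`. The coefficients are bounded in `k`, so the
  -- growing mode is absent; with `a 0 = 0` this determines `a 1`.
  have hzero : a 2 - w * a 1 = 0 := by
    by_contra hne
    have hlt : 1 < ‖w⁻¹‖ := by
      rw [norm_inv]; exact (one_lt_inv₀ (norm_pos_iff.mpr hw0)).mpr hw
    obtain ⟨k, hk⟩ := pow_unbounded_of_one_lt
      ((2 * (4 / z.im * Real.pi)) / ‖a 2 - w * a 1‖) hlt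
    have h1 := norm_semicircleCoeff_le hz (k + 2)
    have h2 := norm_semicircleCoeff_le hz (k + 1)
    rw [div_lt_iff₀ (norm_pos_iff.mpr hne), ← norm_pow, ← norm_mul, ← hpow] at hk
    have h3 : ‖a (k + 2) - w * a (k + 1)‖ ≤ 4 / z.im * Real.pi + 4 / z.im * Real.pi := by
      refine (norm_sub_le _ _).trans (add_le_add h1 ?_)
      rw [norm_mul]
      have := norm_nonneg (a (k + 1))
      nlinarith
    linarith
  have h1 := semicircleCoeff_rec hz 0
  rw [← ha, if_pos rfl, h0] at h1
  rw [semicircleStieltjes_eq_coeff hz, ← ha]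
  have hpi : (Real.pi : ℂ) ≠ 0 := by exact_mod_cast Real.pi_ne_zero
  have h2 : a 1 = 2 * Real.pi * w := by
    have hww : w⁻¹ * w = 1 := inv_mul_cancel₀ hw0
    simp only [zero_add] at h1
    rw [hz'] at h1
    linear_combination w * h1 + w * hzero - a 1 * hww
  rw [h2]
  field_simp

/-- The roots have product `1`. If neither lay in the open disc, both would lie on the circle and be
conjugate, and their sum `z` would be real. -/
lemma exists_quadratic_root {z : ℂ} (hz : 0 < z.im) :
    ∃ w : ℂ, ‖w‖ < 1 ∧ w ^ 2 - z * w + 1 = 0 := by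
  obtain ⟨r, hr⟩ := IsAlgClosed.exists_pow_nat_eq (z ^ 2 - 4) (n := 2) (by norm_num)
  set u := (z + r) / 2
  set v := (z - r) / 2
  have huv : u * v = 1 := by simp only [u, v]; linear_combination (-1 / 4 : ℂ) * hr
  have hu : u ^ 2 - z * u + 1 = 0 := by simp only [u]; linear_combination (1 / 4 : ℂ) * hr
  have hv : v ^ 2 - z * v + 1 = 0 := by simp only [v]; linear_combination (1 / 4 : ℂ) * hr
  have hn : ‖u‖ * ‖v‖ = 1 := by rw [← norm_mul, huv, norm_one]
  by_contra hcon
  push Not at hcon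
  have hu1 : 1 ≤ ‖u‖ := by by_contra h; exact hcon u (not_le.mp h) hu
  have hv1 : 1 ≤ ‖v‖ := by by_contra h; exact hcon v (not_le.mp h) hv
  have hu2 : ‖u‖ = 1 := by nlinarith
  have hvu : v = star u := by
    have h1 : u * star u = 1 := by
      have := Complex.mul_conj' u
      rw [hu2] at this
      simpa using this
    have hu0 : u ≠ 0 := by rintro h; rw [h] at huv; simp at huv
    exact mul_left_cancel₀ hu0 (huv.trans h1.symm)
  have : z = u + star u := by rw [← hvu]; simp only [u, v]; ring
  rw [this] at hz
  simp at hz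

/-- Characterization of the semicircle Stieltjes transform in the upper half plane. -/
lemma semicircleStieltjes_spec {z : ℂ} (hz : 0 < z.im) :
    ‖semicircleStieltjes z‖ < 1 ∧
      semicircleStieltjes z ^ 2 - z * semicircleStieltjes z + 1 = 0 := by
  obtain ⟨w, hw, hq⟩ := exists_quadratic_root hz
  rw [semicircleStieltjes_eq_of_quadratic hz hw hq]
  exact ⟨hw, hq⟩

lemma semicircleStieltjes_ne_zero {z : ℂ} (hz : 0 < z.im) : semicircleStieltjes z ≠ 0 := by
  intro h
  have := (semicircleStieltjes_spec hz).2
  simp [h] at this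

lemma sub_semicircleStieltjes {z : ℂ} (hz : 0 < z.im) :
    z - semicircleStieltjes z = (semicircleStieltjes z)⁻¹ := by
  have h0 := semicircleStieltjes_ne_zero hz
  have := (semicircleStieltjes_spec hz).2
  refine eq_inv_of_mul_eq_one_left ?_
  linear_combination -this

/-- Away from the spectral edges the two roots of the self-consistent equation are separated:
either the second root has an imaginary part bounded below, or the first one lies well inside the
unit disc. -/
lemma semicircleStieltjes_dichotomy {κ : ℝ} (hκ0 : 0 < κ) (hκ1 : κ < 1) {z : ℂ}
    (hz : z ∈ halfPlane κ) :
    (|z.re| ≤ 2 - κ ∧ κ / 4 ≤ ((semicircleStieltjes z)⁻¹).im) ∨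
      (¬ |z.re| ≤ 2 - κ ∧ ‖semicircleStieltjes z‖ ≤ 1 - κ / 4) := by
  obtain ⟨hz0, -, hz1, hz2⟩ := hz
  set m := semicircleStieltjes z with hm
  have hm0 : m ≠ 0 := semicircleStieltjes_ne_zero hz0
  have hm1 : ‖m‖ < 1 := (semicircleStieltjes_spec hz0).1
  have hpos : 0 < ‖m‖ := norm_pos_iff.mpr hm0
  have hzm : z = m + m⁻¹ := by rw [← sub_semicircleStieltjes hz0]; ring
  have hsq : Complex.normSq m = ‖m‖ ^ 2 := (Complex.sq_norm m).symm
  have hre : z.re = m.re * (1 + 1 / ‖m‖ ^ 2) := by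
    rw [hzm, Complex.add_re, Complex.inv_re, hsq]; ring
  have him : z.im = m.im * (1 - 1 / ‖m‖ ^ 2) := by
    rw [hzm, Complex.add_im, Complex.inv_im, hsq]; ring
  have hsum : m.re ^ 2 + m.im ^ 2 = ‖m‖ ^ 2 := by
    rw [← hsq, Complex.normSq_apply]; ring
  set r := ‖m‖ with hr
  have hr1 : 1 < 1 / r ^ 2 := by
    rw [lt_div_iff₀ (by positivity)]; nlinarith
  have him0 : m.im < 0 := by
    by_contra h
    push Not at h
    have : m.im * (1 - 1 / r ^ 2) ≤ 0 := mul_nonpos_of_nonneg_of_nonpos h (by linarith)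
    linarith
  by_cases hbulk : |z.re| ≤ 2 - κ
  · left
    refine ⟨hbulk, ?_⟩
    rw [Complex.inv_im, hsq]
    -- After inserting `Re z = Re m (1 + 1/r²)`, the right side minus the left is `(1 - r²)(r² - (Re
    -- m)² (3 + r²)/4)`, a product of nonnegative factors.
    have hb : (1 - z.re ^ 2 / 4) * r ^ 4 ≤ m.im ^ 2 := by
      have h1 : m.re ^ 2 * (1 + r ^ 2) ^ 2 = z.re ^ 2 * r ^ 4 := by
        rw [hre]; field_simp; ring
      have hs : 0 ≤ 1 - r ^ 2 := by nlinarith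
      have hx : m.re ^ 2 * (3 + r ^ 2) / 4 ≤ r ^ 2 := by
        nlinarith [sq_nonneg m.re, sq_nonneg m.im, mul_nonneg (sq_nonneg m.re) hs]
      have h2 := mul_nonneg hs (sub_nonneg.mpr hx)
      nlinarith
    have hE : z.re ^ 2 ≤ (2 - κ) ^ 2 := by
      rw [← sq_abs]; gcongr
    have hE' : (κ / 4) ^ 2 ≤ 1 - z.re ^ 2 / 4 := by nlinarith
    have h3 : (κ / 4 * r ^ 2) ^ 2 ≤ (-m.im) ^ 2 := by
      have : (κ / 4) ^ 2 * r ^ 4 ≤ (1 - z.re ^ 2 / 4) * r ^ 4 :=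
        mul_le_mul_of_nonneg_right hE' (by positivity)
      nlinarith
    have h4 := le_of_sq_le_sq h3 (by linarith)
    rw [le_div_iff₀ (by positivity)]
    exact h4
  · right
    refine ⟨hbulk, ?_⟩
    push Not at hbulk
    have hout : 2 + κ ≤ |z.re| := by
      rcases abs_cases z.re with ⟨h, h'⟩ | ⟨h, h'⟩ <;>
      rcases abs_cases (z.re + 2) with ⟨h1, h1'⟩ | ⟨h1, h1'⟩ <;>
      rcases abs_cases (z.re - 2) with ⟨h2, h2'⟩ | ⟨h2, h2'⟩ <;> linarith
    have h1 : |z.re| * r ≤ r ^ 2 + 1 := by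
      rw [hre, abs_mul, abs_of_pos (by positivity : 0 < 1 + 1 / r ^ 2)]
      have h2 : |m.re| ≤ r := Complex.abs_re_le_norm m
      calc |m.re| * (1 + 1 / r ^ 2) * r ≤ r * (1 + 1 / r ^ 2) * r := by gcongr
        _ = r ^ 2 + 1 := by field_simp
    by_contra h
    push Not at h
    have h3 : (2 + κ) * r ≤ r ^ 2 + 1 := (mul_le_mul_of_nonneg_right hout hpos.le).trans h1
    nlinarith

/-- Stability of the self-consistent equation: if `g` solves it up to an error `τ` and is separated
from the second root, it is close to the first one. -/
lemma norm_sub_semicircleStieltjes_le {c τ : ℝ} {z g : ℂ} (hz : 0 < z.im) (hc : 0 < c)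
    (hτ : ‖g * (z - g) - 1‖ ≤ τ) (hsep : c ≤ ‖g - (semicircleStieltjes z)⁻¹‖) :
    ‖g - semicircleStieltjes z‖ ≤ τ / c := by
  set m := semicircleStieltjes z
  have h0 : m ≠ 0 := semicircleStieltjes_ne_zero hz
  have hzm : z = m + m⁻¹ := by rw [← sub_semicircleStieltjes hz]; ring
  have hfac : g * (z - g) - 1 = -((g - m) * (g - m⁻¹)) := by
    have : m⁻¹ * m = 1 := inv_mul_cancel₀ h0
    rw [hzm]; linear_combination this
  rw [hfac, norm_neg, norm_mul] at hτ
  rw [le_div_iff₀ hc]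
  exact (mul_le_mul_of_nonneg_left hsep (norm_nonneg _)).trans hτ

/-- Separation in the bulk: with the convention `(z - W)⁻¹` the normalised trace lies in the closed
lower half plane, whereas the spurious root lies well inside the upper one. -/
lemma le_norm_sub_inv_of_im {c : ℝ} {m g : ℂ} (h : c ≤ (m⁻¹).im) (hg : g.im ≤ 0) :
    c ≤ ‖g - m⁻¹‖ := by
  have h1 := Complex.abs_im_le_norm (g - m⁻¹)
  rw [Complex.sub_im, abs_sub_comm] at h1
  linarith [le_abs_self ((m⁻¹).im - g.im)]

/-- Separation outside the bulk: there the spurious root has modulus at least `1 + c`. -/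
lemma le_norm_sub_inv_of_norm {c : ℝ} {m g : ℂ} (hm0 : m ≠ 0) (h : ‖m‖ ≤ 1 - c) (hg : ‖g‖ ≤ 1) :
    c ≤ ‖g - m⁻¹‖ := by
  have hpos : 0 < ‖m‖ := norm_pos_iff.mpr hm0
  have h1 := norm_sub_norm_le (m⁻¹) g
  rw [norm_sub_rev, norm_inv] at h1
  have h2 : 1 + c ≤ ‖m‖⁻¹ := by
    rw [← one_div, le_div_iff₀ hpos]; nlinarith [sq_nonneg c]
  linarith

end Semicircle


/-! ### Moment inequalities for independent sums, and resampling. -/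

section Moments

variable {Ω : Type*} [MeasurableSpace Ω] {P : Measure Ω}

/-- All moments of `f` are finite. -/
def HasMoments (f : Ω → ℝ) (P : Measure Ω) : Prop := ∀ p : ℕ, MemLp f p P

namespace HasMoments

variable {f g : Ω → ℝ}

lemma aestronglyMeasurable (hf : HasMoments f P) : AEStronglyMeasurable f P :=
  (hf 0).aestronglyMeasurable

lemma integrable (hf : HasMoments f P) : Integrable f P := by
  have := hf 1
  rw [Nat.cast_one] at this
  exact memLp_one_iff_integrable.mp this

lemma add (hf : HasMoments f P) (hg : HasMoments g P) : HasMoments (fun ω => f ω + g ω) P :=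
  fun p => (hf p).add (hg p)

lemma const_mul (hf : HasMoments f P) (a : ℝ) : HasMoments (fun ω => a * f ω) P :=
  fun p => (hf p).const_mul a

lemma mul (hf : HasMoments f P) (hg : HasMoments g P) : HasMoments (fun ω => f ω * g ω) P := by
  intro p
  have : ENNReal.HolderTriple ((2 * p : ℕ) : ℝ≥0∞) ((2 * p : ℕ) : ℝ≥0∞) (p : ℝ≥0∞) := by
    constructor
    push_cast
    rw [ENNReal.mul_inv (by simp) (by simp), ← add_mul, ENNReal.inv_two_add_inv_two, one_mul]
  exact (hg (2 * p)).mul (hf (2 * p))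

lemma const [IsFiniteMeasure P] (a : ℝ) : HasMoments (fun _ : Ω => a) P := fun _ => memLp_const a

lemma pow [IsFiniteMeasure P] (hf : HasMoments f P) (k : ℕ) :
    HasMoments (fun ω => f ω ^ k) P := by
  induction k with
  | zero => simpa using const 1
  | succ k ih => simpa [pow_succ] using ih.mul hf

lemma sum [IsFiniteMeasure P] {ι : Type*} (s : Finset ι) {F : ι → Ω → ℝ}
    (hF : ∀ i ∈ s, HasMoments (F i) P) : HasMoments (fun ω => ∑ i ∈ s, F i ω) P :=
  fun p => memLp_finsetSum s fun i hi => hF i hi p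

lemma of_bound [IsFiniteMeasure P] (hf : AEStronglyMeasurable f P) (C : ℝ) (h : ∀ ω, |f ω| ≤ C) :
    HasMoments f P :=
  fun _ => MemLp.of_bound hf C (ae_of_all _ h)

end HasMoments

/-- Expansion of an even power of a sum up to second order. -/
lemma add_pow_even_le (m : ℕ) (hm : 1 ≤ m) (s y : ℝ) :
    (s + y) ^ (2 * m) ≤ s ^ (2 * m) + 2 * m * (s ^ (2 * m - 1) * y) +
      4 ^ m * (s ^ (2 * m - 2) * y ^ 2 + y ^ (2 * m)) := by
  obtain ⟨k, rfl⟩ : ∃ k, m = k + 1 := ⟨m - 1, by omega⟩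
  have e1 : 2 * (k + 1) - 1 = 2 * k + 1 := by omega
  have e2 : 2 * (k + 1) - 2 = 2 * k := by omega
  have e3 : 2 * (k + 1) = 2 * k + 2 := by ring
  have hA : 0 ≤ s ^ (2 * k) * y ^ 2 + y ^ (2 * k + 2) := by
    have := (even_two_mul k).pow_nonneg s
    have := (show Even (2 * k + 2) from ⟨k + 1, by ring⟩).pow_nonneg y
    positivity
  -- A term of order at least two in `y` is dominated by the second-order one when `|y| ≤ |s|` and
  -- by `y^(2m)` otherwise. The binomial coefficients add up to at most `4^m`.
  have hterm : ∀ j ∈ Finset.range (2 * k + 1),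
      y ^ (j + 1 + 1) * s ^ (2 * k + 2 - (j + 1 + 1)) * ((2 * k + 2).choose (j + 1 + 1) : ℝ) ≤
      (s ^ (2 * k) * y ^ 2 + y ^ (2 * k + 2)) * ((2 * k + 2).choose (j + 1 + 1) : ℝ) := by
    intro j hj
    have hj' : j ≤ 2 * k := by simpa [Nat.lt_succ_iff] using hj
    gcongr
    have e4 : 2 * k + 2 - (j + 1 + 1) = 2 * k - j := by omega
    rw [e4]
    have hab : y ^ (j + 1 + 1) * s ^ (2 * k - j) ≤ |y| ^ (j + 2) * |s| ^ (2 * k - j) := by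
      rw [← abs_pow, ← abs_pow, ← abs_mul]; exact le_abs_self _
    refine hab.trans ?_
    have ey : |y| ^ (2 * k + 2) = y ^ (2 * k + 2) := Even.pow_abs ⟨k + 1, by ring⟩ y
    have es : |s| ^ (2 * k) = s ^ (2 * k) := (even_two_mul k).pow_abs s
    have ey2 : |y| ^ 2 = y ^ 2 := sq_abs y
    rcases le_total |y| |s| with h | h
    · have : |y| ^ (j + 2) * |s| ^ (2 * k - j) ≤ s ^ (2 * k) * y ^ 2 := by
        calc |y| ^ (j + 2) * |s| ^ (2 * k - j) = |y| ^ 2 * (|y| ^ j * |s| ^ (2 * k - j)) := by ring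
          _ ≤ |y| ^ 2 * (|s| ^ j * |s| ^ (2 * k - j)) := by gcongr
          _ = s ^ (2 * k) * y ^ 2 := by
            rw [← pow_add, Nat.add_sub_cancel' hj', ey2, es]; ring
      have := (show Even (2 * k + 2) from ⟨k + 1, by ring⟩).pow_nonneg y
      linarith
    · have : |y| ^ (j + 2) * |s| ^ (2 * k - j) ≤ y ^ (2 * k + 2) := by
        calc |y| ^ (j + 2) * |s| ^ (2 * k - j) ≤ |y| ^ (j + 2) * |y| ^ (2 * k - j) := by gcongr
          _ = y ^ (2 * k + 2) := by
            rw [← pow_add, show j + 2 + (2 * k - j) = 2 * k + 2 by omega, ey]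
      have := (even_two_mul k).pow_nonneg s
      nlinarith [mul_nonneg this (sq_nonneg y)]
  rw [e1, e2, e3, add_comm s y, add_pow, Finset.sum_range_succ', Finset.sum_range_succ']
  have hsum := Finset.sum_le_sum hterm
  rw [← Finset.mul_sum] at hsum
  have hch : ∑ j ∈ Finset.range (2 * k + 1), ((2 * k + 2).choose (j + 1 + 1) : ℝ) ≤ 4 ^ (k + 1) := by
    have h := Nat.sum_range_choose (2 * k + 2)
    rw [Finset.sum_range_succ', Finset.sum_range_succ'] at h
    have h' : ∑ j ∈ Finset.range (2 * k + 1), (2 * k + 2).choose (j + 1 + 1) ≤ 2 ^ (2 * k + 2) := by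
      omega
    calc (∑ j ∈ Finset.range (2 * k + 1), ((2 * k + 2).choose (j + 1 + 1) : ℝ))
        = ((∑ j ∈ Finset.range (2 * k + 1), (2 * k + 2).choose (j + 1 + 1) : ℕ) : ℝ) := by
          push_cast; rfl
      _ ≤ ((2 ^ (2 * k + 2) : ℕ) : ℝ) := by exact_mod_cast h'
      _ = 4 ^ (k + 1) := by
          push_cast; rw [show 2 * k + 2 = 2 * (k + 1) by ring, pow_mul]; norm_num
  have h5 := hsum.trans (mul_le_mul_of_nonneg_left hch hA)
  have e5 : 2 * k + 2 - (0 + 1) = 2 * k + 1 := by omega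
  simp only [zero_add, pow_one, pow_zero, Nat.choose_one_right, Nat.choose_zero_right, one_mul,
    Nat.sub_zero, Nat.cast_one, mul_one, e5] at h5 ⊢
  push_cast at h5 ⊢
  linarith

/-- A discrete Gronwall inequality over the subsets of a finite set. -/
lemma finset_gronwall {ι : Type*} [DecidableEq ι] {f : Finset ι → ℝ} {α β : ι → ℝ} (s : Finset ι)
    (hα : ∀ i, 0 ≤ α i) (hβ : ∀ i, 0 ≤ β i) (h0 : f ∅ ≤ 0)
    (hstep : ∀ a ∈ s, ∀ u ⊆ s, a ∉ u → f (insert a u) ≤ (1 + α a) * f u + β a) :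
    f s ≤ Real.exp (∑ i ∈ s, α i) * ∑ i ∈ s, β i := by
  suffices h : ∀ u, u ⊆ s → f u ≤ Real.exp (∑ i ∈ u, α i) * ∑ i ∈ u, β i from h s subset_rfl
  intro u
  induction u using Finset.induction_on with
  | empty => intro _; simpa using h0
  | insert a u ha ih =>
    intro hu
    have hau := Finset.insert_subset_iff.mp hu
    have h1 := hstep a hau.1 u hau.2 ha
    have h2 := ih hau.2
    rw [Finset.sum_insert ha, Finset.sum_insert ha, Real.exp_add]
    set B := ∑ i ∈ u, β i
    set E := Real.exp (∑ i ∈ u, α i)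
    have hB : 0 ≤ B := Finset.sum_nonneg fun i _ => hβ i
    have hE : 1 ≤ E := Real.one_le_exp (Finset.sum_nonneg fun i _ => hα i)
    have hX : 1 + α a ≤ Real.exp (α a) := by linarith [Real.add_one_le_exp (α a)]
    have hX1 : 1 ≤ Real.exp (α a) := Real.one_le_exp (hα a)
    calc f (insert a u) ≤ (1 + α a) * f u + β a := h1
      _ ≤ (1 + α a) * (E * B) + β a := by
          have := hα a; gcongr
      _ ≤ Real.exp (α a) * (E * B) + Real.exp (α a) * E * β a := by
          have h3 : 1 ≤ Real.exp (α a) * E := by nlinarith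
          have h4 := hβ a
          have h5 : 0 ≤ E * B := by positivity
          nlinarith
      _ = Real.exp (α a) * E * (β a + B) := by ring

/-- The moments of a sum of a centred variable with an independent pair. -/
lemma integral_add_mul_pow_le [IsProbabilityMeasure P] {m : ℕ} (hm : 1 ≤ m) {S B Y : Ω → ℝ}
    (hS : HasMoments S P) (hB : HasMoments B P) (hY : HasMoments Y P)
    (hind : IndepFun (fun ω => (S ω, B ω)) Y P) (hmean : ∫ ω, Y ω ∂P = 0) :
    ∫ ω, (S ω + Y ω * B ω) ^ (2 * m) ∂P ≤ ∫ ω, S ω ^ (2 * m) ∂P + 4 ^ m *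
      ((∫ ω, S ω ^ (2 * m - 2) * B ω ^ 2 ∂P) * (∫ ω, Y ω ^ 2 ∂P) +
        (∫ ω, B ω ^ (2 * m) ∂P) * (∫ ω, Y ω ^ (2 * m) ∂P)) := by
  have hYB := hY.mul hB
  have hfac : ∀ (a b k : ℕ), ∫ ω, (S ω ^ a * B ω ^ b) * Y ω ^ k ∂P
      = (∫ ω, S ω ^ a * B ω ^ b ∂P) * ∫ ω, Y ω ^ k ∂P := by
    intro a b k
    have hi : IndepFun (fun ω => S ω ^ a * B ω ^ b) (fun ω => Y ω ^ k) P :=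
      hind.comp (φ := fun q : ℝ × ℝ => q.1 ^ a * q.2 ^ b) (ψ := fun y => y ^ k)
        (by fun_prop) (by fun_prop)
    exact hi.integral_mul_eq_mul_integral ((hS.pow a).mul (hB.pow b)).aestronglyMeasurable
      (hY.pow k).aestronglyMeasurable
  have h1 := hfac (2 * m - 1) 1 1
  have h2 := hfac (2 * m - 2) 2 2
  have h3 := hfac 0 (2 * m) (2 * m)
  simp only [pow_one, pow_zero, one_mul, hmean, mul_zero] at h1 h2 h3
  have i0 := (hS.pow (2 * m)).integrable
  have i1 := ((hS.pow (2 * m - 1)).mul hYB).integrable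
  have i2 := ((hS.pow (2 * m - 2)).mul (hYB.pow 2)).integrable
  have i3 := (hYB.pow (2 * m)).integrable
  have i01 : Integrable (fun ω => S ω ^ (2 * m) + 2 * m * (S ω ^ (2 * m - 1) * (Y ω * B ω))) P :=
    i0.add (i1.const_mul _)
  have i23 : Integrable (fun ω => 4 ^ m * (S ω ^ (2 * m - 2) * (Y ω * B ω) ^ 2 +
      (Y ω * B ω) ^ (2 * m))) P := (i2.add i3).const_mul _
  calc ∫ ω, (S ω + Y ω * B ω) ^ (2 * m) ∂P
      ≤ ∫ ω, (S ω ^ (2 * m) + 2 * m * (S ω ^ (2 * m - 1) * (Y ω * B ω)) +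
        4 ^ m * (S ω ^ (2 * m - 2) * (Y ω * B ω) ^ 2 + (Y ω * B ω) ^ (2 * m))) ∂P := by
        refine integral_mono ((hS.add hYB).pow _).integrable ?_
          fun ω => add_pow_even_le m hm _ _
        exact i01.add i23
    _ = _ := by
        rw [integral_add i01 i23,
          integral_add i0 (i1.const_mul _), integral_const_mul, integral_const_mul,
          integral_add i2 i3]
        have e1 : ∫ ω, S ω ^ (2 * m - 1) * (Y ω * B ω) ∂P = 0 := by
          rw [← h1]; congr 1; funext ω; ring
        have e2 : ∫ ω, S ω ^ (2 * m - 2) * (Y ω * B ω) ^ 2 ∂P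
            = (∫ ω, S ω ^ (2 * m - 2) * B ω ^ 2 ∂P) * (∫ ω, Y ω ^ 2 ∂P) := by
          rw [← h2]; congr 1; funext ω; ring
        have e3 : ∫ ω, (Y ω * B ω) ^ (2 * m) ∂P
            = (∫ ω, B ω ^ (2 * m) ∂P) * (∫ ω, Y ω ^ (2 * m) ∂P) := by
          rw [← h3]; congr 1; funext ω; rw [mul_pow]; ring
        rw [e1, e2, e3, mul_zero, add_zero]

lemma indepFun_of_notMem {ι : Type*} {Y : ι → Ω → ℝ} (hind : iIndepFun Y P)
    (hmeas : ∀ k, Measurable (Y k)) {u : Finset ι} {a : ι} (ha : a ∉ u) {F : (u → ℝ) → ℝ × ℝ}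
    (hF : Measurable F) : IndepFun (fun ω => F fun k : u => Y k ω) (Y a) P := by
  have h := hind.indepFun_finset u {a} (Finset.disjoint_singleton_right.mpr ha) hmeas
  exact h.comp (φ := F) (ψ := fun g : (({a} : Finset ι) → ℝ) => g ⟨a, Finset.mem_singleton_self a⟩)
    hF (measurable_pi_apply _)

/-- Rosenthal's inequality for linear forms. -/
lemma integral_linear_form_pow_le [IsProbabilityMeasure P] {ι : Type*}
    {Y : ι → Ω → ℝ} (hind : iIndepFun Y P) (hmeas : ∀ k, Measurable (Y k))
    (hY : ∀ k, HasMoments (Y k) P) (hmean : ∀ k, ∫ ω, Y k ω ∂P = 0) {m : ℕ} (hm : 1 ≤ m)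
    (s : Finset ι) {N A ρ V : ℝ} (hN : 0 < N) (hA : 0 ≤ A) (hρ : 0 ≤ ρ)
    (h2 : ∀ k ∈ s, ∫ ω, Y k ω ^ 2 ∂P ≤ A / N)
    (h2m : ∀ k ∈ s, ∫ ω, Y k ω ^ (2 * m) ∂P ≤ A * ρ / N)
    (b : ι → ℝ) (hV : ∑ k ∈ s, b k ^ 2 ≤ N * V) :
    ∫ ω, (∑ k ∈ s, Y k ω * b k) ^ (2 * m) ∂P ≤
      Real.exp (4 ^ m * A) * (4 ^ m * A * (V ^ m + ρ / N * ∑ k ∈ s, b k ^ (2 * m))) := by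
  classical
  have hV0 : 0 ≤ V := by
    have : 0 ≤ ∑ k ∈ s, b k ^ 2 := Finset.sum_nonneg fun _ _ => sq_nonneg _
    exact nonneg_of_mul_nonneg_right (this.trans hV) hN
  have hbe : ∀ k, 0 ≤ b k ^ (2 * m) := fun k => (even_two_mul m).pow_nonneg _
  -- The rates below are divided by `V`. If `V = 0`, all coefficients on `s` vanish.
  rcases hV0.eq_or_lt with hV1 | hV1
  · rw [← hV1, mul_zero] at hV
    have hb : ∀ k ∈ s, b k = 0 := by
      intro k hk
      have := (Finset.single_le_sum (f := fun k => b k ^ 2) (fun _ _ => sq_nonneg _) hk).trans hV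
      exact pow_eq_zero_iff two_ne_zero |>.mp (le_antisymm this (sq_nonneg _))
    have : ∀ ω, (∑ k ∈ s, Y k ω * b k) ^ (2 * m) = 0 := by
      intro ω
      rw [Finset.sum_eq_zero fun k hk => by rw [hb k hk, mul_zero], zero_pow (by omega)]
    simp_rw [this]
    rw [integral_zero]
    have : 0 ≤ ∑ k ∈ s, b k ^ (2 * m) := Finset.sum_nonneg fun k _ => hbe k
    positivity
  -- The inequality `S^(2m-2) ≤ S^(2m)/V + V^(m-1)` turns the second-order term into a
  -- multiplicative part `α` and an additive part `β`. By `hV` the rates `α` sum to at most `4^m A`,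
  -- so the Gronwall factor is a constant.
  set α : ι → ℝ := fun k => 4 ^ m * A * b k ^ 2 / (N * V)
  set β : ι → ℝ := fun k => α k * V ^ m + 4 ^ m * A * ρ / N * b k ^ (2 * m)
  have hα : ∀ k, 0 ≤ α k := fun k => by positivity
  have hβ : ∀ k, 0 ≤ β k := fun k => by have := hbe k; have := hα k; positivity
  have hmom : ∀ u : Finset ι, HasMoments (fun ω => ∑ k ∈ u, Y k ω * b k) P := fun u =>
    HasMoments.sum u fun k _ => (hY k).mul (HasMoments.const (b k))
  have key := finset_gronwall (f := fun u => ∫ ω, (∑ k ∈ u, Y k ω * b k) ^ (2 * m) ∂P) s hα hβ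
    (by simp [show m ≠ 0 by omega]) (by
      intro a ha u hu hau
      have hi : IndepFun (fun ω => (∑ k ∈ u, Y k ω * b k, b a)) (Y a) P := by
        have := indepFun_of_notMem hind hmeas hau
          (F := fun g : u → ℝ => (∑ k : u, g k * b k, b a)) (by fun_prop)
        convert this using 3 with ω
        exact (Finset.sum_coe_sort u (fun k => Y k ω * b k)).symm
      have h := integral_add_mul_pow_le hm (hmom u) (HasMoments.const (b a)) (hY a) hi (hmean a)
      have e : ∀ ω, ∑ k ∈ insert a u, Y k ω * b k = ∑ k ∈ u, Y k ω * b k + Y a ω * b a := by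
        intro ω; rw [Finset.sum_insert hau, add_comm]
      simp_rw [e]
      refine h.trans ?_
      rw [integral_mul_const, integral_const, probReal_univ, one_smul]
      set I := ∫ ω, (∑ k ∈ u, Y k ω * b k) ^ (2 * m) ∂P
      have hlow : ∫ ω, (∑ k ∈ u, Y k ω * b k) ^ (2 * m - 2) ∂P ≤ I / V + V ^ (m - 1) := by
        calc _ ≤ ∫ ω, ((∑ k ∈ u, Y k ω * b k) ^ (2 * m) / V + V ^ (m - 1)) ∂P := by
              refine integral_mono ((hmom u).pow _).integrable
                ((((hmom u).pow _).integrable.div_const _).add (integrable_const _)) fun ω => ?_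
              set x := ∑ k ∈ u, Y k ω * b k
              have e1 : x ^ (2 * m - 2) = (x ^ 2) ^ (m - 1) := by rw [← pow_mul]; congr 1; omega
              have e2 : x ^ (2 * m) = (x ^ 2) ^ (m - 1) * x ^ 2 := by
                rw [← pow_mul, ← pow_add]; congr 1; omega
              simp only [e1, e2]
              have hx : 0 ≤ (x ^ 2) ^ (m - 1) := by positivity
              rcases le_total V (x ^ 2) with h | h
              · have : (x ^ 2) ^ (m - 1) ≤ (x ^ 2) ^ (m - 1) * x ^ 2 / V := by
                  rw [le_div_iff₀ hV1]; gcongr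
                have : 0 ≤ V ^ (m - 1) := by positivity
                linarith
              · have : (x ^ 2) ^ (m - 1) ≤ V ^ (m - 1) := by gcongr
                have : 0 ≤ (x ^ 2) ^ (m - 1) * x ^ 2 / V := by positivity
                linarith
          _ = I / V + V ^ (m - 1) := by
              rw [integral_add (((hmom u).pow _).integrable.div_const _) (integrable_const _),
                integral_div, integral_const, probReal_univ, one_smul]
      have hI : 0 ≤ I := integral_nonneg fun ω => (even_two_mul m).pow_nonneg _
      have hY2 : 0 ≤ ∫ ω, Y a ω ^ 2 ∂P := integral_nonneg fun ω => sq_nonneg _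
      have hb := hbe a
      calc I + 4 ^ m * ((∫ ω, (∑ k ∈ u, Y k ω * b k) ^ (2 * m - 2) ∂P) * b a ^ 2 *
            (∫ ω, Y a ω ^ 2 ∂P) + b a ^ (2 * m) * ∫ ω, Y a ω ^ (2 * m) ∂P)
          ≤ I + 4 ^ m * ((I / V + V ^ (m - 1)) * b a ^ 2 * (A / N) +
            b a ^ (2 * m) * (A * ρ / N)) := by
            gcongr
            · exact h2 a ha
            · exact h2m a ha
        _ = (1 + α a) * I + β a := by
            have hVm : V ^ m = V ^ (m - 1) * V := by rw [← pow_succ]; congr 1; omega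
            simp only [α, β, hVm]
            field_simp
            ring)
  refine key.trans ?_
  have hsα : ∑ k ∈ s, α k ≤ 4 ^ m * A := by
    simp only [α]
    rw [← Finset.sum_div, ← Finset.mul_sum, div_le_iff₀ (by positivity)]
    gcongr
  have hsβ : ∑ k ∈ s, β k ≤ 4 ^ m * A * (V ^ m + ρ / N * ∑ k ∈ s, b k ^ (2 * m)) := by
    simp only [β]
    rw [Finset.sum_add_distrib, ← Finset.sum_mul, ← Finset.mul_sum, mul_add]
    refine add_le_add (mul_le_mul_of_nonneg_right hsα (by positivity)) (le_of_eq (by ring))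
  have : 0 ≤ ∑ k ∈ s, β k := Finset.sum_nonneg fun k _ => hβ k
  gcongr

/-- Moments of off-diagonal quadratic forms in terms of those of the associated linear forms. -/
lemma integral_quadratic_form_pow_le [IsProbabilityMeasure P] {ι : Type*} [DecidableEq ι]
    {Y : ι → Ω → ℝ} (hind : iIndepFun Y P) (hmeas : ∀ k, Measurable (Y k))
    (hY : ∀ k, HasMoments (Y k) P) (hmean : ∀ k, ∫ ω, Y k ω ∂P = 0) {m : ℕ} (hm : 1 ≤ m)
    (s : Finset ι) {N A : ℝ} (hN : 0 < N) (hA : 0 ≤ A) (hs : (s.card : ℝ) ≤ N)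
    (h2 : ∀ k ∈ s, ∫ ω, Y k ω ^ 2 ∂P ≤ A / N)
    (h2m : ∀ k ∈ s, ∫ ω, Y k ω ^ (2 * m) ∂P ≤ A / N)
    (r : ι → ι → ℝ) (hr : ∀ k l, r k l = r l k) (B : ι → ℝ) (hB0 : ∀ a, 0 ≤ B a)
    (hB : ∀ a ∈ s, ∀ u ⊆ s, ∫ ω, (∑ l ∈ u, Y l ω * r a l) ^ (2 * m) ∂P ≤ B a) :
    ∫ ω, (∑ k ∈ s, ∑ l ∈ s.erase k, Y k ω * Y l ω * r k l) ^ (2 * m) ∂P ≤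
      Real.exp (4 ^ m * A) * (2 * 16 ^ m * A / N * ∑ a ∈ s, B a) := by
  have hlin : ∀ (u : Finset ι) a, HasMoments (fun ω => ∑ l ∈ u, Y l ω * r a l) P := fun u a =>
    HasMoments.sum u fun k _ => (hY k).mul (HasMoments.const _)
  have hmom : ∀ u : Finset ι,
      HasMoments (fun ω => ∑ k ∈ u, ∑ l ∈ u.erase k, Y k ω * Y l ω * r k l) P := fun u =>
    HasMoments.sum u fun k _ => HasMoments.sum _ fun l _ =>
      ((hY k).mul (hY l)).mul (HasMoments.const _)
  -- Adding the index `a` changes the form by `Y_a T` with `T = 2 ∑ Y_l r_al` independent of `Y_a`.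
  -- The mixed term obeys `Q^(2m-2) T² ≤ Q^(2m) + T^(2m)`, and at most `N` steps of rate `4^m A / N`
  -- are made.
  have key := finset_gronwall
    (f := fun u => ∫ ω, (∑ k ∈ u, ∑ l ∈ u.erase k, Y k ω * Y l ω * r k l) ^ (2 * m) ∂P) s
    (α := fun _ => 4 ^ m * A / N) (β := fun a => 2 * 16 ^ m * A / N * B a)
    (fun _ => by positivity) (fun a => by have := hB0 a; positivity)
    (by simp [show m ≠ 0 by omega]) (by
      intro a ha u hu hau
      have hi : IndepFun (fun ω => (∑ k ∈ u, ∑ l ∈ u.erase k, Y k ω * Y l ω * r k l,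
          2 * ∑ l ∈ u, Y l ω * r a l)) (Y a) P := by
        have := indepFun_of_notMem hind hmeas hau
          (F := fun g : u → ℝ => (∑ k : u, ∑ l ∈ Finset.univ.erase k, g k * g l * r k l,
            2 * ∑ l : u, g l * r a l)) (by fun_prop)
        convert this using 3 with ω
        · rw [← Finset.sum_coe_sort u]
          refine Finset.sum_congr rfl fun k _ => ?_
          have e1 := Finset.sum_coe_sort u (fun l => Y k ω * Y l ω * r k l)
          rw [← Finset.add_sum_erase _ _ k.2] at e1
          rw [← Finset.add_sum_erase _ _ (Finset.mem_univ k)] at e1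
          exact (add_left_cancel e1).symm
        · rw [← Finset.sum_coe_sort u]
      have h := integral_add_mul_pow_le hm (hmom u) ((hlin u a).const_mul 2) (hY a) hi (hmean a)
      have e : ∀ ω, ∑ k ∈ insert a u, ∑ l ∈ (insert a u).erase k, Y k ω * Y l ω * r k l
          = ∑ k ∈ u, ∑ l ∈ u.erase k, Y k ω * Y l ω * r k l
            + Y a ω * (2 * ∑ l ∈ u, Y l ω * r a l) := by
        intro ω
        rw [Finset.sum_insert hau, Finset.erase_insert hau]
        have : ∀ k ∈ u, ∑ l ∈ (insert a u).erase k, Y k ω * Y l ω * r k l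
            = Y a ω * (Y k ω * r a k) + ∑ l ∈ u.erase k, Y k ω * Y l ω * r k l := by
          intro k hk
          have hka : k ≠ a := fun h => hau (h ▸ hk)
          rw [Finset.erase_insert_of_ne hka.symm, Finset.sum_insert (by simp [hau]), hr k a]
          ring
        rw [Finset.sum_congr rfl this, Finset.sum_add_distrib, ← Finset.mul_sum]
        have : ∑ l ∈ u, Y a ω * Y l ω * r a l = Y a ω * ∑ l ∈ u, Y l ω * r a l := by
          rw [Finset.mul_sum]; exact Finset.sum_congr rfl fun l _ => by ring
        rw [this]; ring
      simp_rw [e]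
      refine h.trans ?_
      set Q := fun ω => ∑ k ∈ u, ∑ l ∈ u.erase k, Y k ω * Y l ω * r k l with hQ
      set T := fun ω => 2 * ∑ l ∈ u, Y l ω * r a l with hT
      have hQm : HasMoments Q P := hmom u
      have hTm : HasMoments T P := (hlin u a).const_mul 2
      have hT4 : ∫ ω, T ω ^ (2 * m) ∂P ≤ 4 ^ m * B a := by
        simp only [hT, mul_pow]
        rw [integral_const_mul, pow_mul]
        norm_num only
        exact mul_le_mul_of_nonneg_left (hB a ha u hu) (by positivity)
      have hmix : ∫ ω, Q ω ^ (2 * m - 2) * T ω ^ 2 ∂P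
          ≤ ∫ ω, Q ω ^ (2 * m) ∂P + ∫ ω, T ω ^ (2 * m) ∂P := by
        rw [← integral_add (hQm.pow _).integrable (hTm.pow _).integrable]
        refine integral_mono ((hQm.pow _).mul (hTm.pow _)).integrable
          ((hQm.pow _).add (hTm.pow _)).integrable fun ω => ?_
        simp only
        have e1 : Q ω ^ (2 * m - 2) = (Q ω ^ 2) ^ (m - 1) := by rw [← pow_mul]; congr 1; omega
        have e2 : Q ω ^ (2 * m) = (Q ω ^ 2) ^ (m - 1) * Q ω ^ 2 := by
          rw [← pow_mul, ← pow_add]; congr 1; omega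
        have e3 : T ω ^ (2 * m) = (T ω ^ 2) ^ (m - 1) * T ω ^ 2 := by
          rw [← pow_mul, ← pow_add]; congr 1; omega
        rw [e1, e2, e3]
        have q0 : 0 ≤ (Q ω ^ 2) ^ (m - 1) := by positivity
        have t0 : 0 ≤ (T ω ^ 2) ^ (m - 1) * T ω ^ 2 := by positivity
        rcases le_total (T ω ^ 2) (Q ω ^ 2) with h | h
        · have : (Q ω ^ 2) ^ (m - 1) * T ω ^ 2 ≤ (Q ω ^ 2) ^ (m - 1) * Q ω ^ 2 := by gcongr
          linarith
        · have : (Q ω ^ 2) ^ (m - 1) * T ω ^ 2 ≤ (T ω ^ 2) ^ (m - 1) * T ω ^ 2 := by gcongr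
          have : 0 ≤ (Q ω ^ 2) ^ (m - 1) * Q ω ^ 2 := by positivity
          linarith
      set I := ∫ ω, Q ω ^ (2 * m) ∂P
      have hI : 0 ≤ I := integral_nonneg fun ω => (even_two_mul m).pow_nonneg _
      have hT0 : 0 ≤ ∫ ω, T ω ^ (2 * m) ∂P :=
        integral_nonneg fun ω => (even_two_mul m).pow_nonneg _
      have hBa := hB0 a
      have hY2 : 0 ≤ ∫ ω, Y a ω ^ 2 ∂P := integral_nonneg fun ω => sq_nonneg _
      have hY3 : 0 ≤ ∫ ω, Y a ω ^ (2 * m) ∂P :=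
        integral_nonneg fun ω => (even_two_mul m).pow_nonneg _
      calc I + 4 ^ m * ((∫ ω, Q ω ^ (2 * m - 2) * T ω ^ 2 ∂P) * (∫ ω, Y a ω ^ 2 ∂P) +
            (∫ ω, T ω ^ (2 * m) ∂P) * ∫ ω, Y a ω ^ (2 * m) ∂P)
          ≤ I + 4 ^ m * ((I + 4 ^ m * B a) * (A / N) + 4 ^ m * B a * (A / N)) := by
            gcongr
            · exact hmix.trans (by gcongr)
            · exact h2 a ha
            · exact h2m a ha
        _ = (1 + 4 ^ m * A / N) * I + 2 * 16 ^ m * A / N * B a := by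
            have : (16 : ℝ) ^ m = 4 ^ m * 4 ^ m := by rw [← mul_pow]; norm_num
            rw [this]; ring)
  refine key.trans ?_
  rw [Finset.sum_const, nsmul_eq_mul, ← Finset.mul_sum]
  have hsum : 0 ≤ ∑ a ∈ s, B a := Finset.sum_nonneg fun a _ => hB0 a
  have hcard : (s.card : ℝ) * (4 ^ m * A / N) ≤ 4 ^ m * A :=
    calc (s.card : ℝ) * (4 ^ m * A / N) ≤ N * (4 ^ m * A / N) := by gcongr
      _ = 4 ^ m * A := by field_simp
  exact mul_le_mul_of_nonneg_right (Real.exp_le_exp.mpr hcard) (by positivity)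

/-- Resampling a set of coordinates preserves a product measure. -/
lemma measurePreserving_piecewise {ι : Type*} [Fintype ι] (ν : ι → Measure ℝ)
    [∀ i, IsProbabilityMeasure (ν i)] (A : Finset ι) [∀ i, Decidable (i ∈ A)] :
    MeasurePreserving (fun q : (ι → ℝ) × (ι → ℝ) => A.piecewise q.1 q.2)
      ((Measure.pi ν).prod (Measure.pi ν)) (Measure.pi ν) := by
  have hmeas : Measurable (fun q : (ι → ℝ) × (ι → ℝ) => A.piecewise q.1 q.2) := by
    refine measurable_pi_iff.mpr fun i => ?_
    by_cases h : i ∈ A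
    · simp only [Finset.piecewise, h, if_true]; fun_prop
    · simp only [Finset.piecewise, h, if_false]; fun_prop
  refine ⟨hmeas, (Measure.pi_eq fun s hs => ?_).symm⟩
  rw [Measure.map_apply hmeas (MeasurableSet.univ_pi hs)]
  have : (fun q : (ι → ℝ) × (ι → ℝ) => A.piecewise q.1 q.2) ⁻¹' (Set.univ.pi s)
      = (Set.univ.pi fun i => if i ∈ A then s i else Set.univ) ×ˢ
        (Set.univ.pi fun i => if i ∈ A then Set.univ else s i) := by
    ext q
    simp only [Set.mem_preimage, Set.mem_pi, Set.mem_univ, true_implies, Set.mem_prod,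
      Finset.piecewise]
    constructor
    · intro h
      refine ⟨fun i => ?_, fun i => ?_⟩ <;> have := h i <;> split_ifs at this ⊢ <;> simp_all
    · rintro ⟨h1, h2⟩ i
      have a := h1 i
      have b := h2 i
      split_ifs at a b ⊢ <;> assumption
  rw [this, Measure.prod_prod, Measure.pi_pi, Measure.pi_pi, ← Finset.prod_mul_distrib]
  refine Finset.prod_congr rfl fun i _ => ?_
  split_ifs <;> simp

/-- Fubini's theorem in the form of a conditional expectation: the coordinates in `A` are integrated
with the others frozen. It replaces conditioning on sigma-algebras throughout. -/
lemma integral_resample {ι : Type*} [Fintype ι] (ν : ι → Measure ℝ)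
    [∀ i, IsProbabilityMeasure (ν i)] (A : Finset ι) [∀ i, Decidable (i ∈ A)] {E : Type*}
    [NormedAddCommGroup E] [NormedSpace ℝ E] {f : (ι → ℝ) → E}
    (hf : Integrable f (Measure.pi ν)) :
    ∫ x, f x ∂(Measure.pi ν)
      = ∫ x, ∫ x', f (A.piecewise x' x) ∂(Measure.pi ν) ∂(Measure.pi ν) := by
  have hmp := measurePreserving_piecewise ν A
  have h1 : Integrable (fun q : (ι → ℝ) × (ι → ℝ) => f (A.piecewise q.1 q.2))
      ((Measure.pi ν).prod (Measure.pi ν)) := (hmp.integrable_comp hf.aestronglyMeasurable).mpr hf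
  rw [← integral_prod_symm _ h1]
  conv_lhs => rw [← hmp.map_eq]
  rw [integral_map hmp.measurable.aemeasurable]
  rw [hmp.map_eq]
  exact hf.aestronglyMeasurable

end Moments


/-! ### Moment bounds for complex linear and quadratic forms. -/

section ComplexForms

variable {Ω : Type*} [MeasurableSpace Ω] {P : Measure Ω}

lemma norm_pow_even_le (w : ℂ) (m : ℕ) :
    ‖w‖ ^ (2 * m) ≤ 2 ^ m * (w.re ^ (2 * m) + w.im ^ (2 * m)) := by
  rw [pow_mul, Complex.sq_norm, Complex.normSq_apply, ← sq, ← sq]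
  have h := add_pow_le (sq_nonneg w.re) (sq_nonneg w.im) m
  rw [← pow_mul, ← pow_mul] at h
  refine h.trans (mul_le_mul_of_nonneg_right ?_ ?_)
  · exact pow_le_pow_right₀ (by norm_num) (by omega)
  · exact add_nonneg ((even_two_mul m).pow_nonneg _) ((even_two_mul m).pow_nonneg _)

lemma re_pow_even_le (w : ℂ) (m : ℕ) : w.re ^ (2 * m) ≤ ‖w‖ ^ (2 * m) := by
  rw [← (even_two_mul m).pow_abs]
  exact pow_le_pow_left₀ (abs_nonneg _) (Complex.abs_re_le_norm w) _

lemma im_pow_even_le (w : ℂ) (m : ℕ) : w.im ^ (2 * m) ≤ ‖w‖ ^ (2 * m) := by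
  rw [← (even_two_mul m).pow_abs]
  exact pow_le_pow_left₀ (abs_nonneg _) (Complex.abs_im_le_norm w) _

/-- The constant in Rosenthal's inequality for complex linear forms. -/
noncomputable def linConst (A : ℝ) (m : ℕ) : ℝ :=
  2 ^ m * (2 * (Real.exp (4 ^ m * A) * (4 ^ m * A)))

lemma linConst_nonneg {A : ℝ} (hA : 0 ≤ A) (m : ℕ) : 0 ≤ linConst A m := by
  unfold linConst; positivity

lemma integral_norm_linear_form_le [IsProbabilityMeasure P] {ι : Type*}
    {Y : ι → Ω → ℝ} (hind : iIndepFun Y P) (hmeas : ∀ k, Measurable (Y k))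
    (hY : ∀ k, HasMoments (Y k) P) (hmean : ∀ k, ∫ ω, Y k ω ∂P = 0) {m : ℕ} (hm : 1 ≤ m)
    (s : Finset ι) {N A ρ V : ℝ} (hN : 0 < N) (hA : 0 ≤ A) (hρ : 0 ≤ ρ)
    (h2 : ∀ k ∈ s, ∫ ω, Y k ω ^ 2 ∂P ≤ A / N)
    (h2m : ∀ k ∈ s, ∫ ω, Y k ω ^ (2 * m) ∂P ≤ A * ρ / N)
    (b : ι → ℂ) (hV : ∑ k ∈ s, ‖b k‖ ^ 2 ≤ N * V) :
    ∫ ω, ‖∑ k ∈ s, (Y k ω : ℂ) * b k‖ ^ (2 * m) ∂P ≤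
      linConst A m * (V ^ m + ρ / N * ∑ k ∈ s, ‖b k‖ ^ (2 * m)) := by
  have hre := integral_linear_form_pow_le hind hmeas hY hmean hm s hN hA hρ h2 h2m
    (fun k => (b k).re) ((Finset.sum_le_sum fun k _ => re_pow_even_le (b k) 1).trans hV)
  have him := integral_linear_form_pow_le hind hmeas hY hmean hm s hN hA hρ h2 h2m
    (fun k => (b k).im) ((Finset.sum_le_sum fun k _ => im_pow_even_le (b k) 1).trans hV)
  have hmr : HasMoments (fun ω => ∑ k ∈ s, Y k ω * (b k).re) P :=
    HasMoments.sum s fun k _ => (hY k).mul (HasMoments.const _)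
  have hmi : HasMoments (fun ω => ∑ k ∈ s, Y k ω * (b k).im) P :=
    HasMoments.sum s fun k _ => (hY k).mul (HasMoments.const _)
  have hsr : ∑ k ∈ s, (b k).re ^ (2 * m) ≤ ∑ k ∈ s, ‖b k‖ ^ (2 * m) :=
    Finset.sum_le_sum fun k _ => re_pow_even_le _ _
  have hsi : ∑ k ∈ s, (b k).im ^ (2 * m) ≤ ∑ k ∈ s, ‖b k‖ ^ (2 * m) :=
    Finset.sum_le_sum fun k _ => im_pow_even_le _ _
  calc ∫ ω, ‖∑ k ∈ s, (Y k ω : ℂ) * b k‖ ^ (2 * m) ∂P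
      ≤ ∫ ω, 2 ^ m * ((∑ k ∈ s, Y k ω * (b k).re) ^ (2 * m)
        + (∑ k ∈ s, Y k ω * (b k).im) ^ (2 * m)) ∂P := by
        refine integral_mono_of_nonneg (ae_of_all _ fun ω => by positivity)
          (((hmr.pow _).add (hmi.pow _)).const_mul _).integrable (ae_of_all _ fun ω => ?_)
        refine (norm_pow_even_le _ m).trans (le_of_eq ?_)
        simp
    _ = 2 ^ m * (∫ ω, (∑ k ∈ s, Y k ω * (b k).re) ^ (2 * m) ∂P
        + ∫ ω, (∑ k ∈ s, Y k ω * (b k).im) ^ (2 * m) ∂P) := by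
        rw [integral_const_mul, integral_add (hmr.pow _).integrable (hmi.pow _).integrable]
    _ ≤ 2 ^ m * (Real.exp (4 ^ m * A) * (4 ^ m * A * (V ^ m + ρ / N * ∑ k ∈ s, ‖b k‖ ^ (2 * m)))
        + Real.exp (4 ^ m * A) * (4 ^ m * A * (V ^ m + ρ / N * ∑ k ∈ s, ‖b k‖ ^ (2 * m)))) := by
        gcongr
        · exact hre.trans (by gcongr)
        · exact him.trans (by gcongr)
    _ = _ := by unfold linConst; ring

/-- The constant in the moment bound for complex quadratic forms. -/
noncomputable def quadConst (A : ℝ) (m : ℕ) : ℝ :=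
  2 ^ m * (2 * (Real.exp (4 ^ m * A) * (2 * 16 ^ m * A * (Real.exp (4 ^ m * A) * (4 ^ m * A)))))

lemma quadConst_nonneg {A : ℝ} (hA : 0 ≤ A) (m : ℕ) : 0 ≤ quadConst A m := by
  unfold quadConst; positivity

/-- Two layers: the quadratic form is reduced to the linear forms `∑ Y_l r_al`, to which Rosenthal's
inequality applies, separately for the real and the imaginary part of the coefficients. -/
lemma integral_norm_quadratic_form_le [IsProbabilityMeasure P] {ι : Type*} [DecidableEq ι]
    {Y : ι → Ω → ℝ} (hind : iIndepFun Y P) (hmeas : ∀ k, Measurable (Y k))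
    (hY : ∀ k, HasMoments (Y k) P) (hmean : ∀ k, ∫ ω, Y k ω ∂P = 0) {m : ℕ} (hm : 1 ≤ m)
    (s : Finset ι) {N A ρ : ℝ} {V : ι → ℝ} (hN : 0 < N) (hA : 0 ≤ A) (hρ : 0 ≤ ρ) (hρ1 : ρ ≤ 1)
    (hs : (s.card : ℝ) ≤ N)
    (h2 : ∀ k ∈ s, ∫ ω, Y k ω ^ 2 ∂P ≤ A / N)
    (h2m : ∀ k ∈ s, ∫ ω, Y k ω ^ (2 * m) ∂P ≤ A * ρ / N)
    (r : ι → ι → ℂ) (hr : ∀ k l, r k l = r l k) (hV0 : ∀ a, 0 ≤ V a)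
    (hV : ∀ a ∈ s, ∑ k ∈ s, ‖r a k‖ ^ 2 ≤ N * V a) :
    ∫ ω, ‖∑ k ∈ s, ∑ l ∈ s.erase k, (Y k ω : ℂ) * (Y l ω : ℂ) * r k l‖ ^ (2 * m) ∂P ≤
      quadConst A m * (1 / N * ∑ a ∈ s, (V a ^ m + ρ / N * ∑ l ∈ s, ‖r a l‖ ^ (2 * m))) := by
  set B : ι → ℝ := fun a => Real.exp (4 ^ m * A) *
    (4 ^ m * A * (V a ^ m + ρ / N * ∑ l ∈ s, ‖r a l‖ ^ (2 * m))) with hB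
  have hB0 : ∀ a, 0 ≤ B a := fun a => by have := hV0 a; positivity
  have h2m' : ∀ k ∈ s, ∫ ω, Y k ω ^ (2 * m) ∂P ≤ A / N := fun k hk =>
    (h2m k hk).trans (by gcongr; nlinarith)
  have hlin : ∀ (φ : ℂ → ℝ), (∀ w k, φ w ^ (2 * k) ≤ ‖w‖ ^ (2 * k)) → ∀ a ∈ s, ∀ u ⊆ s,
      ∫ ω, (∑ l ∈ u, Y l ω * φ (r a l)) ^ (2 * m) ∂P ≤ B a := by
    intro φ hφ a ha u hu
    have h := integral_linear_form_pow_le hind hmeas hY hmean hm u hN hA hρ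
      (fun k hk => h2 k (hu hk)) (fun k hk => h2m k (hu hk)) (V := V a)
      (fun k => φ (r a k)) (le_trans ?_ (hV a ha))
    · refine h.trans ?_
      simp only [hB]
      gcongr
      exact (Finset.sum_le_sum fun k _ => hφ _ _).trans
        (Finset.sum_le_sum_of_subset_of_nonneg hu fun _ _ _ => by positivity)
    · exact (Finset.sum_le_sum fun k _ => hφ _ 1).trans
        (Finset.sum_le_sum_of_subset_of_nonneg hu fun _ _ _ => by positivity)
  have hre := integral_quadratic_form_pow_le hind hmeas hY hmean hm s hN hA hs h2 h2m'
    (fun k l => (r k l).re) (fun k l => by rw [hr]) B hB0 (hlin Complex.re re_pow_even_le)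
  have him := integral_quadratic_form_pow_le hind hmeas hY hmean hm s hN hA hs h2 h2m'
    (fun k l => (r k l).im) (fun k l => by rw [hr]) B hB0 (hlin Complex.im im_pow_even_le)
  have hmr : HasMoments (fun ω => ∑ k ∈ s, ∑ l ∈ s.erase k, Y k ω * Y l ω * (r k l).re) P :=
    HasMoments.sum s fun k _ => HasMoments.sum _ fun l _ =>
      ((hY k).mul (hY l)).mul (HasMoments.const _)
  have hmi : HasMoments (fun ω => ∑ k ∈ s, ∑ l ∈ s.erase k, Y k ω * Y l ω * (r k l).im) P :=
    HasMoments.sum s fun k _ => HasMoments.sum _ fun l _ =>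
      ((hY k).mul (hY l)).mul (HasMoments.const _)
  calc ∫ ω, ‖∑ k ∈ s, ∑ l ∈ s.erase k, (Y k ω : ℂ) * (Y l ω : ℂ) * r k l‖ ^ (2 * m) ∂P
      ≤ ∫ ω, 2 ^ m * ((∑ k ∈ s, ∑ l ∈ s.erase k, Y k ω * Y l ω * (r k l).re) ^ (2 * m)
        + (∑ k ∈ s, ∑ l ∈ s.erase k, Y k ω * Y l ω * (r k l).im) ^ (2 * m)) ∂P := by
        refine integral_mono_of_nonneg (ae_of_all _ fun ω => by positivity)
          (((hmr.pow _).add (hmi.pow _)).const_mul _).integrable (ae_of_all _ fun ω => ?_)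
        refine (norm_pow_even_le _ m).trans (le_of_eq ?_)
        simp only [Complex.re_sum, Complex.im_sum, ← Complex.ofReal_mul, Complex.re_ofReal_mul,
          Complex.im_ofReal_mul]
    _ = 2 ^ m * (∫ ω, (∑ k ∈ s, ∑ l ∈ s.erase k, Y k ω * Y l ω * (r k l).re) ^ (2 * m) ∂P
        + ∫ ω, (∑ k ∈ s, ∑ l ∈ s.erase k, Y k ω * Y l ω * (r k l).im) ^ (2 * m) ∂P) := by
        rw [integral_const_mul, integral_add (hmr.pow _).integrable (hmi.pow _).integrable]
    _ ≤ 2 ^ m * (Real.exp (4 ^ m * A) * (2 * 16 ^ m * A / N * ∑ a ∈ s, B a) +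
          Real.exp (4 ^ m * A) * (2 * 16 ^ m * A / N * ∑ a ∈ s, B a)) := by gcongr
    _ = _ := by
        simp only [hB, ← Finset.mul_sum]
        unfold quadConst; ring

end ComplexForms

/-! ### Product model for the entries, and masks. -/

section Model

variable {n : ℕ}

/-- The symmetric matrix with entries `c_{ij} x_{ij}`. -/
def masked (c x : Sym2 (Fin n) → ℝ) : Matrix (Fin n) (Fin n) ℝ :=
  Matrix.of fun i j => c s(i, j) * x s(i, j)

lemma masked_apply (c x : Sym2 (Fin n) → ℝ) (i j : Fin n) :
    masked c x i j = c s(i, j) * x s(i, j) := rfl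

lemma masked_isSymm (c x : Sym2 (Fin n) → ℝ) : (masked c x).IsSymm := by
  ext i j
  simp [masked, Sym2.eq_swap]

/-- The laws of the entries of a sparse matrix: centred, with off-diagonal variance `1 / n`, and
with absolute moments of order `k` bounded by `K_k δ^(k-2) / n`. -/
structure EntryLaws (K : ℕ → ℝ) (n : ℕ) (δ : ℝ) (ν : Sym2 (Fin n) → Measure ℝ) : Prop where
  pos : 0 < n
  nonneg : ∀ k, 0 ≤ K k
  scale_pos : 0 < δ
  scale_le : δ ≤ 1
  -- For `δ = (np)^(-1/2)` this says `p ≤ 1`. It lets powers of `1/n` be absorbed into powers of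
  -- `δ`.
  inv_le : 1 / (n : ℝ) ≤ δ ^ 2
  prob : ∀ e, IsProbabilityMeasure (ν e)
  moments : ∀ e, HasMoments (fun x : ℝ => x) (ν e)
  mean : ∀ e, ∫ x, x ∂(ν e) = 0
  -- Diagonal variances are left free, so that a vanishing diagonal is allowed.
  variance : ∀ e, ¬ e.IsDiag → ∫ x, x ^ 2 ∂(ν e) = 1 / n
  abs_moment : ∀ e k, 2 ≤ k → ∫ x, |x| ^ k ∂(ν e) ≤ K k * δ ^ (k - 2) / n

/-- A mask is a choice of signs and zeros for the entries: at most `q` rows, those in `S`, vanish,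
and every other row has at most `q` zeros. -/
structure IsMask (q : ℕ) (S : Finset (Fin n)) (c : Sym2 (Fin n) → ℝ) : Prop where
  -- Zeros encode minors without changing the dimension; signs serve the parity argument for the
  -- off-diagonal entries.
  vals : ∀ e, c e = -1 ∨ c e = 0 ∨ c e = 1
  card_le : S.card ≤ q
  zero : ∀ i ∈ S, ∀ j, c s(i, j) = 0
  few : ∀ i ∉ S, (Finset.univ.filter fun j => c s(i, j) = 0).card ≤ q

/-- The mask `c` with the `i`-th row switched off. -/
def zeroRow (i : Fin n) (c : Sym2 (Fin n) → ℝ) (e : Sym2 (Fin n)) : ℝ := if i ∈ e then 0 else c e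

lemma masked_zeroRow (i : Fin n) (c x : Sym2 (Fin n) → ℝ) :
    masked (zeroRow i c) x = removeRow i (masked c x) := by
  ext k l
  simp only [masked_apply, zeroRow, removeRow, Matrix.of_apply, Sym2.mem_iff, eq_comm (a := i)]
  split_ifs <;> simp

lemma IsMask.switchOff {q : ℕ} {S : Finset (Fin n)} {c : Sym2 (Fin n) → ℝ} (h : IsMask q S c)
    (i : Fin n) : IsMask (q + 1) (insert i S) (zeroRow i c) where
  vals e := by
    unfold zeroRow
    split_ifs
    · simp
    · exact h.vals e
  card_le := (Finset.card_insert_le _ _).trans (Nat.succ_le_succ h.card_le)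
  zero k hk j := by
    unfold zeroRow
    split_ifs with hi
    · rfl
    · rcases Finset.mem_insert.mp hk with rfl | hk
      · simp at hi
      · exact h.zero k hk j
  few k hk := by
    have hk' : k ≠ i ∧ k ∉ S := by simpa using hk
    refine le_trans (Finset.card_le_card ?_)
      ((Finset.card_insert_le i _).trans (Nat.succ_le_succ (h.few k hk'.2)))
    intro j hj
    simp only [zeroRow, Finset.mem_filter, Finset.mem_univ, true_and, Sym2.mem_iff,
      Finset.mem_insert] at hj ⊢
    by_cases hji : j = i
    · exact Or.inl hji
    · right
      rwa [if_neg (by rintro (h | h); exacts [hk'.1 h.symm, hji h.symm])] at hj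

lemma IsMask.abs_le_one {q : ℕ} {S : Finset (Fin n)} {c : Sym2 (Fin n) → ℝ} (h : IsMask q S c)
    (e : Sym2 (Fin n)) : |c e| ≤ 1 := by
  rcases h.vals e with h | h | h <;> simp [h]

lemma measurable_resolvent_masked (z : ℂ) (c : Sym2 (Fin n) → ℝ) (i j : Fin n) :
    Measurable fun x => resolventMatrix z (masked c x) i j := by
  have hc : Continuous fun x : Sym2 (Fin n) → ℝ => shifted z (masked c x) := by
    refine continuous_pi fun i => continuous_pi fun j => ?_
    simp only [shifted_apply, masked_apply]
    fun_prop
  have h1 : Measurable fun x : Sym2 (Fin n) → ℝ => (shifted z (masked c x)).det⁻¹ :=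
    (Continuous.matrix_det hc).measurable.inv
  have h2 : Measurable fun x : Sym2 (Fin n) → ℝ => (shifted z (masked c x)).adjugate i j :=
    ((Continuous.matrix_adjugate hc).matrix_elem i j).measurable
  have : (fun x => resolventMatrix z (masked c x) i j)
      = fun x => (shifted z (masked c x)).det⁻¹ * (shifted z (masked c x)).adjugate i j := by
    funext x
    rw [resolventMatrix_eq, Matrix.inv_def]
    simp
  rw [this]
  exact h1.mul h2

variable {K : ℕ → ℝ} {δ : ℝ} {ν : Sym2 (Fin n) → Measure ℝ}

lemma measurable_masked (c : Sym2 (Fin n) → ℝ) (i j : Fin n) :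
    Measurable fun x => masked c x i j := by
  unfold masked; fun_prop

lemma hasMoments_norm_resolvent [∀ e, IsProbabilityMeasure (ν e)] {z : ℂ} (hz : 0 < z.im)
    (c : Sym2 (Fin n) → ℝ) (i j : Fin n) :
    HasMoments (fun x => ‖resolventMatrix z (masked c x) i j‖) (Measure.pi ν) :=
  HasMoments.of_bound (measurable_resolvent_masked z c i j).norm.aestronglyMeasurable (1 / z.im)
    fun x => by
      rw [abs_norm]; exact norm_resolvent_le (masked_isSymm c x) hz i j

namespace EntryLaws

lemma integral_comp_eval (h : EntryLaws K n δ ν) (e : Sym2 (Fin n)) {f : ℝ → ℝ}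
    (hf : Measurable f) : ∫ x, f (x e) ∂(Measure.pi ν) = ∫ y, f y ∂(ν e) := by
  have := h.prob
  have hmp := measurePreserving_eval ν e
  rw [← hmp.map_eq, integral_map hmp.measurable.aemeasurable hf.aestronglyMeasurable]

lemma hasMoments_masked (h : EntryLaws K n δ ν) (c : Sym2 (Fin n) → ℝ) (i j : Fin n) :
    HasMoments (fun x => masked c x i j) (Measure.pi ν) := by
  have := h.prob
  have h1 : HasMoments (fun x : Sym2 (Fin n) → ℝ => x s(i, j)) (Measure.pi ν) := fun p =>
    (h.moments _ p).comp_measurePreserving (measurePreserving_eval ν s(i, j))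
  exact h1.const_mul _

lemma integral_masked (h : EntryLaws K n δ ν) (c : Sym2 (Fin n) → ℝ) (i j : Fin n) :
    ∫ x, masked c x i j ∂(Measure.pi ν) = 0 := by
  simp only [masked_apply]
  rw [integral_const_mul, h.integral_comp_eval s(i, j) (f := fun y => y) measurable_id, h.mean,
    mul_zero]

lemma integral_masked_sq (h : EntryLaws K n δ ν) (c : Sym2 (Fin n) → ℝ) {i j : Fin n}
    (hij : i ≠ j) : ∫ x, masked c x i j ^ 2 ∂(Measure.pi ν) = c s(i, j) ^ 2 / n := by
  simp only [masked_apply, mul_pow]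
  rw [integral_const_mul, h.integral_comp_eval s(i, j) (f := fun y => y ^ 2) (by fun_prop),
    h.variance _ (by simpa using hij)]
  ring

lemma integral_abs_masked_pow_le (h : EntryLaws K n δ ν) {q : ℕ} {S : Finset (Fin n)}
    {c : Sym2 (Fin n) → ℝ} (hc : IsMask q S c) (i j : Fin n) {k : ℕ} (hk : 2 ≤ k) :
    ∫ x, |masked c x i j| ^ k ∂(Measure.pi ν) ≤ K k * δ ^ (k - 2) / n := by
  simp only [masked_apply, abs_mul, mul_pow]
  rw [integral_const_mul, h.integral_comp_eval s(i, j) (f := fun y => |y| ^ k) (by fun_prop)]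
  have h1 : |c s(i, j)| ^ k ≤ 1 := pow_le_one₀ (abs_nonneg _) (hc.abs_le_one _)
  have h2 : 0 ≤ ∫ y, |y| ^ k ∂(ν s(i, j)) := integral_nonneg fun y => by positivity
  exact (mul_le_of_le_one_left h2 h1).trans (h.abs_moment _ k hk)

lemma integral_masked_pow_even_le (h : EntryLaws K n δ ν) {q : ℕ} {S : Finset (Fin n)}
    {c : Sym2 (Fin n) → ℝ} (hc : IsMask q S c) (i j : Fin n) {m : ℕ} (hm : 1 ≤ m) :
    ∫ x, masked c x i j ^ (2 * m) ∂(Measure.pi ν) ≤ K (2 * m) * δ ^ (2 * m - 2) / n := by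
  have := h.integral_abs_masked_pow_le hc i j (k := 2 * m) (by omega)
  simpa [(even_two_mul m).pow_abs] using this

lemma iIndepFun_masked (h : EntryLaws K n δ ν) (c : Sym2 (Fin n) → ℝ) (i : Fin n) :
    iIndepFun (fun k x => masked c x i k) (Measure.pi ν) := by
  have := h.prob
  have h1 : iIndepFun (fun e (x : Sym2 (Fin n) → ℝ) => c e * x e) (Measure.pi ν) :=
    iIndepFun_pi (X := fun e y => c e * y) fun e => by fun_prop
  refine h1.precomp (g := fun k : Fin n => s(i, k)) fun k l hkl => ?_
  exact Sym2.congr_right.mp hkl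

end EntryLaws

end Model


/-! ### Linear forms in one row, conditionally on the minor. -/

section RowBounds

variable {n : ℕ} {K : ℕ → ℝ} {δ : ℝ} {ν : Sym2 (Fin n) → Measure ℝ}

lemma HasMoments.mono {Ω : Type*} [MeasurableSpace Ω] {P : Measure Ω} {f g : Ω → ℝ}
    (hg : HasMoments g P) (hf : AEStronglyMeasurable f P) (h : ∀ ω, |f ω| ≤ g ω) :
    HasMoments f P :=
  fun p => (hg p).mono hf (ae_of_all _ fun ω => (h ω).trans (le_abs_self _))

/-- Replacing row `i` by an independent copy. -/
lemma EntryLaws.integral_row_le (h : EntryLaws K n δ ν) (c : Sym2 (Fin n) → ℝ) (i : Fin n) (z : ℂ)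
    {Φ : (Fin n → ℝ) → Matrix (Fin n) (Fin n) ℂ → ℝ} (hΦ0 : ∀ w R, 0 ≤ Φ w R)
    (hΦ : Integrable (fun x => Φ (masked c x i) (resolventMatrix z (masked (zeroRow i c) x)))
      (Measure.pi ν)) {g : (Sym2 (Fin n) → ℝ) → ℝ} (hg : Integrable g (Measure.pi ν))
    (hle : ∀ x, ∫ x', Φ (masked c x' i) (resolventMatrix z (masked (zeroRow i c) x))
      ∂(Measure.pi ν) ≤ g x) :
    ∫ x, Φ (masked c x i) (resolventMatrix z (masked (zeroRow i c) x)) ∂(Measure.pi ν)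
      ≤ ∫ x, g x ∂(Measure.pi ν) := by
  classical
  have := h.prob
  -- The resampled coordinates are exactly the entries of row `i`, which the minor does not see.
  rw [integral_resample ν (Finset.univ.filter fun e => i ∈ e) hΦ]
  refine integral_mono_of_nonneg (ae_of_all _ fun x => integral_nonneg fun x' => hΦ0 _ _) hg
    (ae_of_all _ fun x => ?_)
  refine le_trans (le_of_eq ?_) (hle x)
  refine integral_congr_ae (ae_of_all _ fun x' => ?_)
  have e1 : masked c ((Finset.univ.filter fun e => i ∈ e).piecewise x' x) i = masked c x' i := by
    funext k; simp [masked_apply, Finset.piecewise]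
  have e2 : masked (zeroRow i c) ((Finset.univ.filter fun e => i ∈ e).piecewise x' x)
      = masked (zeroRow i c) x := by
    ext k l
    simp only [masked_apply, zeroRow, Finset.piecewise, Finset.mem_filter, Finset.mem_univ,
      true_and]
    split_ifs <;> simp
  simp only [e1, e2]

lemma IsMask.masked_eq_zero {q : ℕ} {S : Finset (Fin n)} {c : Sym2 (Fin n) → ℝ}
    (hc : IsMask q S c) {k : Fin n} (hk : k ∈ S) (x : Sym2 (Fin n) → ℝ) (i : Fin n) :
    masked c x i k = 0 := by
  rw [masked_apply, Sym2.eq_swap, hc.zero k hk, zero_mul]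

/-- Restricting the sum to the complement of `insert i S` leaves only resolvent entries covered by a
`MomentBound` for the minor; the discarded terms carry a vanishing matrix entry. -/
lemma IsMask.rowForm_eq {q : ℕ} {S : Finset (Fin n)} {c : Sym2 (Fin n) → ℝ}
    (hc : IsMask q S c) (z : ℂ) (x : Sym2 (Fin n) → ℝ) (i j : Fin n) :
    rowForm z (masked c x) i j = ∑ k ∈ (insert i S)ᶜ, (masked c x i k : ℂ) *
      resolventMatrix z (masked (zeroRow i c) x) k j := by
  rw [rowForm, ← masked_zeroRow]
  refine (Finset.sum_subset ?_ ?_).symm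
  · intro k hk
    simp only [Finset.mem_compl, Finset.mem_insert, not_or] at hk
    simp [hk.1]
  · intro k hk hk'
    have hkS : k ∈ S := by
      simp only [Finset.mem_compl, Finset.mem_insert, not_or, not_and, not_not] at hk'
      exact hk' (Finset.ne_of_mem_erase hk)
    rw [hc.masked_eq_zero hkS, Complex.ofReal_zero, zero_mul]

/-- Moments of the entries of a resolvent outside the switched off rows. -/
def MomentBound (ν : Sym2 (Fin n) → Measure ℝ) (S : Finset (Fin n)) (c : Sym2 (Fin n) → ℝ)
    (z : ℂ) (m : ℕ) (Γ : ℝ) : Prop :=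
  ∀ k ∉ S, ∀ l ∉ S, ∫ x, ‖resolventMatrix z (masked c x) k l‖ ^ m ∂(Measure.pi ν) ≤ Γ

lemma MomentBound.half [∀ e, IsProbabilityMeasure (ν e)] {S : Finset (Fin n)}
    {c : Sym2 (Fin n) → ℝ} {z : ℂ} (hz : 0 < z.im) {m : ℕ} {Γ : ℝ} (hΓ : 1 ≤ Γ)
    (h : MomentBound ν S c z (2 * m) Γ) : MomentBound ν S c z m (2 * Γ) := by
  intro k hk l hl
  have hm := hasMoments_norm_resolvent (ν := ν) hz c k l
  calc _ ≤ ∫ x, (1 + ‖resolventMatrix z (masked c x) k l‖ ^ (2 * m)) ∂(Measure.pi ν) := by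
        refine integral_mono (hm.pow m).integrable
          ((integrable_const _).add (hm.pow _).integrable) fun x => ?_
        simp only
        rw [two_mul, pow_add]
        nlinarith [sq_nonneg (‖resolventMatrix z (masked c x) k l‖ ^ m - 1)]
    _ ≤ 1 + Γ := by
        rw [integral_add (integrable_const _) (hm.pow _).integrable]
        simpa using h k hk l hl
    _ ≤ 2 * Γ := by linarith

variable {q : ℕ} {S : Finset (Fin n)} {c : Sym2 (Fin n) → ℝ} {z : ℂ} {t Γ : ℝ} {m : ℕ}

lemma hasMoments_norm_sum [∀ e, IsProbabilityMeasure (ν e)] {ι : Type*} (s : Finset ι)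
    {f : ι → (Sym2 (Fin n) → ℝ) → ℂ} (hf : ∀ k ∈ s, Measurable (f k))
    (h : ∀ k ∈ s, HasMoments (fun x => ‖f k x‖) (Measure.pi ν)) :
    HasMoments (fun x => ‖∑ k ∈ s, f k x‖) (Measure.pi ν) :=
  (HasMoments.sum s h).mono (Finset.measurable_sum s hf).norm.aestronglyMeasurable fun x => by
    rw [abs_norm]; exact norm_sum_le _ _

lemma EntryLaws.hasMoments_row_term (h : EntryLaws K n δ ν) (hz : 0 < z.im)
    (c c' : Sym2 (Fin n) → ℝ) (i j k l : Fin n) :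
    HasMoments (fun x => ‖(masked c x i j : ℂ) * resolventMatrix z (masked c' x) k l‖)
      (Measure.pi ν) := by
  have := h.prob
  refine ((((h.hasMoments_masked c i j).pow 2).add (HasMoments.const 1)).mul
    (hasMoments_norm_resolvent (ν := ν) hz c' k l)).mono ?_ fun x => ?_
  · exact ((Complex.measurable_ofReal.comp (measurable_masked c i j)).mul
      (measurable_resolvent_masked z c' k l)).norm.aestronglyMeasurable
  · rw [abs_norm, norm_mul, Complex.norm_real, Real.norm_eq_abs]
    gcongr
    rw [← sq_abs]
    nlinarith [sq_nonneg (|masked c x i j| - 1), sq_nonneg (|masked c x i j|)]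

/-- The scale conditions tying the size of the entries, the spectral parameter and the control
parameter `t`. -/
structure Scales (n : ℕ) (δ t : ℝ) (z : ℂ) : Prop where
  im_pos : 0 < z.im
  pos : 0 < t
  le_one : t ≤ 1
  -- Two sources of error are put on one footing: high moments of the entries give powers of `δ² ≤
  -- t^8`, and the Ward identity gives powers of `1/(n Im z) ≤ t^8`.
  scale_le : δ ≤ t ^ 4
  one_le : 1 ≤ n * z.im * t ^ 8

lemma Scales.inv_le (h : Scales n δ t z) : 1 / (n * z.im) ≤ t ^ 8 := by
  have h1 := h.one_le
  have hn : 0 < (n : ℝ) := by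
    rcases Nat.eq_zero_or_pos n with rfl | hn
    · simp at h1; linarith
    · exact_mod_cast hn
  have := h.im_pos
  rw [div_le_iff₀ (by positivity)]
  linarith

lemma EntryLaws.scale_pow_le (h : EntryLaws K n δ ν) (hs : Scales n δ t z) (m : ℕ) :
    δ ^ (2 * m - 2) ≤ t ^ (8 * (m - 1)) := by
  calc δ ^ (2 * m - 2) ≤ (t ^ 4) ^ (2 * m - 2) :=
        pow_le_pow_left₀ h.scale_pos.le hs.scale_le _
    _ = t ^ (8 * (m - 1)) := by rw [← pow_mul]; congr 1; omega

/-- Given the minor this is a linear form in row `i`. By the Ward identity its variance proxy is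
`|R'_jj| / (n Im z)`, while the higher-moment term of Rosenthal's inequality carries `δ^(2m-2)`;
both are paid with powers of `t^8`. -/
lemma EntryLaws.integral_norm_rowForm_le (h : EntryLaws K n δ ν) (hs : Scales n δ t z)
    (hc : IsMask q S c) {i j : Fin n} (hj : j ∉ insert i S) (hm : 1 ≤ m) (hΓ : 1 ≤ Γ)
    (hb : MomentBound ν (insert i S) (zeroRow i c) z (2 * m) Γ) :
    ∫ x, ‖rowForm z (masked c x) i j‖ ^ (2 * m) ∂(Measure.pi ν) ≤
      linConst (K 2 + K (2 * m)) m * (3 * Γ) * t ^ (8 * (m - 1)) := by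
  have := h.prob
  have hz := hs.im_pos
  have hn : (0 : ℝ) < n := by exact_mod_cast h.pos
  set A := K 2 + K (2 * m)
  have hA : 0 ≤ A := add_nonneg (h.nonneg _) (h.nonneg _)
  simp_rw [hc.rowForm_eq]
  set s := (insert i S)ᶜ
  have hR := fun k l => hasMoments_norm_resolvent (ν := ν) hz (zeroRow i c) k l
  set g : (Sym2 (Fin n) → ℝ) → ℝ := fun x => linConst A m *
    ((‖resolventMatrix z (masked (zeroRow i c) x) j j‖ * t ^ 8) ^ m + δ ^ (2 * m - 2) / n *
      ∑ k ∈ s, ‖resolventMatrix z (masked (zeroRow i c) x) k j‖ ^ (2 * m)) with hg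
  have i1 : Integrable (fun x => (‖resolventMatrix z (masked (zeroRow i c) x) j j‖ * t ^ 8) ^ m)
      (Measure.pi ν) := (((hR j j).mul (HasMoments.const _)).pow m).integrable
  have i2 : Integrable (fun x => δ ^ (2 * m - 2) / n *
      ∑ k ∈ s, ‖resolventMatrix z (masked (zeroRow i c) x) k j‖ ^ (2 * m)) (Measure.pi ν) :=
    ((HasMoments.sum s fun k _ => (hR k j).pow _).const_mul _).integrable
  refine (h.integral_row_le c i z
    (Φ := fun w R => ‖∑ k ∈ s, (w k : ℂ) * R k j‖ ^ (2 * m)) (g := g)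
    (fun _ _ => by positivity) ?_ ((i1.add i2).const_mul _) fun x => ?_).trans ?_
  · refine ((hasMoments_norm_sum s (fun k _ => ?_) fun k _ =>
      h.hasMoments_row_term hz c (zeroRow i c) i k k j).pow _).integrable
    exact (Complex.measurable_ofReal.comp (measurable_masked c i k)).mul
      (measurable_resolvent_masked z _ k j)
  · refine integral_norm_linear_form_le (h.iIndepFun_masked c i) (fun k => measurable_masked c i k)
      (fun k => h.hasMoments_masked c i k) (fun k => h.integral_masked c i k) hm s hn hA
      (pow_nonneg h.scale_pos.le _) (fun k _ => ?_) (fun k _ => ?_) _ ?_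
    · refine (h.integral_masked_pow_even_le hc i k le_rfl).trans ?_
      simp only [mul_one, Nat.sub_self, pow_zero]
      gcongr
      exact le_add_of_nonneg_right (h.nonneg _)
    · refine (h.integral_masked_pow_even_le hc i k hm).trans ?_
      have := h.scale_pos
      gcongr
      exact le_add_of_nonneg_left (h.nonneg _)
    · have hsym := masked_isSymm (zeroRow i c) x
      calc ∑ k ∈ s, ‖resolventMatrix z (masked (zeroRow i c) x) k j‖ ^ 2
          ≤ ∑ k, ‖resolventMatrix z (masked (zeroRow i c) x) k j‖ ^ 2 :=
            Finset.sum_le_sum_of_subset_of_nonneg (Finset.subset_univ _)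
              fun _ _ _ => by positivity
        _ = ∑ k, ‖resolventMatrix z (masked (zeroRow i c) x) j k‖ ^ 2 :=
            Finset.sum_congr rfl fun k _ => by rw [resolvent_symm hsym]
        _ ≤ ‖resolventMatrix z (masked (zeroRow i c) x) j j‖ / z.im :=
            sum_norm_sq_resolvent_le hsym hz j
        _ = n * (‖resolventMatrix z (masked (zeroRow i c) x) j j‖ * (1 / (n * z.im))) := by
            field_simp
        _ ≤ _ := by gcongr; exact hs.inv_le
  · have hcard : (s.card : ℝ) ≤ n := by
      have := Finset.card_le_univ s
      rw [Fintype.card_fin] at this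
      exact_mod_cast this
    have h1 : ∫ x, (‖resolventMatrix z (masked (zeroRow i c) x) j j‖ * t ^ 8) ^ m ∂(Measure.pi ν)
        ≤ 2 * Γ * t ^ (8 * (m - 1)) := by
      simp only [mul_pow]
      rw [integral_mul_const]
      have := hs.pos
      have h2 : (t ^ 8) ^ m ≤ t ^ (8 * (m - 1)) := by
        rw [← pow_mul]; exact pow_le_pow_of_le_one hs.pos.le hs.le_one (by omega)
      have := hb.half hz hΓ j hj j hj
      gcongr
    have h2 : ∫ x, δ ^ (2 * m - 2) / n *
        ∑ k ∈ s, ‖resolventMatrix z (masked (zeroRow i c) x) k j‖ ^ (2 * m) ∂(Measure.pi ν)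
        ≤ Γ * t ^ (8 * (m - 1)) := by
      rw [integral_const_mul, integral_finsetSum _ fun k _ => ((hR k j).pow _).integrable]
      have h3 : ∑ k ∈ s, ∫ x, ‖resolventMatrix z (masked (zeroRow i c) x) k j‖ ^ (2 * m)
          ∂(Measure.pi ν) ≤ n * Γ := by
        calc _ ≤ ∑ k ∈ s, Γ := Finset.sum_le_sum fun k hk => hb k (Finset.mem_compl.mp hk) j hj
          _ = s.card * Γ := by rw [Finset.sum_const, nsmul_eq_mul]
          _ ≤ n * Γ := by gcongr
      have h4 := h.scale_pow_le hs m
      have := h.scale_pos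
      calc _ ≤ t ^ (8 * (m - 1)) / n * (n * Γ) := by
            have := hs.pos
            gcongr
        _ = Γ * t ^ (8 * (m - 1)) := by field_simp
    simp only [hg]
    rw [integral_const_mul, integral_add i1 i2, mul_assoc]
    have := linConst_nonneg hA m
    gcongr
    linarith

end RowBounds


/-! ### The error term in Schur's formula. -/

section SelfConsistent

variable {n : ℕ} {K : ℕ → ℝ} {δ : ℝ} {ν : Sym2 (Fin n) → Measure ℝ}
  {q : ℕ} {S : Finset (Fin n)} {c : Sym2 (Fin n) → ℝ} {z : ℂ} {t Γ : ℝ} {m : ℕ}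

/-- The normalized trace of the resolvent. -/
noncomputable def avgRes (z : ℂ) (W : Matrix (Fin n) (Fin n) ℝ) : ℂ :=
  (1 / (n : ℂ)) * ∑ k, resolventMatrix z W k k

/-- The error in the self-consistent equation for the `i`-th diagonal entry of the resolvent. -/
noncomputable def selfErr (z : ℂ) (W : Matrix (Fin n) (Fin n) ℝ) (i : Fin n) : ℂ :=
  W i i + ∑ j ∈ Finset.univ.erase i, rowForm z W i j * (W i j : ℂ) - avgRes z W

lemma resolvent_mul_selfErr {W : Matrix (Fin n) (Fin n) ℝ} (hW : W.IsSymm) (hz : 0 < z.im)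
    (i : Fin n) : resolventMatrix z W i i * (z - avgRes z W - selfErr z W i) = 1 := by
  rw [← resolvent_diag_mul_schur hW hz i, selfErr]
  ring

/-- The off-diagonal quadratic form in Schur's formula. -/
noncomputable def offForm (w : Fin n → ℝ) (R : Matrix (Fin n) (Fin n) ℂ) (s : Finset (Fin n)) : ℂ :=
  ∑ k ∈ s, ∑ l ∈ s.erase k, (w k : ℂ) * (w l : ℂ) * R k l

/-- The diagonal fluctuation in Schur's formula. -/
noncomputable def diagForm (w v : Fin n → ℝ) (R : Matrix (Fin n) (Fin n) ℂ)
    (s : Finset (Fin n)) : ℂ :=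
  ∑ k ∈ s, ((w k ^ 2 - v k : ℝ) : ℂ) * R k k

/-- The mean of the diagonal part of the quadratic form is `∑ c_ik² R'_kk / n`. It differs from the
normalised trace by at most `q + 1` missing terms and by the change of trace under removal of a row,
which costs `3`; hence `q + 4`. -/
lemma selfErr_decomp (h : EntryLaws K n δ ν) (hz : 0 < z.im) (hc : IsMask q S c) {i : Fin n}
    (hi : i ∉ S) (x : Sym2 (Fin n) → ℝ) :
    ‖selfErr z (masked c x) i - (masked c x i i
      + offForm (masked c x i) (resolventMatrix z (masked (zeroRow i c) x)) (insert i S)ᶜ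
      + diagForm (masked c x i) (fun k => c s(i, k) ^ 2 / n)
          (resolventMatrix z (masked (zeroRow i c) x)) (insert i S)ᶜ)‖
      ≤ (q + 4) * (1 / (n * z.im)) := by
  have hn : (0 : ℝ) < n := by exact_mod_cast h.pos
  set R' := resolventMatrix z (masked (zeroRow i c) x) with hR'
  set w := masked c x i
  set s := (insert i S)ᶜ with hs
  have hsym := masked_isSymm c x
  have hsum : ∑ j ∈ Finset.univ.erase i, rowForm z (masked c x) i j * (masked c x i j : ℂ)
      = ∑ k ∈ s, ∑ l ∈ s, (w k : ℂ) * (w l : ℂ) * R' k l := by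
    have e1 : ∑ j ∈ Finset.univ.erase i, rowForm z (masked c x) i j * (masked c x i j : ℂ)
        = ∑ j ∈ s, rowForm z (masked c x) i j * (masked c x i j : ℂ) := by
      refine (Finset.sum_subset ?_ ?_).symm
      · intro k hk
        simp only [hs, Finset.mem_compl, Finset.mem_insert, not_or] at hk
        simp [hk.1]
      · intro k hk hk'
        have hkS : k ∈ S := by
          simp only [hs, Finset.mem_compl, Finset.mem_insert, not_or, not_and, not_not] at hk'
          exact hk' (Finset.ne_of_mem_erase hk)
        rw [hc.masked_eq_zero hkS, Complex.ofReal_zero, mul_zero]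
    rw [e1, Finset.sum_comm]
    refine Finset.sum_congr rfl fun j _ => ?_
    rw [hc.rowForm_eq, Finset.sum_mul]
    exact Finset.sum_congr rfl fun k _ => by ring
  have hsplit : ∑ k ∈ s, ∑ l ∈ s, (w k : ℂ) * (w l : ℂ) * R' k l
      = offForm w R' s + diagForm w (fun k => c s(i, k) ^ 2 / n) R' s
        + ∑ k ∈ s, ((c s(i, k) ^ 2 / n : ℝ) : ℂ) * R' k k := by
    rw [offForm, diagForm, ← Finset.sum_add_distrib, ← Finset.sum_add_distrib]
    refine Finset.sum_congr rfl fun k hk => ?_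
    rw [← Finset.add_sum_erase _ _ hk]
    push_cast
    ring
  have hD : selfErr z (masked c x) i - (masked c x i i + offForm w R' s
      + diagForm w (fun k => c s(i, k) ^ 2 / n) R' s)
      = ∑ k ∈ s, ((c s(i, k) ^ 2 / n : ℝ) : ℂ) * R' k k - avgRes z (masked c x) := by
    rw [selfErr, hsum, hsplit]; ring
  rw [hD]
  set Z := insert i (Finset.univ.filter fun j => c s(i, j) = 0) with hZ
  have hcard : (Z.card : ℝ) ≤ q + 1 := by
    have := (Finset.card_insert_le i _).trans (Nat.succ_le_succ (hc.few i hi))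
    exact_mod_cast this
  have hmain : ∑ k ∈ s, ((c s(i, k) ^ 2 / n : ℝ) : ℂ) * R' k k
      = (1 / (n : ℂ)) * (∑ k, R' k k) - (1 / (n : ℂ)) * ∑ k ∈ Z, R' k k := by
    rw [← mul_sub, ← Finset.sum_compl_add_sum Z, add_sub_cancel_right, Finset.mul_sum]
    refine (Finset.sum_subset_zero_on_sdiff ?_ ?_ ?_).symm
    · intro k hk
      simp only [hZ, hs, Finset.mem_compl, Finset.mem_insert, Finset.mem_filter, Finset.mem_univ,
        true_and, not_or] at hk ⊢
      refine ⟨hk.1, fun hkS => hk.2 ?_⟩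
      rw [Sym2.eq_swap]
      exact hc.zero k hkS i
    · intro k hk
      simp only [hZ, hs, Finset.mem_sdiff, Finset.mem_compl, Finset.mem_insert, Finset.mem_filter,
        Finset.mem_univ, true_and, not_or] at hk
      have h1 : c s(i, k) = 0 := by
        by_contra h1
        exact hk.2 ⟨hk.1.1, h1⟩
      simp [h1]
    · intro k hk
      simp only [hZ, Finset.mem_compl, Finset.mem_insert, Finset.mem_filter, Finset.mem_univ,
        true_and, not_or] at hk
      have : c s(i, k) ^ 2 = 1 := by
        rcases hc.vals s(i, k) with h1 | h1 | h1
        · rw [h1]; norm_num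
        · exact absurd h1 hk.2
        · rw [h1]; norm_num
      rw [this]; push_cast; ring
  rw [hmain, avgRes]
  have htr := norm_trace_resolvent_removeRow_sub_le hsym hz i
  rw [← masked_zeroRow, ← hR', norm_sub_rev] at htr
  have hZb : ‖∑ k ∈ Z, R' k k‖ ≤ (q + 1) * (1 / z.im) := by
    refine (norm_sum_le _ _).trans ?_
    calc ∑ k ∈ Z, ‖R' k k‖ ≤ ∑ k ∈ Z, 1 / z.im :=
          Finset.sum_le_sum fun k _ => norm_resolvent_le (masked_isSymm _ x) hz k k
      _ = Z.card * (1 / z.im) := by rw [Finset.sum_const, nsmul_eq_mul]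
      _ ≤ (q + 1) * (1 / z.im) := by gcongr
  have hn' : ‖(1 / (n : ℂ))‖ = 1 / n := by simp
  calc _ = ‖(1 / (n : ℂ)) * (∑ k, R' k k - ∑ k, resolventMatrix z (masked c x) k k)
        - (1 / (n : ℂ)) * ∑ k ∈ Z, R' k k‖ := by congr 1; ring
    _ ≤ 1 / n * (3 / z.im) + 1 / n * ((q + 1) * (1 / z.im)) := by
        refine (norm_sub_le _ _).trans ?_
        rw [norm_mul, norm_mul, hn']
        gcongr
    _ = (q + 4) * (1 / (n * z.im)) := by field_simp; ring

/-- The quadratic analogue of the bound for `rowForm`, with one Ward identity for each row of the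
minor. -/
lemma EntryLaws.integral_norm_offForm_le (h : EntryLaws K n δ ν) (hs : Scales n δ t z)
    (hc : IsMask q S c) (i : Fin n) (hm : 1 ≤ m) (hΓ : 1 ≤ Γ)
    (hb : MomentBound ν (insert i S) (zeroRow i c) z (2 * m) Γ) :
    ∫ x, ‖offForm (masked c x i) (resolventMatrix z (masked (zeroRow i c) x)) (insert i S)ᶜ‖
      ^ (2 * m) ∂(Measure.pi ν) ≤
      quadConst (K 2 + K (2 * m)) m * (3 * Γ) * t ^ (8 * (m - 1)) := by
  have := h.prob
  have hz := hs.im_pos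
  have hn : (0 : ℝ) < n := by exact_mod_cast h.pos
  have ht := hs.pos
  have hδ := h.scale_pos
  set A := K 2 + K (2 * m)
  have hA : 0 ≤ A := add_nonneg (h.nonneg _) (h.nonneg _)
  set s := (insert i S)ᶜ
  have hcard : (s.card : ℝ) ≤ n := by
    have := Finset.card_le_univ s
    rw [Fintype.card_fin] at this
    exact_mod_cast this
  have hR := fun k l => hasMoments_norm_resolvent (ν := ν) hz (zeroRow i c) k l
  set V : (Sym2 (Fin n) → ℝ) → Fin n → ℝ := fun x a =>
    ‖resolventMatrix z (masked (zeroRow i c) x) a a‖ * t ^ 8 with hV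
  set g : (Sym2 (Fin n) → ℝ) → ℝ := fun x => quadConst A m * (1 / n * ∑ a ∈ s, (V x a ^ m +
    δ ^ (2 * m - 2) / n *
      ∑ k ∈ s, ‖resolventMatrix z (masked (zeroRow i c) x) a k‖ ^ (2 * m))) with hg
  have i1 : ∀ a, Integrable (fun x => V x a ^ m) (Measure.pi ν) := fun a =>
    (((hR a a).mul (HasMoments.const _)).pow m).integrable
  have i2 : ∀ a, Integrable (fun x => δ ^ (2 * m - 2) / n *
      ∑ k ∈ s, ‖resolventMatrix z (masked (zeroRow i c) x) a k‖ ^ (2 * m)) (Measure.pi ν) :=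
    fun a => ((HasMoments.sum s fun k _ => (hR a k).pow _).const_mul _).integrable
  have i12 : ∀ a, Integrable (fun x => V x a ^ m + δ ^ (2 * m - 2) / n *
      ∑ k ∈ s, ‖resolventMatrix z (masked (zeroRow i c) x) a k‖ ^ (2 * m)) (Measure.pi ν) :=
    fun a => (i1 a).add (i2 a)
  have i3 : Integrable (fun x => ∑ a ∈ s, (V x a ^ m + δ ^ (2 * m - 2) / n *
      ∑ k ∈ s, ‖resolventMatrix z (masked (zeroRow i c) x) a k‖ ^ (2 * m))) (Measure.pi ν) :=
    integrable_finsetSum _ fun a _ => i12 a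
  have hterm : ∀ k l : Fin n, HasMoments (fun x => ‖(masked c x i k : ℂ) * (masked c x i l : ℂ) *
      resolventMatrix z (masked (zeroRow i c) x) k l‖) (Measure.pi ν) := by
    intro k l
    have h1 := (h.hasMoments_row_term hz c (zeroRow i c) i l k l)
    have h2 : HasMoments (fun x => |masked c x i k|) (Measure.pi ν) := fun p =>
      (h.hasMoments_masked c i k p).abs
    convert h2.mul h1 using 2 with x
    rw [mul_assoc, norm_mul, Complex.norm_real, Real.norm_eq_abs]
  have hmeasterm : ∀ k l : Fin n, Measurable (fun x => (masked c x i k : ℂ) *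
      (masked c x i l : ℂ) * resolventMatrix z (masked (zeroRow i c) x) k l) := fun k l =>
    ((Complex.measurable_ofReal.comp (measurable_masked c i k)).mul
      (Complex.measurable_ofReal.comp (measurable_masked c i l))).mul
      (measurable_resolvent_masked z _ k l)
  refine (h.integral_row_le c i z
    (Φ := fun w R => ‖offForm w R s‖ ^ (2 * m)) (g := g)
    (fun _ _ => by positivity) ?_ ((i3.const_mul _).const_mul _) fun x => ?_).trans ?_
  · exact ((hasMoments_norm_sum s (fun k _ => Finset.measurable_sum _ fun l _ => hmeasterm k l)
      fun k _ => hasMoments_norm_sum _ (fun l _ => hmeasterm k l) fun l _ => hterm k l).pow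
      _).integrable
  · have hsym := masked_isSymm (zeroRow i c) x
    refine integral_norm_quadratic_form_le (h.iIndepFun_masked c i)
      (fun k => measurable_masked c i k) (fun k => h.hasMoments_masked c i k)
      (fun k => h.integral_masked c i k) hm s hn hA (pow_nonneg hδ.le _)
      (pow_le_one₀ hδ.le h.scale_le) hcard (fun k _ => ?_) (fun k _ => ?_)
      (resolventMatrix z (masked (zeroRow i c) x)) (resolvent_symm hsym)
      (fun a => by positivity) fun a _ => ?_
    · refine (h.integral_masked_pow_even_le hc i k le_rfl).trans ?_
      simp only [mul_one, Nat.sub_self, pow_zero]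
      gcongr
      exact le_add_of_nonneg_right (h.nonneg _)
    · refine (h.integral_masked_pow_even_le hc i k hm).trans ?_
      gcongr
      exact le_add_of_nonneg_left (h.nonneg _)
    · calc ∑ k ∈ s, ‖resolventMatrix z (masked (zeroRow i c) x) a k‖ ^ 2
          ≤ ∑ k, ‖resolventMatrix z (masked (zeroRow i c) x) a k‖ ^ 2 :=
            Finset.sum_le_sum_of_subset_of_nonneg (Finset.subset_univ _)
              fun _ _ _ => by positivity
        _ ≤ ‖resolventMatrix z (masked (zeroRow i c) x) a a‖ / z.im :=
            sum_norm_sq_resolvent_le hsym hz a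
        _ = n * (‖resolventMatrix z (masked (zeroRow i c) x) a a‖ * (1 / (n * z.im))) := by
            field_simp
        _ ≤ n * (‖resolventMatrix z (masked (zeroRow i c) x) a a‖ * t ^ 8) := by
            gcongr; exact hs.inv_le
  · have h1 : ∀ a ∈ s, ∫ x, (V x a ^ m + δ ^ (2 * m - 2) / n *
        ∑ k ∈ s, ‖resolventMatrix z (masked (zeroRow i c) x) a k‖ ^ (2 * m)) ∂(Measure.pi ν)
        ≤ 3 * Γ * t ^ (8 * (m - 1)) := by
      intro a ha
      have ha' := Finset.mem_compl.mp ha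
      rw [integral_add (i1 a) (i2 a)]
      have h1 : ∫ x, V x a ^ m ∂(Measure.pi ν) ≤ 2 * Γ * t ^ (8 * (m - 1)) := by
        simp only [hV, mul_pow]
        rw [integral_mul_const]
        have h2 : (t ^ 8) ^ m ≤ t ^ (8 * (m - 1)) := by
          rw [← pow_mul]; exact pow_le_pow_of_le_one hs.pos.le hs.le_one (by omega)
        have := hb.half hz hΓ a ha' a ha'
        gcongr
      have h2 : ∫ x, δ ^ (2 * m - 2) / n *
          ∑ k ∈ s, ‖resolventMatrix z (masked (zeroRow i c) x) a k‖ ^ (2 * m) ∂(Measure.pi ν)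
          ≤ Γ * t ^ (8 * (m - 1)) := by
        rw [integral_const_mul, integral_finsetSum _ fun k _ => ((hR a k).pow _).integrable]
        have h3 : ∑ k ∈ s, ∫ x, ‖resolventMatrix z (masked (zeroRow i c) x) a k‖ ^ (2 * m)
            ∂(Measure.pi ν) ≤ n * Γ := by
          calc _ ≤ ∑ k ∈ s, Γ :=
                Finset.sum_le_sum fun k hk => hb a ha' k (Finset.mem_compl.mp hk)
            _ = s.card * Γ := by rw [Finset.sum_const, nsmul_eq_mul]
            _ ≤ n * Γ := by gcongr
        have h4 := h.scale_pow_le hs m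
        calc _ ≤ t ^ (8 * (m - 1)) / n * (n * Γ) := by gcongr
          _ = Γ * t ^ (8 * (m - 1)) := by field_simp
      linarith
    simp only [hg]
    rw [integral_const_mul, integral_const_mul,
      integral_finsetSum _ fun a _ => i12 a]
    have := quadConst_nonneg hA m
    rw [mul_assoc]
    refine mul_le_mul_of_nonneg_left ?_ this
    calc _ ≤ 1 / (n : ℝ) * ∑ a ∈ s, 3 * Γ * t ^ (8 * (m - 1)) :=
          mul_le_mul_of_nonneg_left (Finset.sum_le_sum h1) (by positivity)
      _ = 1 / n * (s.card * (3 * Γ * t ^ (8 * (m - 1)))) := by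
          rw [Finset.sum_const, nsmul_eq_mul]
      _ ≤ 1 / n * (n * (3 * Γ * t ^ (8 * (m - 1)))) := by gcongr
      _ = 3 * Γ * t ^ (8 * (m - 1)) := by field_simp

lemma sub_pow_even_le {a b : ℝ} (ha : 0 ≤ a) (hb : 0 ≤ b) (m : ℕ) :
    (a - b) ^ (2 * m) ≤ a ^ (2 * m) + b ^ (2 * m) := by
  rcases le_total b a with h | h
  · have : (a - b) ^ (2 * m) ≤ a ^ (2 * m) := pow_le_pow_left₀ (by linarith) (by linarith) _
    have : 0 ≤ b ^ (2 * m) := by positivity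
    linarith
  · have : (b - a) ^ (2 * m) ≤ b ^ (2 * m) := pow_le_pow_left₀ (by linarith) (by linarith) _
    have h2 : (a - b) ^ (2 * m) = (b - a) ^ (2 * m) := by
      rw [← neg_sub, (even_two_mul m).neg_pow]
    have : 0 ≤ a ^ (2 * m) := by positivity
    linarith

lemma avg_pow_le {ι : Type*} (s : Finset ι) {N : ℝ} (hN : 0 < N) (hs : (s.card : ℝ) ≤ N)
    {f : ι → ℝ} (hf : ∀ k, 0 ≤ f k) {m : ℕ} (hm : 1 ≤ m) :
    (1 / N * ∑ k ∈ s, f k) ^ m ≤ 1 / N * ∑ k ∈ s, f k ^ m := by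
  rcases s.eq_empty_or_nonempty with rfl | hne
  · simp [show m ≠ 0 by omega]
  obtain ⟨k, rfl⟩ : ∃ k, m = k + 1 := ⟨m - 1, by omega⟩
  have h := pow_sum_div_card_le_sum_pow (s := s) (f := f) (fun i _ => hf i) k
  have hpos : (0 : ℝ) < s.card := by exact_mod_cast hne.card_pos
  rw [div_le_iff₀ (by positivity)] at h
  have h0 : 0 ≤ ∑ k_1 ∈ s, f k_1 ^ (k + 1) := Finset.sum_nonneg fun i _ => pow_nonneg (hf i) _
  calc (1 / N * ∑ k ∈ s, f k) ^ (k + 1) = 1 / N ^ (k + 1) * (∑ k ∈ s, f k) ^ (k + 1) := by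
        rw [mul_pow, one_div_pow]
    _ ≤ 1 / N ^ (k + 1) * ((∑ i ∈ s, f i ^ (k + 1)) * N ^ k) := by
        gcongr
        exact h.trans (by gcongr)
    _ = 1 / N * ∑ i ∈ s, f i ^ (k + 1) := by field_simp; ring

/-- The centred squares are smaller than the entries by a factor `δ`. Divided by `δ` they satisfy
the hypotheses of the linear bound with `ρ = 1`, and the prefactor `δ^(2m)` supplies the smallness.
-/
lemma EntryLaws.integral_norm_diagForm_le (h : EntryLaws K n δ ν) (hs : Scales n δ t z)
    (hc : IsMask q S c) (i : Fin n) (hm : 1 ≤ m) (hΓ : 1 ≤ Γ)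
    (hb : MomentBound ν (insert i S) (zeroRow i c) z (2 * m) Γ) :
    ∫ x, ‖diagForm (masked c x i) (fun k => c s(i, k) ^ 2 / n)
      (resolventMatrix z (masked (zeroRow i c) x)) (insert i S)ᶜ‖ ^ (2 * m) ∂(Measure.pi ν) ≤
      linConst (K 4 + K (2 * (2 * m)) + 2) m * (2 * Γ) * t ^ (8 * (m - 1)) := by
  have := h.prob
  have hz := hs.im_pos
  have hn : (0 : ℝ) < n := by exact_mod_cast h.pos
  have ht := hs.pos
  have hδ := h.scale_pos
  set A := K 4 + K (2 * (2 * m)) + 2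
  have hA : 0 ≤ A := add_nonneg (add_nonneg (h.nonneg _) (h.nonneg _)) (by norm_num)
  set s := (insert i S)ᶜ with hsdef
  have hcard : (s.card : ℝ) ≤ n := by
    have := Finset.card_le_univ s
    rw [Fintype.card_fin] at this
    exact_mod_cast this
  have hR := fun k l => hasMoments_norm_resolvent (ν := ν) hz (zeroRow i c) k l
  -- The true second moment is used so that every `Y k` is centred, including `k = i`, where the
  -- variance is not prescribed. On `s` it agrees with `c_ik² / n`.
  set v : Fin n → ℝ := fun k => ∫ x, masked c x i k ^ 2 ∂(Measure.pi ν) with hv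
  have hvs : ∀ k ∈ s, v k = c s(i, k) ^ 2 / n := by
    intro k hk
    refine h.integral_masked_sq c ?_
    rintro rfl
    simp [hsdef] at hk
  have hv0 : ∀ k, 0 ≤ v k := fun k => integral_nonneg fun x => sq_nonneg _
  have hv1 : ∀ k ∈ s, v k ≤ 1 / n := by
    intro k hk
    rw [hvs k hk]
    gcongr
    exact (sq_le_one_iff_abs_le_one _).mpr (hc.abs_le_one _)
  set Y : Fin n → (Sym2 (Fin n) → ℝ) → ℝ := fun k x => (masked c x i k ^ 2 - v k) / δ with hY
  have hYmom : ∀ k, HasMoments (Y k) (Measure.pi ν) := by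
    intro k
    convert (((h.hasMoments_masked c i k).pow 2).add (HasMoments.const (-v k))).const_mul (1 / δ)
      using 2 with x
    simp only [hY]; ring
  have hYmeas : ∀ k, Measurable (Y k) := fun k =>
    (((measurable_masked c i k).pow_const 2).sub_const _).div_const _
  have hYind : iIndepFun Y (Measure.pi ν) :=
    (h.iIndepFun_masked c i).comp (fun k y => (y ^ 2 - v k) / δ) fun k => by fun_prop
  have hYmean : ∀ k, ∫ x, Y k x ∂(Measure.pi ν) = 0 := by
    intro k
    simp only [hY]
    rw [integral_div, integral_sub ((h.hasMoments_masked c i k).pow 2).integrable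
      (integrable_const _)]
    simp [hv]
  have hYpow : ∀ k ∈ s, ∀ r, 1 ≤ r →
      ∫ x, Y k x ^ (2 * r) ∂(Measure.pi ν) ≤ (K (2 * (2 * r)) + 1) / n := by
    intro k hk r hr
    have hr0 := h.nonneg (2 * (2 * r))
    have h1 : ∫ x, (masked c x i k ^ 2 - v k) ^ (2 * r) ∂(Measure.pi ν)
        ≤ (K (2 * (2 * r)) + 1) / n * δ ^ (4 * r - 2) := by
      calc _ ≤ ∫ x, (masked c x i k ^ (2 * (2 * r)) + v k ^ (2 * r)) ∂(Measure.pi ν) := by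
            refine integral_mono_of_nonneg (ae_of_all _ fun x => (even_two_mul r).pow_nonneg _)
              (((h.hasMoments_masked c i k).pow _).integrable.add (integrable_const _))
              (ae_of_all _ fun x => ?_)
            simp only
            rw [pow_mul (masked c x i k) 2]
            exact sub_pow_even_le (sq_nonneg _) (hv0 k) r
        _ = ∫ x, masked c x i k ^ (2 * (2 * r)) ∂(Measure.pi ν) + v k ^ (2 * r) := by
            rw [integral_add ((h.hasMoments_masked c i k).pow _).integrable (integrable_const _)]
            simp
        _ ≤ K (2 * (2 * r)) * δ ^ (2 * (2 * r) - 2) / n + 1 / n * δ ^ (4 * r - 2) := by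
            refine add_le_add (h.integral_masked_pow_even_le hc i k (by omega)) ?_
            calc v k ^ (2 * r) ≤ (1 / (n : ℝ)) ^ (2 * r) := pow_le_pow_left₀ (hv0 k) (hv1 k hk) _
              _ = 1 / n * (1 / (n : ℝ)) ^ (2 * r - 1) := by
                  rw [← pow_succ']; congr 1; omega
              _ ≤ 1 / n * (δ ^ 2) ^ (2 * r - 1) := by gcongr; exact h.inv_le
              _ = 1 / n * δ ^ (4 * r - 2) := by rw [← pow_mul]; congr 2; omega
        _ = _ := by rw [show 2 * (2 * r) - 2 = 4 * r - 2 by omega]; ring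
    simp only [hY, div_pow]
    rw [integral_div, div_le_iff₀ (by positivity)]
    exact h1.trans (mul_le_mul_of_nonneg_left
      (pow_le_pow_of_le_one hδ.le h.scale_le (by omega)) (by positivity))
  set g : (Sym2 (Fin n) → ℝ) → ℝ := fun x => δ ^ (2 * m) * (linConst A m * (2 * (1 / n *
    ∑ k ∈ s, ‖resolventMatrix z (masked (zeroRow i c) x) k k‖ ^ (2 * m)))) with hg
  have i1 : HasMoments (fun x =>
      ∑ k ∈ s, ‖resolventMatrix z (masked (zeroRow i c) x) k k‖ ^ (2 * m)) (Measure.pi ν) :=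
    HasMoments.sum s fun k _ => (hR k k).pow _
  have heq : ∀ (w : Fin n → ℝ) (R : Matrix (Fin n) (Fin n) ℂ),
      diagForm w (fun k => c s(i, k) ^ 2 / n) R s
        = (δ : ℂ) * ∑ k ∈ s, (((w k ^ 2 - v k) / δ : ℝ) : ℂ) * R k k := by
    intro w R
    rw [diagForm, Finset.mul_sum]
    refine Finset.sum_congr rfl fun k hk => ?_
    rw [hvs k hk, ← mul_assoc, ← Complex.ofReal_mul]
    congr 2
    field_simp
  refine (h.integral_row_le c i z
    (Φ := fun w R => ‖diagForm w (fun k => c s(i, k) ^ 2 / n) R s‖ ^ (2 * m)) (g := g)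
    (fun _ _ => by positivity) ?_
    (((((i1.const_mul _).const_mul _).const_mul _).const_mul _).integrable) fun x => ?_).trans ?_
  · refine ((hasMoments_norm_sum s (fun k _ => ?_) fun k _ => ?_).pow _).integrable
    · exact (Complex.measurable_ofReal.comp (((measurable_masked c i k).pow_const 2).sub_const
        _)).mul (measurable_resolvent_masked z _ k k)
    · have h1 := ((h.hasMoments_masked c i k).pow 2).add (HasMoments.const (-(c s(i, k) ^ 2 / n)))
      have h2 : HasMoments (fun x => |masked c x i k ^ 2 + -(c s(i, k) ^ 2 / n)|) (Measure.pi ν) :=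
        fun p => (h1 p).abs
      convert h2.mul (hR k k) using 2 with x
      rw [norm_mul, Complex.norm_real, Real.norm_eq_abs, sub_eq_add_neg]
  · simp only [heq, norm_mul, mul_pow, Complex.norm_real, Real.norm_eq_abs, abs_of_pos hδ]
    rw [integral_const_mul]
    simp only [hg]
    gcongr
    set R := resolventMatrix z (masked (zeroRow i c) x)
    have hle : (K (2 * (2 * 1)) + 1) / n ≤ A / n := by
      gcongr
      have := h.nonneg (2 * (2 * m))
      simp only [A]; norm_num; linarith
    have hle' : (K (2 * (2 * m)) + 1) / n ≤ A * 1 / n := by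
      rw [mul_one]
      gcongr
      have := h.nonneg 4
      simp only [A]; linarith
    have := integral_norm_linear_form_le hYind hYmeas hYmom hYmean hm s hn hA zero_le_one
      (fun k hk => (hYpow k hk 1 le_rfl).trans hle) (fun k hk => (hYpow k hk m hm).trans hle')
      (fun k => R k k) (V := 1 / n * ∑ k ∈ s, ‖R k k‖ ^ 2) (le_of_eq (by field_simp))
    refine this.trans ?_
    have hj := avg_pow_le s hn hcard (f := fun k => ‖R k k‖ ^ 2) (fun k => by positivity) hm
    simp only [← pow_mul] at hj
    have := linConst_nonneg hA m
    gcongr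
    linarith
  · simp only [hg]
    rw [integral_const_mul, integral_const_mul, integral_const_mul, integral_const_mul,
      integral_finsetSum _ fun k _ => ((hR k k).pow _).integrable]
    have h3 : ∑ k ∈ s, ∫ x, ‖resolventMatrix z (masked (zeroRow i c) x) k k‖ ^ (2 * m)
        ∂(Measure.pi ν) ≤ n * Γ := by
      calc _ ≤ ∑ k ∈ s, Γ := Finset.sum_le_sum fun k hk =>
            hb k (Finset.mem_compl.mp hk) k (Finset.mem_compl.mp hk)
        _ = s.card * Γ := by rw [Finset.sum_const, nsmul_eq_mul]
        _ ≤ n * Γ := by gcongr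
    have h4 : δ ^ (2 * m) ≤ t ^ (8 * (m - 1)) :=
      (pow_le_pow_of_le_one hδ.le h.scale_le (by omega)).trans (h.scale_pow_le hs m)
    have := linConst_nonneg hA m
    calc _ ≤ t ^ (8 * (m - 1)) * (linConst A m * (2 * (1 / n * (n * Γ)))) := by gcongr
      _ = _ := by field_simp

/-- The constant in the moment bound for `selfErr`. -/
noncomputable def errConst (K : ℕ → ℝ) (q m : ℕ) : ℝ :=
  4 ^ (2 * m) * (K (2 * m) + quadConst (K 2 + K (2 * m)) m * 3
    + linConst (K 4 + K (2 * (2 * m)) + 2) m * 2 + (q + 4) ^ (2 * m))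

lemma add_four_pow_le {a b c d : ℝ} (ha : 0 ≤ a) (hb : 0 ≤ b) (hc : 0 ≤ c) (hd : 0 ≤ d) (k : ℕ) :
    (a + b + c + d) ^ k ≤ 4 ^ k * (a ^ k + b ^ k + c ^ k + d ^ k) := by
  set M := max (max a b) (max c d)
  have hM : a + b + c + d ≤ 4 * M := by
    have h1 : a ≤ M := (le_max_left a b).trans (le_max_left _ _)
    have h2 : b ≤ M := (le_max_right a b).trans (le_max_left _ _)
    have h3 : c ≤ M := (le_max_left c d).trans (le_max_right _ _)
    have h4 : d ≤ M := (le_max_right c d).trans (le_max_right _ _)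
    linarith
  have hMk : M ^ k ≤ a ^ k + b ^ k + c ^ k + d ^ k := by
    have := pow_nonneg ha k
    have := pow_nonneg hb k
    have := pow_nonneg hc k
    have := pow_nonneg hd k
    rcases max_choice (max a b) (max c d) with h | h <;> simp only [M, h]
    · rcases max_choice a b with h | h <;> rw [h] <;> linarith
    · rcases max_choice c d with h | h <;> rw [h] <;> linarith
  calc (a + b + c + d) ^ k ≤ (4 * M) ^ k := pow_le_pow_left₀ (by positivity) hM k
    _ = 4 ^ k * M ^ k := mul_pow _ _ _
    _ ≤ _ := by gcongr

lemma measurable_selfErr (z : ℂ) (c : Sym2 (Fin n) → ℝ) (i : Fin n) :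
    Measurable fun x => selfErr z (masked c x) i := by
  have hm := fun k l => (Complex.measurable_ofReal.comp (measurable_masked c k l))
  unfold selfErr rowForm avgRes
  simp_rw [← masked_zeroRow]
  refine ((hm i i).add (Finset.measurable_sum _ fun j _ => (Finset.measurable_sum _ fun k _ =>
    (hm i k).mul (measurable_resolvent_masked z _ k j)).mul (hm i j))).sub
    (measurable_const.mul (Finset.measurable_sum _ fun k _ => measurable_resolvent_masked z c k k))

lemma EntryLaws.hasMoments_rowForm (h : EntryLaws K n δ ν) (hz : 0 < z.im) (hc : IsMask q S c)
    (i j : Fin n) : HasMoments (fun x => ‖rowForm z (masked c x) i j‖) (Measure.pi ν) := by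
  have := h.prob
  simp_rw [hc.rowForm_eq]
  exact hasMoments_norm_sum _ (fun k _ =>
    (Complex.measurable_ofReal.comp (measurable_masked c i k)).mul
      (measurable_resolvent_masked z _ k j))
    fun k _ => h.hasMoments_row_term hz c (zeroRow i c) i k k j

lemma EntryLaws.hasMoments_selfErr (h : EntryLaws K n δ ν) (hz : 0 < z.im) (hc : IsMask q S c)
    {i : Fin n} : HasMoments (fun x => ‖selfErr z (masked c x) i‖) (Measure.pi ν) := by
  have := h.prob
  have hW : ∀ k, HasMoments (fun x => ‖(masked c x i k : ℂ)‖) (Measure.pi ν) := fun k p => by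
    simpa only [Complex.norm_real] using (h.hasMoments_masked c i k p).norm
  have hR := fun (c : Sym2 (Fin n) → ℝ) (k l : Fin n) =>
    hasMoments_norm_resolvent (ν := ν) hz c k l
  have hrow := h.hasMoments_rowForm hz hc i
  refine (((hW i).add (HasMoments.sum (Finset.univ.erase i) fun j _ => (hrow j).mul (hW j))).add
    ((HasMoments.sum Finset.univ fun k _ => hR c k k).const_mul (1 / n))).mono
    (measurable_selfErr z c i).norm.aestronglyMeasurable fun x => ?_
  rw [abs_norm, selfErr, avgRes]
  refine (norm_sub_le _ _).trans (add_le_add ((norm_add_le _ _).trans (add_le_add le_rfl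
    ((norm_sum_le _ _).trans (Finset.sum_le_sum fun j _ => (norm_mul _ _).le)))) ?_)
  rw [norm_mul]
  refine mul_le_mul (by simp) (norm_sum_le _ _) (norm_nonneg _) (by positivity)

lemma EntryLaws.integral_norm_selfErr_le (h : EntryLaws K n δ ν) (hs : Scales n δ t z)
    (hc : IsMask q S c) {i : Fin n} (hi : i ∉ S) (hm : 1 ≤ m) (hΓ : 1 ≤ Γ)
    (hb : MomentBound ν (insert i S) (zeroRow i c) z (2 * m) Γ) :
    ∫ x, ‖selfErr z (masked c x) i‖ ^ (2 * m) ∂(Measure.pi ν) ≤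
      errConst K q m * Γ * t ^ (8 * (m - 1)) := by
  have := h.prob
  have hz := hs.im_pos
  have hn : (0 : ℝ) < n := by exact_mod_cast h.pos
  have ht := hs.pos
  have hδ := h.scale_pos
  set R' := fun x => resolventMatrix z (masked (zeroRow i c) x) with hR'
  set O1 := fun x => offForm (masked c x i) (R' x) (insert i S)ᶜ
  set O2 := fun x => diagForm (masked c x i) (fun k => c s(i, k) ^ 2 / n) (R' x) (insert i S)ᶜ
  have b1 := h.integral_norm_offForm_le hs hc i hm hΓ hb
  have b2 := h.integral_norm_diagForm_le hs hc i hm hΓ hb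
  have b0 := h.integral_masked_pow_even_le hc i i hm
  have hpt : ∀ x, ‖selfErr z (masked c x) i‖ ^ (2 * m) ≤ 4 ^ (2 * m) * (masked c x i i ^ (2 * m)
      + ‖O1 x‖ ^ (2 * m) + ‖O2 x‖ ^ (2 * m) + ((q + 4) * t ^ 8) ^ (2 * m)) := by
    intro x
    have hd := (selfErr_decomp h hz hc hi x).trans
      (mul_le_mul_of_nonneg_left hs.inv_le (by positivity))
    have h1 : ‖selfErr z (masked c x) i‖ ≤ |masked c x i i| + ‖O1 x‖ + ‖O2 x‖ + (q + 4) * t ^ 8 := by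
      have e : selfErr z (masked c x) i = ((masked c x i i : ℂ) + O1 x + O2 x) +
        (selfErr z (masked c x) i - ((masked c x i i : ℂ) + O1 x + O2 x)) := by ring
      rw [e]
      refine (norm_add_le _ _).trans (add_le_add ?_ hd)
      refine (norm_add_le _ _).trans (add_le_add ?_ le_rfl)
      refine (norm_add_le _ _).trans (add_le_add ?_ le_rfl)
      rw [Complex.norm_real, Real.norm_eq_abs]
    refine (pow_le_pow_left₀ (norm_nonneg _) h1 _).trans ((add_four_pow_le (abs_nonneg _)
      (norm_nonneg _) (norm_nonneg _) (by positivity) _).trans (le_of_eq ?_))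
    rw [(even_two_mul m).pow_abs]
  have i0 := ((h.hasMoments_masked c i i).pow (2 * m)).integrable
  have hterm : ∀ k l : Fin n, HasMoments (fun x => ‖(masked c x i k : ℂ) * (masked c x i l : ℂ) *
      R' x k l‖) (Measure.pi ν) := by
    intro k l
    have h1 := (h.hasMoments_row_term hz c (zeroRow i c) i l k l)
    have h2 : HasMoments (fun x => |masked c x i k|) (Measure.pi ν) := fun p =>
      (h.hasMoments_masked c i k p).abs
    convert h2.mul h1 using 2 with x
    rw [mul_assoc, norm_mul, Complex.norm_real, Real.norm_eq_abs]
  have hmW := fun k => (Complex.measurable_ofReal.comp (measurable_masked c i k))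
  have i1 : HasMoments (fun x => ‖O1 x‖) (Measure.pi ν) :=
    hasMoments_norm_sum _ (fun k _ => Finset.measurable_sum _ fun l _ =>
      ((hmW k).mul (hmW l)).mul (measurable_resolvent_masked z _ k l))
      fun k _ => hasMoments_norm_sum _ (fun l _ =>
        ((hmW k).mul (hmW l)).mul (measurable_resolvent_masked z _ k l)) fun l _ => hterm k l
  have i2 : HasMoments (fun x => ‖O2 x‖) (Measure.pi ν) := by
    refine hasMoments_norm_sum _ (fun k _ => ?_) fun k _ => ?_
    · exact (Complex.measurable_ofReal.comp (((measurable_masked c i k).pow_const 2).sub_const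
        _)).mul (measurable_resolvent_masked z _ k k)
    · have h1 := ((h.hasMoments_masked c i k).pow 2).add (HasMoments.const (-(c s(i, k) ^ 2 / n)))
      have h2 : HasMoments (fun x => |masked c x i k ^ 2 + -(c s(i, k) ^ 2 / n)|) (Measure.pi ν) :=
        fun p => (h1 p).abs
      convert h2.mul (hasMoments_norm_resolvent (ν := ν) hz (zeroRow i c) k k) using 2 with x
      rw [norm_mul, Complex.norm_real, Real.norm_eq_abs, sub_eq_add_neg]
  have i1' := (i1.pow (2 * m)).integrable
  have i2' := (i2.pow (2 * m)).integrable
  have i01 : Integrable (fun x => masked c x i i ^ (2 * m) + ‖O1 x‖ ^ (2 * m)) (Measure.pi ν) :=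
    i0.add i1'
  have i012 : Integrable (fun x => masked c x i i ^ (2 * m) + ‖O1 x‖ ^ (2 * m)
      + ‖O2 x‖ ^ (2 * m)) (Measure.pi ν) := i01.add i2'
  calc _ ≤ ∫ x, 4 ^ (2 * m) * (masked c x i i ^ (2 * m) + ‖O1 x‖ ^ (2 * m) + ‖O2 x‖ ^ (2 * m)
        + ((q + 4) * t ^ 8) ^ (2 * m)) ∂(Measure.pi ν) :=
        integral_mono_of_nonneg (ae_of_all _ fun x => by positivity)
          ((i012.add (integrable_const _)).const_mul _) (ae_of_all _ hpt)
    _ = 4 ^ (2 * m) * (∫ x, masked c x i i ^ (2 * m) ∂(Measure.pi ν)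
        + ∫ x, ‖O1 x‖ ^ (2 * m) ∂(Measure.pi ν) + ∫ x, ‖O2 x‖ ^ (2 * m) ∂(Measure.pi ν)
        + ((q + 4) * t ^ 8) ^ (2 * m)) := by
        rw [integral_const_mul, integral_add i012 (integrable_const _), integral_add i01 i2',
          integral_add i0 i1']
        simp
    _ ≤ 4 ^ (2 * m) * (K (2 * m) * Γ * t ^ (8 * (m - 1))
        + quadConst (K 2 + K (2 * m)) m * (3 * Γ) * t ^ (8 * (m - 1))
        + linConst (K 4 + K (2 * (2 * m)) + 2) m * (2 * Γ) * t ^ (8 * (m - 1))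
        + (q + 4) ^ (2 * m) * Γ * t ^ (8 * (m - 1))) := by
        gcongr
        · refine b0.trans ?_
          have hK := h.nonneg (2 * m)
          have h4 := h.scale_pow_le hs m
          have hn1 : (1 : ℝ) ≤ n := by exact_mod_cast h.pos
          calc K (2 * m) * δ ^ (2 * m - 2) / n ≤ K (2 * m) * δ ^ (2 * m - 2) :=
                div_le_self (by positivity) hn1
            _ ≤ K (2 * m) * t ^ (8 * (m - 1)) := by gcongr
            _ ≤ K (2 * m) * Γ * t ^ (8 * (m - 1)) := by
                gcongr; exact le_mul_of_one_le_right hK hΓ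
        · rw [mul_pow, ← pow_mul]
          have : t ^ (8 * (2 * m)) ≤ t ^ (8 * (m - 1)) :=
            pow_le_pow_of_le_one ht.le hs.le_one (by omega)
          gcongr
          exact le_mul_of_one_le_right (by positivity) hΓ
    _ = _ := by unfold errConst; ring

end SelfConsistent


/-! ### Induction over scales: moments of the Schur error and of the residual. -/

section LocalLaw

variable {κ : ℝ} {K : ℕ → ℝ} {J : ℕ}

/-- A uniform bound on the moments of the entries of the resolvent at spectral parameters with
`Im z ≥ t ^ J`. -/
def Controlled (κ : ℝ) (K : ℕ → ℝ) (J : ℕ) : Prop :=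
  ∀ q m : ℕ, ∃ Γ : ℝ, 1 ≤ Γ ∧ ∀ (n : ℕ) (δ t : ℝ) (ν : Sym2 (Fin n) → Measure ℝ) (z : ℂ)
    (S : Finset (Fin n)) (c : Sym2 (Fin n) → ℝ), EntryLaws K n δ ν → Scales n δ t z →
    z ∈ halfPlane κ → t ^ J ≤ z.im → IsMask q S c → MomentBound ν S c z m Γ

lemma controlled_zero : Controlled κ K 0 := by
  refine fun q m => ⟨1, le_rfl, fun n δ t ν z S c h hs _ hJ _ k _ l _ => ?_⟩
  have := h.prob
  rw [pow_zero] at hJ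
  calc _ ≤ ∫ _, (1 : ℝ) ∂(Measure.pi ν) := by
        refine integral_mono ((hasMoments_norm_resolvent hs.im_pos c k l).pow m).integrable
          (integrable_const _) fun x => ?_
        refine pow_le_one₀ (norm_nonneg _)
          ((norm_resolvent_le (masked_isSymm c x) hs.im_pos k l).trans ?_)
        exact (div_le_one₀ hs.im_pos).mpr hJ
    _ = 1 := by simp

/-- The point `re z + i a im z`. -/
def liftIm (a : ℝ) (z : ℂ) : ℂ := ⟨z.re, a * z.im⟩

lemma Scales.liftIm {n : ℕ} {δ t : ℝ} {z : ℂ} (h : Scales n δ t z) {a : ℝ} (ha : 1 ≤ a) :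
    Scales n δ t (liftIm a z) where
  im_pos := mul_pos (by linarith) h.im_pos
  pos := h.pos
  le_one := h.le_one
  scale_le := h.scale_le
  one_le := by
    refine h.one_le.trans ?_
    have h1 := h.pos
    have h2 := h.im_pos
    simp only [SparseWigner.liftIm]
    gcongr
    exact le_mul_of_one_le_left h2.le ha

lemma liftIm_mem {a : ℝ} (ha : 1 ≤ a) {z : ℂ} (hz : z ∈ halfPlane κ) : liftIm a z ∈ halfPlane κ :=
  ⟨mul_pos (by linarith) hz.1, hz.2⟩

/-- Crude bounds one scale below. -/
lemma Controlled.rough (hJ : Controlled κ K J) (q m : ℕ) :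
    ∃ Γ : ℝ, 1 ≤ Γ ∧ ∀ (n : ℕ) (δ t : ℝ) (ν : Sym2 (Fin n) → Measure ℝ) (z : ℂ)
    (S : Finset (Fin n)) (c : Sym2 (Fin n) → ℝ), EntryLaws K n δ ν → Scales n δ t z →
    z ∈ halfPlane κ → t ^ (J + 1) ≤ z.im → IsMask q S c →
    MomentBound ν S c z m (Γ * (1 / t) ^ m) := by
  obtain ⟨Γ, hΓ, H⟩ := hJ q m
  refine ⟨4 ^ m * (3 * Γ + 1), ?_, fun n δ t ν z S c h hs hz hJ hc k hk l hl => ?_⟩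
  · have : (1 : ℝ) ≤ 4 ^ m := one_le_pow₀ (by norm_num)
    nlinarith
  have := h.prob
  have ht := hs.pos
  have ht1 : 1 ≤ 1 / t := by rw [le_div_iff₀ ht, one_mul]; exact hs.le_one
  -- Raising the height by the factor `1/t` brings the point into the range of the induction
  -- hypothesis; coming back down costs `1/t` for each power of the resolvent.
  set w := liftIm (1 / t) z
  have hwim : w.im = z.im / t := by simp only [w, liftIm]; ring
  have hb := H n δ t ν w S c h (hs.liftIm ht1) (liftIm_mem ht1 hz) (by
    rw [hwim, le_div_iff₀ ht, ← pow_succ]; exact hJ) hc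
  have hle : z.im ≤ w.im := by
    rw [hwim, le_div_iff₀ ht]; have := hs.le_one; have := hs.im_pos; nlinarith
  have hw : 0 < w.im := hs.im_pos.trans_le hle
  have hR := fun k l => hasMoments_norm_resolvent (ν := ν) hw c k l
  set R := fun x => resolventMatrix w (masked c x)
  have hpt : ∀ x, ‖resolventMatrix z (masked c x) k l‖ ^ m ≤ (1 / t) ^ m * (4 ^ m *
      (‖R x k l‖ ^ m + ‖R x k k‖ ^ m + ‖R x l l‖ ^ m + 1)) := by
    intro x
    have h1 := norm_resolvent_le_of_im_le (masked_isSymm c x) hs.im_pos (z := w) rfl hle k l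
    have h2 : w.im / z.im = 1 / t := by rw [hwim]; have := hs.im_pos; field_simp
    rw [h2] at h1
    have h3 : ‖resolventMatrix z (masked c x) k l‖
        ≤ 1 / t * (‖R x k l‖ + ‖R x k k‖ + ‖R x l l‖ + 0) := by
      have := norm_nonneg (R x k l)
      nlinarith
    calc _ ≤ (1 / t * (‖R x k l‖ + ‖R x k k‖ + ‖R x l l‖ + 0)) ^ m :=
          pow_le_pow_left₀ (norm_nonneg _) h3 m
      _ ≤ (1 / t) ^ m * (4 ^ m * (‖R x k l‖ ^ m + ‖R x k k‖ ^ m + ‖R x l l‖ ^ m + 0 ^ m)) := by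
          rw [mul_pow]
          gcongr
          exact add_four_pow_le (norm_nonneg _) (norm_nonneg _) (norm_nonneg _) le_rfl m
      _ ≤ _ := by
          gcongr
          exact zero_pow_le_one m
  have i1 := ((hR k l).pow m).integrable
  have i2 := ((hR k k).pow m).integrable
  have i3 := ((hR l l).pow m).integrable
  have i12 : Integrable (fun x => ‖R x k l‖ ^ m + ‖R x k k‖ ^ m) (Measure.pi ν) := i1.add i2
  have i123 : Integrable (fun x => ‖R x k l‖ ^ m + ‖R x k k‖ ^ m + ‖R x l l‖ ^ m)
    (Measure.pi ν) := i12.add i3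
  calc _ ≤ ∫ x, (1 / t) ^ m * (4 ^ m * (‖R x k l‖ ^ m + ‖R x k k‖ ^ m + ‖R x l l‖ ^ m + 1))
        ∂(Measure.pi ν) :=
        integral_mono ((hasMoments_norm_resolvent hs.im_pos c k l).pow m).integrable
          (((i123.add (integrable_const 1)).const_mul _).const_mul _) hpt
    _ = (1 / t) ^ m * (4 ^ m * (∫ x, ‖R x k l‖ ^ m ∂(Measure.pi ν)
        + ∫ x, ‖R x k k‖ ^ m ∂(Measure.pi ν) + ∫ x, ‖R x l l‖ ^ m ∂(Measure.pi ν) + 1)) := by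
        rw [integral_const_mul, integral_const_mul, integral_add i123 (integrable_const _),
          integral_add i12 i3, integral_add i1 i2, integral_const, probReal_univ, one_smul]
    _ ≤ (1 / t) ^ m * (4 ^ m * (Γ + Γ + Γ + 1)) := by
        gcongr
        · exact hb k hk l hl
        · exact hb k hk k hk
        · exact hb l hl l hl
    _ = _ := by ring

/-- The balance that drives the induction: the loss `(1/t)^(2m)` of the rough bound against the gain
`t^(8(m-1))` of the moment inequalities. -/
lemma rough_mul_pow {t : ℝ} (ht : 0 < t) {m : ℕ} (hm : 2 ≤ m) :
    (1 / t) ^ (2 * m) * t ^ (8 * (m - 1)) = t ^ (6 * m - 8) := by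
  rw [one_div, inv_pow, inv_mul_eq_div, div_eq_iff (by positivity), ← pow_add]
  congr 1; omega

lemma one_le_rough {t Γ : ℝ} (ht : 0 < t) (ht1 : t ≤ 1) (hΓ : 1 ≤ Γ) (m : ℕ) :
    1 ≤ Γ * (1 / t) ^ m := by
  have h1 : 1 ≤ (1 / t) ^ m := one_le_pow₀ (by rw [le_div_iff₀ ht]; linarith)
  nlinarith

lemma Controlled.integral_selfErr_le (hJ : Controlled κ K J) (q m : ℕ) (hm : 2 ≤ m) :
    ∃ C : ℝ, 0 ≤ C ∧ ∀ (n : ℕ) (δ t : ℝ) (ν : Sym2 (Fin n) → Measure ℝ) (z : ℂ)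
    (S : Finset (Fin n)) (c : Sym2 (Fin n) → ℝ), EntryLaws K n δ ν → Scales n δ t z →
    z ∈ halfPlane κ → t ^ (J + 1) ≤ z.im → IsMask q S c → ∀ i ∉ S,
    ∫ x, ‖selfErr z (masked c x) i‖ ^ (2 * m) ∂(Measure.pi ν) ≤ C * t ^ (6 * m - 8) := by
  -- The minor has one more row switched off, so the hypothesis is used at `q + 1`; for this reason
  -- `Controlled` quantifies over all `q`.
  obtain ⟨Γ, hΓ, H⟩ := hJ.rough (q + 1) (2 * m)
  refine ⟨|errConst K q m * Γ|, abs_nonneg _, fun n δ t ν z S c h hs hz hJ hc i hi => ?_⟩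
  have ht := hs.pos
  refine (h.integral_norm_selfErr_le hs hc hi (by omega) (one_le_rough ht hs.le_one hΓ _)
    (H n δ t ν z _ _ h hs hz hJ (hc.switchOff i))).trans ?_
  rw [← rough_mul_pow ht hm]
  calc _ = errConst K q m * Γ * ((1 / t) ^ (2 * m) * t ^ (8 * (m - 1))) := by ring
    _ ≤ _ := by gcongr; exact le_abs_self _

lemma Controlled.integral_rowForm_le (hJ : Controlled κ K J) (q m : ℕ) (hm : 2 ≤ m) :
    ∃ C : ℝ, 0 ≤ C ∧ ∀ (n : ℕ) (δ t : ℝ) (ν : Sym2 (Fin n) → Measure ℝ) (z : ℂ)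
    (S : Finset (Fin n)) (c : Sym2 (Fin n) → ℝ), EntryLaws K n δ ν → Scales n δ t z →
    z ∈ halfPlane κ → t ^ (J + 1) ≤ z.im → IsMask q S c → ∀ i, ∀ j ∉ insert i S,
    ∫ x, ‖rowForm z (masked c x) i j‖ ^ (2 * m) ∂(Measure.pi ν) ≤ C * t ^ (6 * m - 8) := by
  obtain ⟨Γ, hΓ, H⟩ := hJ.rough (q + 1) (2 * m)
  refine ⟨|linConst (K 2 + K (2 * m)) m * (3 * Γ)|, abs_nonneg _,
    fun n δ t ν z S c h hs hz hJ hc i j hj => ?_⟩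
  have ht := hs.pos
  refine (h.integral_norm_rowForm_le hs hc hj (by omega) (one_le_rough ht hs.le_one hΓ _)
    (H n δ t ν z _ _ h hs hz hJ (hc.switchOff i))).trans ?_
  rw [← rough_mul_pow ht hm]
  calc _ = linConst (K 2 + K (2 * m)) m * (3 * Γ) *
        ((1 / t) ^ (2 * m) * t ^ (8 * (m - 1))) := by ring
    _ ≤ _ := by gcongr; exact le_abs_self _

/-- The residual of the self-consistent equation. -/
noncomputable def residual {n : ℕ} (z : ℂ) (W : Matrix (Fin n) (Fin n) ℝ) : ℂ :=
  avgRes z W * (z - avgRes z W) - 1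

section Residual

variable {n q : ℕ} {δ t : ℝ} {ν : Sym2 (Fin n) → Measure ℝ} {z : ℂ} {S : Finset (Fin n)}
  {c : Sym2 (Fin n) → ℝ}

/-- Average the relation `R_ii (z - g) - 1 = R_ii E_i`. For the at most `q` rows in `S` the error is
not controlled, but there `R_ii = 1/z`, and their total weight is at most `q |g| / (n Im z)`. -/
lemma norm_residual_le (hn : 0 < n) (hs : Scales n δ t z) (hc : IsMask q S c)
    (x : Sym2 (Fin n) → ℝ) :
    ‖residual z (masked c x)‖ ≤
      1 / n * ∑ i ∈ Sᶜ, ‖resolventMatrix z (masked c x) i i‖ * ‖selfErr z (masked c x) i‖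
      + q * t ^ 8 * (1 / n * ∑ i ∈ Sᶜ, ‖resolventMatrix z (masked c x) i i‖)
      + (q * t ^ 8) * (q * t ^ 8) := by
  have hz := hs.im_pos
  have ht := hs.pos
  have hn' : (0 : ℝ) < n := by exact_mod_cast hn
  have hnc : (n : ℂ) ≠ 0 := by exact_mod_cast hn.ne'
  have hsym := masked_isSymm c x
  set W := masked c x
  set g := avgRes z W with hg
  have hz0 : z ≠ 0 := by rintro rfl; simp at hz
  have hzn : z.im ≤ ‖z‖ := (le_abs_self _).trans (Complex.abs_im_le_norm z)
  have hq : (S.card : ℝ) ≤ q := by exact_mod_cast hc.card_le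
  have hinv := hs.inv_le
  have hS : ∀ i ∈ S, resolventMatrix z W i i = 1 / z := by
    intro i hi
    rw [resolvent_row_of_zero hsym hz (fun j => ?_), if_pos rfl]
    simp only [W, masked_apply, hc.zero i hi j, zero_mul]
  have hres : residual z W = (1 / (n : ℂ)) * ∑ i, (resolventMatrix z W i i * (z - g) - 1) := by
    rw [residual, Finset.sum_sub_distrib, ← Finset.sum_mul, hg, avgRes]
    simp only [Finset.sum_const, Finset.card_univ, Fintype.card_fin, nsmul_eq_mul, mul_one]
    field_simp
  have hterm : ∀ i, resolventMatrix z W i i * (z - g) - 1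
      = resolventMatrix z W i i * selfErr z W i := by
    intro i
    have := resolvent_mul_selfErr hsym hz i
    linear_combination this
  have hgb : ‖g‖ ≤ 1 / n * ∑ i ∈ Sᶜ, ‖resolventMatrix z W i i‖ + q * t ^ 8 := by
    rw [hg, avgRes, norm_mul, ← Finset.sum_compl_add_sum S]
    have h1 : ‖(1 / (n : ℂ))‖ = 1 / n := by simp
    rw [h1]
    have h2 : ‖∑ i ∈ S, resolventMatrix z W i i‖ ≤ q * (1 / z.im) := by
      refine (norm_sum_le _ _).trans ?_
      calc _ ≤ ∑ i ∈ S, 1 / z.im := Finset.sum_le_sum fun i _ => norm_resolvent_le hsym hz i i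
        _ = S.card * (1 / z.im) := by rw [Finset.sum_const, nsmul_eq_mul]
        _ ≤ _ := by gcongr
    calc _ ≤ 1 / n * (∑ i ∈ Sᶜ, ‖resolventMatrix z W i i‖ + q * (1 / z.im)) := by
          gcongr
          exact (norm_add_le _ _).trans (add_le_add (norm_sum_le _ _) h2)
      _ = 1 / n * ∑ i ∈ Sᶜ, ‖resolventMatrix z W i i‖ + q * (1 / (n * z.im)) := by
          field_simp
      _ ≤ _ := by gcongr
  have hSb : ‖∑ i ∈ S, (resolventMatrix z W i i * (z - g) - 1)‖ ≤ q * (‖g‖ / z.im) := by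
    refine (norm_sum_le _ _).trans ?_
    calc _ ≤ ∑ i ∈ S, ‖g‖ / z.im := by
          refine Finset.sum_le_sum fun i hi => ?_
          rw [hS i hi, show 1 / z * (z - g) - 1 = -(g / z) by field_simp; ring, norm_neg, norm_div]
          gcongr
      _ = S.card * (‖g‖ / z.im) := by rw [Finset.sum_const, nsmul_eq_mul]
      _ ≤ _ := by gcongr
  have hSc : ‖∑ i ∈ Sᶜ, (resolventMatrix z W i i * (z - g) - 1)‖
      ≤ ∑ i ∈ Sᶜ, ‖resolventMatrix z W i i‖ * ‖selfErr z W i‖ := by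
    refine (norm_sum_le _ _).trans (Finset.sum_le_sum fun i _ => ?_)
    rw [hterm, norm_mul]
  rw [hres, ← Finset.sum_compl_add_sum S, norm_mul, show ‖(1 / (n : ℂ))‖ = 1 / n by simp]
  calc _ ≤ 1 / n * (∑ i ∈ Sᶜ, ‖resolventMatrix z W i i‖ * ‖selfErr z W i‖ + q * (‖g‖ / z.im)) := by
        gcongr
        exact (norm_add_le _ _).trans (add_le_add hSc hSb)
    _ = 1 / n * ∑ i ∈ Sᶜ, ‖resolventMatrix z W i i‖ * ‖selfErr z W i‖
        + q * (1 / (n * z.im)) * ‖g‖ := by field_simp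
    _ ≤ 1 / n * ∑ i ∈ Sᶜ, ‖resolventMatrix z W i i‖ * ‖selfErr z W i‖
        + q * t ^ 8 * (1 / n * ∑ i ∈ Sᶜ, ‖resolventMatrix z W i i‖ + q * t ^ 8) := by gcongr
    _ = _ := by ring

lemma measurable_avgRes (z : ℂ) (c : Sym2 (Fin n) → ℝ) :
    Measurable fun x => avgRes z (masked c x) :=
  measurable_const.mul (Finset.measurable_sum _ fun k _ => measurable_resolvent_masked z c k k)

lemma measurable_residual (z : ℂ) (c : Sym2 (Fin n) → ℝ) :
    Measurable fun x => residual z (masked c x) :=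
  ((measurable_avgRes z c).mul ((measurable_avgRes z c).const_sub z)).sub_const 1

lemma norm_avgRes_le (hz : 0 < z.im) {W : Matrix (Fin n) (Fin n) ℝ} (hW : W.IsSymm) :
    ‖avgRes z W‖ ≤ 1 / z.im := by
  rw [avgRes, norm_mul]
  have h2 : ‖∑ i, resolventMatrix z W i i‖ ≤ n * (1 / z.im) := by
    refine (norm_sum_le _ _).trans ?_
    calc _ ≤ ∑ _i : Fin n, 1 / z.im := Finset.sum_le_sum fun i _ => norm_resolvent_le hW hz i i
      _ = n * (1 / z.im) := by simp
  rcases Nat.eq_zero_or_pos n with rfl | hn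
  · simp [hz.le]
  have hn' : (0 : ℝ) < n := by exact_mod_cast hn
  calc _ ≤ 1 / n * (n * (1 / z.im)) := by
        refine mul_le_mul (by simp) h2 (norm_nonneg _) (by positivity)
    _ = 1 / z.im := by field_simp

lemma hasMoments_norm_residual [∀ e, IsProbabilityMeasure (ν e)] (hz : 0 < z.im)
    (c : Sym2 (Fin n) → ℝ) : HasMoments (fun x => ‖residual z (masked c x)‖) (Measure.pi ν) :=
  HasMoments.of_bound (measurable_residual z c).norm.aestronglyMeasurable
    (1 / z.im * (‖z‖ + 1 / z.im) + 1) fun x => by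
    rw [abs_norm, residual]
    have h1 := norm_avgRes_le hz (masked_isSymm c x)
    refine (norm_sub_le _ _).trans ?_
    rw [norm_one, norm_mul]
    gcongr
    exact (norm_sub_le _ _).trans (by gcongr)

end Residual

lemma Controlled.integral_residual_le (hJ : Controlled κ K J) (q m : ℕ) (hm : 4 ≤ m) :
    ∃ C : ℝ, 0 ≤ C ∧ ∀ (n : ℕ) (δ t : ℝ) (ν : Sym2 (Fin n) → Measure ℝ) (z : ℂ)
    (S : Finset (Fin n)) (c : Sym2 (Fin n) → ℝ), EntryLaws K n δ ν → Scales n δ t z →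
    z ∈ halfPlane κ → t ^ (J + 1) ≤ z.im → IsMask q S c →
    ∫ x, ‖residual z (masked c x)‖ ^ m ∂(Measure.pi ν) ≤ C * t ^ m := by
  obtain ⟨Γ, hΓ, H⟩ := hJ.rough q (2 * m)
  obtain ⟨Γ', hΓ', H'⟩ := hJ.rough q m
  obtain ⟨C, hC, HC⟩ := hJ.integral_selfErr_le q m (by omega)
  refine ⟨4 ^ m * ((Γ + C) + q ^ m * Γ' + (q * q) ^ m), by positivity,
    fun n δ t ν z S c h hs hz hJ hc => ?_⟩
  have := h.prob
  have ht := hs.pos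
  have ht1 := hs.le_one
  have hz' := hs.im_pos
  have hn' : (0 : ℝ) < n := by exact_mod_cast h.pos
  have hcard : ((Sᶜ.card : ℕ) : ℝ) ≤ n := by
    have := Finset.card_le_univ Sᶜ
    rw [Fintype.card_fin] at this
    exact_mod_cast this
  have hR := fun k => hasMoments_norm_resolvent (ν := ν) hz' c k k
  have hE := fun k => h.hasMoments_selfErr hz' hc (i := k)
  set R := fun x => resolventMatrix z (masked c x)
  set E := fun x i => selfErr z (masked c x) i
  have hpt : ∀ x, ‖residual z (masked c x)‖ ^ m ≤
      4 ^ m * (1 / n * ∑ i ∈ Sᶜ, (‖R x i i‖ * ‖E x i‖) ^ m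
        + (q * t ^ 8) ^ m * (1 / n * ∑ i ∈ Sᶜ, ‖R x i i‖ ^ m) + (q * q) ^ m * t ^ m) := by
    intro x
    refine (pow_le_pow_left₀ (norm_nonneg _)
      ((norm_residual_le h.pos hs hc x).trans (le_add_of_nonneg_right le_rfl)) m).trans
      ((add_four_pow_le (by positivity) (by positivity) (by positivity) le_rfl m).trans ?_)
    rw [zero_pow (by omega), add_zero]
    gcongr
    · exact avg_pow_le _ hn' hcard (fun k => by positivity) (by omega)
    · rw [mul_pow]
      gcongr
      exact avg_pow_le _ hn' hcard (fun k => by positivity) (by omega)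
    · rw [← mul_pow]
      refine pow_le_pow_left₀ (by positivity) ?_ m
      have : t ^ 8 * t ^ 8 ≤ t := by
        rw [← pow_add]
        exact pow_le_of_le_one ht.le ht1 (by norm_num)
      calc (q : ℝ) * t ^ 8 * (q * t ^ 8) = q * q * (t ^ 8 * t ^ 8) := by ring
        _ ≤ _ := by gcongr
  have hRE : ∀ i ∈ Sᶜ, ∫ x, (‖R x i i‖ * ‖E x i‖) ^ m ∂(Measure.pi ν) ≤ (Γ + C) * t ^ m := by
    intro i hi
    have hi' := Finset.mem_compl.mp hi
    have b1 := H n δ t ν z S c h hs hz hJ hc i hi' i hi'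
    have b2 := HC n δ t ν z S c h hs hz hJ hc i hi'
    have i1 := ((hR i).pow (2 * m)).integrable
    have i2 := ((hE i).pow (2 * m)).integrable
    -- The weight `t^(3m)` balances the two bounds: the first product is `t^m`, the second
    -- `t^(3m-8)`, which is at most `t^m` because `m ≥ 4`.
    calc _ ≤ ∫ x, (t ^ (3 * m) * ‖R x i i‖ ^ (2 * m) + 1 / t ^ (3 * m) * ‖E x i‖ ^ (2 * m))
          ∂(Measure.pi ν) := by
          refine integral_mono (((hR i).mul (hE i)).pow m).integrable
            ((i1.const_mul _).add (i2.const_mul _)) fun x => ?_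
          simp only
          rw [mul_pow, two_mul m, pow_add, pow_add]
          set a := ‖R x i i‖ ^ m
          set b := ‖E x i‖ ^ m
          set l := t ^ (3 * m)
          have hl : 0 < l := by positivity
          have : l * (a * a) + 1 / l * (b * b) - a * b
              = ((l * a - b) ^ 2 + (l * a) * b) / l := by field_simp; ring
          have h2 : 0 ≤ ((l * a - b) ^ 2 + (l * a) * b) / l := by positivity
          linarith
      _ = t ^ (3 * m) * ∫ x, ‖R x i i‖ ^ (2 * m) ∂(Measure.pi ν)
          + 1 / t ^ (3 * m) * ∫ x, ‖E x i‖ ^ (2 * m) ∂(Measure.pi ν) := by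
          rw [integral_add (i1.const_mul _) (i2.const_mul _), integral_const_mul,
            integral_const_mul]
      _ ≤ t ^ (3 * m) * (Γ * (1 / t) ^ (2 * m)) + 1 / t ^ (3 * m) * (C * t ^ (6 * m - 8)) := by
          gcongr
      _ ≤ Γ * t ^ m + C * t ^ m := by
          have e1 : t ^ (3 * m) * (1 / t) ^ (2 * m) = t ^ m := by
            rw [one_div, inv_pow, ← div_eq_mul_inv, div_eq_iff (by positivity), ← pow_add]
            congr 1; omega
          have e2 : 1 / t ^ (3 * m) * t ^ (6 * m - 8) = t ^ (3 * m - 8) := by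
            rw [one_div, inv_mul_eq_div, div_eq_iff (by positivity), ← pow_add]
            congr 1; omega
          have e3 : t ^ (3 * m - 8) ≤ t ^ m := pow_le_pow_of_le_one ht.le ht1 (by omega)
          calc _ = Γ * (t ^ (3 * m) * (1 / t) ^ (2 * m))
                + C * (1 / t ^ (3 * m) * t ^ (6 * m - 8)) := by ring
            _ ≤ _ := by rw [e1, e2]; gcongr
      _ = _ := by ring
  have i1 : Integrable (fun x => ∑ i ∈ Sᶜ, (‖R x i i‖ * ‖E x i‖) ^ m) (Measure.pi ν) :=
    (HasMoments.sum _ fun i _ => ((hR i).mul (hE i)).pow m).integrable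
  have i2 : Integrable (fun x => ∑ i ∈ Sᶜ, ‖R x i i‖ ^ m) (Measure.pi ν) :=
    (HasMoments.sum _ fun i _ => (hR i).pow m).integrable
  have i12 : Integrable (fun x => 1 / (n : ℝ) * ∑ i ∈ Sᶜ, (‖R x i i‖ * ‖E x i‖) ^ m
        + (q * t ^ 8) ^ m * (1 / n * ∑ i ∈ Sᶜ, ‖R x i i‖ ^ m)) (Measure.pi ν) :=
    (i1.const_mul _).add ((i2.const_mul _).const_mul _)
  have havg : ∀ {f : Fin n → ℝ} {B : ℝ}, 0 ≤ B → (∀ i ∈ Sᶜ, f i ≤ B) →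
      1 / (n : ℝ) * ∑ i ∈ Sᶜ, f i ≤ B := by
    intro f B hB hf
    calc _ ≤ 1 / (n : ℝ) * ∑ i ∈ Sᶜ, B := by gcongr with i hi; exact hf i hi
      _ = 1 / n * (Sᶜ.card * B) := by rw [Finset.sum_const, nsmul_eq_mul]
      _ ≤ 1 / n * (n * B) := by gcongr
      _ = B := by field_simp
  calc _ ≤ ∫ x, 4 ^ m * (1 / n * ∑ i ∈ Sᶜ, (‖R x i i‖ * ‖E x i‖) ^ m
        + (q * t ^ 8) ^ m * (1 / n * ∑ i ∈ Sᶜ, ‖R x i i‖ ^ m) + (q * q) ^ m * t ^ m)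
        ∂(Measure.pi ν) :=
        integral_mono ((hasMoments_norm_residual hz' c).pow m).integrable
          ((i12.add (integrable_const _)).const_mul _) hpt
    _ = 4 ^ m * (1 / n * ∑ i ∈ Sᶜ, ∫ x, (‖R x i i‖ * ‖E x i‖) ^ m ∂(Measure.pi ν)
        + (q * t ^ 8) ^ m * (1 / n * ∑ i ∈ Sᶜ, ∫ x, ‖R x i i‖ ^ m ∂(Measure.pi ν))
        + (q * q) ^ m * t ^ m) := by
        rw [integral_const_mul, integral_add i12 (integrable_const _),
          integral_add (i1.const_mul _) ((i2.const_mul _).const_mul _), integral_const_mul,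
          integral_const_mul, integral_const_mul,
          integral_finsetSum _ fun i _ => (((hR i).mul (hE i)).pow m).integrable,
          integral_finsetSum _ fun i _ => ((hR i).pow m).integrable, integral_const, probReal_univ, one_smul]
    _ ≤ 4 ^ m * ((Γ + C) * t ^ m + (q * t ^ 8) ^ m * (Γ' * (1 / t) ^ m)
        + (q * q) ^ m * t ^ m) := by
        refine mul_le_mul_of_nonneg_left (add_le_add (add_le_add (havg (by positivity) hRE)
          (mul_le_mul_of_nonneg_left (havg (by positivity) fun i hi => ?_) (by positivity)))
          le_rfl) (by positivity)
        exact H' n δ t ν z S c h hs hz hJ hc i (Finset.mem_compl.mp hi) i (Finset.mem_compl.mp hi)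
    _ ≤ 4 ^ m * ((Γ + C) * t ^ m + q ^ m * Γ' * t ^ m + (q * q) ^ m * t ^ m) := by
        refine mul_le_mul_of_nonneg_left (add_le_add (add_le_add le_rfl ?_) le_rfl) (by positivity)
        have e : (t ^ 8) ^ m * (1 / t) ^ m ≤ t ^ m := by
          rw [← mul_pow]
          gcongr
          have : t ^ 8 * (1 / t) = t ^ 7 := by field_simp
          rw [this]
          exact pow_le_of_le_one ht.le ht1 (by norm_num)
        calc _ = q ^ m * Γ' * ((t ^ 8) ^ m * (1 / t) ^ m) := by rw [mul_pow]; ring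
          _ ≤ _ := mul_le_mul_of_nonneg_left e (by positivity)
    _ = _ := by ring

end LocalLaw


lemma HasMoments.measureReal_lt_le {Ω : Type*} [MeasurableSpace Ω] {P : Measure Ω}
    [IsProbabilityMeasure P] {f : Ω → ℝ} (hf : HasMoments f P) (h0 : ∀ ω, 0 ≤ f ω) {a : ℝ}
    (ha : 0 < a) (m : ℕ) : P.real {ω | a < f ω} ≤ (1 / a) ^ m * ∫ ω, f ω ^ m ∂P := by
  have h := mul_meas_ge_le_integral_of_nonneg (μ := P) (f := fun ω => f ω ^ m)
    (ae_of_all _ fun ω => pow_nonneg (h0 ω) m) (hf.pow m).integrable (a ^ m)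
  have h2 : P.real {ω | a < f ω} ≤ P.real {ω | a ^ m ≤ f ω ^ m} :=
    measureReal_mono fun ω (hω : a < f ω) => pow_le_pow_left₀ ha.le hω.le m
  rw [one_div, inv_pow, inv_mul_eq_div, le_div_iff₀ (by positivity)]
  calc _ = a ^ m * P.real {ω | a < f ω} := by ring
    _ ≤ _ := (mul_le_mul_of_nonneg_left h2 (by positivity)).trans h

/-! ### Induction over scales: selecting the right root and closing the induction. -/

section LocalLaw

variable {κ : ℝ} {K : ℕ → ℝ} {J q : ℕ}

/-- The standing assumptions at spectral parameters with `Im z ≥ t ^ J`. -/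
structure Setting (κ : ℝ) (K : ℕ → ℝ) (J q n : ℕ) (δ t : ℝ) (ν : Sym2 (Fin n) → Measure ℝ) (z : ℂ)
    (S : Finset (Fin n)) (c : Sym2 (Fin n) → ℝ) : Prop where
  laws : EntryLaws K n δ ν
  scales : Scales n δ t z
  mem : z ∈ halfPlane κ
  le_im : t ^ J ≤ z.im
  mask : IsMask q S c

lemma Setting.liftIm {n : ℕ} {δ t : ℝ} {ν : Sym2 (Fin n) → Measure ℝ} {z : ℂ}
    {S : Finset (Fin n)} {c : Sym2 (Fin n) → ℝ} (h : Setting κ K J q n δ t ν z S c) {a : ℝ}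
    (ha : 1 ≤ a) : Setting κ K J q n δ t ν (liftIm a z) S c where
  laws := h.laws
  scales := h.scales.liftIm ha
  mem := liftIm_mem ha h.mem
  le_im := h.le_im.trans (le_mul_of_one_le_left h.scales.im_pos.le ha)
  mask := h.mask

/-- Markov's inequality at a high moment gives any prescribed power of `t`, which later pays for
deterministic bounds and for union bounds. -/
lemma Controlled.residual_tail (hJ : Controlled κ K J) (q D : ℕ) {a : ℝ} (ha : 0 < a) :
    ∃ C : ℝ, 0 ≤ C ∧ ∀ (n : ℕ) (δ t : ℝ) (ν : Sym2 (Fin n) → Measure ℝ) (z : ℂ)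
    (S : Finset (Fin n)) (c : Sym2 (Fin n) → ℝ), Setting κ K (J + 1) q n δ t ν z S c →
    (Measure.pi ν).real {x | a < ‖residual z (masked c x)‖} ≤ C * t ^ D := by
  obtain ⟨C, hC, H⟩ := hJ.integral_residual_le q (D + 4) (by omega)
  refine ⟨(1 / a) ^ (D + 4) * C, by positivity, fun n δ t ν z S c h => ?_⟩
  have := h.laws.prob
  have ht := h.scales.pos
  refine ((hasMoments_norm_residual h.scales.im_pos c).measureReal_lt_le
    (fun _ => norm_nonneg _) ha (D + 4)).trans ?_
  rw [mul_assoc]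
  gcongr
  refine (H n δ t ν z S c h.laws h.scales h.mem h.le_im h.mask).trans ?_
  gcongr ?_ * ?_
  exact pow_le_pow_of_le_one ht.le h.scales.le_one (by omega)

lemma Controlled.selfErr_tail (hJ : Controlled κ K J) (q D : ℕ) {a : ℝ} (ha : 0 < a) :
    ∃ C : ℝ, 0 ≤ C ∧ ∀ (n : ℕ) (δ t : ℝ) (ν : Sym2 (Fin n) → Measure ℝ) (z : ℂ)
    (S : Finset (Fin n)) (c : Sym2 (Fin n) → ℝ), Setting κ K (J + 1) q n δ t ν z S c →
    ∀ i ∉ S, (Measure.pi ν).real {x | a < ‖selfErr z (masked c x) i‖} ≤ C * t ^ D := by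
  obtain ⟨C, hC, H⟩ := hJ.integral_selfErr_le q (D + 2) (by omega)
  refine ⟨(1 / a) ^ (2 * (D + 2)) * C, by positivity, fun n δ t ν z S c h i hi => ?_⟩
  have := h.laws.prob
  have ht := h.scales.pos
  refine ((h.laws.hasMoments_selfErr h.scales.im_pos h.mask (i := i)).measureReal_lt_le
    (fun _ => norm_nonneg _) ha (2 * (D + 2))).trans ?_
  rw [mul_assoc]
  gcongr
  refine (H n δ t ν z S c h.laws h.scales h.mem h.le_im h.mask i hi).trans ?_
  gcongr ?_ * ?_
  exact pow_le_pow_of_le_one ht.le h.scales.le_one (by omega)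

/-- Quantitative continuity in the height: the increment of the normalised trace is at most `(a -
1)` times minus its imaginary part at the upper point. -/
lemma norm_avgRes_le_of_liftIm {n : ℕ} {z : ℂ} {W : Matrix (Fin n) (Fin n) ℝ} (hW : W.IsSymm)
    (hz : 0 < z.im) {a : ℝ} (ha : 1 ≤ a) : ‖avgRes z W‖ ≤ a * ‖avgRes (liftIm a z) W‖ := by
  set w := liftIm a z
  have hle : z.im ≤ w.im := le_mul_of_one_le_left hz.le ha
  have him : (w.im - z.im) / z.im = a - 1 := by
    simp only [w, liftIm]; field_simp
  have h1 : ‖avgRes z W - avgRes w W‖ ≤ (a - 1) * -(avgRes w W).im := by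
    have e : (avgRes w W).im = 1 / n * ∑ k, (resolventMatrix w W k k).im := by
      rw [avgRes, show (1 / (n : ℂ)) = ((1 / n : ℝ) : ℂ) by push_cast; rfl, Complex.im_ofReal_mul,
        Complex.im_sum]
    rw [e, avgRes, avgRes, ← mul_sub, ← Finset.sum_sub_distrib, norm_mul,
      show ‖(1 / (n : ℂ))‖ = 1 / n by simp]
    calc _ ≤ 1 / (n : ℝ) * ∑ k, (a - 1) * -(resolventMatrix w W k k).im := by
          gcongr
          refine (norm_sum_le _ _).trans (Finset.sum_le_sum fun k _ => ?_)
          have := norm_resolvent_sub_le hW hz (z := w) rfl hle k k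
          rw [him] at this
          linarith
      _ = _ := by rw [← Finset.mul_sum, Finset.sum_neg_distrib]; ring
  have h2 : -(avgRes w W).im ≤ ‖avgRes w W‖ :=
    (neg_le_abs _).trans (Complex.abs_im_le_norm _)
  have h3 := norm_sub_norm_le (avgRes z W) (avgRes w W)
  nlinarith

lemma avgRes_im_nonpos {n : ℕ} {z : ℂ} {W : Matrix (Fin n) (Fin n) ℝ} (hW : W.IsSymm)
    (hz : 0 < z.im) : (avgRes z W).im ≤ 0 := by
  rw [avgRes, show (1 / (n : ℂ)) = ((1 / n : ℝ) : ℂ) by push_cast; rfl, Complex.im_ofReal_mul,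
    Complex.im_sum]
  exact mul_nonpos_of_nonneg_of_nonpos (by positivity)
    (Finset.sum_nonpos fun k _ => resolvent_diag_im_nonpos hW hz k)

/-- Outside of the bulk, the normalised trace is bounded away from the spurious root of the
self-consistent equation. -/
lemma Controlled.avgRes_tail (hκ : κ ∈ Set.Ioo (0 : ℝ) 1) (hJ : Controlled κ K J) (q D : ℕ) :
    ∃ C : ℝ, 0 ≤ C ∧ ∀ (n : ℕ) (δ t : ℝ) (ν : Sym2 (Fin n) → Measure ℝ) (z : ℂ)
    (S : Finset (Fin n)) (c : Sym2 (Fin n) → ℝ), Setting κ K (J + 1) q n δ t ν z S c →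
    ¬ |z.re| ≤ 2 - κ →
    (Measure.pi ν).real {x | 1 - κ / 8 < ‖avgRes z (masked c x)‖} ≤ C * t ^ D := by
  obtain ⟨hκ0, hκ1⟩ := hκ
  -- Dividing this threshold by the separation `κ/4` leaves an error `κ/8` in the trace. The surplus
  -- exponent `J + 1` pays for the number of heights visited.
  obtain ⟨C, hC, H⟩ := hJ.residual_tail q (D + (J + 1)) (a := κ / 4 * (κ / 8)) (by positivity)
  refine ⟨(16 / κ + 1) * C, by positivity, fun n δ t ν z S c h hre => ?_⟩
  have := h.laws.prob
  have ht := h.scales.pos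
  have ht1 := h.scales.le_one
  -- Bootstrap down a vertical line, starting from height `2` where the trace is at most `1/2`. A
  -- bound `1 - κ/8` at one height gives a bound `(1 + κ/8)(1 - κ/8) ≤ 1` at the next, which
  -- excludes the spurious root. If the residual is small there, the trace is within `κ/8` of `m`,
  -- hence again at most `1 - κ/8`.
  have key : ∀ (l : ℕ) (w : ℂ), Setting κ K (J + 1) q n δ t ν w S c → ¬ |w.re| ≤ 2 - κ →
      2 ≤ w.im * (1 + κ / 8) ^ l →
      (Measure.pi ν).real {x | 1 - κ / 8 < ‖avgRes w (masked c x)‖}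
        ≤ l * (C * t ^ (D + (J + 1))) := by
    intro l
    induction l with
    | zero =>
      intro w hw _ him
      have : {x | 1 - κ / 8 < ‖avgRes w (masked c x)‖} = ∅ := by
        rw [Set.eq_empty_iff_forall_notMem]
        intro x hx
        rw [Set.mem_ofPred_eq] at hx
        have h1 := norm_avgRes_le hw.scales.im_pos (masked_isSymm c x)
        have h2 : 1 / w.im ≤ 1 / 2 := by gcongr; simpa using him
        linarith
      rw [this]; simp
    | succ l ih =>
      intro w hw hwre him
      have hM : 1 ≤ 1 + κ / 8 := by linarith
      have h1 := ih (liftIm (1 + κ / 8) w) (hw.liftIm hM) hwre (by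
        rw [pow_succ] at him
        simp only [SparseWigner.liftIm]
        linarith)
      have h2 := H n δ t ν w S c hw
      have hsub : {x | 1 - κ / 8 < ‖avgRes w (masked c x)‖} ⊆
          {x | 1 - κ / 8 < ‖avgRes (liftIm (1 + κ / 8) w) (masked c x)‖} ∪
          {x | κ / 4 * (κ / 8) < ‖residual w (masked c x)‖} := by
        intro x hx
        rw [Set.mem_ofPred_eq] at hx
        by_contra hcon
        simp only [Set.mem_union, Set.mem_ofPred_eq, not_or, not_lt] at hcon
        have h3 := norm_avgRes_le_of_liftIm (masked_isSymm c x) hw.scales.im_pos hM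
        have h4 : ‖avgRes w (masked c x)‖ ≤ 1 := by nlinarith [hcon.1]
        obtain h5 | h5 := semicircleStieltjes_dichotomy hκ0 hκ1 hw.mem
        · exact hwre h5.1
        have h6 := norm_sub_semicircleStieltjes_le hw.scales.im_pos (by positivity) hcon.2
          (le_norm_sub_inv_of_norm (semicircleStieltjes_ne_zero hw.scales.im_pos) h5.2 h4)
        rw [mul_div_cancel_left₀ _ (by positivity)] at h6
        have := norm_sub_norm_le (avgRes w (masked c x)) (semicircleStieltjes w)
        linarith [h5.2]
      refine (measureReal_mono hsub).trans ((measureReal_union_le _ _).trans ?_)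
      push_cast
      linarith
  have hz := h.scales.im_pos
  -- By Bernoulli's inequality this many steps reach height `2`. The count is cruder than the
  -- logarithmic optimum but polynomial in `1/t`, which suffices.
  set l := ⌈16 / (κ * z.im)⌉₊
  have hl1 : 16 / (κ * z.im) ≤ l := Nat.le_ceil _
  have hl2 : (l : ℝ) ≤ 16 / (κ * z.im) + 1 := (Nat.ceil_lt_add_one (by positivity)).le
  refine (key l z h hre ?_).trans ?_
  · have hb := one_add_mul_le_pow (a := κ / 8) (by linarith) l
    have h3 : 16 ≤ l * (κ * z.im) := (div_le_iff₀ (by positivity)).mp hl1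
    calc (2 : ℝ) ≤ z.im * (1 + l * (κ / 8)) := by nlinarith
      _ ≤ _ := by gcongr
  · have hp : 0 < t ^ (J + 1) := by positivity
    have hp1 : t ^ (J + 1) ≤ 1 := pow_le_one₀ ht.le ht1
    have h3 : (l : ℝ) * t ^ (J + 1) ≤ 16 / κ + 1 := by
      calc (l : ℝ) * t ^ (J + 1) ≤ (16 / (κ * z.im) + 1) * t ^ (J + 1) := by gcongr
        _ = 16 / κ * (t ^ (J + 1) / z.im) + t ^ (J + 1) := by field_simp
        _ ≤ 16 / κ * 1 + 1 := by
            gcongr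
            exact (div_le_one₀ hz).mpr h.le_im
        _ = _ := by ring
    calc _ = (l * t ^ (J + 1)) * (C * t ^ D) := by rw [pow_add]; ring
      _ ≤ (16 / κ + 1) * (C * t ^ D) := by gcongr
      _ = _ := by ring

/-- In the bulk the event is empty, since the sign of the imaginary part selects the root
deterministically; outside it forces the trace to be exceptionally large. -/
lemma Controlled.sub_semicircle_tail (hκ : κ ∈ Set.Ioo (0 : ℝ) 1) (hJ : Controlled κ K J)
    (q D : ℕ) :
    ∃ C : ℝ, 0 ≤ C ∧ ∀ (n : ℕ) (δ t : ℝ) (ν : Sym2 (Fin n) → Measure ℝ) (z : ℂ)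
    (S : Finset (Fin n)) (c : Sym2 (Fin n) → ℝ), Setting κ K (J + 1) q n δ t ν z S c →
    (Measure.pi ν).real {x | ‖residual z (masked c x)‖ / (κ / 4) <
      ‖avgRes z (masked c x) - semicircleStieltjes z‖} ≤ C * t ^ D := by
  obtain ⟨C, hC, H⟩ := hJ.avgRes_tail hκ q D
  obtain ⟨hκ0, hκ1⟩ := hκ
  refine ⟨C, hC, fun n δ t ν z S c h => ?_⟩
  have := h.laws.prob
  have ht := h.scales.pos
  have hz := h.scales.im_pos
  obtain h5 | h5 := semicircleStieltjes_dichotomy hκ0 hκ1 h.mem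
  · have : {x | ‖residual z (masked c x)‖ / (κ / 4) <
        ‖avgRes z (masked c x) - semicircleStieltjes z‖} = ∅ := by
      rw [Set.eq_empty_iff_forall_notMem]
      intro x hx
      rw [Set.mem_ofPred_eq] at hx
      exact hx.not_ge (norm_sub_semicircleStieltjes_le hz (by positivity) le_rfl
        (le_norm_sub_inv_of_im h5.2 (avgRes_im_nonpos (masked_isSymm c x) hz)))
    rw [this, measureReal_empty]
    positivity
  · refine (measureReal_mono fun x hx => ?_).trans (H n δ t ν z S c h h5.1)
    by_contra hcon
    rw [Set.mem_ofPred_eq] at hx hcon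
    rw [not_lt] at hcon
    exact hx.not_ge (norm_sub_semicircleStieltjes_le hz (by positivity) le_rfl
      (le_norm_sub_inv_of_norm (semicircleStieltjes_ne_zero hz) h5.2 (by linarith)))

/-- As `|z - m| = 1/|m| ≥ 1`, the denominator in Schur's formula stays above `1/2`. -/
lemma norm_resolvent_diag_le_two {n : ℕ} {z : ℂ} {W : Matrix (Fin n) (Fin n) ℝ} (hW : W.IsSymm)
    (hz : 0 < z.im) {i : Fin n} (hg : ‖avgRes z W - semicircleStieltjes z‖ ≤ 1 / 4)
    (he : ‖selfErr z W i‖ ≤ 1 / 4) : ‖resolventMatrix z W i i‖ ≤ 2 := by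
  have h1 := resolvent_mul_selfErr hW hz i
  have h2 : 1 ≤ ‖z - semicircleStieltjes z‖ := by
    rw [sub_semicircleStieltjes hz, norm_inv]
    exact (one_le_inv₀ (norm_pos_iff.mpr (semicircleStieltjes_ne_zero hz))).mpr
      (semicircleStieltjes_spec hz).1.le
  have h3 : 1 / 2 ≤ ‖z - avgRes z W - selfErr z W i‖ := by
    have e : z - semicircleStieltjes z = (z - avgRes z W - selfErr z W i)
      + (avgRes z W - semicircleStieltjes z) + selfErr z W i := by ring
    have := norm_add₃_le (a := z - avgRes z W - selfErr z W i)
      (b := avgRes z W - semicircleStieltjes z) (c := selfErr z W i)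
    rw [← e] at this
    linarith
  have h4 : ‖resolventMatrix z W i i‖ * ‖z - avgRes z W - selfErr z W i‖ = 1 := by
    rw [← norm_mul, h1, norm_one]
  nlinarith [norm_nonneg (resolventMatrix z W i i)]

lemma Controlled.diag_tail (hκ : κ ∈ Set.Ioo (0 : ℝ) 1) (hJ : Controlled κ K J) (q D : ℕ) :
    ∃ C : ℝ, 0 ≤ C ∧ ∀ (n : ℕ) (δ t : ℝ) (ν : Sym2 (Fin n) → Measure ℝ) (z : ℂ)
    (S : Finset (Fin n)) (c : Sym2 (Fin n) → ℝ), Setting κ K (J + 1) q n δ t ν z S c →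
    ∀ i ∉ S, (Measure.pi ν).real {x | 2 < ‖resolventMatrix z (masked c x) i i‖} ≤ C * t ^ D := by
  have hκ0 := hκ.1
  obtain ⟨C₁, hC₁, H₁⟩ := hJ.sub_semicircle_tail hκ q D
  obtain ⟨C₂, hC₂, H₂⟩ := hJ.residual_tail q D (a := κ / 16) (by positivity)
  obtain ⟨C₃, hC₃, H₃⟩ := hJ.selfErr_tail q D (a := 1 / 4) (by norm_num)
  refine ⟨C₁ + C₂ + C₃, by positivity, fun n δ t ν z S c h i hi => ?_⟩
  have := h.laws.prob
  have hz := h.scales.im_pos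
  have hsub : {x | 2 < ‖resolventMatrix z (masked c x) i i‖} ⊆
      ({x | ‖residual z (masked c x)‖ / (κ / 4) <
        ‖avgRes z (masked c x) - semicircleStieltjes z‖} ∪
      {x | κ / 16 < ‖residual z (masked c x)‖}) ∪ {x | 1 / 4 < ‖selfErr z (masked c x) i‖} := by
    intro x hx
    rw [Set.mem_ofPred_eq] at hx
    by_contra hcon
    simp only [Set.mem_union, Set.mem_ofPred_eq, not_or, not_lt] at hcon
    refine hx.not_ge (norm_resolvent_diag_le_two (masked_isSymm c x) hz
      (hcon.1.1.trans ?_) hcon.2)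
    rw [div_le_iff₀ (by positivity)]
    linarith [hcon.1.2]
  refine (measureReal_mono hsub).trans ((measureReal_union_le _ _).trans
    ((add_le_add (measureReal_union_le _ _) le_rfl).trans ?_))
  linarith [H₁ n δ t ν z S c h, H₂ n δ t ν z S c h, H₃ n δ t ν z S c h i hi]

/-- On the exceptional event the deterministic bound `1 / Im z ≤ t^(-(J+1))` is used, and the tail
exponent `(J+1) m` is chosen to cancel its `m`-th power. -/
lemma Controlled.integral_diag_le (hκ : κ ∈ Set.Ioo (0 : ℝ) 1) (hJ : Controlled κ K J) (q m : ℕ) :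
    ∃ C : ℝ, 0 ≤ C ∧ ∀ (n : ℕ) (δ t : ℝ) (ν : Sym2 (Fin n) → Measure ℝ) (z : ℂ)
    (S : Finset (Fin n)) (c : Sym2 (Fin n) → ℝ), Setting κ K (J + 1) q n δ t ν z S c →
    ∀ i ∉ S, ∫ x, ‖resolventMatrix z (masked c x) i i‖ ^ m ∂(Measure.pi ν) ≤ C := by
  obtain ⟨C, hC, H⟩ := hJ.diag_tail hκ q ((J + 1) * m)
  refine ⟨2 ^ m + C, by positivity, fun n δ t ν z S c h i hi => ?_⟩
  have := h.laws.prob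
  have hz := h.scales.im_pos
  have ht := h.scales.pos
  set B := {x | 2 < ‖resolventMatrix z (masked c x) i i‖}
  have hB : MeasurableSet B :=
    measurableSet_lt measurable_const (measurable_resolvent_masked z c i i).norm
  have hint : Integrable (B.indicator fun _ => (1 / z.im) ^ m) (Measure.pi ν) :=
    (integrable_const _).indicator hB
  calc _ ≤ ∫ x, (2 ^ m + B.indicator (fun _ => (1 / z.im) ^ m) x) ∂(Measure.pi ν) := by
        refine integral_mono ((hasMoments_norm_resolvent hz c i i).pow m).integrable
          ((integrable_const _).add hint) fun x => ?_
        by_cases hx : x ∈ B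
        · simp only [Set.indicator_of_mem hx]
          refine le_add_of_nonneg_of_le (by positivity) ?_
          exact pow_le_pow_left₀ (norm_nonneg _) (norm_resolvent_le (masked_isSymm c x) hz i i) m
        · simp only [Set.indicator_of_notMem hx, add_zero]
          exact pow_le_pow_left₀ (norm_nonneg _) (not_lt.mp hx) m
    _ = 2 ^ m + (Measure.pi ν).real B * (1 / z.im) ^ m := by
        rw [integral_add (integrable_const _) hint, integral_indicator_const _ hB, integral_const,
          probReal_univ, one_smul, smul_eq_mul]
    _ ≤ 2 ^ m + C * t ^ ((J + 1) * m) * (1 / z.im) ^ m := by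
        gcongr
        exact H n δ t ν z S c h i hi
    _ = 2 ^ m + C * (t ^ (J + 1) / z.im) ^ m := by rw [pow_mul, div_pow, div_pow]; ring
    _ ≤ 2 ^ m + C * 1 := by
        gcongr
        exact pow_le_one₀ (by positivity) ((div_le_one₀ hz).mpr h.le_im)
    _ = _ := by ring

/-- The diagonal bound no longer loses a factor `1/t`, and off-diagonal entries follow from `R_ij =
R_ii` times `rowForm` by Cauchy–Schwarz. Here `m + 2` replaces `m` only to meet the requirement of
at least `2` in the bound for `rowForm`. -/
lemma Controlled.succ (hκ : κ ∈ Set.Ioo (0 : ℝ) 1) (hJ : Controlled κ K J) :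
    Controlled κ K (J + 1) := by
  intro q m
  obtain ⟨C₁, hC₁, H₁⟩ := hJ.integral_diag_le hκ q (2 * (m + 2))
  obtain ⟨C₂, hC₂, H₂⟩ := hJ.integral_rowForm_le q (m + 2) (by omega)
  refine ⟨1 + C₁ + C₂, by linarith, fun n δ t ν z S c hl hs hz hle hc i hi j hj => ?_⟩
  have h : Setting κ K (J + 1) q n δ t ν z S c := ⟨hl, hs, hz, hle, hc⟩
  have := hl.prob
  have hz := hs.im_pos
  have ht := hs.pos
  have hR := fun k l => hasMoments_norm_resolvent (ν := ν) hz c k l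
  have b1 := H₁ n δ t ν z S c h i hi
  have hstep : ∀ a : ℝ, 0 ≤ a → a ^ m ≤ 1 + a ^ (m + 2) := by
    intro a ha
    rcases le_total a 1 with h1 | h1
    · have := pow_le_one₀ (n := m) ha h1
      have : 0 ≤ a ^ (m + 2) := by positivity
      linarith
    · have := pow_le_pow_right₀ h1 (show m ≤ m + 2 by omega)
      linarith
  have i1 := ((hR i i).pow (2 * (m + 2))).integrable
  by_cases hij : j = i
  · subst hij
    calc _ ≤ ∫ x, (1 + ‖resolventMatrix z (masked c x) j j‖ ^ (2 * (m + 2)))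
          ∂(Measure.pi ν) := by
          refine integral_mono ((hR j j).pow m).integrable ((integrable_const _).add i1) fun x => ?_
          rcases le_total ‖resolventMatrix z (masked c x) j j‖ 1 with h1 | h1
          · have := pow_le_one₀ (n := m) (norm_nonneg _) h1
            have : 0 ≤ ‖resolventMatrix z (masked c x) j j‖ ^ (2 * (m + 2)) := by positivity
            simp only
            linarith
          · have := pow_le_pow_right₀ h1 (show m ≤ 2 * (m + 2) by omega)
            simp only
            linarith
      _ = 1 + ∫ x, ‖resolventMatrix z (masked c x) j j‖ ^ (2 * (m + 2)) ∂(Measure.pi ν) := by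
          rw [integral_add (integrable_const _) i1, integral_const, probReal_univ, one_smul]
      _ ≤ _ := by linarith
  · have b2 := H₂ n δ t ν z S c hl hs h.mem hle hc i j (by simp [hij, hj])
    have b3 : C₂ * t ^ (6 * (m + 2) - 8) ≤ C₂ :=
      mul_le_of_le_one_right hC₂ (pow_le_one₀ ht.le hs.le_one)
    have i2 := ((hl.hasMoments_rowForm hz hc i j).pow (2 * (m + 2))).integrable
    have i12 : Integrable (fun x => ‖resolventMatrix z (masked c x) i i‖ ^ (2 * (m + 2))
          + ‖rowForm z (masked c x) i j‖ ^ (2 * (m + 2))) (Measure.pi ν) := i1.add i2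
    calc _ ≤ ∫ x, (1 + (‖resolventMatrix z (masked c x) i i‖ ^ (2 * (m + 2))
          + ‖rowForm z (masked c x) i j‖ ^ (2 * (m + 2)))) ∂(Measure.pi ν) := by
          refine integral_mono ((hR i j).pow m).integrable ((integrable_const _).add i12)
            fun x => (hstep _ (norm_nonneg _)).trans ?_
          simp only [resolvent_offdiag_eq (masked_isSymm c x) hz hij, norm_mul, mul_pow,
            two_mul (m + 2), pow_add _ (m + 2) (m + 2)]
          nlinarith [sq_nonneg (‖resolventMatrix z (masked c x) i i‖ ^ (m + 2)
            - ‖rowForm z (masked c x) i j‖ ^ (m + 2)),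
            mul_nonneg (pow_nonneg (norm_nonneg (resolventMatrix z (masked c x) i i)) (m + 2))
              (pow_nonneg (norm_nonneg (rowForm z (masked c x) i j)) (m + 2))]
      _ = 1 + (∫ x, ‖resolventMatrix z (masked c x) i i‖ ^ (2 * (m + 2)) ∂(Measure.pi ν)
          + ∫ x, ‖rowForm z (masked c x) i j‖ ^ (2 * (m + 2)) ∂(Measure.pi ν)) := by
          rw [integral_add (integrable_const _) i12, integral_add i1 i2, integral_const,
            probReal_univ, one_smul]
      _ ≤ _ := by linarith

/-- The moments of the entries of the resolvent are bounded at all polynomial scales. -/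
theorem controlled (hκ : κ ∈ Set.Ioo (0 : ℝ) 1) (K : ℕ → ℝ) (J : ℕ) : Controlled κ K J := by
  induction J with
  | zero => exact controlled_zero
  | succ J ih => exact ih.succ hκ

end LocalLaw


/-! ### Expected diagonal entries. -/

section DiagonalLaw

variable {κ : ℝ} {K : ℕ → ℝ} {J q : ℕ}

lemma norm_resolvent_diag_sub_le {n : ℕ} {z : ℂ} {W : Matrix (Fin n) (Fin n) ℝ} (hW : W.IsSymm)
    (hz : 0 < z.im) (i : Fin n) : ‖resolventMatrix z W i i - semicircleStieltjes z‖ ≤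
      ‖resolventMatrix z W i i‖ * (‖avgRes z W - semicircleStieltjes z‖ + ‖selfErr z W i‖) := by
  have h1 := resolvent_mul_selfErr hW hz i
  have h2 := (semicircleStieltjes_spec hz).2
  set m := semicircleStieltjes z
  have e : resolventMatrix z W i i - m
      = resolventMatrix z W i i * m * ((avgRes z W - m) + selfErr z W i) := by
    linear_combination m * h1 + resolventMatrix z W i i * h2
  have hm : ‖m‖ ≤ 1 := (semicircleStieltjes_spec hz).1.le
  calc _ = ‖resolventMatrix z W i i‖ * ‖m‖ * ‖(avgRes z W - m) + selfErr z W i‖ := by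
        rw [e, norm_mul, norm_mul]
    _ ≤ ‖resolventMatrix z W i i‖ * 1 * (‖avgRes z W - m‖ + ‖selfErr z W i‖) := by
        gcongr
        exact norm_add_le _ _
    _ = _ := by ring

/-- Adapted to a factor `a` with bounded second moment and a factor `b` with fourth moment `O(t^4)`:
the expectation of each term on the right is then `O(t)`. -/
lemma mul_le_add_pow_four {a b t : ℝ} (ht : 0 < t) :
    a * b ≤ t * a ^ 2 + t + 1 / t ^ 3 * b ^ 4 := by
  have h1 : t * a ^ 2 + 1 / t * b ^ 2 - a * b = ((t * a) ^ 2 + b ^ 2 - (t * a) * b) / t := by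
    field_simp
  have h2 : 0 ≤ ((t * a) ^ 2 + b ^ 2 - (t * a) * b) / t := by
    apply div_nonneg _ ht.le
    nlinarith [sq_nonneg (t * a - b), sq_nonneg (t * a + b)]
  have h3 : t + 1 / t ^ 3 * b ^ 4 - 1 / t * b ^ 2 = ((t ^ 2) ^ 2 + (b ^ 2) ^ 2 - t ^ 2 * b ^ 2)
      / t ^ 3 := by
    field_simp
  have h4 : 0 ≤ ((t ^ 2) ^ 2 + (b ^ 2) ^ 2 - t ^ 2 * b ^ 2) / t ^ 3 := by
    apply div_nonneg _ (by positivity)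
    nlinarith [sq_nonneg (t ^ 2 - b ^ 2), sq_nonneg (t ^ 2 + b ^ 2)]
  linarith

/-- The expected diagonal entries of the resolvent are close to the Stieltjes transform of the
semicircle law. -/
theorem exists_integral_resolvent_diag_sub_le (hκ : κ ∈ Set.Ioo (0 : ℝ) 1) (K : ℕ → ℝ) (J q : ℕ) :
    ∃ C : ℝ, 0 ≤ C ∧ ∀ (n : ℕ) (δ t : ℝ) (ν : Sym2 (Fin n) → Measure ℝ) (z : ℂ)
    (S : Finset (Fin n)) (c : Sym2 (Fin n) → ℝ), Setting κ K (J + 1) q n δ t ν z S c →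
    ∀ i ∉ S, ‖∫ x, resolventMatrix z (masked c x) i i ∂(Measure.pi ν) - semicircleStieltjes z‖
      ≤ C * t := by
  have hJ := controlled hκ K J
  have hκ0 := hκ.1
  obtain ⟨C₁, hC₁, H₁⟩ := hJ.integral_diag_le hκ q 2
  obtain ⟨C₂, hC₂, H₂⟩ := hJ.integral_residual_le q 4 le_rfl
  obtain ⟨C₃, hC₃, H₃⟩ := hJ.integral_selfErr_le q 2 le_rfl
  -- On the exceptional event the integrand is at most `2 / t^(J+1)`; the exponent `J + 2` leaves
  -- one factor `t`.
  obtain ⟨C₄, hC₄, H₄⟩ := hJ.sub_semicircle_tail hκ q (J + 2)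
  refine ⟨4 / κ * (C₁ + 1 + C₂) + (C₁ + 1 + C₃) + 2 * C₄, by positivity,
    fun n δ t ν z S c h i hi => ?_⟩
  have := h.laws.prob
  have hz := h.scales.im_pos
  have ht := h.scales.pos
  have ht1 := h.scales.le_one
  have b1 := H₁ n δ t ν z S c h i hi
  have b2 := H₂ n δ t ν z S c h.laws h.scales h.mem h.le_im h.mask
  have b3 := H₃ n δ t ν z S c h.laws h.scales h.mem h.le_im h.mask i hi
  have b4 := H₄ n δ t ν z S c h
  set m := semicircleStieltjes z
  have hm1 : ‖m‖ ≤ 1 := (semicircleStieltjes_spec hz).1.le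
  set R := fun x => resolventMatrix z (masked c x) i i with hR
  set T := fun x => residual z (masked c x)
  set E := fun x => selfErr z (masked c x) i
  set B := {x | ‖T x‖ / (κ / 4) < ‖avgRes z (masked c x) - m‖}
  have hB : MeasurableSet B := measurableSet_lt ((measurable_residual z c).norm.div_const _)
    ((measurable_avgRes z c).sub_const m).norm
  have hRm : Measurable R := measurable_resolvent_masked z c i i
  have hRmom : HasMoments (fun x => ‖R x‖) (Measure.pi ν) := hasMoments_norm_resolvent hz c i i
  have hRint : Integrable R (Measure.pi ν) :=
    (integrable_norm_iff hRm.aestronglyMeasurable).mp hRmom.integrable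
  have i1 := (hRmom.pow 2).integrable
  have i2 := ((hasMoments_norm_residual (ν := ν) hz c).pow 4).integrable
  have i3 := ((h.laws.hasMoments_selfErr hz h.mask (i := i)).pow 4).integrable
  have i4 : Integrable (B.indicator fun _ => 2 / t ^ (J + 1)) (Measure.pi ν) :=
    (integrable_const _).indicator hB
  have j2 : Integrable (fun x => 4 / κ * (t * ‖R x‖ ^ 2 + t + 1 / t ^ 3 * ‖T x‖ ^ 4))
    (Measure.pi ν) := (((i1.const_mul _).add (integrable_const _)).add (i2.const_mul _)).const_mul _
  have j3 : Integrable (fun x => t * ‖R x‖ ^ 2 + t + 1 / t ^ 3 * ‖E x‖ ^ 4)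
    (Measure.pi ν) := ((i1.const_mul _).add (integrable_const _)).add (i3.const_mul _)
  have j23 : Integrable (fun x => 4 / κ * (t * ‖R x‖ ^ 2 + t + 1 / t ^ 3 * ‖T x‖ ^ 4)
    + (t * ‖R x‖ ^ 2 + t + 1 / t ^ 3 * ‖E x‖ ^ 4)) (Measure.pi ν) := j2.add j3
  have hpt : ∀ x, ‖R x - m‖ ≤ 4 / κ * (t * ‖R x‖ ^ 2 + t + 1 / t ^ 3 * ‖T x‖ ^ 4)
      + (t * ‖R x‖ ^ 2 + t + 1 / t ^ 3 * ‖E x‖ ^ 4) + B.indicator (fun _ => 2 / t ^ (J + 1)) x := by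
    intro x
    by_cases hx : x ∈ B
    · rw [Set.indicator_of_mem hx]
      refine le_add_of_nonneg_of_le (by positivity) ?_
      have h1 : ‖R x‖ ≤ 1 / t ^ (J + 1) := (norm_resolvent_le (masked_isSymm c x) hz i i).trans
        (one_div_le_one_div_of_le (by positivity) h.le_im)
      have h2 : 1 ≤ 1 / t ^ (J + 1) := by
        rw [le_div_iff₀ (by positivity), one_mul]; exact pow_le_one₀ ht.le ht1
      calc _ ≤ ‖R x‖ + ‖m‖ := norm_sub_le _ _
        _ ≤ 1 / t ^ (J + 1) + 1 / t ^ (J + 1) := by linarith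
        _ = _ := by ring
    · rw [Set.indicator_of_notMem hx, add_zero]
      have h1 : ‖avgRes z (masked c x) - m‖ ≤ 4 / κ * ‖T x‖ := by
        refine (not_lt.mp hx).trans (le_of_eq ?_)
        field_simp
      have h2 := norm_resolvent_diag_sub_le (masked_isSymm c x) hz i
      have h3 := mul_le_add_pow_four (a := ‖R x‖) (b := ‖T x‖) ht
      have h4 := mul_le_add_pow_four (a := ‖R x‖) (b := ‖E x‖) ht
      calc _ ≤ ‖R x‖ * (4 / κ * ‖T x‖ + ‖E x‖) := h2.trans (by gcongr)
        _ = 4 / κ * (‖R x‖ * ‖T x‖) + ‖R x‖ * ‖E x‖ := by ring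
        _ ≤ _ := by gcongr
  have hstart : ‖∫ x, R x ∂(Measure.pi ν) - m‖ ≤ ∫ x, ‖R x - m‖ ∂(Measure.pi ν) := by
    have : ∫ x, R x ∂(Measure.pi ν) - m = ∫ x, (R x - m) ∂(Measure.pi ν) := by
      rw [integral_sub hRint (integrable_const _), integral_const, probReal_univ, one_smul]
    rw [this]
    exact norm_integral_le_integral_norm _
  have hbase : ∀ {A : ℝ} {f : (Sym2 (Fin n) → ℝ) → ℝ}, 0 ≤ A →
      Integrable (fun x => f x ^ 4) (Measure.pi ν) →
      ∫ x, f x ^ 4 ∂(Measure.pi ν) ≤ A * t ^ 4 →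
      ∫ x, (t * ‖R x‖ ^ 2 + t + 1 / t ^ 3 * f x ^ 4) ∂(Measure.pi ν) ≤ (C₁ + 1 + A) * t := by
    intro A f hA hf hle
    have j1 : Integrable (fun x => t * ‖R x‖ ^ 2 + t) (Measure.pi ν) :=
      (i1.const_mul _).add (integrable_const _)
    rw [integral_add j1 (hf.const_mul _),
      integral_add (i1.const_mul _) (integrable_const _), integral_const_mul, integral_const_mul,
      integral_const, probReal_univ, one_smul]
    calc _ ≤ t * C₁ + t + 1 / t ^ 3 * (A * t ^ 4) := by gcongr
      _ = _ := by field_simp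
  calc _ ≤ ∫ x, ‖R x - m‖ ∂(Measure.pi ν) := hstart
    _ ≤ ∫ x, (4 / κ * (t * ‖R x‖ ^ 2 + t + 1 / t ^ 3 * ‖T x‖ ^ 4)
      + (t * ‖R x‖ ^ 2 + t + 1 / t ^ 3 * ‖E x‖ ^ 4) + B.indicator (fun _ => 2 / t ^ (J + 1)) x)
        ∂(Measure.pi ν) :=
        integral_mono (hRint.sub (integrable_const _)).norm (j23.add i4) hpt
    _ = 4 / κ * ∫ x, (t * ‖R x‖ ^ 2 + t + 1 / t ^ 3 * ‖T x‖ ^ 4) ∂(Measure.pi ν)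
      + ∫ x, (t * ‖R x‖ ^ 2 + t + 1 / t ^ 3 * ‖E x‖ ^ 4) ∂(Measure.pi ν)
      + (Measure.pi ν).real B * (2 / t ^ (J + 1)) := by
        rw [integral_add j23 i4, integral_add j2 j3, integral_const_mul,
          integral_indicator_const _ hB, smul_eq_mul]
    _ ≤ 4 / κ * ((C₁ + 1 + C₂) * t) + (C₁ + 1 + C₃) * t
      + (C₄ * t ^ (J + 2)) * (2 / t ^ (J + 1)) := by
        refine add_le_add (add_le_add (mul_le_mul_of_nonneg_left (hbase hC₂ i2 b2) (by positivity))
          (hbase hC₃ i3 ?_)) (mul_le_mul_of_nonneg_right b4 (by positivity))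
        simpa using b3
    _ = _ := by
        rw [show t ^ (J + 2) = t ^ (J + 1) * t by rw [← pow_succ]]
        field_simp

end DiagonalLaw


/-! ### Parity under sign flips, and walks of the odd vertex. -/

section Telescope

variable {n : ℕ}

/-- The difference of the values of `G` at the two signs in position `e`. -/
def signDiff (e : Sym2 (Fin n)) (G : (Sym2 (Fin n) → ℝ) → ℂ) (c : Sym2 (Fin n) → ℝ) : ℂ :=
  G (Function.update c e 1) - G (Function.update c e (-1))

/-- A choice of signs. -/
def IsSign (c : Sym2 (Fin n) → ℝ) : Prop := ∀ e, c e = 1 ∨ c e = -1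

lemma IsSign.update {c : Sym2 (Fin n) → ℝ} (hc : IsSign c) (e : Sym2 (Fin n)) {s : ℝ}
    (hs : s = 1 ∨ s = -1) : IsSign (Function.update c e s) := by
  intro e'
  rcases eq_or_ne e' e with rfl | h
  · rwa [Function.update_self]
  · rw [Function.update_of_ne h]; exact hc e'

/-- Flip the signs of the off-diagonal entries in row `u`. -/
def flipRow (u : Fin n) (c : Sym2 (Fin n) → ℝ) (e : Sym2 (Fin n)) : ℝ :=
  if u ∈ e ∧ ¬ e.IsDiag then -c e else c e

/-- `G` is odd under flips of the rows `v` and `j`, and even under flips of the other rows. -/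
def OddAt (v j : Fin n) (G : (Sym2 (Fin n) → ℝ) → ℂ) : Prop :=
  ∀ c, IsSign c → ∀ u, G (flipRow u c) = (if u = v ∨ u = j then -1 else 1) * G c

lemma flipRow_update {e : Sym2 (Fin n)} (he : ¬ e.IsDiag) (u : Fin n) (c : Sym2 (Fin n) → ℝ)
    (s : ℝ) : Function.update (flipRow u c) e s =
      flipRow u (Function.update c e (if u ∈ e then -s else s)) := by
  funext e'
  rcases eq_or_ne e' e with rfl | h
  · simp only [Function.update_self, flipRow, he, not_false_eq_true, and_true]
    split_ifs <;> simp
  · simp only [Function.update_of_ne h, flipRow]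

/-- Differencing across the edge `(v, k)` moves the odd vertex from `v` to `k`: a flip of row `v` or
`k` also exchanges the two values at the edge, which brings one more sign. -/
lemma OddAt.signDiff {v j k : Fin n} {G : (Sym2 (Fin n) → ℝ) → ℂ} (hG : OddAt v j G) (hvj : v ≠ j)
    (hkv : k ≠ v) (hkj : k ≠ j) : OddAt k j (signDiff s(v, k) G) := by
  intro c hc u
  have he : ¬ (s(v, k) : Sym2 (Fin n)).IsDiag := by simpa using hkv.symm
  have h1 := hG _ (hc.update s(v, k) (Or.inl rfl)) u
  have h2 := hG _ (hc.update s(v, k) (Or.inr rfl)) u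
  simp only [SparseWigner.signDiff, flipRow_update he]
  by_cases hu : u = v ∨ u = k
  · simp only [Sym2.mem_iff, hu, if_true, neg_neg, h1, h2]
    rcases hu with rfl | rfl
    · simp [hvj, hkv.symm]; ring
    · simp [hkv, hkj]
  · simp only [Sym2.mem_iff, hu, if_false, h1, h2]
    rw [not_or] at hu
    simp only [hu.1, hu.2, false_or]
    ring

/-- Flip the signs of the entries `(v, k)`, `k ∈ A`. -/
def partialFlip (v : Fin n) (A : Finset (Fin n)) (c : Sym2 (Fin n) → ℝ) (e : Sym2 (Fin n)) : ℝ :=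
  if ∃ k ∈ A, e = s(v, k) then -c e else c e

lemma IsSign.partialFlip {c : Sym2 (Fin n) → ℝ} (hc : IsSign c) (v : Fin n) (A : Finset (Fin n)) :
    IsSign (partialFlip v A c) := by
  intro e
  simp only [SparseWigner.partialFlip]
  split_ifs
  · rcases hc e with h | h <;> simp [h]
  · exact hc e

lemma partialFlip_insert {v k : Fin n} {A : Finset (Fin n)} (hk : k ∉ A) (c : Sym2 (Fin n) → ℝ) :
    partialFlip v (insert k A) c =
      Function.update (partialFlip v A c) s(v, k) (-partialFlip v A c s(v, k)) := by
  funext e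
  have h0 : ¬ ∃ k' ∈ A, s(v, k) = s(v, k') := by
    rintro ⟨k', hk', h⟩
    exact hk (Sym2.congr_right.mp h ▸ hk')
  rcases eq_or_ne e s(v, k) with rfl | h
  · rw [Function.update_self]
    simp only [partialFlip, if_neg h0]
    exact if_pos ⟨k, Finset.mem_insert_self _ _, rfl⟩
  · rw [Function.update_of_ne h]
    simp only [partialFlip, Finset.exists_mem_insert, h, false_or]

lemma norm_sub_update_neg {G : (Sym2 (Fin n) → ℝ) → ℂ} {c : Sym2 (Fin n) → ℝ} (hc : IsSign c)
    (e : Sym2 (Fin n)) : ‖G c - G (Function.update c e (-c e))‖ = ‖signDiff e G c‖ := by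
  rcases hc e with h | h
  · rw [signDiff, h]
    congr 3
    rw [← h, Function.update_eq_self]
  · rw [signDiff, h, norm_sub_rev, neg_neg]
    congr 3
    rw [← h, Function.update_eq_self]

lemma norm_sub_partialFlip_le {G : (Sym2 (Fin n) → ℝ) → ℂ} {c : Sym2 (Fin n) → ℝ} (hc : IsSign c)
    {v : Fin n} {B : Fin n → ℝ} (A : Finset (Fin n))
    (hB : ∀ k ∈ A, ∀ c', IsSign c' → ‖signDiff s(v, k) G c'‖ ≤ B k) :
    ‖G c - G (partialFlip v A c)‖ ≤ ∑ k ∈ A, B k := by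
  induction A using Finset.induction_on with
  | empty =>
    have : partialFlip v ∅ c = c := by funext e; simp [partialFlip]
    simp [this]
  | insert k A hk ih =>
    rw [Finset.sum_insert hk, partialFlip_insert hk, add_comm]
    have h1 := ih fun k' hk' => hB k' (Finset.mem_insert_of_mem hk')
    have h2 := hB k (Finset.mem_insert_self _ _) _ (hc.partialFlip v A)
    rw [← norm_sub_update_neg (hc.partialFlip v A)] at h2
    exact (norm_sub_le_norm_sub_add_norm_sub _ _ _).trans (add_le_add h1 h2)

/-- Flipping the edges at `v` one after the other turns `G` into `-G`, so `2 ‖G‖` is at most the sum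
of the single-edge differences. -/
lemma OddAt.norm_le {v j : Fin n} {G : (Sym2 (Fin n) → ℝ) → ℂ} (hG : OddAt v j G)
    {c : Sym2 (Fin n) → ℝ} (hc : IsSign c) {B : Fin n → ℝ}
    (hB : ∀ k ≠ v, ∀ c', IsSign c' → ‖SparseWigner.signDiff s(v, k) G c'‖ ≤ B k) :
    ‖G c‖ ≤ ∑ k ∈ Finset.univ.erase v, B k := by
  have h1 := norm_sub_partialFlip_le hc (Finset.univ.erase v)
    fun k hk => hB k (Finset.ne_of_mem_erase hk)
  have h2 : partialFlip v (Finset.univ.erase v) c = flipRow v c := by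
    funext e
    simp only [partialFlip, flipRow]
    congr 1
    rw [eq_iff_iff]
    constructor
    · rintro ⟨k, hk, rfl⟩
      exact ⟨Sym2.mem_mk_left v k, by simpa using (Finset.ne_of_mem_erase hk).symm⟩
    · rintro ⟨he, hd⟩
      obtain ⟨k, rfl⟩ := he
      exact ⟨k, by simpa [eq_comm] using hd, rfl⟩
  rw [h2, hG c hc v, if_pos (Or.inl rfl), neg_one_mul, sub_neg_eq_add, ← two_mul, norm_mul] at h1
  have : ‖(2 : ℂ)‖ = 2 := by simp
  rw [this] at h1
  linarith [norm_nonneg (G c)]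

/-- Iterated sign differences. -/
def signDiffs (F : (Sym2 (Fin n) → ℝ) → ℂ) (L : List (Sym2 (Fin n))) :
    (Sym2 (Fin n) → ℝ) → ℂ := L.foldr signDiff F

/-- Once an edge has been differenced, its sign has no further effect. Hence a walk that reuses an
edge contributes zero, and only lists without repetition matter. -/
lemma signDiffs_update {F : (Sym2 (Fin n) → ℝ) → ℂ} {L : List (Sym2 (Fin n))} {e : Sym2 (Fin n)}
    (he : e ∈ L) (c : Sym2 (Fin n) → ℝ) (s : ℝ) :
    signDiffs F L (Function.update c e s) = signDiffs F L c := by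
  induction L generalizing c with
  | nil => simp at he
  | cons e' L ih =>
    simp only [signDiffs, List.foldr_cons, signDiff]
    rcases eq_or_ne e e' with rfl | h
    · simp only [Function.update_idem]
    · have he' : e ∈ L := by simpa [h] using he
      have := ih he'
      simp only [signDiffs] at this
      rw [Function.update_comm h, Function.update_comm h, this, this]

/-- The bound on a function all of whose iterated sign differences are small. -/
lemma norm_le_of_signDiffs {i j : Fin n} {F : (Sym2 (Fin n) → ℝ) → ℂ} (hF : OddAt i j F)
    (hij : i ≠ j) {B ρ : ℝ} (hB : 0 ≤ B) (hρ : 0 ≤ ρ) {r : ℕ}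
    (h : ∀ L : List (Sym2 (Fin n)), L.Nodup → (∀ e ∈ L, ¬ e.IsDiag) → L.length ≤ r →
      ∀ c, IsSign c → ‖signDiffs F L c‖ ≤ B * ρ ^ L.length)
    {c : Sym2 (Fin n) → ℝ} (hc : IsSign c) :
    ‖F c‖ ≤ B * (n * ρ) ^ r + B * ρ * ∑ l ∈ Finset.range r, (n * ρ) ^ l := by
  -- Here `L` is the set of edges walked so far, `v` the current odd vertex and `l` the number of
  -- steps left. A step to a vertex other than `j` costs `ρ` with `n` choices. A step to `j` ends
  -- the walk, since the two odd vertices would coincide, and costs `ρ` with one choice.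
  have key : ∀ (l : ℕ) (L : List (Sym2 (Fin n))) (v : Fin n), L.Nodup → (∀ e ∈ L, ¬ e.IsDiag) →
      L.length + l = r → v ≠ j → OddAt v j (signDiffs F L) → ∀ c, IsSign c →
      ‖signDiffs F L c‖ ≤ ρ ^ L.length *
        (B * (n * ρ) ^ l + B * ρ * ∑ l ∈ Finset.range l, (n * ρ) ^ l) := by
    intro l
    induction l with
    | zero =>
      intro L v hL hd hl _ _ c hc
      refine (h L hL hd (by omega) c hc).trans (le_of_eq ?_)
      simp; ring
    | succ l ih =>
      intro L v hL hd hl hvj hodd c hc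
      set A := B * (n * ρ) ^ l + B * ρ * ∑ l ∈ Finset.range l, (n * ρ) ^ l
      have hA : 0 ≤ A := by positivity
      have hb := hodd.norm_le hc (B := fun k => ρ ^ (L.length + 1) * A +
          if k = j then B * ρ ^ (L.length + 1) else 0) ?_
      · refine hb.trans ?_
        calc _ ≤ ∑ k, (ρ ^ (L.length + 1) * A + if k = j then B * ρ ^ (L.length + 1) else 0) :=
              Finset.sum_le_sum_of_subset_of_nonneg (Finset.subset_univ _) fun k _ _ => by
                split_ifs <;> positivity
          _ = n * (ρ ^ (L.length + 1) * A) + B * ρ ^ (L.length + 1) := by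
              rw [Finset.sum_add_distrib]; simp
          _ = _ := by
              rw [Finset.sum_range_succ', pow_zero]
              simp only [A, pow_succ _ _, ← Finset.sum_mul]
              ring
      · intro k hk c' hc'
        have hpos : 0 ≤ ρ ^ (L.length + 1) * A := by positivity
        by_cases he : s(v, k) ∈ L
        · rw [SparseWigner.signDiff, signDiffs_update he, signDiffs_update he, sub_self, norm_zero]
          split_ifs <;> positivity
        have hL' : (s(v, k) :: L).Nodup := List.nodup_cons.mpr ⟨he, hL⟩
        have hd' : ∀ e ∈ s(v, k) :: L, ¬ e.IsDiag := by
          intro e he'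
          rcases List.mem_cons.mp he' with rfl | he'
          · simpa using hk.symm
          · exact hd e he'
        split_ifs with hkj
        · have := h (s(v, k) :: L) hL' hd' (by simp; omega) c' hc'
          simp only [List.length_cons] at this
          exact this.trans (le_add_of_nonneg_left hpos)
        · rw [add_zero]
          exact ih (s(v, k) :: L) k hL' hd' (by simp; omega) hkj (hodd.signDiff hvj hk hkj) c' hc'
  have := key r [] i List.nodup_nil (by simp) (by simp) hij hF c hc
  simpa [signDiffs] using this

end Telescope


/-! ### Third-order bounds for reflection differences. -/

section ThirdOrder

/-- An odd part is linear up to third order. -/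
lemma norm_odd_part_sub_le {h h₁ h₂ h₃ : ℝ → ℂ} (d₁ : ∀ s, HasDerivAt h (h₁ s) s)
    (d₂ : ∀ s, HasDerivAt h₁ (h₂ s) s) (d₃ : ∀ s, HasDerivAt h₂ (h₃ s) s) {M y : ℝ}
    (hM : ∀ s, |s| ≤ |y| → ‖h₃ s‖ ≤ M) :
    ‖h y - h (-y) - (2 * y : ℝ) • h₁ 0‖ ≤ 2 * M * |y| ^ 3 := by
  have hM0 : 0 ≤ M := (norm_nonneg _).trans (hM 0 (by simp))
  set I := Set.Icc (-|y|) |y|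
  have hI : Convex ℝ I := convex_Icc _ _
  have h0 : (0 : ℝ) ∈ I := by simp [I]
  have hy : y ∈ I := ⟨neg_abs_le y, le_abs_self y⟩
  have hneg : ∀ {f f' : ℝ → ℂ}, (∀ s, HasDerivAt f (f' s) s) → ∀ s,
      HasDerivAt (fun s => f (-s)) (-f' (-s)) s := fun hf s => by
    exact ((hf (-s)).scomp s (hasDerivAt_neg s)).congr_deriv (by simp)
  have e₂ : ∀ s ∈ I, ‖h₂ s - h₂ (-s)‖ ≤ 2 * M * |y| := by
    intro s hs
    have hs' : -s ∈ I := ⟨by linarith [hs.2], by linarith [hs.1]⟩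
    have := hI.norm_image_sub_le_of_norm_hasDerivWithin_le (f := h₂)
      (fun x _ => (d₃ x).hasDerivWithinAt) (fun x hx => hM x (abs_le.mpr hx)) hs' hs
    refine this.trans ?_
    rw [show s - -s = 2 * s by ring, Real.norm_eq_abs, abs_mul, abs_two]
    nlinarith [abs_le.mpr hs]
  have e₁ : ∀ s ∈ I, ‖h₁ s + h₁ (-s) - (2 : ℝ) • h₁ 0‖ ≤ 2 * M * |y| * |y| := by
    intro s hs
    have := hI.norm_image_sub_le_of_norm_hasDerivWithin_le (f := fun s => h₁ s + h₁ (-s))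
      (f' := fun s => h₂ s - h₂ (-s)) (fun x _ => by
        exact (((d₂ x).fun_add (hneg d₂ x)).congr_deriv (sub_eq_add_neg _ _).symm).hasDerivWithinAt)
      e₂ h0 hs
    simp only [neg_zero, sub_zero] at this
    rw [two_smul]
    refine this.trans ?_
    have : ‖s‖ ≤ |y| := abs_le.mpr hs
    gcongr
  have := hI.norm_image_sub_le_of_norm_hasDerivWithin_le
    (f := fun s : ℝ => h s - h (-s) - s • ((2 : ℝ) • h₁ 0))
    (f' := fun s => h₁ s + h₁ (-s) - (2 : ℝ) • h₁ 0) (fun x _ => by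
        have := ((d₁ x).fun_sub (hneg d₁ x)).fun_sub
          ((hasDerivAt_id' x).smul_const ((2 : ℝ) • h₁ 0))
        exact (this.congr_deriv (by simp)).hasDerivWithinAt) e₁ h0 hy
  simp only [neg_zero, sub_self, zero_mul, zero_smul, sub_zero, smul_smul] at this
  rw [mul_comm 2 y]
  refine this.trans (le_of_eq ?_)
  rw [Real.norm_eq_abs]; ring

/-- The derivative at zero is eliminated between the expansions at `y` and at `τ`, so the linear
term involves only values of `h`. This keeps the difference operator free of derivatives. -/
lemma norm_odd_part_difference_le {h h₁ h₂ h₃ : ℝ → ℂ} (d₁ : ∀ s, HasDerivAt h (h₁ s) s)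
    (d₂ : ∀ s, HasDerivAt h₁ (h₂ s) s) (d₃ : ∀ s, HasDerivAt h₂ (h₃ s) s) {M y τ : ℝ} (hτ : 0 < τ)
    (hM : ∀ s, |s| ≤ |y| + τ → ‖h₃ s‖ ≤ M) :
    ‖h y - h (-y) - (y / τ : ℝ) • (h τ - h (-τ))‖ ≤ 2 * (|y| + τ) ^ 3 * M := by
  have hM0 : 0 ≤ M := (norm_nonneg _).trans (hM 0 (by simp; positivity))
  have a := norm_odd_part_sub_le d₁ d₂ d₃ (y := y) fun s hs => hM s (by linarith)
  have b := norm_odd_part_sub_le d₁ d₂ d₃ (y := τ) fun s hs => hM s (by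
    rw [abs_of_pos hτ] at hs; linarith [abs_nonneg y])
  rw [abs_of_pos hτ] at b
  have e : h y - h (-y) - (y / τ : ℝ) • (h τ - h (-τ)) = (h y - h (-y) - (2 * y : ℝ) • h₁ 0)
      - (y / τ : ℝ) • (h τ - h (-τ) - (2 * τ : ℝ) • h₁ 0) := by
    rw [smul_sub (y / τ) (h τ - h (-τ)), smul_smul, show y / τ * (2 * τ) = 2 * y by field_simp]
    abel
  rw [e]
  refine (norm_sub_le _ _).trans ?_
  rw [norm_smul, Real.norm_eq_abs, abs_div, abs_of_pos hτ]
  calc _ ≤ 2 * M * |y| ^ 3 + |y| / τ * (2 * M * τ ^ 3) := by gcongr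
    _ = 2 * (|y| ^ 3 + |y| * τ ^ 2) * M := by field_simp
    _ ≤ _ := by
        gcongr
        have := abs_nonneg y
        nlinarith [mul_nonneg this hτ.le, mul_nonneg (mul_nonneg this this) hτ.le, pow_pos hτ 3,
          mul_nonneg this (sq_nonneg τ)]

variable {ι : Type*} [DecidableEq ι] {τ : ℝ}

/-- The difference of `g` under a reflection of the coordinate `e`, up to a linear term. -/
noncomputable def cubicDiff (τ : ℝ) (e : ι) (g : (ι → ℝ) → ℂ) (x : ι → ℝ) : ℂ :=
  g x - g (Function.update x e (-x e))
    - (x e / τ : ℝ) • (g (Function.update x e τ) - g (Function.update x e (-τ)))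

/-- `g'` is the partial derivative of `g` in the coordinate `e`. -/
def IsPartial (e : ι) (g g' : (ι → ℝ) → ℂ) : Prop :=
  ∀ x s, HasDerivAt (fun s => g (Function.update x e s)) (g' (Function.update x e s)) s

lemma IsPartial.cubicDiff {e e' : ι} (h : e ≠ e') {g g' : (ι → ℝ) → ℂ} (hg : IsPartial e g g') :
    IsPartial e (cubicDiff τ e' g) (cubicDiff τ e' g') := by
  intro x s
  simp only [SparseWigner.cubicDiff, Function.update_of_ne h.symm]
  simp only [Function.update_comm h]
  exact ((hg x s).fun_sub (hg _ s)).fun_sub (((hg _ s).fun_sub (hg _ s)).fun_const_smul _)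

lemma IsPartial.cubicDiffs {e : ι} {L : List ι} (h : e ∉ L) {g g' : (ι → ℝ) → ℂ}
    (hg : IsPartial e g g') :
    IsPartial e (L.foldr (SparseWigner.cubicDiff τ) g) (L.foldr (SparseWigner.cubicDiff τ) g') := by
  induction L with
  | nil => exact hg
  | cons e' L ih =>
    rw [List.mem_cons, not_or] at h
    exact (ih h.2).cubicDiff h.1

/-- The points which agree with `x` off `L`, with controlled coordinates on `L`. -/
def Near (τ : ℝ) (L : List ι) (x x' : ι → ℝ) : Prop :=
  ∀ e, if e ∈ L then |x' e| ≤ |x e| + τ else x' e = x e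

/-- Iterated differences are bounded by third derivatives. -/
lemma exists_norm_cubicDiffs_le (hτ : 0 < τ) {𝒢 : ℕ → Set ((ι → ℝ) → ℂ)} {V : Set ι}
    (h𝒢 : ∀ d, ∀ g ∈ 𝒢 d, ∀ e ∈ V, ∃ g' ∈ 𝒢 (d + 1), IsPartial e g g') {L : List ι}
    (hL : L.Nodup) (hLV : ∀ e ∈ L, e ∈ V) {d : ℕ} {g : (ι → ℝ) → ℂ} (hg : g ∈ 𝒢 d) :
    ∃ G ∈ 𝒢 (d + 3 * L.length), ∀ (x : ι → ℝ) (M : ℝ), (∀ x', Near τ L x x' → ‖G x'‖ ≤ M) →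
      ‖L.foldr (cubicDiff τ) g x‖ ≤ (L.map fun e => 2 * (|x e| + τ) ^ 3).prod * M := by
  induction L generalizing d g with
  | nil =>
    refine ⟨g, by simpa using hg, fun x M hM => ?_⟩
    simpa using hM x fun e => by simp
  | cons e L ih =>
    rw [List.nodup_cons] at hL
    have heV := hLV e (by simp)
    obtain ⟨g₁, hg₁, d₁⟩ := h𝒢 d g hg e heV
    obtain ⟨g₂, hg₂, d₂⟩ := h𝒢 _ g₁ hg₁ e heV
    obtain ⟨g₃, hg₃, d₃⟩ := h𝒢 _ g₂ hg₂ e heV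
    -- Partial derivatives in `e` commute with the differences in the other coordinates, so the
    -- induction hypothesis may be applied to the third derivative.
    obtain ⟨G, hG, H⟩ := ih hL.2 (fun e' he' => hLV e' (List.mem_cons_of_mem _ he')) hg₃
    refine ⟨G, ?_, fun x M hM => ?_⟩
    · have : d + 1 + 1 + 1 + 3 * L.length = d + 3 * (e :: L).length := by
        rw [List.length_cons]; ring
      rwa [← this]
    set h := L.foldr (cubicDiff τ) g
    have e₁ := (IsPartial.cubicDiffs (τ := τ) hL.1 d₁) x
    have e₂ := (IsPartial.cubicDiffs (τ := τ) hL.1 d₂) x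
    have e₃ := (IsPartial.cubicDiffs (τ := τ) hL.1 d₃) x
    have key := norm_odd_part_difference_le e₁ e₂ e₃ (y := x e) hτ
      (M := (L.map fun e => 2 * (|x e| + τ) ^ 3).prod * M) ?_
    · rw [Function.update_eq_self] at key
      rw [List.foldr_cons, List.map_cons, List.prod_cons, mul_assoc]
      exact key
    · intro s hs
      have hprod : (L.map fun e' => 2 * (|Function.update x e s e'| + τ) ^ 3)
          = L.map fun e' => 2 * (|x e'| + τ) ^ 3 := by
        refine List.map_congr_left fun e' he' => ?_
        rw [Function.update_of_ne (ne_of_mem_of_not_mem he' hL.1)]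
      rw [← hprod]
      refine H _ M fun x' hx' => hM x' fun e' => ?_
      have h1 := hx' e'
      rcases eq_or_ne e' e with rfl | hne
      · rw [if_neg hL.1, Function.update_self] at h1
        simpa [h1] using hs
      · rw [Function.update_of_ne hne] at h1
        simpa [hne] using h1

end ThirdOrder


/-! ### Polynomial growth and integration of the differences. -/

section Growth

variable {ι : Type*} [Fintype ι] {τ : ℝ}

/-- Measurable functions of polynomial growth. -/
def PolyGrowth (g : (ι → ℝ) → ℂ) : Prop :=
  Measurable g ∧ ∃ (A : ℝ) (k : ℕ), 0 ≤ A ∧ ∀ x, ‖g x‖ ≤ A * (1 + ∑ e, |x e|) ^ k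

lemma PolyGrowth.sub {f g : (ι → ℝ) → ℂ} (hf : PolyGrowth f) (hg : PolyGrowth g) :
    PolyGrowth fun x => f x - g x := by
  obtain ⟨hm, A, k, hA, h⟩ := hf
  obtain ⟨hm', A', k', hA', h'⟩ := hg
  refine ⟨hm.sub hm', A + A', k + k', by positivity, fun x => ?_⟩
  have h2 : 1 ≤ 1 + ∑ e', |x e'| :=
    le_add_of_nonneg_right (Finset.sum_nonneg fun _ _ => abs_nonneg _)
  calc _ ≤ A * (1 + ∑ e, |x e|) ^ k + A' * (1 + ∑ e, |x e|) ^ k' :=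
        (norm_sub_le _ _).trans (add_le_add (h x) (h' x))
    _ ≤ A * (1 + ∑ e, |x e|) ^ (k + k') + A' * (1 + ∑ e, |x e|) ^ (k + k') := by
        gcongr <;> first | exact h2 | omega
    _ = _ := by ring

lemma PolyGrowth.coord_smul {g : (ι → ℝ) → ℂ} (hg : PolyGrowth g) (e : ι) (s : ℝ) :
    PolyGrowth fun x => (x e / s : ℝ) • g x := by
  obtain ⟨hm, A, k, hA, h⟩ := hg
  refine ⟨((measurable_pi_apply e).div_const s).smul hm, 1 / |s| * A, k + 1, by positivity,
    fun x => ?_⟩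
  have h2 : |x e| ≤ 1 + ∑ e', |x e'| := by
    have := Finset.single_le_sum (f := fun e' => |x e'|) (fun _ _ => abs_nonneg _)
      (Finset.mem_univ e)
    linarith
  rw [norm_smul, Real.norm_eq_abs, abs_div]
  calc _ ≤ (1 + ∑ e', |x e'|) / |s| * (A * (1 + ∑ e, |x e|) ^ k) := by
        gcongr
        exact h x
    _ = _ := by ring

lemma PolyGrowth.integrable {ν : ι → Measure ℝ} [∀ e, IsProbabilityMeasure (ν e)]
    (hν : ∀ e, HasMoments (fun y : ℝ => y) (ν e)) {g : (ι → ℝ) → ℂ} (hg : PolyGrowth g)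
    (c : ι → ℝ) : Integrable (fun x => g (c * x)) (Measure.pi ν) := by
  obtain ⟨hm, A, k, hA, h⟩ := hg
  have h1 : ∀ e, HasMoments (fun x : ι → ℝ => |c e * x e|) (Measure.pi ν) := fun e => by
    have h2 : HasMoments (fun x : ι → ℝ => x e) (Measure.pi ν) := fun p =>
      (hν e p).comp_measurePreserving (measurePreserving_eval ν e)
    exact fun p => (h2.const_mul (c e) p).norm
  have h2 := ((((HasMoments.const 1).add (HasMoments.sum Finset.univ fun e _ => h1 e)).pow
    k).const_mul A).integrable
  exact h2.mono' (hm.comp (by fun_prop)).aestronglyMeasurable (ae_of_all _ fun x => h (c * x))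

variable [DecidableEq ι]

lemma sum_abs_update_le (x : ι → ℝ) (e : ι) (s : ℝ) :
    ∑ e', |Function.update x e s e'| ≤ (∑ e', |x e'|) + |s| := by
  calc _ ≤ ∑ e', (|x e'| + if e' = e then |s| else 0) := by
        refine Finset.sum_le_sum fun e' _ => ?_
        rcases eq_or_ne e' e with rfl | h
        · simp
        · simp [h]
    _ = _ := by rw [Finset.sum_add_distrib]; simp

lemma PolyGrowth.update {g : (ι → ℝ) → ℂ} (hg : PolyGrowth g) (e : ι) (s : ℝ) :
    PolyGrowth fun x => g (Function.update x e s) := by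
  obtain ⟨hm, A, k, hA, h⟩ := hg
  refine ⟨hm.comp (by fun_prop), A * (1 + |s|) ^ k, k, by positivity, fun x => (h _).trans ?_⟩
  rw [mul_assoc, ← mul_pow]
  have h1 := sum_abs_update_le x e s
  have h2 : 0 ≤ ∑ e', |x e'| := Finset.sum_nonneg fun _ _ => abs_nonneg _
  gcongr
  nlinarith [abs_nonneg s]

lemma PolyGrowth.reflect {g : (ι → ℝ) → ℂ} (hg : PolyGrowth g) (e : ι) :
    PolyGrowth fun x => g (Function.update x e (-x e)) := by
  obtain ⟨hm, A, k, hA, h⟩ := hg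
  refine ⟨hm.comp (by fun_prop), A, k, hA, fun x => (h _).trans (le_of_eq ?_)⟩
  congr 3
  refine Finset.sum_congr rfl fun e' _ => ?_
  rcases eq_or_ne e' e with rfl | h
  · simp
  · simp [h]

lemma PolyGrowth.cubicDiff {g : (ι → ℝ) → ℂ} (hg : PolyGrowth g) (e : ι) :
    PolyGrowth (cubicDiff τ e g) :=
  (hg.sub (hg.reflect e)).sub (((hg.update e τ).sub (hg.update e (-τ))).coord_smul e τ)

lemma PolyGrowth.cubicDiffs {g : (ι → ℝ) → ℂ} (hg : PolyGrowth g) (L : List ι) :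
    PolyGrowth (L.foldr (SparseWigner.cubicDiff τ) g) := by
  induction L with
  | nil => exact hg
  | cons e L ih => exact ih.cubicDiff e

/-- The linear term does not contribute to the expectation. -/
lemma integral_cubicDiff {ν : ι → Measure ℝ} [∀ e, IsProbabilityMeasure (ν e)]
    (hν : ∀ e, HasMoments (fun y : ℝ => y) (ν e)) (hmean : ∀ e, ∫ y, y ∂(ν e) = 0)
    {g : (ι → ℝ) → ℂ} (hg : PolyGrowth g) (c : ι → ℝ) (e : ι) :
    ∫ x, cubicDiff τ e g (c * x) ∂(Measure.pi ν) =
      ∫ x, g (c * x) ∂(Measure.pi ν)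
        - ∫ x, g (Function.update (c * x) e (-(c * x) e)) ∂(Measure.pi ν) := by
  have hlin := ((hg.update e τ).sub (hg.update e (-τ))).coord_smul e τ
  have i1 := hg.integrable hν c
  have i2 := (hg.reflect e).integrable hν c
  have i3 := hlin.integrable hν c
  simp only [cubicDiff]
  have i12 : Integrable (fun x => g (c * x) - g (Function.update (c * x) e (-(c * x) e)))
    (Measure.pi ν) := i1.sub i2
  rw [integral_sub i12 i3, integral_sub i1 i2, sub_eq_self]
  -- The coefficient of the linear term does not depend on the coordinate `e`; integrating that
  -- coordinate first, which is centred, gives zero.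
  rw [integral_resample ν {e} i3]
  have hzero : ∫ x', (x' e : ℝ) ∂(Measure.pi ν) = 0 := by
    have hmp := measurePreserving_eval ν e
    rw [← hmean e, ← hmp.map_eq, integral_map hmp.measurable.aemeasurable
      (f := fun y : ℝ => y) aestronglyMeasurable_id]
  refine (integral_congr_ae (ae_of_all _ fun x => ?_)).trans (integral_zero _ _)
  have hup : ∀ x' s, Function.update (c * ({e} : Finset ι).piecewise x' x) e s
      = Function.update (c * x) e s := by
    intro x' s
    funext e'
    rcases eq_or_ne e' e with rfl | h
    · simp
    · simp [h]
  simp only [hup, Pi.mul_apply, Finset.mem_singleton, Finset.piecewise_eq_of_mem]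
  rw [integral_smul_const]
  have : ∫ x', c e * x' e / τ ∂(Measure.pi ν) = 0 := by
    simp only [mul_div_assoc]
    rw [integral_const_mul, integral_div, hzero]; simp
  rw [this, zero_smul]

end Growth

/-! ### Sign differences of expectations as expectations of reflection differences. -/

section SignDiffs

variable {n : ℕ} {τ : ℝ}

/-- The signs `c`, replaced by `1` on `L`. -/
def setOne (L : List (Sym2 (Fin n))) (c : Sym2 (Fin n) → ℝ) (e : Sym2 (Fin n)) : ℝ :=
  if e ∈ L then 1 else c e

/-- Changing the sign of the edge `e` from `1` to `-1` reflects the coordinate `e`. The linear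
correction can be subtracted freely because it has mean zero. -/
lemma signDiffs_integral {ν : Sym2 (Fin n) → Measure ℝ} [∀ e, IsProbabilityMeasure (ν e)]
    (hν : ∀ e, HasMoments (fun y : ℝ => y) (ν e)) (hmean : ∀ e, ∫ y, y ∂(ν e) = 0)
    {g : (Sym2 (Fin n) → ℝ) → ℂ} (hg : PolyGrowth g) {L : List (Sym2 (Fin n))} (hL : L.Nodup)
    (c : Sym2 (Fin n) → ℝ) :
    signDiffs (fun c => ∫ x, g (c * x) ∂(Measure.pi ν)) L c =
      ∫ x, L.foldr (cubicDiff τ) g (setOne L c * x) ∂(Measure.pi ν) := by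
  induction L generalizing c with
  | nil =>
    have : setOne [] c = c := by funext e; simp [setOne]
    simp [signDiffs, this]
  | cons e L ih =>
    rw [List.nodup_cons] at hL
    have h1 := ih hL.2 (Function.update c e 1)
    have h2 := ih hL.2 (Function.update c e (-1))
    have e1 : setOne L (Function.update c e 1) = setOne (e :: L) c := by
      funext e'
      rcases eq_or_ne e' e with rfl | h
      · simp [setOne]
      · simp [setOne, h]
    have e2 : ∀ x, setOne L (Function.update c e (-1)) * x = Function.update (setOne (e :: L) c * x)
        e (-(setOne (e :: L) c * x) e) := by
      intro x
      funext e'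
      rcases eq_or_ne e' e with rfl | h
      · simp [setOne, hL.1]
      · simp [setOne, h]
    rw [e1] at h1
    simp only [e2] at h2
    rw [List.foldr_cons, integral_cubicDiff hν hmean (hg.cubicDiffs L), ← h1, ← h2]
    rfl

end SignDiffs


/-! ### Derivatives of resolvent entries and perturbation of finitely many entries. -/

section ResolventCalculus

variable {n : ℕ} {z : ℂ}

/-- The symmetric matrix with entries `x_{ij}`. -/
def symMatrix (x : Sym2 (Fin n) → ℝ) : Matrix (Fin n) (Fin n) ℝ := Matrix.of fun i j => x s(i, j)

lemma symMatrix_apply (x : Sym2 (Fin n) → ℝ) (i j : Fin n) : symMatrix x i j = x s(i, j) := rfl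

lemma symMatrix_isSymm (x : Sym2 (Fin n) → ℝ) : (symMatrix x).IsSymm := by
  ext i j
  simp [symMatrix, Sym2.eq_swap]

lemma masked_eq_symMatrix (c x : Sym2 (Fin n) → ℝ) : masked c x = symMatrix (c * x) := rfl

/-- The product `A E B`, with `E` the symmetric matrix which is `1` in position `e`. -/
def edgeProd (e : Sym2 (Fin n)) (A B : Matrix (Fin n) (Fin n) ℂ) (p q : Fin n) : ℂ :=
  ∑ a, ∑ b, if s(a, b) = e then A p a * B b q else 0

lemma edgeProd_mk {α β : Fin n} (h : α ≠ β) (A B : Matrix (Fin n) (Fin n) ℂ) (p q : Fin n) :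
    edgeProd s(α, β) A B p q = A p α * B β q + A p β * B α q := by
  have key : ∀ a b, (if s(a, b) = s(α, β) then A p a * B b q else 0) =
      (if a = α then if b = β then A p α * B β q else 0 else 0)
      + (if a = β then if b = α then A p β * B α q else 0 else 0) := by
    intro a b
    by_cases h1 : a = α
    · subst h1
      by_cases h2 : b = β
      · subst h2; simp [h]
      · simp [h, h2]
    · by_cases h2 : a = β
      · subst h2
        by_cases h3 : b = α
        · subst h3; simp [h1, Sym2.eq_swap]
        · simp [h1, h3]
      · simp [h1, h2]
  simp only [edgeProd, key, Finset.sum_add_distrib]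
  simp

lemma resolvent_eq_add_edges (hz : 0 < z.im) {x x' : Sym2 (Fin n) → ℝ} {L : List (Sym2 (Fin n))}
    (h : ∀ e ∉ L, x' e = x e) (p q : Fin n) :
    resolventMatrix z (symMatrix x') p q = resolventMatrix z (symMatrix x) p q +
      ∑ e ∈ L.toFinset, ((x' e - x e : ℝ) : ℂ) *
        edgeProd e (resolventMatrix z (symMatrix x)) (resolventMatrix z (symMatrix x')) p q := by
  have h1 := congrFun (congrFun (resolvent_sub_resolvent (symMatrix_isSymm x)
    (symMatrix_isSymm x') hz) p) q
  set R := resolventMatrix z (symMatrix x)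
  set R' := resolventMatrix z (symMatrix x')
  have h2 : ∑ e ∈ L.toFinset, ((x' e - x e : ℝ) : ℂ) * edgeProd e R R' p q
      = ∑ a, ∑ b, R p a * ((x' s(a, b) - x s(a, b) : ℝ) : ℂ) * R' b q := by
    simp only [edgeProd, Finset.mul_sum]
    rw [Finset.sum_comm]
    refine Finset.sum_congr rfl fun a _ => ?_
    rw [Finset.sum_comm]
    refine Finset.sum_congr rfl fun b _ => ?_
    simp only [mul_ite, mul_zero, Finset.sum_ite_eq, List.mem_toFinset]
    split_ifs with hab
    · ring
    · rw [h _ hab]; simp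
  rw [h2]
  simp only [Matrix.sub_apply, Matrix.mul_apply, Matrix.map_apply, Finset.sum_mul] at h1
  rw [Finset.sum_comm] at h1
  have h3 : ∑ a, ∑ b, R p a * ((x' s(a, b) - x s(a, b) : ℝ) : ℂ) * R' b q = - (R p q - R' p q) := by
    rw [h1, ← Finset.sum_neg_distrib]
    refine Finset.sum_congr rfl fun a _ => ?_
    rw [← Finset.sum_neg_distrib]
    refine Finset.sum_congr rfl fun b _ => ?_
    simp only [symMatrix_apply]
    push_cast
    ring
  rw [h3]
  ring

lemma continuous_resolvent_symMatrix (hz : 0 < z.im) (p q : Fin n) :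
    Continuous fun x : Sym2 (Fin n) → ℝ => resolventMatrix z (symMatrix x) p q := by
  have hc : Continuous fun x : Sym2 (Fin n) → ℝ => shifted z (symMatrix x) := by
    refine continuous_pi fun i => continuous_pi fun j => ?_
    simp only [shifted_apply, symMatrix_apply]
    fun_prop
  have : (fun x => resolventMatrix z (symMatrix x) p q)
      = fun x => (shifted z (symMatrix x)).det⁻¹ * (shifted z (symMatrix x)).adjugate p q := by
    funext x
    rw [resolventMatrix_eq, Matrix.inv_def]
    simp
  rw [this]
  exact ((Continuous.matrix_det hc).inv₀
    fun x => (isUnit_det_shifted (symMatrix_isSymm x) hz).ne_zero).mul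
    ((Continuous.matrix_adjugate hc).matrix_elem p q)

/-- The resolvent identity computes the difference quotient exactly, and continuity of the resolvent
gives its limit. -/
lemma hasDerivAt_resolvent (hz : 0 < z.im) {α β : Fin n} (h : α ≠ β) (x : Sym2 (Fin n) → ℝ)
    (s : ℝ) (p q : Fin n) :
    HasDerivAt (fun s => resolventMatrix z (symMatrix (Function.update x s(α, β) s)) p q)
      (resolventMatrix z (symMatrix (Function.update x s(α, β) s)) p α *
        resolventMatrix z (symMatrix (Function.update x s(α, β) s)) β q +
      resolventMatrix z (symMatrix (Function.update x s(α, β) s)) p β *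
        resolventMatrix z (symMatrix (Function.update x s(α, β) s)) α q) s := by
  set R := fun s => resolventMatrix z (symMatrix (Function.update x s(α, β) s)) with hR
  have hcont : ∀ p q, Continuous fun s => R s p q := fun p q =>
    (continuous_resolvent_symMatrix hz p q).comp (by fun_prop)
  rw [hasDerivAt_iff_tendsto_slope]
  have hlim : Tendsto (fun s' => R s p α * R s' β q + R s p β * R s' α q) (𝓝[≠] s)
      (𝓝 (R s p α * R s β q + R s p β * R s α q)) := by
    have : Continuous fun s' => R s p α * R s' β q + R s p β * R s' α q := by
      have := hcont β q; have := hcont α q; fun_prop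
    exact (this.tendsto s).mono_left nhdsWithin_le_nhds
  refine hlim.congr' ?_
  filter_upwards [self_mem_nhdsWithin] with s' hs'
  have hne : s' - s ≠ 0 := sub_ne_zero.mpr hs'
  have h1 := resolvent_eq_add_edges hz (x := Function.update x s(α, β) s)
    (x' := Function.update x s(α, β) s') (L := [s(α, β)])
    (fun e he => by
      have : e ≠ s(α, β) := by simpa using he
      simp [this]) p q
  simp only [List.toFinset_cons, List.toFinset_nil, insert_empty_eq, Finset.sum_singleton,
    Function.update_self, edgeProd_mk h] at h1
  rw [slope, vsub_eq_sub, show (fun s => resolventMatrix z (symMatrix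
    (Function.update x s(α, β) s)) p q) s' - (fun s => resolventMatrix z (symMatrix
    (Function.update x s(α, β) s)) p q) s = ((s' - s : ℝ) : ℂ) *
      (R s p α * R s' β q + R s p β * R s' α q) by simp only [hR]; rw [h1]; ring]
  rw [← Complex.real_smul, smul_smul, inv_mul_cancel₀ hne, one_smul]

/-- The value of a monomial in the entries of a matrix. -/
def evalMono (R : Matrix (Fin n) (Fin n) ℂ) (l : List (Fin n × Fin n)) : ℂ :=
  (l.map fun a => R a.1 a.2).prod

/-- The value of a sum of monomials in the entries of a matrix. -/
def evalPoly (R : Matrix (Fin n) (Fin n) ℂ) (P : List (List (Fin n × Fin n))) : ℂ :=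
  (P.map (evalMono R)).sum

/-- The derivative of a monomial in the resolvent entries with respect to an entry of the matrix. -/
def derivMono (α β : Fin n) : List (Fin n × Fin n) → List (List (Fin n × Fin n))
  | [] => []
  | (p, q) :: l => ((p, α) :: (β, q) :: l) :: ((p, β) :: (α, q) :: l) ::
      (derivMono α β l).map fun l' => (p, q) :: l'

lemma length_derivMono (α β : Fin n) (l : List (Fin n × Fin n)) :
    (derivMono α β l).length = 2 * l.length := by
  induction l with
  | nil => rfl
  | cons a l ih => simp [derivMono, ih]; ring

lemma mem_derivMono {V : Finset (Fin n)} {α β : Fin n} (hα : α ∈ V) (hβ : β ∈ V)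
    {l : List (Fin n × Fin n)} (hl : ∀ a ∈ l, a.1 ∈ V ∧ a.2 ∈ V) :
    ∀ l' ∈ derivMono α β l, l'.length = l.length + 1 ∧ ∀ a ∈ l', a.1 ∈ V ∧ a.2 ∈ V := by
  induction l with
  | nil => simp [derivMono]
  | cons a l ih =>
    obtain ⟨p, q⟩ := a
    have hpq := hl (p, q) (by simp)
    have ih' := ih fun a ha => hl a (List.mem_cons_of_mem _ ha)
    intro l' hl'
    simp only [derivMono, List.mem_cons, List.mem_map] at hl'
    rcases hl' with rfl | rfl | ⟨l'', hl'', rfl⟩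
    · refine ⟨by simp, fun a ha => ?_⟩
      simp only [List.mem_cons] at ha
      rcases ha with rfl | rfl | ha
      · exact ⟨hpq.1, hα⟩
      · exact ⟨hβ, hpq.2⟩
      · exact hl a (List.mem_cons_of_mem _ ha)
    · refine ⟨by simp, fun a ha => ?_⟩
      simp only [List.mem_cons] at ha
      rcases ha with rfl | rfl | ha
      · exact ⟨hpq.1, hβ⟩
      · exact ⟨hα, hpq.2⟩
      · exact hl a (List.mem_cons_of_mem _ ha)
    · refine ⟨by simp [(ih' l'' hl'').1], fun a ha => ?_⟩
      rcases List.mem_cons.mp ha with rfl | ha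
      · exact hpq
      · exact (ih' l'' hl'').2 a ha

lemma evalPoly_map_cons (R : Matrix (Fin n) (Fin n) ℂ) (a : Fin n × Fin n)
    (P : List (List (Fin n × Fin n))) :
    evalPoly R (P.map fun l => a :: l) = R a.1 a.2 * evalPoly R P := by
  induction P with
  | nil => simp [evalPoly]
  | cons l P ih =>
    simp only [evalPoly, List.map_cons, List.sum_cons, mul_add] at ih ⊢
    rw [ih]
    simp [evalMono]

lemma hasDerivAt_evalMono (hz : 0 < z.im) {α β : Fin n} (h : α ≠ β) (x : Sym2 (Fin n) → ℝ)
    (s : ℝ) (l : List (Fin n × Fin n)) :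
    HasDerivAt (fun s => evalMono (resolventMatrix z (symMatrix (Function.update x s(α, β) s))) l)
      (evalPoly (resolventMatrix z (symMatrix (Function.update x s(α, β) s))) (derivMono α β l))
      s := by
  induction l with
  | nil => simpa [evalMono, derivMono, evalPoly] using hasDerivAt_const s (1 : ℂ)
  | cons a l ih =>
    obtain ⟨p, q⟩ := a
    have h1 := (hasDerivAt_resolvent hz h x s p q).fun_mul ih
    refine HasDerivAt.congr_deriv (f := fun s => evalMono (resolventMatrix z (symMatrix
      (Function.update x s(α, β) s))) ((p, q) :: l)) (by simpa [evalMono] using h1) ?_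
    have h2 := evalPoly_map_cons (resolventMatrix z (symMatrix (Function.update x s(α, β) s)))
      (p, q) (derivMono α β l)
    simp only [evalPoly, derivMono, List.map_cons, List.sum_cons] at h2 ⊢
    rw [h2]
    simp only [evalMono, List.map_cons, List.prod_cons]
    ring

lemma hasDerivAt_evalPoly (hz : 0 < z.im) {α β : Fin n} (h : α ≠ β) (x : Sym2 (Fin n) → ℝ)
    (s : ℝ) (P : List (List (Fin n × Fin n))) :
    HasDerivAt (fun s => evalPoly (resolventMatrix z (symMatrix (Function.update x s(α, β) s))) P)
      (evalPoly (resolventMatrix z (symMatrix (Function.update x s(α, β) s)))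
        (P.flatMap (derivMono α β))) s := by
  induction P with
  | nil => simpa [evalPoly] using hasDerivAt_const s (0 : ℂ)
  | cons l P ih =>
    have h1 := (hasDerivAt_evalMono hz h x s l).fun_add ih
    simpa [evalPoly] using h1

/-- The sums of `2 ^ d d!` monomials of degree `d + 1` in the resolvent entries with indices
in `V`. -/
def resolventPolys (z : ℂ) (V : Finset (Fin n)) (d : ℕ) : Set ((Sym2 (Fin n) → ℝ) → ℂ) :=
  {g | ∃ P : List (List (Fin n × Fin n)), P.length = 2 ^ d * d.factorial ∧
    (∀ l ∈ P, l.length = d + 1 ∧ ∀ a ∈ l, a.1 ∈ V ∧ a.2 ∈ V) ∧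
    g = fun x => evalPoly (resolventMatrix z (symMatrix x)) P}

lemma exists_isPartial_resolventPolys (hz : 0 < z.im) {V : Finset (Fin n)} (d : ℕ)
    {g : (Sym2 (Fin n) → ℝ) → ℂ} (hg : g ∈ resolventPolys z V d) {e : Sym2 (Fin n)}
    (he : ¬ e.IsDiag) (heV : ∀ a ∈ e, a ∈ V) :
    ∃ g' ∈ resolventPolys z V (d + 1), IsPartial e g g' := by
  obtain ⟨P, hlen, hP, rfl⟩ := hg
  induction e using Sym2.ind with
  | _ α β =>
    have h : α ≠ β := by simpa using he
    have hα := heV α (by simp)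
    have hβ := heV β (by simp)
    refine ⟨_, ⟨P.flatMap (derivMono α β), ?_, ?_, rfl⟩, fun x s => hasDerivAt_evalPoly hz h x s P⟩
    · rw [List.length_flatMap]
      have : P.map (fun l => (derivMono α β l).length) = P.map fun _ => 2 * (d + 1) :=
        List.map_congr_left fun l hl => by rw [length_derivMono, (hP l hl).1]
      rw [this, List.map_const', List.sum_replicate, hlen, smul_eq_mul, Nat.factorial_succ]
      ring
    · intro l' hl'
      obtain ⟨l, hl, hl'⟩ := List.mem_flatMap.mp hl'
      have := mem_derivMono hα hβ (hP l hl).2 l' hl'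
      rwa [(hP l hl).1] at this

lemma resolvent_mem_resolventPolys (z : ℂ) {V : Finset (Fin n)} {i j : Fin n} (hi : i ∈ V)
    (hj : j ∈ V) : (fun x => resolventMatrix z (symMatrix x) i j) ∈ resolventPolys z V 0 :=
  ⟨[[(i, j)]], by simp, by simp [hi, hj], by simp [evalPoly, evalMono]⟩

lemma norm_resolventPoly_le {V : Finset (Fin n)} {d : ℕ} {g : (Sym2 (Fin n) → ℝ) → ℂ}
    (hg : g ∈ resolventPolys z V d) {x : Sym2 (Fin n) → ℝ} {ρ : ℝ}
    (hρ : ∀ a ∈ V, ∀ b ∈ V, ‖resolventMatrix z (symMatrix x) a b‖ ≤ ρ) :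
    ‖g x‖ ≤ 2 ^ d * d.factorial * ρ ^ (d + 1) := by
  obtain ⟨P, hlen, hP, rfl⟩ := hg
  have hmono : ∀ l : List (Fin n × Fin n), (∀ a ∈ l, a.1 ∈ V ∧ a.2 ∈ V) →
      ‖evalMono (resolventMatrix z (symMatrix x)) l‖ ≤ ρ ^ l.length := by
    intro l
    induction l with
    | nil => simp [evalMono]
    | cons a l ih =>
      intro hl
      have h1 := ih fun a ha => hl a (List.mem_cons_of_mem _ ha)
      have h2 := hl a (by simp)
      have h3 := hρ _ h2.1 _ h2.2
      simp only [evalMono, List.map_cons, List.prod_cons, norm_mul, List.length_cons] at h1 ⊢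
      rw [pow_succ, mul_comm (ρ ^ _)]
      exact mul_le_mul h3 h1 (norm_nonneg _) ((norm_nonneg _).trans h3)
  have hsum : ∀ Q : List (List (Fin n × Fin n)), (∀ l ∈ Q, l ∈ P) →
      ‖evalPoly (resolventMatrix z (symMatrix x)) Q‖ ≤ Q.length * ρ ^ (d + 1) := by
    intro Q
    induction Q with
    | nil => simp [evalPoly]
    | cons l Q ih =>
      intro hQ
      have h1 := ih fun l hl => hQ l (List.mem_cons_of_mem _ hl)
      have h2 := hP l (hQ l (by simp))
      have h3 := hmono l h2.2
      rw [h2.1] at h3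
      simp only [evalPoly, List.map_cons, List.sum_cons, List.length_cons] at h1 ⊢
      refine (norm_add_le _ _).trans ?_
      push_cast
      linarith
  have := hsum P fun l hl => hl
  rw [hlen] at this
  push_cast at this
  exact this

/-- A bound on the resolvent near a matrix with the entries in `L` switched off. -/
lemma norm_resolvent_near_le (hz : 0 < z.im) {τ : ℝ} {x x' x₀ : Sym2 (Fin n) → ℝ}
    {L : List (Sym2 (Fin n))} (hd : ∀ e ∈ L, ¬ e.IsDiag) {V : Finset (Fin n)}
    (hV : ∀ e ∈ L, ∀ a ∈ e, a ∈ V) (h₀ : ∀ e, x₀ e = if e ∈ L then 0 else x e)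
    (hx' : Near τ L x x') {Γ : ℝ}
    (hΓ : ∀ a ∈ V, ∀ b ∈ V, ‖resolventMatrix z (symMatrix x₀) a b‖ ≤ Γ) (hΓ0 : 0 ≤ Γ) (N : ℕ)
    {a b : Fin n} (ha : a ∈ V) (hb : b ∈ V) :
    ‖resolventMatrix z (symMatrix x') a b‖ ≤
      2 * Γ + (4 * Γ * ∑ e ∈ L.toFinset, (|x e| + τ)) ^ N / z.im := by
  set R' := resolventMatrix z (symMatrix x')
  set β := ∑ e ∈ L.toFinset, (|x e| + τ)
  -- The largest entry `ρ` on the block satisfies `ρ ≤ Γ + 2 Γ β ρ`, because the resolvent identity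
  -- along edges inside `V` involves only entries of the block.
  obtain ⟨⟨a', b'⟩, hab, hmax⟩ := Finset.exists_max_image (V ×ˢ V) (fun q => ‖R' q.1 q.2‖)
    ⟨(a, b), Finset.mem_product.mpr ⟨ha, hb⟩⟩
  rw [Finset.mem_product] at hab
  have hmax' : ∀ a ∈ V, ∀ b ∈ V, ‖R' a b‖ ≤ ‖R' a' b'‖ := fun a ha b hb =>
    hmax (a, b) (Finset.mem_product.mpr ⟨ha, hb⟩)
  refine (hmax' a ha b hb).trans ?_
  set ρ := ‖R' a' b'‖
  have hρ : 0 ≤ ρ := norm_nonneg _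
  have hx₀ : ∀ e ∉ L, x' e = x₀ e := fun e he => by
    have := hx' e
    rw [if_neg he] at this
    rw [this, h₀, if_neg he]
  have hτ : ∀ e ∈ L, |x' e| ≤ |x e| + τ := fun e he => by
    have := hx' e
    rwa [if_pos he] at this
  have hβ0 : 0 ≤ β := Finset.sum_nonneg fun e he =>
    (abs_nonneg _).trans (hτ e (List.mem_toFinset.mp he))
  have hself : ρ ≤ Γ + β * (2 * Γ * ρ) := by
    have e1 : R' a' b' = _ := resolvent_eq_add_edges hz hx₀ a' b'
    calc ρ = ‖_‖ := congrArg norm e1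
      _ ≤ Γ + ∑ e ∈ L.toFinset, (|x e| + τ) * (2 * Γ * ρ) := by
          refine (norm_add_le _ _).trans (add_le_add (hΓ _ hab.1 _ hab.2)
            ((norm_sum_le _ _).trans (Finset.sum_le_sum fun e he => ?_)))
          have he' := List.mem_toFinset.mp he
          rw [norm_mul, Complex.norm_real, h₀, if_pos he', sub_zero, Real.norm_eq_abs]
          refine mul_le_mul (hτ e he') ?_ (norm_nonneg _) ((abs_nonneg _).trans (hτ e he'))
          have hVe := hV e he'
          have hde := hd e he'
          clear he he'
          induction e using Sym2.ind with
          | _ α β =>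
            have h : α ≠ β := by simpa using hde
            have hα := hVe α (by simp)
            have hβ := hVe β (by simp)
            rw [edgeProd_mk h]
            refine (norm_add_le _ _).trans ?_
            rw [norm_mul, norm_mul]
            have h1 := mul_le_mul (hΓ a' hab.1 α hα) (hmax' β hβ b' hab.2) (norm_nonneg _) hΓ0
            have h2 := mul_le_mul (hΓ a' hab.1 β hβ) (hmax' α hα b' hab.2) (norm_nonneg _) hΓ0
            linarith
      _ = _ := by rw [← Finset.sum_mul]
  -- For a small perturbation the self-bound gives `ρ ≤ 2 Γ`. Otherwise the trivial bound `1 / Im z`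
  -- is multiplied by a quantity at least `1`, whose power `N` will later compensate the small `Im
  -- z`.
  by_cases hsmall : 4 * Γ * β ≤ 1
  · have : 0 ≤ (4 * Γ * β) ^ N / z.im := by positivity
    nlinarith
  · have h1 : 1 ≤ (4 * Γ * β) ^ N := one_le_pow₀ (not_le.mp hsmall).le
    have h2 : ρ ≤ 1 / z.im := norm_resolvent_le (symMatrix_isSymm x') hz a' b'
    have h3 : 1 / z.im ≤ (4 * Γ * β) ^ N / z.im := by gcongr
    linarith

end ResolventCalculus


/-! ### Sign flips as conjugation of the matrix. -/

section Parity

variable {n : ℕ} {z : ℂ}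

/-- With `D` the diagonal matrix of the `d a`, one has `W' = D W D` and `D² = 1`, so the resolvents
are conjugate as well. -/
lemma resolvent_conj_signs {W W' : Matrix (Fin n) (Fin n) ℝ} (hW : W.IsSymm) (hz : 0 < z.im)
    {d : Fin n → ℝ} (hd : ∀ a, d a * d a = 1) (h : ∀ a b, W' a b = d a * d b * W a b)
    (i j : Fin n) : resolventMatrix z W' i j = d i * d j * resolventMatrix z W i j := by
  have hd' : ∀ a, (d a : ℂ) * d a = 1 := fun a => by exact_mod_cast hd a
  have hs : ∀ a b, shifted z W' a b = d a * d b * shifted z W a b := by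
    intro a b
    rw [shifted_apply, shifted_apply, h]
    split_ifs with hab
    · subst hab
      push_cast
      linear_combination (-z) * hd' a
    · push_cast; ring
  have hmul : shifted z W' * Matrix.of (fun a b => (d a * d b * resolventMatrix z W a b : ℂ)) = 1 := by
    ext a b
    have h1 := congrFun (congrFun (shifted_mul_resolvent hW hz) a) b
    rw [Matrix.mul_apply] at h1 ⊢
    calc _ = d a * d b * ∑ k, shifted z W a k * resolventMatrix z W k b := by
          rw [Finset.mul_sum]
          refine Finset.sum_congr rfl fun k _ => ?_
          rw [hs, Matrix.of_apply]
          linear_combination (d a * d b * shifted z W a k * resolventMatrix z W k b) * hd' k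
      _ = _ := by
          rw [h1, Matrix.one_apply]
          split_ifs with hab
          · subst hab; rw [hd', one_mul]
          · rw [mul_zero]
  rw [resolventMatrix_eq, Matrix.inv_eq_right_inv hmul, Matrix.of_apply]

/-- The flips act on the deterministic signs, so the parity is exact pointwise and no symmetry of
the laws is required. -/
lemma oddAt_integral_resolvent (hz : 0 < z.im) (ν : Sym2 (Fin n) → Measure ℝ) {i j : Fin n}
    (hij : i ≠ j) :
    OddAt i j fun c => ∫ x, resolventMatrix z (symMatrix (c * x)) i j ∂(Measure.pi ν) := by
  intro c _ u
  simp only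
  rw [← integral_const_mul]
  refine integral_congr_ae (ae_of_all _ fun x => ?_)
  simp only
  rw [resolvent_conj_signs (symMatrix_isSymm (c * x)) hz (d := fun a => if a = u then -1 else 1)
    (fun a => by split_ifs <;> norm_num) (fun a b => ?_)]
  · congr 1
    by_cases h1 : i = u
    · subst h1; simp [hij.symm]
    · by_cases h2 : j = u
      · subst h2; simp [h1]
      · simp [h1, h2, eq_comm (a := u)]
  · simp only [symMatrix_apply, Pi.mul_apply, flipRow, Sym2.mem_iff, Sym2.mk_isDiag_iff]
    by_cases h1 : a = u
    · subst h1
      by_cases h2 : b = a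
      · subst h2; simp
      · simp [h2, eq_comm (a := a)]
    · by_cases h2 : b = u
      · subst h2; simp [h1]
      · simp [h1, h2, eq_comm (a := u)]

end Parity

/-! ### Factorisation over disjoint sets of coordinates. -/

section Factor

variable {ι : Type*} [Fintype ι] {ν : ι → Measure ℝ} [∀ e, IsProbabilityMeasure (ν e)]

lemma integral_mul_of_piecewise [DecidableEq ι] (A : Finset ι) {φ ψ : (ι → ℝ) → ℝ}
    (hφ : ∀ x x', φ (A.piecewise x' x) = φ x') (hψ : ∀ x x', ψ (A.piecewise x' x) = ψ x)
    (h : Integrable (fun x => φ x * ψ x) (Measure.pi ν)) :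
    ∫ x, φ x * ψ x ∂(Measure.pi ν) = (∫ x, φ x ∂(Measure.pi ν)) * ∫ x, ψ x ∂(Measure.pi ν) := by
  rw [integral_resample ν A h]
  simp only [hφ, hψ, integral_mul_const, integral_const_mul]

lemma integral_prod_eval [DecidableEq ι] (A : Finset ι) (f : ι → ℝ → ℝ) :
    ∫ x, ∏ e ∈ A, f e (x e) ∂(Measure.pi ν) = ∏ e ∈ A, ∫ y, f e y ∂(ν e) := by
  have h := integral_fintype_prod_eq_prod (μ := ν) (fun e y => if e ∈ A then f e y else (1 : ℝ))
  have h1 : ∀ e, ∫ y, (if e ∈ A then f e y else (1 : ℝ)) ∂(ν e)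
      = if e ∈ A then ∫ y, f e y ∂(ν e) else 1 := by
    intro e
    split_ifs <;> simp
  simp only [h1, Finset.prod_ite_mem, Finset.univ_inter] at h
  exact h

lemma HasMoments.prod {Ω : Type*} [MeasurableSpace Ω] {P : Measure Ω} [IsFiniteMeasure P]
    {κ : Type*} (A : Finset κ) {f : κ → Ω → ℝ} (hf : ∀ e ∈ A, HasMoments (f e) P) :
    HasMoments (fun ω => ∏ e ∈ A, f e ω) P := by
  classical
  induction A using Finset.induction_on with
  | empty => simpa using HasMoments.const 1
  | insert e A he ih =>
    simp only [Finset.prod_insert he]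
    exact (hf e (Finset.mem_insert_self _ _)).mul
      (ih fun e' he' => hf e' (Finset.mem_insert_of_mem he'))

end Factor

/-! ### Expected off-diagonal entries. -/

section OffDiagonal

variable {κ : ℝ} {n : ℕ} {K : ℕ → ℝ} {δ t : ℝ} {ν : Sym2 (Fin n) → Measure ℝ} {z : ℂ}

/-- The shift `1/n` is the step `τ` of the difference operators; it is small enough not to change
the order of the moments. -/
lemma EntryLaws.integral_shifted_pow_le (h : EntryLaws K n δ ν) (e : Sym2 (Fin n)) {k : ℕ}
    (hk : 2 ≤ k) :
    ∫ y, (|y| + 1 / n) ^ k ∂(ν e) ≤ 2 ^ k * (K k + 1) * (δ ^ (k - 2) / n) := by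
  have := h.prob e
  have hn : (0 : ℝ) < n := by exact_mod_cast h.pos
  have hδ := h.scale_pos
  have hm : HasMoments (fun y : ℝ => |y|) (ν e) := fun p => (h.moments e p).norm
  have i1 := (hm.pow k).integrable
  have hsmall : (1 / (n : ℝ)) ^ k ≤ δ ^ (k - 2) / n := by
    obtain ⟨l, rfl⟩ : ∃ l, k = l + 2 := ⟨k - 2, by omega⟩
    have h1 : (1 / (n : ℝ)) ^ (l + 1) ≤ δ ^ l := by
      calc _ ≤ (δ ^ 2) ^ (l + 1) := pow_le_pow_left₀ (by positivity) h.inv_le _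
        _ = δ ^ (2 * (l + 1)) := by rw [pow_mul]
        _ ≤ δ ^ l := pow_le_pow_of_le_one hδ.le h.scale_le (by omega)
    rw [pow_succ, Nat.add_sub_cancel, div_eq_mul_one_div (δ ^ l)]
    gcongr
  calc _ ≤ ∫ y, 2 ^ k * (|y| ^ k + (1 / n) ^ k) ∂(ν e) := by
        refine integral_mono ((hm.add (HasMoments.const _)).pow k).integrable
          ((i1.add (integrable_const _)).const_mul _) fun y => ?_
        refine (add_pow_le (abs_nonneg y) (by positivity) k).trans ?_
        gcongr
        · norm_num
        · omega
    _ = 2 ^ k * (∫ y, |y| ^ k ∂(ν e) + (1 / n) ^ k) := by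
        rw [integral_const_mul, integral_add i1 (integrable_const _), integral_const,
          probReal_univ, one_smul]
    _ ≤ 2 ^ k * (K k * δ ^ (k - 2) / n + δ ^ (k - 2) / n) := by
        gcongr
        exact h.abs_moment e k hk
    _ = _ := by ring

lemma isMask_zeroOn {c : Sym2 (Fin n) → ℝ} (hc : IsSign c) (L : List (Sym2 (Fin n))) :
    IsMask L.length ∅ fun e => if e ∈ L then 0 else c e where
  vals e := by
    split_ifs
    · simp
    · rcases hc e with h | h <;> simp [h]
  card_le := by simp
  zero i hi := by simp at hi
  few i _ := by
    refine (Finset.card_le_card_of_injOn (fun j => s(i, j)) (t := L.toFinset) (fun j hj => ?_)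
      fun a _ b _ h => Sym2.congr_right.mp h).trans (List.toFinset_card_le L)
    simp only [Finset.coe_filter, Finset.mem_univ, true_and, Set.mem_ofPred_eq, ite_eq_left_iff] at hj
    rw [Finset.mem_coe, List.mem_toFinset]
    by_contra hn
    rcases hc s(i, j) with h | h <;> simp [hn, h] at hj

lemma polyGrowth_resolvent (hz : 0 < z.im) (i j : Fin n) :
    PolyGrowth fun x : Sym2 (Fin n) → ℝ => resolventMatrix z (symMatrix x) i j :=
  ⟨(continuous_resolvent_symMatrix hz i j).measurable, 1 / z.im, 0, by positivity, fun x => by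
    simpa using norm_resolvent_le (symMatrix_isSymm x) hz i j⟩

end OffDiagonal


section OffDiagonal

variable {κ : ℝ} {n : ℕ} {K : ℕ → ℝ} {δ t : ℝ} {ν : Sym2 (Fin n) → Measure ℝ} {z : ℂ}

/-- The constant in the bound on the moments of the shifted entries. -/
noncomputable def shiftConst (K : ℕ → ℝ) (M : ℕ) : ℝ :=
  2 * (2 ^ 3 * (K 3 + 1)) + 2 * (2 ^ (3 + M) * (K (3 + M) + 1))

lemma shiftConst_nonneg (hK : ∀ k, 0 ≤ K k) (M : ℕ) : 0 ≤ shiftConst K M := by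
  have := hK 3
  have := hK (3 + M)
  unfold shiftConst; positivity

/-- The cube contributes `δ / n` per edge, which is the gain of one step of the walk; additional
powers contribute as many powers of `δ`. -/
lemma EntryLaws.integral_prod_shifted_le (h : EntryLaws K n δ ν) (s : Finset (Sym2 (Fin n)))
    {M : ℕ} {k : Sym2 (Fin n) → ℕ} (hk : ∀ e, k e = 0 ∨ k e = M) :
    ∫ x, ∏ e ∈ s, (2 * (|x e| + 1 / n) ^ (3 + k e)) ∂(Measure.pi ν) ≤
      ∏ e ∈ s, (shiftConst K M * (δ / n) * δ ^ k e) := by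
  have := h.prob
  have hδ := h.scale_pos
  rw [integral_prod_eval s fun e y => 2 * (|y| + 1 / (n : ℝ)) ^ (3 + k e)]
  refine Finset.prod_le_prod (fun e _ => integral_nonneg fun y => by positivity) fun e _ => ?_
  rw [integral_const_mul]
  have h1 := h.integral_shifted_pow_le e (k := 3 + k e) (by omega)
  have hc : 2 * (2 ^ (3 + k e) * (K (3 + k e) + 1)) ≤ shiftConst K M := by
    have := h.nonneg 3
    have := h.nonneg (3 + M)
    unfold shiftConst
    rcases hk e with hk | hk <;> rw [hk]
    · exact le_add_of_nonneg_right (by positivity)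
    · exact le_add_of_nonneg_left (by positivity)
  calc _ ≤ 2 * (2 ^ (3 + k e) * (K (3 + k e) + 1) * (δ ^ (3 + k e - 2) / n)) := by gcongr
    _ = 2 * (2 ^ (3 + k e) * (K (3 + k e) + 1)) * ((δ / n) * δ ^ k e) := by
        rw [show 3 + k e - 2 = k e + 1 by omega, pow_succ]; ring
    _ ≤ shiftConst K M * ((δ / n) * δ ^ k e) := by gcongr
    _ = _ := by ring

/-- The sum of the absolute values of the entries of the resolvent on `V`. -/
noncomputable def blockSum (z : ℂ) (V : Finset (Fin n)) (W : Matrix (Fin n) (Fin n) ℝ) : ℝ :=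
  ∑ q ∈ V ×ˢ V, ‖resolventMatrix z W q.1 q.2‖

lemma blockSum_nonneg (V : Finset (Fin n)) (W : Matrix (Fin n) (Fin n) ℝ) :
    0 ≤ blockSum z V W := Finset.sum_nonneg fun _ _ => norm_nonneg _

lemma le_blockSum {V : Finset (Fin n)} (W : Matrix (Fin n) (Fin n) ℝ) {a b : Fin n} (ha : a ∈ V)
    (hb : b ∈ V) : ‖resolventMatrix z W a b‖ ≤ blockSum z V W := by
  have hab : (a, b) ∈ V ×ˢ V := Finset.mem_product.mpr ⟨ha, hb⟩
  have := Finset.single_le_sum (f := fun q : Fin n × Fin n => ‖resolventMatrix z W q.1 q.2‖)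
    (s := V ×ˢ V) (fun _ _ => norm_nonneg _) hab
  exact this

lemma hasMoments_blockSum [∀ e, IsProbabilityMeasure (ν e)] (hz : 0 < z.im) (V : Finset (Fin n))
    (c : Sym2 (Fin n) → ℝ) :
    HasMoments (fun x => blockSum z V (masked c x)) (Measure.pi ν) :=
  HasMoments.sum _ fun q _ => hasMoments_norm_resolvent hz c q.1 q.2

lemma integral_blockSum_pow_le [∀ e, IsProbabilityMeasure (ν e)] (hz : 0 < z.im)
    {V : Finset (Fin n)} {v : ℕ} (hv : V.card ≤ v) (hv0 : 0 < v) {c : Sym2 (Fin n) → ℝ} {m : ℕ}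
    (hm : 1 ≤ m) {Γ : ℝ} (hΓ : 0 ≤ Γ) (hb : MomentBound ν ∅ c z m Γ) :
    ∫ x, blockSum z V (masked c x) ^ m ∂(Measure.pi ν) ≤ ((v : ℝ) * v) ^ m * Γ := by
  have hN : (0 : ℝ) < (v : ℝ) * v := by positivity
  have hcard : (((V ×ˢ V).card : ℕ) : ℝ) ≤ (v : ℝ) * v := by
    rw [Finset.card_product]
    exact_mod_cast Nat.mul_le_mul hv hv
  have hR := fun q : Fin n × Fin n => hasMoments_norm_resolvent (ν := ν) hz c q.1 q.2
  calc _ ≤ ∫ x, ((v : ℝ) * v) ^ m * (1 / ((v : ℝ) * v) *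
        ∑ q ∈ V ×ˢ V, ‖resolventMatrix z (masked c x) q.1 q.2‖ ^ m) ∂(Measure.pi ν) := by
        refine integral_mono ((hasMoments_blockSum hz V c).pow m).integrable
          (((HasMoments.sum _ fun q _ => (hR q).pow m).const_mul _).const_mul _).integrable
          fun x => ?_
        have := avg_pow_le (V ×ˢ V) hN hcard
          (f := fun q => ‖resolventMatrix z (masked c x) q.1 q.2‖) (fun _ => norm_nonneg _) hm
        refine le_trans (le_of_eq ?_) (mul_le_mul_of_nonneg_left this (by positivity))
        rw [← mul_pow, blockSum]
        congr 1
        field_simp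
    _ = ((v : ℝ) * v) ^ m * (1 / ((v : ℝ) * v) *
        ∑ q ∈ V ×ˢ V, ∫ x, ‖resolventMatrix z (masked c x) q.1 q.2‖ ^ m ∂(Measure.pi ν)) := by
        rw [integral_const_mul, integral_const_mul,
          integral_finsetSum _ fun q _ => ((hR q).pow m).integrable]
    _ ≤ ((v : ℝ) * v) ^ m * (1 / ((v : ℝ) * v) * ∑ q ∈ V ×ˢ V, Γ) := by
        gcongr with q hq
        exact hb q.1 (by simp) q.2 (by simp)
    _ ≤ ((v : ℝ) * v) ^ m * (1 / ((v : ℝ) * v) * ((v : ℝ) * v * Γ)) := by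
        rw [Finset.sum_const, nsmul_eq_mul]
        gcongr
    _ = _ := by field_simp

/-- The points at which the iterated differences of a resolvent entry are evaluated. -/
lemma exists_edge_support (i j : Fin n) {L : List (Sym2 (Fin n))} (hd : ∀ e ∈ L, ¬ e.IsDiag) :
    ∃ V : Finset (Fin n), i ∈ V ∧ j ∈ V ∧ (∀ e ∈ L, ∀ a ∈ e, a ∈ V) ∧
      V.card ≤ 2 * L.length + 2 := by
  refine ⟨insert i (insert j (L.toFinset.biUnion fun e => e.toFinset)), by simp, by simp, ?_, ?_⟩
  · intro e he a ha
    simp only [Finset.mem_insert, Finset.mem_biUnion, List.mem_toFinset, Sym2.mem_toFinset]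
    exact Or.inr (Or.inr ⟨e, he, ha⟩)
  · have h1 : (L.toFinset.biUnion fun e => e.toFinset).card ≤ L.toFinset.card * 2 :=
      Finset.card_biUnion_le_card_mul _ _ _ fun e he =>
        (Sym2.card_toFinset_of_not_isDiag e (hd e (List.mem_toFinset.mp he))).le
    have h2 := List.toFinset_card_le L
    refine (Finset.card_insert_le _ _).trans ?_
    have := Finset.card_insert_le j (L.toFinset.biUnion fun e => e.toFinset)
    omega

/-- Three derivatives per edge produce monomials of degree `3 |L| + 1`. They are bounded through the
resolvent with the edges of `L` switched off, which is independent of the factors `|x e|` and hence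
can be integrated separately. -/
lemma norm_cubicDiffs_resolvent_le (hz : 0 < z.im) {τ : ℝ} (hτ : 0 < τ) {i j : Fin n}
    {V : Finset (Fin n)} (hi : i ∈ V) (hj : j ∈ V) {L : List (Sym2 (Fin n))} (hL : L.Nodup)
    (hd : ∀ e ∈ L, ¬ e.IsDiag) (hV : ∀ e ∈ L, ∀ a ∈ e, a ∈ V) (c x : Sym2 (Fin n) → ℝ) (N : ℕ) :
    ‖L.foldr (cubicDiff τ) (fun x => resolventMatrix z (symMatrix x) i j) (setOne L c * x)‖ ≤
      (∏ e ∈ L.toFinset, 2 * (|x e| + τ) ^ 3) * (2 ^ (3 * L.length) * (3 * L.length).factorial *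
      (2 * blockSum z V (masked (fun e => if e ∈ L then 0 else c e) x) +
        (4 * blockSum z V (masked (fun e => if e ∈ L then 0 else c e) x) *
          ∑ e ∈ L.toFinset, (|x e| + τ)) ^ N / z.im) ^ (3 * L.length + 1)) := by
  obtain ⟨G, hG, H⟩ := exists_norm_cubicDiffs_le hτ (𝒢 := resolventPolys z V)
    (V := {e | ¬ e.IsDiag ∧ ∀ a ∈ e, a ∈ V})
    (fun d g hg e he => exists_isPartial_resolventPolys hz d hg he.1 he.2) hL
    (fun e he => ⟨hd e he, hV e he⟩) (resolvent_mem_resolventPolys z hi hj)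
  have habs : ∀ e ∈ L, |(setOne L c * x) e| = |x e| := fun e he => by
    simp [setOne, he]
  have hprod : (L.map fun e => 2 * (|(setOne L c * x) e| + τ) ^ 3).prod
      = ∏ e ∈ L.toFinset, 2 * (|x e| + τ) ^ 3 := by
    rw [List.prod_toFinset _ hL]
    congr 1
    exact List.map_congr_left fun e he => by rw [habs e he]
  have hsum : ∑ e ∈ L.toFinset, (|(setOne L c * x) e| + τ) = ∑ e ∈ L.toFinset, (|x e| + τ) :=
    Finset.sum_congr rfl fun e he => by rw [habs e (List.mem_toFinset.mp he)]
  refine (H (setOne L c * x) _ fun x' hx' => ?_).trans (le_of_eq (congrArg (· * _) hprod))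
  rw [zero_add] at hG
  refine norm_resolventPoly_le hG fun a ha b hb => ?_
  rw [← hsum]
  refine norm_resolvent_near_le hz hd hV
    (x₀ := (fun e => if e ∈ L then 0 else c e) * x) (fun e => ?_) hx'
    (fun a ha b hb => le_blockSum _ ha hb) (blockSum_nonneg _ _) N ha hb
  by_cases he : e ∈ L <;> simp [he, setOne]

end OffDiagonal


section OffDiagonal

variable {κ : ℝ}

/-- Iterated sign differences of the expected resolvent entries decay like `(δ / n) ^ r`. -/
lemma exists_signDiffs_le (hκ : κ ∈ Set.Ioo (0 : ℝ) 1) (K : ℕ → ℝ) (J r : ℕ) :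
    ∃ B : ℝ, 0 ≤ B ∧ ∀ (n : ℕ) (δ t : ℝ) (ν : Sym2 (Fin n) → Measure ℝ) (z : ℂ),
    EntryLaws K n δ ν → Scales n δ t z → z ∈ halfPlane κ → t ^ J ≤ z.im →
    ∀ (i j : Fin n) (L : List (Sym2 (Fin n))), L.Nodup → (∀ e ∈ L, ¬ e.IsDiag) → L.length = r →
    ∀ c, IsSign c →
    ‖signDiffs (fun c => ∫ x, resolventMatrix z (symMatrix (c * x)) i j ∂(Measure.pi ν)) L c‖
      ≤ B * (δ / n) ^ r := by
  -- Here `m` is the degree of the monomials and `M` is `m` times the exponent `J + 1` used in the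
  -- perturbation bound. `v` bounds the number of vertices met by `r` edges and by the two indices.
  set m := 3 * r + 1 with hm
  set M := (J + 1) * m with hM
  set v := 2 * r + 2 with hv
  obtain ⟨Γ₁, hΓ₁, H₁⟩ := controlled hκ K J r m
  obtain ⟨Γ₂, hΓ₂, H₂⟩ := controlled hκ K J r M
  set k₀ : ℝ := 2 ^ (3 * r) * (3 * r).factorial
  set G₁ : ℝ := ((v : ℝ) * v) ^ m * Γ₁
  set G₂ : ℝ := ((v : ℝ) * v) ^ M * Γ₂
  refine ⟨k₀ * 2 ^ m * (2 ^ m * G₁ + (4 * (r + 1)) ^ M * r * G₂) * |shiftConst K M| ^ r,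
    by positivity, fun n δ t ν z h hs hz hJ i j L hL hd hr c hc => ?_⟩
  have := h.prob
  have hzi := hs.im_pos
  have hn : (0 : ℝ) < n := by exact_mod_cast h.pos
  have hτ : (0 : ℝ) < 1 / n := by positivity
  have hδ := h.scale_pos
  have ht := hs.pos
  obtain ⟨V, hi, hj, hV, hVc⟩ := exists_edge_support i j hd
  rw [hr] at hVc
  set c₀ : Sym2 (Fin n) → ℝ := fun e => if e ∈ L then 0 else c e with hc₀
  have hmask : IsMask r ∅ c₀ := hr ▸ isMask_zeroOn hc L
  have hA : |shiftConst K M| = shiftConst K M := abs_of_nonneg (shiftConst_nonneg h.nonneg M)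
  set A := shiftConst K M
  have hA0 : 0 ≤ A := hA ▸ abs_nonneg _
  set s := L.toFinset with hsdef
  have hcard : s.card = r := by rw [hsdef, List.toFinset_card_of_nodup hL, hr]
  set b : Sym2 (Fin n) → (Sym2 (Fin n) → ℝ) → ℝ := fun e x => |x e| + 1 / n with hb
  have hb0 : ∀ e x, 0 ≤ b e x := fun e x => by simp only [hb]; positivity
  set U : (Sym2 (Fin n) → ℕ) → (Sym2 (Fin n) → ℝ) → ℝ :=
    fun k x => ∏ e ∈ s, (2 * b e x ^ (3 + k e)) with hU
  have hU0 : ∀ k x, 0 ≤ U k x := fun k x => Finset.prod_nonneg fun e _ => by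
    have := hb0 e x; positivity
  set Γ : (Sym2 (Fin n) → ℝ) → ℝ := fun x => blockSum z V (masked c₀ x) with hΓ
  have hΓ0 : ∀ x, 0 ≤ Γ x := fun x => blockSum_nonneg _ _
  have hm1 : 1 ≤ m := by omega
  have hM1 : 1 ≤ M := Nat.mul_pos (Nat.succ_pos J) hm1
  have hbm : ∀ e, HasMoments (b e) (Measure.pi ν) := fun e => by
    have h2 : HasMoments (fun x : Sym2 (Fin n) → ℝ => |x e|) (Measure.pi ν) := fun p =>
      ((h.moments e p).comp_measurePreserving (measurePreserving_eval ν e)).norm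
    exact h2.add (HasMoments.const _)
  have hUm : ∀ k, HasMoments (U k) (Measure.pi ν) := fun k =>
    HasMoments.prod s fun e _ => ((hbm e).pow _).const_mul 2
  have hΓm : HasMoments Γ (Measure.pi ν) := hasMoments_blockSum hzi V c₀
  have hfac : ∀ k l, ∫ x, U k x * Γ x ^ l ∂(Measure.pi ν)
      = (∫ x, U k x ∂(Measure.pi ν)) * ∫ x, Γ x ^ l ∂(Measure.pi ν) := by
    intro k l
    refine integral_mul_of_piecewise s (φ := U k) (ψ := fun x => Γ x ^ l) (fun x x' => ?_)
      (fun x x' => ?_) ((hUm k).mul (hΓm.pow l)).integrable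
    · refine Finset.prod_congr rfl fun e he => ?_
      simp only [hb, Finset.piecewise_eq_of_mem _ _ _ he]
    · simp only [hΓ]
      congr 2
      ext a b'
      simp only [masked_apply, hc₀]
      by_cases he : s(a, b') ∈ L
      · simp [he]
      · rw [Finset.piecewise_eq_of_notMem _ _ _ (by rwa [hsdef, List.mem_toFinset])]
  have g₁ : ∫ x, Γ x ^ m ∂(Measure.pi ν) ≤ G₁ := integral_blockSum_pow_le hzi hVc (by omega) hm1
    (by linarith) (H₁ n δ t ν z ∅ c₀ h hs hz hJ hmask)
  have g₂ : ∫ x, Γ x ^ M ∂(Measure.pi ν) ≤ G₂ := integral_blockSum_pow_le hzi hVc (by omega) hM1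
    (by linarith) (H₂ n δ t ν z ∅ c₀ h hs hz hJ hmask)
  have u₀ : ∫ x, U (fun _ => 0) x ∂(Measure.pi ν) ≤ (A * (δ / n)) ^ r := by
    refine (h.integral_prod_shifted_le s (M := M) (k := fun _ => 0) fun _ => Or.inl rfl).trans
      (le_of_eq ?_)
    simp only [pow_zero, mul_one, Finset.prod_const, hcard, A]
  have u₁ : ∀ e ∈ s, ∫ x, U (fun e' => if e' = e then M else 0) x ∂(Measure.pi ν)
      ≤ (A * (δ / n)) ^ r * δ ^ M := by
    intro e he
    refine (h.integral_prod_shifted_le s (M := M) (k := fun e' => if e' = e then M else 0)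
      fun e' => by split_ifs <;> simp).trans (le_of_eq ?_)
    rw [Finset.prod_mul_distrib, Finset.prod_const, hcard]
    congr 1
    simp only [pow_ite, pow_zero]
    rw [Finset.prod_ite_eq' s e, if_pos he]
  have hpt : ∀ x, ‖L.foldr (cubicDiff (1 / n)) (fun x => resolventMatrix z (symMatrix x) i j)
      (setOne L c * x)‖ ≤ k₀ * 2 ^ m * (2 ^ m * (U (fun _ => 0) x * Γ x ^ m) +
        (4 * (r + 1)) ^ M * (1 / z.im) ^ m *
          ∑ e ∈ s, U (fun e' => if e' = e then M else 0) x * Γ x ^ M) := by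
    intro x
    have h1 := norm_cubicDiffs_resolvent_le hzi hτ hi hj hL hd hV c x (J + 1)
    rw [hr] at h1
    refine h1.trans ?_
    set β := ∑ e ∈ s, b e x with hβ
    have hβ0 : 0 ≤ β := Finset.sum_nonneg fun e _ => hb0 e x
    -- Spreading the power over the edges keeps every term a product over coordinates. The averaging
    -- uses `r + 1` in place of `r`, which avoids a case distinction for `r = 0`.
    have hβM : β ^ M ≤ (r + 1) ^ M * ∑ e ∈ s, b e x ^ M := by
      have := avg_pow_le s (N := r + 1) (by positivity) (by rw [hcard]; linarith)
        (f := fun e => b e x) (fun e => hb0 e x) hM1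
      rw [mul_pow, div_pow, one_pow, one_div_mul_eq_div, div_le_iff₀ (by positivity)] at this
      refine this.trans ?_
      rw [mul_comm]
      gcongr
      have hsum : 0 ≤ ∑ e ∈ s, b e x ^ M := Finset.sum_nonneg fun e _ => pow_nonneg (hb0 e x) M
      refine mul_le_of_le_one_left hsum ?_
      rw [div_le_one₀ (by positivity)]
      linarith [Nat.cast_nonneg (α := ℝ) r]
    have hUe : ∀ e ∈ s, U (fun e' => if e' = e then M else 0) x = U (fun _ => 0) x * b e x ^ M := by
      intro e he
      simp only [hU, pow_add, pow_ite, pow_zero, mul_one]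
      simp only [← mul_assoc]
      rw [Finset.prod_mul_distrib, Finset.prod_ite_eq' s e, if_pos he]
    have hsumU : U (fun _ => 0) x * β ^ M ≤ (r + 1) ^ M *
        ∑ e ∈ s, U (fun e' => if e' = e then M else 0) x := by
      rw [Finset.sum_congr rfl hUe, ← Finset.mul_sum]
      calc _ ≤ U (fun _ => 0) x * ((r + 1) ^ M * ∑ e ∈ s, b e x ^ M) :=
            mul_le_mul_of_nonneg_left hβM (hU0 _ _)
        _ = _ := by ring
    have hsplit : (2 * Γ x + (4 * Γ x * β) ^ (J + 1) / z.im) ^ m ≤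
        2 ^ m * (2 ^ m * Γ x ^ m + 4 ^ M * (1 / z.im) ^ m * (Γ x ^ M * β ^ M)) := by
      have hg := hΓ0 x
      refine (add_pow_le (by positivity) (by positivity) m).trans ?_
      have e1 : (2 * Γ x) ^ m = 2 ^ m * Γ x ^ m := mul_pow _ _ _
      have e2 : ((4 * Γ x * β) ^ (J + 1) / z.im) ^ m
          = 4 ^ M * (1 / z.im) ^ m * (Γ x ^ M * β ^ M) := by
        rw [div_eq_mul_one_div, mul_pow, ← pow_mul, mul_pow, mul_pow]; ring
      rw [e1, e2]
      gcongr
      · norm_num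
      · omega
    have hU00 : (∏ e ∈ s, 2 * (|x e| + 1 / (n : ℝ)) ^ 3) = U (fun _ => 0) x := by
      simp only [hU, hb, add_zero]
    have hu := hU0 (fun _ => 0) x
    have hg := hΓ0 x
    calc (∏ e ∈ s, 2 * (|x e| + 1 / (n : ℝ)) ^ 3) *
          (k₀ * (2 * Γ x + (4 * Γ x * β) ^ (J + 1) / z.im) ^ m)
        ≤ U (fun _ => 0) x * (k₀ * (2 ^ m * (2 ^ m * Γ x ^ m +
          4 ^ M * (1 / z.im) ^ m * (Γ x ^ M * β ^ M)))) := by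
          rw [hU00]
          gcongr
      _ = k₀ * 2 ^ m * (2 ^ m * (U (fun _ => 0) x * Γ x ^ m) +
          4 ^ M * (1 / z.im) ^ m * Γ x ^ M * (U (fun _ => 0) x * β ^ M)) := by ring
      _ ≤ k₀ * 2 ^ m * (2 ^ m * (U (fun _ => 0) x * Γ x ^ m) +
          4 ^ M * (1 / z.im) ^ m * Γ x ^ M * ((r + 1) ^ M *
            ∑ e ∈ s, U (fun e' => if e' = e then M else 0) x)) := by
          gcongr
      _ = _ := by
          rw [← Finset.sum_mul]
          rw [mul_pow 4 ((r : ℝ) + 1)]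
          ring
  rw [signDiffs_integral (τ := 1 / n) h.moments h.mean (polyGrowth_resolvent hzi i j) hL]
  have i1 : Integrable (fun x => U (fun _ => 0) x * Γ x ^ m) (Measure.pi ν) :=
    ((hUm _).mul (hΓm.pow m)).integrable
  have i2 : ∀ e ∈ s, Integrable (fun x => U (fun e' => if e' = e then M else 0) x * Γ x ^ M)
    (Measure.pi ν) := fun e _ => ((hUm _).mul (hΓm.pow M)).integrable
  have i2' := (integrable_finsetSum s i2).const_mul ((4 * ((r : ℝ) + 1)) ^ M * (1 / z.im) ^ m)
  -- The large-perturbation branch lost `(1 / Im z)^m`. It is repaid by `δ^M`, since `δ^(J+1) ≤ t^J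
  -- ≤ Im z`.
  have hscale : (1 / z.im) ^ m * δ ^ M ≤ 1 := by
    rw [hM, pow_mul, ← mul_pow]
    refine pow_le_one₀ (by positivity) ?_
    rw [one_div_mul_eq_div, div_le_one₀ hzi]
    calc δ ^ (J + 1) ≤ (t ^ 4) ^ (J + 1) := pow_le_pow_left₀ hδ.le hs.scale_le _
      _ = t ^ (4 * (J + 1)) := by rw [pow_mul]
      _ ≤ t ^ J := pow_le_pow_of_le_one ht.le hs.le_one (by omega)
      _ ≤ _ := hJ
  have hγ₁ : 0 ≤ ∫ x, Γ x ^ m ∂(Measure.pi ν) := integral_nonneg fun x => pow_nonneg (hΓ0 x) m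
  have hγ₂ : 0 ≤ ∫ x, Γ x ^ M ∂(Measure.pi ν) := integral_nonneg fun x => pow_nonneg (hΓ0 x) M
  calc _ ≤ ∫ x, k₀ * 2 ^ m * (2 ^ m * (U (fun _ => 0) x * Γ x ^ m) +
        (4 * (r + 1)) ^ M * (1 / z.im) ^ m *
          ∑ e ∈ s, U (fun e' => if e' = e then M else 0) x * Γ x ^ M) ∂(Measure.pi ν) :=
        norm_integral_le_of_norm_le (((i1.const_mul _).add i2').const_mul _) (ae_of_all _ hpt)
    _ = k₀ * 2 ^ m * (2 ^ m * ((∫ x, U (fun _ => 0) x ∂(Measure.pi ν)) *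
          ∫ x, Γ x ^ m ∂(Measure.pi ν)) + (4 * (r + 1)) ^ M * (1 / z.im) ^ m *
          ∑ e ∈ s, (∫ x, U (fun e' => if e' = e then M else 0) x ∂(Measure.pi ν)) *
            ∫ x, Γ x ^ M ∂(Measure.pi ν)) := by
        rw [integral_const_mul, integral_add (i1.const_mul _) i2', integral_const_mul,
          integral_const_mul, integral_finsetSum s i2, hfac]
        simp only [hfac]
    _ ≤ k₀ * 2 ^ m * (2 ^ m * ((A * (δ / n)) ^ r * G₁) + (4 * (r + 1)) ^ M * (1 / z.im) ^ m *
          ∑ e ∈ s, ((A * (δ / n)) ^ r * δ ^ M) * G₂) := by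
        gcongr with e he
        exact u₁ e he
    _ = k₀ * 2 ^ m * (2 ^ m * ((A * (δ / n)) ^ r * G₁) + (4 * (r + 1)) ^ M *
          (r * ((A * (δ / n)) ^ r * G₂)) * ((1 / z.im) ^ m * δ ^ M)) := by
        rw [Finset.sum_const, hcard, nsmul_eq_mul]; ring
    _ ≤ k₀ * 2 ^ m * (2 ^ m * ((A * (δ / n)) ^ r * G₁) + (4 * (r + 1)) ^ M *
          (r * ((A * (δ / n)) ^ r * G₂)) * 1) := by
        gcongr
    _ = _ := by rw [hA, mul_pow]; ring

/-- The expected off-diagonal entries of the resolvent are small. -/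
theorem exists_integral_resolvent_offdiag_le (hκ : κ ∈ Set.Ioo (0 : ℝ) 1) (K : ℕ → ℝ) (J : ℕ) :
    ∃ C : ℝ, 0 ≤ C ∧ ∀ (n : ℕ) (δ t : ℝ) (ν : Sym2 (Fin n) → Measure ℝ) (z : ℂ),
    EntryLaws K n δ ν → Scales n δ t z → z ∈ halfPlane κ → t ^ J ≤ z.im →
    ∀ i j : Fin n, i ≠ j →
    ‖∫ x, resolventMatrix z (symMatrix x) i j ∂(Measure.pi ν)‖ ≤ C * (δ ^ 4 + δ / n) := by
  choose B hB H using exists_signDiffs_le hκ K J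
  set B' := ∑ r ∈ Finset.range 5, B r
  have hB' : 0 ≤ B' := Finset.sum_nonneg fun r _ => hB r
  refine ⟨4 * B', by positivity, fun n δ t ν z h hs hz hJ i j hij => ?_⟩
  have hn : (0 : ℝ) < n := by exact_mod_cast h.pos
  have hδ := h.scale_pos
  have hδ1 := h.scale_le
  have hone : IsSign (1 : Sym2 (Fin n) → ℝ) := fun e => Or.inl rfl
  -- Four steps give `δ^4 = (np)^(-2)`, the order needed against `‖u‖₁² ≤ (s_n np)²`. Walks that hit
  -- `j` earlier contribute a multiple of `δ / n`.
  have key := norm_le_of_signDiffs (oddAt_integral_resolvent hs.im_pos ν hij) hij hB'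
    (ρ := δ / n) (by positivity) (r := 4) (fun L hL hd hl c hc =>
      (H L.length n δ t ν z h hs hz hJ i j L hL hd rfl c hc).trans (by
        gcongr
        exact Finset.single_le_sum (f := B) (fun r _ => hB r) (Finset.mem_range.mpr (by omega))))
    hone
  simp only [one_mul] at key
  refine key.trans ?_
  rw [mul_div_cancel₀ δ hn.ne']
  have hsum : ∑ l ∈ Finset.range 4, δ ^ l ≤ 4 := by
    calc _ ≤ ∑ l ∈ Finset.range 4, (1 : ℝ) :=
          Finset.sum_le_sum fun l _ => pow_le_one₀ hδ.le hδ1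
      _ = 4 := by simp
  have h4 : 0 ≤ δ ^ 4 := by positivity
  have h5 : 0 ≤ B' * (δ / n) := by positivity
  nlinarith [mul_nonneg hB' h4, mul_le_mul_of_nonneg_left hsum h5]

end OffDiagonal


/-! ### Assembly of the quadratic form. -/

section QuadraticForm

variable {κ : ℝ}

lemma isMask_one (n : ℕ) : IsMask 0 (∅ : Finset (Fin n)) (1 : Sym2 (Fin n) → ℝ) where
  vals _ := Or.inr (Or.inr rfl)
  card_le := by simp
  zero := by simp
  few := by simp

lemma integrable_resolvent_symMatrix {n : ℕ} {z : ℂ} (hz : 0 < z.im)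
    (μ : Measure (Sym2 (Fin n) → ℝ)) [IsFiniteMeasure μ] (i j : Fin n) :
    Integrable (fun x => resolventMatrix z (symMatrix x) i j) μ :=
  Integrable.of_bound (continuous_resolvent_symMatrix hz i j).aestronglyMeasurable (1 / z.im)
    (ae_of_all _ fun x => norm_resolvent_le (symMatrix_isSymm x) hz i j)

lemma integral_resolventForm {n : ℕ} {z : ℂ} (hz : 0 < z.im)
    (μ : Measure (Sym2 (Fin n) → ℝ)) [IsFiniteMeasure μ] (u : EuclideanSpace ℝ (Fin n)) :
    ∫ x, resolventForm z (symMatrix x) u ∂μ =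
      ∑ i, ∑ j, (u i : ℂ) * (∫ x, resolventMatrix z (symMatrix x) i j ∂μ) * (u j : ℂ) := by
  have hint : ∀ i j : Fin n, Integrable
      (fun x => (u i : ℂ) * resolventMatrix z (symMatrix x) i j * (u j : ℂ)) μ :=
    fun i j => ((integrable_resolvent_symMatrix hz μ i j).const_mul _).mul_const _
  unfold resolventForm
  rw [integral_finsetSum _ fun i _ => integrable_finsetSum _ fun j _ => hint i j]
  refine Finset.sum_congr rfl fun i _ => ?_
  rw [integral_finsetSum _ fun j _ => hint i j]
  refine Finset.sum_congr rfl fun j _ => ?_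
  rw [integral_mul_const, integral_const_mul]

/-- The expected quadratic form of the resolvent at a unit vector. -/
theorem exists_integral_resolventForm_sub_le (hκ : κ ∈ Set.Ioo (0 : ℝ) 1) (K : ℕ → ℝ) (J : ℕ) :
    ∃ C : ℝ, 0 ≤ C ∧ ∀ (n : ℕ) (δ t : ℝ) (ν : Sym2 (Fin n) → Measure ℝ) (z : ℂ),
    EntryLaws K n δ ν → Scales n δ t z → z ∈ halfPlane κ → t ^ (J + 1) ≤ z.im →
    ∀ u : EuclideanSpace ℝ (Fin n), ‖u‖ = 1 →
    ‖∫ x, resolventForm z (symMatrix x) u ∂(Measure.pi ν) - semicircleStieltjes z‖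
      ≤ C * (t + (δ ^ 4 + δ / n) * (∑ i, |u i|) ^ 2) := by
  obtain ⟨C₁, hC₁, H₁⟩ := exists_integral_resolvent_diag_sub_le hκ K J 0
  obtain ⟨C₂, hC₂, H₂⟩ := exists_integral_resolvent_offdiag_le hκ K (J + 1)
  refine ⟨C₁ + C₂, by positivity, fun n δ t ν z h hs hz hJ u hu => ?_⟩
  have := h.prob
  have hδ := h.scale_pos
  have ht := hs.pos
  have hsq : ∑ i, |u i| ^ 2 = 1 := by
    have := EuclideanSpace.norm_sq_eq u
    rw [hu, one_pow] at this
    simpa using this.symm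
  have hsqC : ∑ i, (u i : ℂ) ^ 2 = 1 := by
    have : ∑ i, (u i) ^ 2 = 1 := by simpa using hsq
    exact_mod_cast this
  set r : Fin n → Fin n → ℂ := fun i j => ∫ x, resolventMatrix z (symMatrix x) i j ∂(Measure.pi ν)
    with hr
  set ρ := δ ^ 4 + δ / n with hρ
  have hρ0 : 0 ≤ ρ := by positivity
  have hone : ∀ x : Sym2 (Fin n) → ℝ, masked 1 x = symMatrix x := fun x => by
    rw [masked_eq_symMatrix, one_mul]
  have hdiag : ∀ i, ‖r i i - semicircleStieltjes z‖ ≤ C₁ * t := fun i => by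
    have := H₁ n δ t ν z ∅ 1 ⟨h, hs, hz, hJ, isMask_one n⟩ i (by simp)
    simpa only [hone] using this
  have hoff : ∀ i j, i ≠ j → ‖r i j‖ ≤ C₂ * ρ := H₂ n δ t ν z h hs hz hJ
  have hsplit : ∫ x, resolventForm z (symMatrix x) u ∂(Measure.pi ν) - semicircleStieltjes z =
      ∑ i, ∑ j, (u i : ℂ) * (r i j - if i = j then semicircleStieltjes z else 0) * (u j : ℂ) := by
    rw [integral_resolventForm hs.im_pos]
    simp only [mul_sub, sub_mul, Finset.sum_sub_distrib]
    congr 1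
    simp only [mul_ite, mul_zero, ite_mul, zero_mul, Finset.sum_ite_eq, Finset.mem_univ, if_true]
    calc _ = (∑ i, (u i : ℂ) ^ 2) * semicircleStieltjes z := by rw [hsqC, one_mul]
      _ = _ := by
        rw [Finset.sum_mul]
        exact Finset.sum_congr rfl fun i _ => by ring
  rw [hsplit]
  have hterm : ∀ i j,
      ‖(u i : ℂ) * (r i j - if i = j then semicircleStieltjes z else 0) * (u j : ℂ)‖
        ≤ (if i = j then |u i| ^ 2 * (C₁ * t) else 0) + |u i| * |u j| * (C₂ * ρ) := by
    intro i j
    rw [norm_mul, norm_mul, Complex.norm_real, Complex.norm_real, Real.norm_eq_abs,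
      Real.norm_eq_abs]
    have h0 : 0 ≤ |u i| * |u j| * (C₂ * ρ) := by positivity
    by_cases hij : i = j
    · subst hij
      simp only [if_true]
      have := mul_le_mul_of_nonneg_left (hdiag i) (sq_nonneg |u i|)
      nlinarith
    · simp only [hij, if_false, sub_zero, zero_add]
      have := mul_le_mul_of_nonneg_left (hoff i j hij) (mul_nonneg (abs_nonneg (u i))
        (abs_nonneg (u j)))
      nlinarith
  calc _ ≤ ∑ i, ∑ j, ((if i = j then |u i| ^ 2 * (C₁ * t) else 0) +
        |u i| * |u j| * (C₂ * ρ)) :=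
        (norm_sum_le _ _).trans (Finset.sum_le_sum fun i _ =>
          (norm_sum_le _ _).trans (Finset.sum_le_sum fun j _ => hterm i j))
    _ = C₁ * t + C₂ * (ρ * (∑ i, |u i|) ^ 2) := by
        simp only [Finset.sum_add_distrib, Finset.sum_ite_eq, Finset.mem_univ, if_true,
          ← Finset.sum_mul, ← Finset.mul_sum]
        rw [hsq]
        ring
    _ ≤ _ := by
        have h1 : 0 ≤ C₁ * (ρ * (∑ i, |u i|) ^ 2) := by positivity
        have h2 : 0 ≤ C₂ * t := by positivity
        nlinarith

end QuadraticForm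

/-! ### Choice of the scales on the spectral domain. -/

section SpectralScales

/-- The scale on which the errors are measured. -/
noncomputable def errorScale (ε : ℝ) (n : ℕ) (p : ℝ) : ℝ :=
  (min (n * p) ((n : ℝ) ^ ε)) ^ (-(1 / 8) : ℝ)

/-- The exponent `-1/8` is dictated by `Scales`: with `τ = min(np, n^ε)` one has `t^4 = τ^(-1/2) ≥
(np)^(-1/2)` and `t^8 = 1/τ`, whereas `n Im z ≥ n s_n ≥ n^ε ≥ τ`. -/
lemma scales_errorScale {ε sn p : ℝ} {n : ℕ} {z : ℂ} (hε : 0 < ε)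
    (hnp : 1 ≤ n * p) (hn : 1 ≤ n) (hs : (n : ℝ) ^ (-1 + ε) ≤ sn) (hz : sn ≤ z.im) :
    Scales n (Real.sqrt (n * p))⁻¹ (errorScale ε n p) z := by
  have hn1 : (1 : ℝ) ≤ n := by exact_mod_cast hn
  have hn0 : (0 : ℝ) < n := by linarith
  have hnε : 1 ≤ (n : ℝ) ^ ε := Real.one_le_rpow hn1 hε.le
  set τ := min (n * p) ((n : ℝ) ^ ε) with hτ
  have hτ1 : 1 ≤ τ := le_min hnp hnε
  have hτ0 : 0 < τ := by linarith
  have hsn : 0 < sn := (Real.rpow_pos_of_pos hn0 _).trans_le hs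
  have hpow : ∀ k : ℕ, errorScale ε n p ^ k = τ ^ (-(1 / 8) * k : ℝ) := fun k => by
    rw [errorScale, ← hτ, ← Real.rpow_natCast, ← Real.rpow_mul hτ0.le]
  refine ⟨hsn.trans_le hz, Real.rpow_pos_of_pos hτ0 _,
    Real.rpow_le_one_of_one_le_of_nonpos hτ1 (by norm_num), ?_, ?_⟩
  · rw [hpow 4, show (-(1 / 8) * ((4 : ℕ) : ℝ) : ℝ) = -(1 / 2) by norm_num, Real.rpow_neg hτ0.le,
      ← Real.sqrt_eq_rpow]
    exact inv_anti₀ (Real.sqrt_pos.mpr hτ0) (Real.sqrt_le_sqrt (min_le_left _ _))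
  · rw [hpow 8, show (-(1 / 8) * ((8 : ℕ) : ℝ) : ℝ) = -1 by norm_num, Real.rpow_neg_one]
    have h1 : (n : ℝ) ^ ε ≤ n * z.im := by
      calc (n : ℝ) ^ ε = n * (n : ℝ) ^ (-1 + ε) := by
            rw [Real.rpow_add hn0, Real.rpow_neg_one, ← mul_assoc, mul_inv_cancel₀ hn0.ne', one_mul]
        _ ≤ _ := mul_le_mul_of_nonneg_left (hs.trans hz) hn0.le
    rw [← div_eq_mul_inv, le_div_iff₀ hτ0, one_mul]
    exact (min_le_right _ _).trans h1

lemma errorScale_pow_le {ε c p : ℝ} {n : ℕ} {z : ℂ} (hε : 0 < ε)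
    (hnp : 1 ≤ n * p) (hn : 1 ≤ n) (hz : (min (n * p) ((n : ℝ) ^ ε)) ^ (-c) ≤ z.im) :
    errorScale ε n p ^ (⌈8 * c⌉₊ + 1) ≤ z.im := by
  have hn1 : (1 : ℝ) ≤ n := by exact_mod_cast hn
  set τ := min (n * p) ((n : ℝ) ^ ε) with hτ
  have hτ1 : 1 ≤ τ := le_min hnp (Real.one_le_rpow hn1 hε.le)
  refine le_trans ?_ hz
  rw [errorScale, ← hτ, ← Real.rpow_natCast, ← Real.rpow_mul (by linarith)]
  refine Real.rpow_le_rpow_of_exponent_le hτ1 ?_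
  have := Nat.le_ceil (8 * c)
  push_cast
  linarith

variable {κ : ℝ}

/-- The isotropic bound on the spectral domain, in the product model. -/
theorem exists_isotropic_le (hκ : κ ∈ Set.Ioo (0 : ℝ) 1) {ε : ℝ} (hε : 0 < ε) (c : ℝ)
    (K : ℕ → ℝ) : ∃ C : ℝ, 0 ≤ C ∧
    ∀ (n : ℕ) (p sn : ℝ) (ν : Sym2 (Fin n) → Measure ℝ), 1 ≤ n * p →
    (n : ℝ) ^ (-1 + ε) ≤ sn → EntryLaws K n (Real.sqrt (n * p))⁻¹ ν →
    ∀ z ∈ halfPlane κ, max sn ((min (n * p) ((n : ℝ) ^ ε)) ^ (-c)) ≤ z.im →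
    ∀ u ∈ testVectors n p sn,
    ‖∫ x, resolventForm z (symMatrix x) u ∂(Measure.pi ν) - semicircleStieltjes z‖
      ≤ C * (errorScale ε n p + sn ^ 2 + (Real.sqrt (n * p))⁻¹) := by
  obtain ⟨C, hC, H⟩ := exists_integral_resolventForm_sub_le hκ K ⌈8 * c⌉₊
  refine ⟨C, hC, fun n p sn ν hnp hs h z hz him u hu => ?_⟩
  have hn : 1 ≤ n := h.pos
  have hn0 : (0 : ℝ) < n := by exact_mod_cast h.pos
  obtain ⟨him1, him2⟩ := max_le_iff.mp him
  obtain ⟨hu1, hu2⟩ := hu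
  refine (H n _ _ ν z h (scales_errorScale hε hnp hn hs him1) hz
    (errorScale_pow_le hε hnp hn him2) u hu1).trans ?_
  refine mul_le_mul_of_nonneg_left ?_ hC
  have hS0 : 0 ≤ ∑ i, |u i| := Finset.sum_nonneg fun i _ => abs_nonneg _
  set S := ∑ i, |u i| with hS
  have hsq : ∑ i, |u i| ^ 2 = 1 := by
    have := EuclideanSpace.norm_sq_eq u
    rw [hu1, one_pow] at this
    simpa using this.symm
  have hCS : S ^ 2 ≤ n := by
    have := sq_sum_le_card_mul_sum_sq (s := Finset.univ) (f := fun i => |u i|)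
    rw [hsq] at this
    simpa using this
  have hnp0 : 0 < n * p := by linarith
  have h4 : (Real.sqrt (n * p))⁻¹ ^ 4 = ((n * p) ^ 2)⁻¹ := by
    rw [inv_pow, show 4 = 2 * 2 by norm_num, pow_mul, Real.sq_sqrt hnp0.le]
  -- The constraint on `‖u‖₁` is used for the term `δ^4`; the term `δ / n` needs only
  -- Cauchy–Schwarz.
  have h1 : (Real.sqrt (n * p))⁻¹ ^ 4 * S ^ 2 ≤ sn ^ 2 := by
    rw [h4, inv_mul_le_iff₀ (by positivity), ← mul_pow, mul_comm]
    exact pow_le_pow_left₀ hS0 hu2 2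
  have h2 : (Real.sqrt (n * p))⁻¹ / n * S ^ 2 ≤ (Real.sqrt (n * p))⁻¹ := by
    calc _ ≤ (Real.sqrt (n * p))⁻¹ / n * n := mul_le_mul_of_nonneg_left hCS (by positivity)
      _ = _ := div_mul_cancel₀ _ hn0.ne'
  nlinarith

end SpectralScales


/-! ### From independent families to product measures. -/

section ProductLaws

variable {ι Ω : Type*} [Fintype ι] [MeasurableSpace Ω] {P : Measure Ω}

lemma map_pi_prod_eq_pi_sum (μ₁ μ₂ : ι → Measure ℝ) [∀ i, IsProbabilityMeasure (μ₁ i)]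
    [∀ i, IsProbabilityMeasure (μ₂ i)] :
    (Measure.pi fun i => (μ₁ i).prod (μ₂ i)).map
      (fun x => (Sum.elim (fun i => (x i).1) (fun i => (x i).2) : ι ⊕ ι → ℝ)) =
      Measure.pi (Sum.elim μ₁ μ₂) := by
  have : ∀ k, IsProbabilityMeasure (Sum.elim μ₁ μ₂ k) := by
    rintro (i | i) <;> simp only [Sum.elim_inl, Sum.elim_inr] <;> infer_instance
  have hm : Measurable
      (fun x : ι → ℝ × ℝ => (Sum.elim (fun i => (x i).1) (fun i => (x i).2) : ι ⊕ ι → ℝ)) := by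
    refine measurable_pi_lambda _ ?_
    rintro (i | i) <;> simp only [Sum.elim_inl, Sum.elim_inr] <;> fun_prop
  refine (Measure.pi_eq fun s hs => ?_).symm
  rw [Measure.map_apply hm (.univ_pi hs), Fintype.prod_sum_type]
  have : (fun x : ι → ℝ × ℝ => (Sum.elim (fun i => (x i).1) (fun i => (x i).2) : ι ⊕ ι → ℝ)) ⁻¹'
      (Set.univ.pi s) = Set.univ.pi fun i => s (Sum.inl i) ×ˢ s (Sum.inr i) := by
    ext x
    simp only [Set.mem_preimage, Set.mem_univ_pi, Set.mem_prod, Sum.forall, Sum.elim_inl,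
      Sum.elim_inr, forall_and]
  rw [this, Measure.pi_pi]
  simp only [Measure.prod_prod, Finset.prod_mul_distrib, Sum.elim_inl, Sum.elim_inr]

/-- If two families are jointly independent, functions of corresponding pairs are independent. -/
lemma map_pair_eq_pi {X Y : ι → Ω → ℝ} (hX : ∀ i, AEMeasurable (X i) P)
    (hY : ∀ i, AEMeasurable (Y i) P) (h : iIndepFun (Sum.elim X Y) P) {g : ℝ × ℝ → ℝ}
    (hg : Measurable g) :
    P.map (fun ω i => g (X i ω, Y i ω)) =
      Measure.pi fun i => ((P.map (X i)).prod (P.map (Y i))).map g := by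
  have := h.isProbabilityMeasure
  have hXY : ∀ k, AEMeasurable (Sum.elim X Y k) P := by
    rintro (i | i) <;> simp [hX, hY]
  have := fun i => Measure.isProbabilityMeasure_map (hX i)
  have := fun i => Measure.isProbabilityMeasure_map (hY i)
  have h1 := h.map_fun_eq_pi_map hXY
  have h2 : (fun k => P.map (Sum.elim X Y k)) =
      Sum.elim (fun i => P.map (X i)) (fun i => P.map (Y i)) := by
    funext k
    rcases k with i | i <;> rfl
  rw [h2, ← map_pi_prod_eq_pi_sum] at h1
  have hE : Measurable fun (y : ι ⊕ ι → ℝ) (i : ι) => g (y (Sum.inl i), y (Sum.inr i)) := by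
    fun_prop
  have hm : Measurable
      (fun x : ι → ℝ × ℝ => (Sum.elim (fun i => (x i).1) (fun i => (x i).2) : ι ⊕ ι → ℝ)) := by
    refine measurable_pi_lambda _ ?_
    rintro (i | i) <;> simp only [Sum.elim_inl, Sum.elim_inr] <;> fun_prop
  have h3 := congrArg (Measure.map fun (y : ι ⊕ ι → ℝ) (i : ι) => g (y (Sum.inl i), y (Sum.inr i)))
    h1
  rw [AEMeasurable.map_map_of_aemeasurable hE.aemeasurable (aemeasurable_pi_lambda _ hXY),
    Measure.map_map hE hm] at h3
  have := fun i => Measure.isProbabilityMeasure_map (μ := (P.map (X i)).prod (P.map (Y i)))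
    hg.aemeasurable
  refine h3.trans ?_
  exact Measure.pi_map_pi fun i => hg.aemeasurable

/-- Independence is not affected by adding constants to the family. -/
lemma map_eq_pi_of_const [IsProbabilityMeasure P] {s : ι → Prop} [DecidablePred s]
    {X : ι → Ω → ℝ} (hX : ∀ i, AEMeasurable (X i) P) (h0 : ∀ i, ¬ s i → ∀ ω, X i ω = 0)
    (h : iIndepFun (fun (i : {i // s i}) => X i) P) :
    P.map (fun ω i => X i ω) = Measure.pi fun i => P.map (X i) := by
  have := fun i => Measure.isProbabilityMeasure_map (hX i)
  refine (Measure.pi_eq fun S hS => ?_).symm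
  have hp : ∀ i, P.map (X i) (S i) = P (X i ⁻¹' S i) := fun i =>
    Measure.map_apply_of_aemeasurable (hX i) (hS i)
  have hpre : (fun ω i => X i ω) ⁻¹' Set.univ.pi S = ⋂ i, X i ⁻¹' S i := by
    ext ω
    simp
  rw [Measure.map_apply_of_aemeasurable (aemeasurable_pi_lambda _ hX) (.univ_pi hS), hpre]
  simp only [hp]
  by_cases hex : ∃ i, ¬ s i ∧ (0 : ℝ) ∉ S i
  · obtain ⟨i, hi, hiS⟩ := hex
    have he : X i ⁻¹' S i = ∅ := by
      ext ω
      simp [h0 i hi ω, hiS]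
    rw [Finset.prod_eq_zero (Finset.mem_univ i) (by rw [he, measure_empty])]
    exact measure_mono_null (Set.iInter_subset _ i) (by rw [he, measure_empty])
  · push Not at hex
    have hu : ∀ i, ¬ s i → X i ⁻¹' S i = Set.univ := fun i hi => by
      ext ω
      simp [h0 i hi ω, hex i hi]
    have hI : ⋂ i, X i ⁻¹' S i = ⋂ i : {i // s i}, X i ⁻¹' S i := by
      ext ω
      simp only [Set.mem_iInter]
      refine ⟨fun H i => H i, fun H i => ?_⟩
      by_cases hi : s i
      · exact H ⟨i, hi⟩
      · rw [hu i hi]; trivial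
    rw [hI, h.meas_iInter fun i => ⟨S i, hS i, rfl⟩,
      ← Fintype.prod_subtype_mul_prod_subtype s fun i => P (X i ⁻¹' S i)]
    rw [Finset.prod_eq_one (s := (Finset.univ : Finset {i // ¬ s i})) fun i _ => by
      rw [hu i i.2, measure_univ], mul_one]

end ProductLaws

section Bernoulli

lemma hasMoments_bernoulli (p : unitInterval) :
    HasMoments (fun x : ℝ => x) (bernoulliMeasure (1 : ℝ) 0 p) := fun k => by
  refine MemLp.of_bound aestronglyMeasurable_id 1 ?_
  rw [bernoulliMeasure_def, ae_add_measure_iff]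
  exact ⟨Measure.ae_smul_measure (by simp) _,
    Measure.ae_smul_measure (by simp) _⟩

end Bernoulli


/-! ### The sparse Wigner matrix in the product model. -/

section SparseModel

variable {n : ℕ} {Ω : Type*} [MeasurableSpace Ω] {P : Measure Ω} {νd νo : Measure ℝ}
  {p : unitInterval} {G Ξ : Ω → Matrix (Fin n) (Fin n) ℝ}

lemma IsSubGaussianLaw.hasMoments {ν : Measure ℝ} (h : IsSubGaussianLaw ν) :
    HasMoments (fun x : ℝ => x) ν := fun k => by
  have hu : integrableExpSet (fun x : ℝ => x) ν = Set.univ :=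
    Set.eq_univ_of_forall fun θ => h.integrable_exp θ
  exact_mod_cast memLp_of_mem_interior_integrableExpSet (X := fun x : ℝ => x) (μ := ν)
    (by rw [hu, interior_univ]; trivial) (k : NNReal)

/-- The law of `δ x y` for independent `x ∼ μ` and `y ∼ Ber(p)`. -/
noncomputable def dilutedLaw (δ : ℝ) (p : unitInterval) (μ : Measure ℝ) : Measure ℝ :=
  (μ.prod (bernoulliMeasure (1 : ℝ) 0 p)).map fun q => δ * (q.1 * q.2)

lemma measurable_diluted (δ : ℝ) : Measurable fun q : ℝ × ℝ => δ * (q.1 * q.2) := by fun_prop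

instance (δ : ℝ) (p : unitInterval) (μ : Measure ℝ) [IsProbabilityMeasure μ] :
    IsProbabilityMeasure (dilutedLaw δ p μ) :=
  Measure.isProbabilityMeasure_map (measurable_diluted δ).aemeasurable

lemma hasMoments_dilutedLaw (δ : ℝ) (p : unitInterval) {μ : Measure ℝ} [IsProbabilityMeasure μ]
    (h : HasMoments (fun x : ℝ => x) μ) : HasMoments (fun x : ℝ => x) (dilutedLaw δ p μ) := by
  have h1 : HasMoments (fun q : ℝ × ℝ => q.1) (μ.prod (bernoulliMeasure (1 : ℝ) 0 p)) :=
    fun k => (h k).comp_fst _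
  have h2 : HasMoments (fun q : ℝ × ℝ => q.2) (μ.prod (bernoulliMeasure (1 : ℝ) 0 p)) :=
    fun k => (hasMoments_bernoulli p k).comp_snd _
  intro k
  refine (memLp_map_measure_iff aestronglyMeasurable_id
    (measurable_diluted δ).aemeasurable).mpr ?_
  exact (h1.mul h2).const_mul δ k

lemma integral_dilutedLaw (δ : ℝ) (p : unitInterval) {μ : Measure ℝ} [IsProbabilityMeasure μ] :
    ∫ x, x ∂(dilutedLaw δ p μ) = δ * p * ∫ x, x ∂μ := by
  rw [dilutedLaw, integral_map (measurable_diluted δ).aemeasurable (by fun_prop),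
    integral_const_mul, integral_prod_mul (fun x : ℝ => x) (fun x : ℝ => x),
    integral_bernoulliMeasure]
  simp only [smul_eq_mul]
  ring

lemma integral_sq_dilutedLaw (δ : ℝ) (p : unitInterval) {μ : Measure ℝ}
    [IsProbabilityMeasure μ] :
    ∫ x, x ^ 2 ∂(dilutedLaw δ p μ) = δ ^ 2 * p * ∫ x, x ^ 2 ∂μ := by
  rw [dilutedLaw, integral_map (measurable_diluted δ).aemeasurable (by fun_prop)]
  simp only [mul_pow]
  rw [integral_const_mul, integral_prod_mul (fun x : ℝ => x ^ 2) (fun x : ℝ => x ^ 2),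
    integral_bernoulliMeasure]
  simp only [smul_eq_mul]
  ring

lemma integral_abs_pow_dilutedLaw {δ : ℝ} (hδ : 0 ≤ δ) (p : unitInterval) {μ : Measure ℝ}
    [IsProbabilityMeasure μ] {k : ℕ} (hk : k ≠ 0) :
    ∫ x, |x| ^ k ∂(dilutedLaw δ p μ) = δ ^ k * p * ∫ x, |x| ^ k ∂μ := by
  rw [dilutedLaw, integral_map (measurable_diluted δ).aemeasurable (by fun_prop)]
  simp only [abs_mul, mul_pow, abs_of_nonneg hδ]
  rw [integral_const_mul, integral_prod_mul (fun x : ℝ => |x| ^ k) (fun x : ℝ => |x| ^ k),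
    integral_bernoulliMeasure]
  simp only [smul_eq_mul, abs_one, one_pow, abs_zero, zero_pow hk]
  ring

/-- The laws of the entries of a sparse Wigner matrix. -/
noncomputable def sparseLaw (δ : ℝ) (p : unitInterval) (νd νo : Measure ℝ)
    (e : Sym2 (Fin n)) : Measure ℝ :=
  dilutedLaw δ p (if e.IsDiag then νd else νo)

/-- Every positive moment of a Bernoulli variable equals `p`, and `δ² p = 1/n`; thus a `k`-th
absolute moment is `δ^(k-2) / n` times that of the weight. -/
lemma entryLaws_sparseLaw [IsProbabilityMeasure νd] [IsProbabilityMeasure νo]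
    (h : EntryAssumption νd νo) (hnp : 1 ≤ n * (p : ℝ)) :
    EntryLaws (fun k => (∫ x, |x| ^ k ∂νd) + ∫ x, |x| ^ k ∂νo) n (Real.sqrt (n * p))⁻¹
      (sparseLaw (Real.sqrt (n * p))⁻¹ p νd νo) := by
  have hn : 0 < n := Nat.pos_of_ne_zero fun h0 => by
    subst h0
    norm_num at hnp
  have hn0 : (0 : ℝ) < n := by exact_mod_cast hn
  have hnp0 : 0 < n * (p : ℝ) := by linarith
  have hp0 : (p : ℝ) ≠ 0 := fun h0 => by simp [h0] at hnp0
  set δ := (Real.sqrt (n * p))⁻¹ with hδ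
  have hδ0 : 0 < δ := inv_pos.mpr (Real.sqrt_pos.mpr hnp0)
  have hδ2 : δ ^ 2 = (n * (p : ℝ))⁻¹ := by rw [hδ, inv_pow, Real.sq_sqrt hnp0.le]
  have hδp : δ ^ 2 * p = 1 / n := by rw [hδ2]; field_simp
  have hprob : ∀ e : Sym2 (Fin n), IsProbabilityMeasure (if e.IsDiag then νd else νo) := fun e => by
    split_ifs <;> infer_instance
  have hd0 : ∀ k : ℕ, 0 ≤ ∫ x, |x| ^ k ∂νd := fun k => integral_nonneg fun x => by positivity
  have ho0 : ∀ k : ℕ, 0 ≤ ∫ x, |x| ^ k ∂νo := fun k => integral_nonneg fun x => by positivity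
  refine ⟨hn, fun k => add_nonneg (hd0 k) (ho0 k), hδ0, ?_, ?_, fun e => ?_, fun e => ?_,
    fun e => ?_, fun e he => ?_, fun e k hk => ?_⟩
  · exact inv_le_one_of_one_le₀ (by rw [Real.one_le_sqrt]; exact hnp)
  · rw [hδ2, one_div]
    refine inv_anti₀ hnp0 ?_
    nlinarith [p.2.2]
  · unfold sparseLaw; infer_instance
  · refine hasMoments_dilutedLaw _ _ ?_
    split_ifs
    exacts [h.subGaussian_diag.hasMoments, h.subGaussian_off.hasMoments]
  · rw [sparseLaw, integral_dilutedLaw]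
    split_ifs
    · rw [h.mean_diag, mul_zero]
    · rw [h.mean_off, mul_zero]
  · have hv := h.variance_off
    rw [variance_of_integral_eq_zero aemeasurable_id h.mean_off] at hv
    rw [sparseLaw, integral_sq_dilutedLaw, if_neg he, hδp]
    simp only [id] at hv
    rw [hv, mul_one]
  · rw [sparseLaw, integral_abs_pow_dilutedLaw hδ0.le _ (by omega)]
    have hle : ∫ x, |x| ^ k ∂(if e.IsDiag then νd else νo) ≤
        (∫ x, |x| ^ k ∂νd) + ∫ x, |x| ^ k ∂νo := by
      split_ifs
      · linarith [ho0 k]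
      · linarith [hd0 k]
    have hsplit : δ ^ k * p = δ ^ (k - 2) / n := by
      calc δ ^ k * p = δ ^ (k - 2) * (δ ^ 2 * p) := by
            rw [← mul_assoc, ← pow_add, Nat.sub_add_cancel hk]
        _ = _ := by rw [hδp]; ring
    rw [hsplit]
    calc _ ≤ δ ^ (k - 2) / n * ((∫ x, |x| ^ k ∂νd) + ∫ x, |x| ^ k ∂νo) :=
          mul_le_mul_of_nonneg_left hle (by positivity)
      _ = _ := by ring

/-- The infimum and supremum of an unordered pair pick its representative on or above the diagonal,
where the independence hypotheses are formulated. -/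
lemma apply_inf_sup {M : Matrix (Fin n) (Fin n) ℝ} (hM : M.IsSymm) (i j : Fin n) :
    M s(i, j).inf s(i, j).sup = M i j := by
  rcases le_total i j with h | h
  · simp [h]
  · simpa [h] using hM.apply i j

lemma isDiag_iff_inf_eq_sup (e : Sym2 (Fin n)) : e.IsDiag ↔ e.inf = e.sup := by
  induction e with
  | _ i j => simp

lemma IsSparseModel.map_eq_pi (h : IsSparseModel P νd νo p G Ξ) (δ : ℝ) :
    P.map (fun ω (e : Sym2 (Fin n)) => δ * (G ω e.inf e.sup * Ξ ω e.inf e.sup)) =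
      Measure.pi (sparseLaw δ p νd νo) := by
  have hG : ∀ e : Sym2 (Fin n),
      HasLaw (fun ω => G ω e.inf e.sup) (if e.IsDiag then νd else νo) P := fun e => by
    split_ifs with he
    · rw [isDiag_iff_inf_eq_sup] at he
      rw [← he]
      exact h.law_diag _
    · rw [isDiag_iff_inf_eq_sup] at he
      exact h.law_off _ _ (lt_of_le_of_ne (Sym2.inf_le_sup e) he)
  have hΞ : ∀ e : Sym2 (Fin n),
      HasLaw (fun ω => Ξ ω e.inf e.sup) (bernoulliMeasure (1 : ℝ) 0 p) P :=
    fun e => h.law_Ξ _ _ (Sym2.inf_le_sup e)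
  have hind : iIndepFun (Sum.elim (fun (e : Sym2 (Fin n)) ω => G ω e.inf e.sup)
      (fun (e : Sym2 (Fin n)) ω => Ξ ω e.inf e.sup)) P := by
    have h1 := h.indep.precomp (g := Sum.map Sym2.sortEquiv Sym2.sortEquiv)
      (Function.Injective.sumMap (Equiv.injective _) (Equiv.injective _))
    convert h1 using 1
    funext k
    rcases k with e | e <;> rfl
  have := map_pair_eq_pi (fun e => (hG e).aemeasurable) (fun e => (hΞ e).aemeasurable) hind
    (measurable_diluted δ)
  rw [this]
  congr 1
  funext e
  rw [(hG e).map_eq, (hΞ e).map_eq]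
  rfl

lemma continuous_resolventForm_symMatrix {z : ℂ} (hz : 0 < z.im) (u : EuclideanSpace ℝ (Fin n)) :
    Continuous fun x => resolventForm z (symMatrix x) u :=
  continuous_finsetSum _ fun i _ => continuous_finsetSum _ fun j _ =>
    (continuous_const.mul (continuous_resolvent_symMatrix hz i j)).mul continuous_const

lemma IsSparseModel.integral_resolventForm (h : IsSparseModel P νd νo p G Ξ) {z : ℂ}
    (hz : 0 < z.im) (u : EuclideanSpace ℝ (Fin n)) :
    ∫ ω, resolventForm z (sparseWigner p (G ω) (Ξ ω)) u ∂P =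
      ∫ x, resolventForm z (symMatrix x) u
        ∂(Measure.pi (sparseLaw (Real.sqrt (n * p))⁻¹ p νd νo)) := by
  have hm : AEMeasurable (fun ω (e : Sym2 (Fin n)) =>
      (Real.sqrt (n * p))⁻¹ * (G ω e.inf e.sup * Ξ ω e.inf e.sup)) P := by
    refine aemeasurable_pi_lambda _ fun e => ?_
    have h1 : AEMeasurable (fun ω => G ω e.inf e.sup) P := by
      rcases (Sym2.inf_le_sup e).eq_or_lt with he | he
      · rw [← he]; exact (h.law_diag _).aemeasurable
      · exact (h.law_off _ _ he).aemeasurable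
    exact (h1.mul (h.law_Ξ _ _ (Sym2.inf_le_sup e)).aemeasurable).const_mul _
  rw [← h.map_eq_pi, integral_map hm (continuous_resolventForm_symMatrix hz u).aestronglyMeasurable]
  refine integral_congr_ae (ae_of_all _ fun ω => ?_)
  have : sparseWigner p (G ω) (Ξ ω) = symMatrix fun e : Sym2 (Fin n) =>
      (Real.sqrt (n * p))⁻¹ * (G ω e.inf e.sup * Ξ ω e.inf e.sup) := by
    ext i j
    rw [symMatrix_apply, apply_inf_sup (h.symm_G ω), apply_inf_sup (h.symm_Ξ ω)]
    rfl
  simp only [this]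

end SparseModel


/-! ### Dilations of the matrix and of the semicircle transform. -/

section Dilation

variable {n : ℕ} {z : ℂ} {a κ : ℝ}

lemma resolventMatrix_smul (ha : 0 < a) (hz : 0 < z.im) {W : Matrix (Fin n) (Fin n) ℝ}
    (hW : W.IsSymm) :
    resolventMatrix z (a • W) = ((a⁻¹ : ℝ) : ℂ) • resolventMatrix (z / a) W := by
  have ha' : (a : ℂ) ≠ 0 := by exact_mod_cast ha.ne'
  have hz' : 0 < (z / a).im := by
    rw [Complex.div_ofReal_im]; positivity
  let := invertibleOfNonzero ha'
  have hdet := isUnit_det_shifted hW hz'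
  have h1 : z • (1 : Matrix (Fin n) (Fin n) ℂ) - (a • W).map (fun x : ℝ => (x : ℂ)) =
      (a : ℂ) • shifted (z / a) W := by
    ext i j
    simp only [shifted, Matrix.sub_apply, Matrix.smul_apply, Matrix.map_apply, smul_eq_mul]
    push_cast
    field_simp
  rw [resolventMatrix, h1, Matrix.inv_smul _ _ hdet, invOf_eq_inv, Complex.ofReal_inv]
  rfl

lemma resolventForm_smul (ha : 0 < a) (hz : 0 < z.im) {W : Matrix (Fin n) (Fin n) ℝ}
    (hW : W.IsSymm) (u : EuclideanSpace ℝ (Fin n)) :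
    resolventForm z (a • W) u = ((a⁻¹ : ℝ) : ℂ) * resolventForm (z / a) W u := by
  simp only [resolventForm, resolventMatrix_smul ha hz hW, Matrix.smul_apply, smul_eq_mul,
    Finset.mul_sum]
  exact Finset.sum_congr rfl fun i _ => Finset.sum_congr rfl fun j _ => by ring

/-- Since `|Re z|` may be as large as `κ⁻¹`, a deviation of `a` from `1` of order `κ²` is what moves
the real part by at most `κ/2`. -/
lemma div_mem_halfPlane (hκ : κ ∈ Set.Ioo (0 : ℝ) 1) (ha : 1 - κ ^ 2 / 8 ≤ a) (ha1 : a ≤ 1)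
    (hz : z ∈ halfPlane κ) : z / a ∈ halfPlane (κ / 2) := by
  obtain ⟨hκ0, hκ1⟩ := hκ
  obtain ⟨h0, h1, h2, h3⟩ := hz
  have ha2 : 1 / 2 ≤ a := by nlinarith
  have ha0 : 0 < a := by linarith
  have hdiff : |z.re / a - z.re| ≤ κ / 2 := by
    have : z.re / a - z.re = z.re * ((1 - a) / a) := by field_simp
    rw [this, abs_mul, abs_of_nonneg (div_nonneg (by linarith) ha0.le)]
    calc |z.re| * ((1 - a) / a) ≤ κ⁻¹ * (κ ^ 2 / 2) := by
          refine mul_le_mul h1 ?_ (div_nonneg (by linarith) ha0.le) (by positivity)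
          rw [div_le_iff₀ ha0]
          nlinarith [sq_nonneg κ]
      _ = κ / 2 := by field_simp
  refine ⟨?_, ?_, ?_, ?_⟩
  · rw [Complex.div_ofReal_im]; positivity
  · rw [Complex.div_ofReal_re]
    have : κ ≤ κ⁻¹ := hκ1.le.trans (one_le_inv₀ hκ0 |>.mpr hκ1.le)
    have h4 := abs_add_le z.re (z.re / a - z.re)
    rw [add_sub_cancel] at h4
    have h5 : (κ / 2)⁻¹ = 2 * κ⁻¹ := by rw [inv_div]; ring
    rw [h5]
    linarith
  · rw [Complex.div_ofReal_re]
    have h4 := abs_sub (z.re / a + 2) (z.re / a - z.re)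
    rw [show z.re / a + 2 - (z.re / a - z.re) = z.re + 2 by ring] at h4
    linarith
  · rw [Complex.div_ofReal_re]
    have h4 := abs_sub (z.re / a - 2) (z.re / a - z.re)
    rw [show z.re / a - 2 - (z.re / a - z.re) = z.re - 2 by ring] at h4
    linarith

lemma semicircleStieltjes_im_nonpos (hz : 0 < z.im) : (semicircleStieltjes z).im ≤ 0 := by
  set m := semicircleStieltjes z with hm
  have hm1 : ‖m‖ < 1 := (semicircleStieltjes_spec hz).1
  have hpos : 0 < ‖m‖ := norm_pos_iff.mpr (semicircleStieltjes_ne_zero hz)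
  have hzm : z = m + m⁻¹ := by rw [← sub_semicircleStieltjes hz]; ring
  have him : z.im = m.im * (1 - 1 / ‖m‖ ^ 2) := by
    rw [hzm, Complex.add_im, Complex.inv_im, ← Complex.sq_norm m]; ring
  have hr1 : 1 < 1 / ‖m‖ ^ 2 := by
    rw [lt_div_iff₀ (by positivity)]; nlinarith
  by_contra h
  push Not at h
  have : m.im * (1 - 1 / ‖m‖ ^ 2) ≤ 0 := mul_nonpos_of_nonneg_of_nonpos h.le (by linarith)
  linarith

/-- Stability of the Stieltjes transform of the semicircle law under dilations. -/
lemma norm_dilated_semicircleStieltjes_sub_le (hκ : κ ∈ Set.Ioo (0 : ℝ) 1)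
    (ha : 1 - κ ^ 2 / 8 ≤ a) (ha1 : a ≤ 1) (hz : z ∈ halfPlane κ) :
    ‖((a⁻¹ : ℝ) : ℂ) * semicircleStieltjes (z / a) - semicircleStieltjes z‖ ≤
      ((a ^ 2)⁻¹ - 1) / (κ / 4) := by
  have hza := div_mem_halfPlane hκ ha ha1 hz
  obtain ⟨hκ0, hκ1⟩ := hκ
  have ha0 : 0 < a := by nlinarith
  have ha' : (a : ℂ) ≠ 0 := by exact_mod_cast ha0.ne'
  have hz0 := hz.1
  set m' := semicircleStieltjes (z / a) with hm'
  obtain ⟨hn, hq⟩ := semicircleStieltjes_spec hza.1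
  rw [← hm'] at hn hq
  set g := ((a⁻¹ : ℝ) : ℂ) * m' with hg
  have hinv : 1 ≤ (a ^ 2)⁻¹ := (one_le_inv₀ (by positivity)).mpr (by nlinarith)
  refine norm_sub_semicircleStieltjes_le hz0 (by positivity) ?_ ?_
  · have : g * (z - g) - 1 = ((1 - (a ^ 2)⁻¹ : ℝ) : ℂ) * m' ^ 2 := by
      have h1 : z / a * m' = m' ^ 2 + 1 := by linear_combination -hq
      have h2 : g * z = m' ^ 2 + 1 := by
        rw [← h1, hg]; push_cast; field_simp
      rw [mul_sub, h2, hg]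
      push_cast
      field_simp
      ring
    rw [this, norm_mul, Complex.norm_real, Real.norm_eq_abs, abs_sub_comm,
      abs_of_nonneg (by linarith), norm_pow]
    exact mul_le_of_le_one_right (by linarith) (pow_le_one₀ (norm_nonneg _) hn.le)
  · rcases semicircleStieltjes_dichotomy hκ0 hκ1 hz with ⟨-, h⟩ | ⟨hout, h⟩
    · refine le_norm_sub_inv_of_im h ?_
      rw [hg, Complex.im_ofReal_mul]
      exact mul_nonpos_of_nonneg_of_nonpos (by positivity) (semicircleStieltjes_im_nonpos hza.1)
    · refine le_norm_sub_inv_of_norm (semicircleStieltjes_ne_zero hz0) h ?_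
      have hre : 2 ≤ |z.re| := by
        obtain ⟨-, -, h2, h3⟩ := hz
        by_contra hlt
        push Not at hlt hout
        rcases abs_cases z.re with ⟨e, -⟩ | ⟨e, -⟩ <;> rw [e] at hlt hout
        · rw [abs_of_neg (by linarith)] at h3; linarith
        · rw [abs_of_pos (by linarith)] at h2; linarith
      have hre' : 2 ≤ |(z / a).re| := by
        rw [Complex.div_ofReal_re, abs_div, abs_of_pos ha0, le_div_iff₀ ha0]
        nlinarith
      rcases semicircleStieltjes_dichotomy (half_pos hκ0) (by linarith) hza with
        ⟨h1, -⟩ | ⟨-, h1⟩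
      · linarith
      · rw [hg, norm_mul, Complex.norm_real, Real.norm_eq_abs, abs_of_pos (inv_pos.mpr ha0),
          inv_mul_le_iff₀ ha0, mul_one]
        refine h1.trans ?_
        nlinarith

end Dilation


/-! ### The centred adjacency matrix in the product model. -/

section ErdosRenyi

variable {n : ℕ} {Ω : Type*} [MeasurableSpace Ω] {P : Measure Ω} {p : unitInterval}
  {A : Ω → Matrix (Fin n) (Fin n) ℝ}

/-- The law of `b (ξ - p)` for `ξ ∼ Ber(p)`. -/
noncomputable def centredBernoulli (b : ℝ) (p : unitInterval) : Measure ℝ :=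
  (bernoulliMeasure (1 : ℝ) 0 p).map fun x => b * (x - p)

lemma measurable_centredBernoulli (b : ℝ) (p : unitInterval) :
    Measurable fun x : ℝ => b * (x - p) := by fun_prop

instance (b : ℝ) (p : unitInterval) : IsProbabilityMeasure (centredBernoulli b p) :=
  Measure.isProbabilityMeasure_map (measurable_centredBernoulli b p).aemeasurable

lemma integral_centredBernoulli (b : ℝ) (p : unitInterval) {f : ℝ → ℝ} (hf : Continuous f) :
    ∫ x, f x ∂(centredBernoulli b p) =
      p * f (b * (1 - p)) + (1 - p) * f (b * (0 - p)) := by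
  rw [centredBernoulli, integral_map (measurable_centredBernoulli b p).aemeasurable
    hf.aestronglyMeasurable, integral_bernoulliMeasure]
  simp only [smul_eq_mul]

lemma hasMoments_centredBernoulli (b : ℝ) (p : unitInterval) :
    HasMoments (fun x : ℝ => x) (centredBernoulli b p) := fun k => by
  refine (memLp_map_measure_iff aestronglyMeasurable_id
    (measurable_centredBernoulli b p).aemeasurable).mpr ?_
  exact ((hasMoments_bernoulli p).add (HasMoments.const (-(p : ℝ)))).const_mul b k

/-- The laws of the entries of a centred adjacency matrix. -/
noncomputable def erdosRenyiLaw (b : ℝ) (p : unitInterval) (e : Sym2 (Fin n)) : Measure ℝ :=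
  if e.IsDiag then Measure.dirac 0 else centredBernoulli b p

/-- Dividing by `√(np(1-p))` makes the off-diagonal variance exactly `1/n`. As `1 - p ≥ 1/4`, this
scale is at most twice `δ`, whence the constants `2^k`. -/
lemma entryLaws_erdosRenyiLaw (hnp : 1 ≤ n * (p : ℝ)) (hp : (p : ℝ) ≤ 3 / 4) :
    EntryLaws (fun k => 2 ^ k) n (Real.sqrt (n * p))⁻¹
      (erdosRenyiLaw (Real.sqrt (n * p * (1 - p)))⁻¹ p) := by
  have hn : 0 < n := Nat.pos_of_ne_zero fun h0 => by
    subst h0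
    norm_num at hnp
  have hn0 : (0 : ℝ) < n := by exact_mod_cast hn
  have hnp0 : 0 < n * (p : ℝ) := by linarith
  have hp0 : 0 < (p : ℝ) := pos_of_mul_pos_right hnp0 hn0.le
  have hq0 : 0 < 1 - (p : ℝ) := by linarith
  set δ := (Real.sqrt (n * p))⁻¹ with hδ
  set b := (Real.sqrt (n * p * (1 - p)))⁻¹ with hb
  have hδ0 : 0 < δ := inv_pos.mpr (Real.sqrt_pos.mpr hnp0)
  have hδ2 : δ ^ 2 = (n * (p : ℝ))⁻¹ := by rw [hδ, inv_pow, Real.sq_sqrt hnp0.le]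
  have hb0 : 0 < b := inv_pos.mpr (Real.sqrt_pos.mpr (by positivity))
  have hb2 : b ^ 2 = (n * (p : ℝ) * (1 - p))⁻¹ := by
    rw [hb, inv_pow, Real.sq_sqrt (by positivity)]
  have hbδ : b ≤ 2 * δ := by
    refine le_of_sq_le_sq ?_ (by positivity)
    rw [mul_pow, hb2, hδ2, mul_inv, mul_comm]
    refine mul_le_mul_of_nonneg_right ?_ (by positivity)
    rw [inv_le_comm₀ hq0 (by norm_num)]
    linarith
  have hbp : b ^ 2 * (p * (1 - p)) = 1 / n := by rw [hb2]; field_simp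
  refine ⟨hn, fun k => by positivity, hδ0, ?_, ?_, fun e => ?_, fun e => ?_, fun e => ?_,
    fun e he => ?_, fun e k hk => ?_⟩
  · exact inv_le_one_of_one_le₀ (by rw [Real.one_le_sqrt]; exact hnp)
  · rw [hδ2, one_div]
    refine inv_anti₀ hnp0 ?_
    nlinarith [p.2.2]
  · unfold erdosRenyiLaw; split_ifs <;> infer_instance
  · unfold erdosRenyiLaw
    split_ifs
    · exact fun k => MemLp.of_bound aestronglyMeasurable_id 0 (by simp)
    · exact hasMoments_centredBernoulli b p
  · unfold erdosRenyiLaw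
    split_ifs
    · simp
    · rw [integral_centredBernoulli b p (f := fun x => x) continuous_id]
      ring
  · rw [erdosRenyiLaw, if_neg he, integral_centredBernoulli b p (f := fun x => x ^ 2) (by fun_prop),
      ← hbp]
    ring
  · unfold erdosRenyiLaw
    split_ifs
    · rw [integral_dirac, abs_zero, zero_pow (by omega)]
      positivity
    · rw [integral_centredBernoulli b p (f := fun x => |x| ^ k) (by fun_prop)]
      have h1 : ∀ y : ℝ, |y| ≤ 1 → |b * y| ^ k ≤ b ^ k * y ^ 2 := fun y hy => by
        rw [abs_mul, abs_of_pos hb0, mul_pow, ← sq_abs y]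
        exact mul_le_mul_of_nonneg_left (pow_le_pow_of_le_one (abs_nonneg y) hy hk)
          (by positivity)
      have h2 := h1 (1 - p) (by rw [abs_of_pos hq0]; linarith)
      have h3 := h1 (0 - p) (by rw [zero_sub, abs_neg, abs_of_pos hp0]; linarith)
      calc _ ≤ p * (b ^ k * (1 - p) ^ 2) + (1 - p) * (b ^ k * (0 - p) ^ 2) := by gcongr
        _ = b ^ (k - 2) * (b ^ 2 * (p * (1 - p))) := by
            rw [← mul_assoc (b ^ (k - 2)), ← pow_add, Nat.sub_add_cancel hk]; ring
        _ = b ^ (k - 2) / n := by rw [hbp]; ring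
        _ ≤ (2 * δ) ^ (k - 2) / n := by gcongr
        _ ≤ _ := by
            rw [mul_pow]
            gcongr
            · norm_num
            · omega

lemma IsErdosRenyi.aemeasurable (h : IsErdosRenyi P p A) (e : Sym2 (Fin n)) :
    AEMeasurable (fun ω => A ω e.inf e.sup) P := by
  rcases (Sym2.inf_le_sup e).eq_or_lt with he | he
  · rw [← he]
    simp only [h.diag]
    exact aemeasurable_const
  · exact (h.law _ _ he).aemeasurable

/-- The centred and rescaled entries of the adjacency matrix. -/
noncomputable def centredEntry (b : ℝ) (p : unitInterval) (A : Ω → Matrix (Fin n) (Fin n) ℝ)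
    (e : Sym2 (Fin n)) (ω : Ω) : ℝ :=
  if e.IsDiag then 0 else b * (A ω e.inf e.sup - p)

lemma IsErdosRenyi.aemeasurable_centredEntry (h : IsErdosRenyi P p A) (b : ℝ)
    (e : Sym2 (Fin n)) : AEMeasurable (centredEntry b p A e) P := by
  unfold centredEntry
  split_ifs
  · exact aemeasurable_const
  · exact ((h.aemeasurable e).sub_const _).const_mul _

lemma IsErdosRenyi.map_eq_pi [IsProbabilityMeasure P] (h : IsErdosRenyi P p A) (b : ℝ) :
    P.map (fun ω e => centredEntry b p A e ω) = Measure.pi (erdosRenyiLaw b p) := by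
  have hlt : ∀ e : {e : Sym2 (Fin n) // ¬ e.IsDiag}, e.1.inf < e.1.sup := fun e =>
    lt_of_le_of_ne (Sym2.inf_le_sup e.1) fun he => e.2 ((isDiag_iff_inf_eq_sup e.1).mpr he)
  have hind : iIndepFun (fun (e : {e : Sym2 (Fin n) // ¬ e.IsDiag}) => centredEntry b p A e) P := by
    have h1 := h.indep.precomp
      (g := fun e : {e : Sym2 (Fin n) // ¬ e.IsDiag} => ⟨(e.1.inf, e.1.sup), hlt e⟩) (by
        intro e e' hee
        have h2 := congrArg Subtype.val hee
        exact Subtype.ext (Sym2.sortEquiv.injective (Subtype.ext h2)))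
    have h2 := h1.comp (fun _ x => b * (x - p)) fun _ => measurable_centredBernoulli b p
    convert h2 using 1
    funext e ω
    simp [centredEntry, e.2]
  rw [map_eq_pi_of_const (fun e => h.aemeasurable_centredEntry b e)
    (fun e he ω => by rw [centredEntry, if_pos (not_not.mp he)]) hind]
  congr 1
  funext e
  by_cases he : e.IsDiag
  · have : centredEntry b p A e = fun _ => 0 := by
      funext ω
      rw [centredEntry, if_pos he]
    rw [this, Measure.map_const, measure_univ, one_smul, erdosRenyiLaw, if_pos he]
  · have hl := h.law _ _ (hlt ⟨e, he⟩)
    have : centredEntry b p A e = (fun x => b * (x - p)) ∘ fun ω => A ω e.inf e.sup := by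
      funext ω
      simp [centredEntry, he]
    rw [this, ← AEMeasurable.map_map_of_aemeasurable
      (measurable_centredBernoulli b p).aemeasurable (h.aemeasurable e), hl.map_eq, erdosRenyiLaw,
      if_neg he]
    rfl

lemma IsErdosRenyi.integral_apply (h : IsErdosRenyi P p A) {i j : Fin n} (hij : i ≠ j) :
    ∫ ω, A ω i j ∂P = p := by
  have key : ∀ i j : Fin n, i < j → ∫ ω, A ω i j ∂P = p := fun i j hij => by
    rw [(h.law i j hij).integral_eq, integral_bernoulliMeasure]
    simp
  rcases hij.lt_or_gt with hlt | hlt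
  · exact key i j hlt
  · rw [← key j i hlt]
    exact integral_congr_ae (ae_of_all _ fun ω => ((h.symm ω).apply i j).symm)

lemma IsErdosRenyi.smul_centred (h : IsErdosRenyi P p A) (hp : (p : ℝ) < 1) (ω : Ω) :
    (Real.sqrt (n * p))⁻¹ • centred P A ω = Real.sqrt (1 - p) •
      symMatrix fun e => centredEntry (Real.sqrt (n * p * (1 - p)))⁻¹ p A e ω := by
  have hq : 0 < Real.sqrt (1 - p) := Real.sqrt_pos.mpr (by linarith)
  have hb : Real.sqrt (1 - p) * (Real.sqrt (n * p * (1 - p)))⁻¹ = (Real.sqrt (n * p))⁻¹ := by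
    have hnp : 0 ≤ n * (p : ℝ) := mul_nonneg (Nat.cast_nonneg n) p.2.1
    rw [Real.sqrt_mul hnp, mul_inv, mul_comm, mul_assoc, inv_mul_cancel₀ hq.ne', mul_one]
  ext i j
  rw [Matrix.smul_apply, Matrix.smul_apply, symMatrix_apply, smul_eq_mul, smul_eq_mul, centred,
    Matrix.of_apply, centredEntry]
  by_cases hij : i = j
  · subst hij
    simp [h.diag]
  · rw [h.integral_apply hij, if_neg (by simpa using hij), apply_inf_sup (h.symm ω), ← mul_assoc, hb]

lemma IsErdosRenyi.integral_resolventForm [IsProbabilityMeasure P] (h : IsErdosRenyi P p A)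
    (hp : (p : ℝ) < 1) {z : ℂ} (hz : 0 < z.im) (u : EuclideanSpace ℝ (Fin n)) :
    ∫ ω, resolventForm z ((Real.sqrt (n * p))⁻¹ • centred P A ω) u ∂P =
      (((Real.sqrt (1 - p))⁻¹ : ℝ) : ℂ) *
        ∫ x, resolventForm (z / (Real.sqrt (1 - p) : ℝ)) (symMatrix x) u
          ∂(Measure.pi (erdosRenyiLaw (Real.sqrt (n * p * (1 - p)))⁻¹ p)) := by
  have hq : 0 < Real.sqrt (1 - p) := Real.sqrt_pos.mpr (by linarith)
  have hz' : 0 < (z / (Real.sqrt (1 - p) : ℝ)).im := by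
    rw [Complex.div_ofReal_im]; positivity
  simp only [h.smul_centred hp, resolventForm_smul hq hz (symMatrix_isSymm _)]
  rw [integral_const_mul, ← h.map_eq_pi, integral_map
    (aemeasurable_pi_lambda _ fun e => h.aemeasurable_centredEntry _ e)
    (continuous_resolventForm_symMatrix hz' u).aestronglyMeasurable]

end ErdosRenyi


/-! ### Passage to the limit. -/

section Limit

variable {p : ℕ → unitInterval} {κ ε c : ℝ} {s : ℕ → ℝ}

lemma tendsto_isotropicError_of_le {Ω : ℕ → Type*} [∀ n, MeasurableSpace (Ω n)]
    {P : ∀ n, Measure (Ω n)} {W : ∀ n, Ω n → Matrix (Fin n) (Fin n) ℝ} {b : ℕ → ℝ}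
    (hb : Tendsto b atTop (𝓝 0))
    (h : ∀ᶠ n in atTop, ∀ z ∈ spectralDomain κ ε c n (p n) (s n),
      ∀ u ∈ testVectors n (p n) (s n),
      ‖(∫ ω, resolventForm z (W n ω) u ∂(P n)) - semicircleStieltjes z‖ ≤ b n) :
    Tendsto (fun n => isotropicError κ ε c (p n) (s n) (P n) (W n)) atTop (𝓝 0) := by
  have hb' : Tendsto (fun n => ENNReal.ofReal (b n)) atTop (𝓝 0) := by
    simpa using ENNReal.tendsto_ofReal hb
  refine tendsto_of_tendsto_of_tendsto_of_le_of_le' tendsto_const_nhds hb'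
    (Eventually.of_forall fun n => zero_le) ?_
  filter_upwards [h] with n hn
  refine iSup₂_le fun z hz => iSup₂_le fun u hu => ?_
  rw [← ofReal_norm]
  exact ENNReal.ofReal_le_ofReal (hn z hz u hu)

lemma tendsto_mul_atTop_of_log
    (hp : (fun n : ℕ => Real.log n) =o[atTop] (fun n : ℕ => (n : ℝ) * (p n : ℝ))) :
    Tendsto (fun n : ℕ => (n : ℝ) * (p n : ℝ)) atTop atTop := by
  refine tendsto_atTop_mono' atTop ?_ (Real.tendsto_log_atTop.comp tendsto_natCast_atTop_atTop)
  filter_upwards [hp.bound one_pos] with n hn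
  rw [one_mul, Real.norm_eq_abs, Real.norm_eq_abs,
    abs_of_nonneg (mul_nonneg (Nat.cast_nonneg n) (p n).2.1)] at hn
  exact (le_abs_self _).trans hn

lemma tendsto_zero_of_mul_isLittleO
    (hp : (fun n : ℕ => (n : ℝ) * (p n : ℝ)) =o[atTop] (fun n : ℕ => (n : ℝ))) :
    Tendsto (fun n => (p n : ℝ)) atTop (𝓝 0) := by
  refine hp.tendsto_div_nhds_zero.congr' ?_
  filter_upwards [eventually_ge_atTop 1] with n hn
  have : (n : ℝ) ≠ 0 := by positivity
  field_simp

lemma tendsto_errorScale (hε : 0 < ε)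
    (hp : Tendsto (fun n : ℕ => (n : ℝ) * (p n : ℝ)) atTop atTop) :
    Tendsto (fun n : ℕ => errorScale ε n (p n)) atTop (𝓝 0) := by
  refine (tendsto_rpow_neg_atTop (y := 1 / 8) (by norm_num)).comp ?_
  refine tendsto_atTop.mpr fun b => ?_
  filter_upwards [tendsto_atTop.mp hp b, tendsto_atTop.mp
    ((tendsto_rpow_atTop hε).comp tendsto_natCast_atTop_atTop) b] with n h1 h2
  exact le_min h1 h2

lemma tendsto_error (hε : 0 < ε)
    (hp : Tendsto (fun n : ℕ => (n : ℝ) * (p n : ℝ)) atTop atTop) (hs : Tendsto s atTop (𝓝 0)) :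
    Tendsto (fun n : ℕ => errorScale ε n (p n) + s n ^ 2 + (Real.sqrt (n * p n))⁻¹) atTop
      (𝓝 0) := by
  have h1 := tendsto_errorScale hε hp
  have h2 : Tendsto (fun n => s n ^ 2) atTop (𝓝 0) := by simpa using hs.pow 2
  have h3 : Tendsto (fun n : ℕ => (Real.sqrt (n * p n))⁻¹) atTop (𝓝 0) :=
    tendsto_inv_atTop_zero.comp (Real.tendsto_sqrt_atTop.comp hp)
  simpa using (h1.add h2).add h3

theorem tendsto_isotropicError_sparseWigner (hκ : κ ∈ Set.Ioo (0 : ℝ) 1) (hε : 0 < ε)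
    (hp : Tendsto (fun n : ℕ => (n : ℝ) * (p n : ℝ)) atTop atTop)
    (hs_lower : ∀ n : ℕ, 1 ≤ n → (n : ℝ) ^ (-1 + ε) ≤ s n) (hs : Tendsto s atTop (𝓝 0))
    {νd νo : Measure ℝ} [IsProbabilityMeasure νd] [IsProbabilityMeasure νo]
    (hν : EntryAssumption νd νo) {Ω : ℕ → Type*} [∀ n, MeasurableSpace (Ω n)]
    {P : ∀ n, Measure (Ω n)} {G Ξ : ∀ n, Ω n → Matrix (Fin n) (Fin n) ℝ}
    (h : ∀ n, IsSparseModel (P n) νd νo (p n) (G n) (Ξ n)) :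
    Tendsto (fun n => isotropicError κ ε c (p n) (s n) (P n)
      (fun ω => sparseWigner (p n) (G n ω) (Ξ n ω))) atTop (𝓝 0) := by
  obtain ⟨C, hC, H⟩ := exists_isotropic_le hκ hε c
    (fun k => (∫ x, |x| ^ k ∂νd) + ∫ x, |x| ^ k ∂νo)
  have hlim := (tendsto_error hε hp hs).const_mul C
  rw [mul_zero] at hlim
  refine tendsto_isotropicError_of_le hlim ?_
  filter_upwards [tendsto_atTop.mp hp 1, eventually_ge_atTop 1] with n hnp hn z hz u hu
  rw [(h n).integral_resolventForm hz.1.1]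
  exact H n (p n) (s n) _ hnp (hs_lower n hn) (entryLaws_sparseLaw hν hnp) z hz.1 hz.2.1 u hu

theorem tendsto_isotropicError_erdosRenyi (hκ : κ ∈ Set.Ioo (0 : ℝ) 1) (hε : 0 < ε)
    (hp : Tendsto (fun n : ℕ => (n : ℝ) * (p n : ℝ)) atTop atTop)
    (hp0 : Tendsto (fun n => (p n : ℝ)) atTop (𝓝 0))
    (hs_lower : ∀ n : ℕ, 1 ≤ n → (n : ℝ) ^ (-1 + ε) ≤ s n) (hs : Tendsto s atTop (𝓝 0))
    {Ω : ℕ → Type*} [∀ n, MeasurableSpace (Ω n)]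
    {P : ∀ n, Measure (Ω n)} [∀ n, IsProbabilityMeasure (P n)]
    {A : ∀ n, Ω n → Matrix (Fin n) (Fin n) ℝ} (h : ∀ n, IsErdosRenyi (P n) (p n) (A n)) :
    Tendsto (fun n => isotropicError κ ε c (p n) (s n) (P n)
      (fun ω => (Real.sqrt (n * (p n : ℝ)))⁻¹ • centred (P n) (A n) ω)) atTop (𝓝 0) := by
  have hκ0 := hκ.1
  have hκ1 := hκ.2
  -- The bound is applied at `z / √(1-p)`, which is only known to lie in the domain with parameter
  -- `κ/2`.
  obtain ⟨C, hC, H⟩ := exists_isotropic_le (κ := κ / 2) ⟨by linarith, by linarith⟩ hε c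
    (fun k => 2 ^ k)
  have hlim : Tendsto (fun n : ℕ => 2 * (C * (errorScale ε n (p n) + s n ^ 2 +
      (Real.sqrt (n * p n))⁻¹)) + 8 / κ * p n) atTop (𝓝 0) := by
    have := (((tendsto_error hε hp hs).const_mul C).const_mul 2).add (hp0.const_mul (8 / κ))
    rwa [mul_zero, mul_zero, mul_zero, add_zero] at this
  refine tendsto_isotropicError_of_le hlim ?_
  have hsmall : ∀ᶠ n in atTop, (p n : ℝ) ≤ κ ^ 2 / 8 :=
    hp0.eventually_le_const (by positivity)
  filter_upwards [tendsto_atTop.mp hp 1, eventually_ge_atTop 1, hsmall] with n hnp hn hpκ z hz u hu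
  have hpn := (p n).2.1
  have hp4 : (p n : ℝ) ≤ 1 / 8 := by nlinarith
  have hz0 := hz.1.1
  set q : ℝ := 1 - p n with hq
  have hq0 : 0 < q := by linarith
  have hq1 : q ≤ 1 := by linarith
  rw [(h n).integral_resolventForm (by linarith) hz0, ← hq]
  set a := Real.sqrt q with ha
  have ha0 : 0 < a := Real.sqrt_pos.mpr hq0
  have ha2 : a ^ 2 = q := Real.sq_sqrt hq0.le
  have ha1 : a ≤ 1 := by rw [ha, Real.sqrt_le_one]; exact hq1
  have hqa : q ≤ a := by nlinarith
  have haκ : 1 - κ ^ 2 / 8 ≤ a := by linarith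
  have hainv : a⁻¹ ≤ 2 := by rw [inv_le_comm₀ ha0 (by norm_num)]; linarith
  have him : z.im ≤ (z / (a : ℂ)).im := by
    rw [Complex.div_ofReal_im, le_div_iff₀ ha0]
    nlinarith
  have h1 := H n (p n) (s n) _ hnp (hs_lower n hn) (entryLaws_erdosRenyiLaw hnp (by linarith))
    (z / a) (div_mem_halfPlane hκ haκ ha1 hz.1) (hz.2.1.trans him) u hu
  have h2 := norm_dilated_semicircleStieltjes_sub_le hκ haκ ha1 hz.1
  rw [← hq] at h1
  set I := ∫ x, resolventForm (z / a) (symMatrix x) u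
    ∂(Measure.pi (erdosRenyiLaw (Real.sqrt (n * p n * q))⁻¹ (p n)))
  have h3 : ((a ^ 2)⁻¹ - 1) / (κ / 4) ≤ 8 / κ * p n := by
    have : (a ^ 2)⁻¹ - 1 ≤ 2 * p n := by
      rw [ha2, sub_le_iff_le_add, inv_le_iff_one_le_mul₀ hq0]
      nlinarith
    calc _ ≤ 2 * p n / (κ / 4) := by gcongr
      _ = _ := by rw [div_div_eq_mul_div]; ring
  calc _ = ‖((a⁻¹ : ℝ) : ℂ) * (I - semicircleStieltjes (z / a)) +
        (((a⁻¹ : ℝ) : ℂ) * semicircleStieltjes (z / a) - semicircleStieltjes z)‖ := by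
        congr 1; ring
    _ ≤ a⁻¹ * ‖I - semicircleStieltjes (z / a)‖ +
        ‖((a⁻¹ : ℝ) : ℂ) * semicircleStieltjes (z / a) - semicircleStieltjes z‖ := by
        refine (norm_add_le _ _).trans ?_
        rw [norm_mul, Complex.norm_real, Real.norm_eq_abs, abs_of_pos (inv_pos.mpr ha0)]
    _ ≤ _ := add_le_add (mul_le_mul hainv h1 (norm_nonneg _) (by norm_num)) (h2.trans h3)

end Limit

end SparseWigner

theorem mainTheorem7
    (p : ℕ → unitInterval)
    (hp_lower : (fun n : ℕ => Real.log n) =o[atTop] (fun n : ℕ => (n : ℝ) * (p n : ℝ)))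
    (hp_upper : (fun n : ℕ => (n : ℝ) * (p n : ℝ)) =o[atTop] (fun n : ℕ => (n : ℝ)))
    (κ : ℝ) (hκ : κ ∈ Set.Ioo (0 : ℝ) 1)
    (ε : ℝ) (hε : ε ∈ Set.Ioo (0 : ℝ) 1)
    (c : ℝ) (hc : 0 < c)
    (s : ℕ → ℝ) (hs_pos : ∀ n, 0 < s n)
    (hs_lower : ∀ n : ℕ, 1 ≤ n → (n : ℝ) ^ (-1 + ε) ≤ s n)
    (hs_lim : Tendsto s atTop (𝓝 0)) :
    (∀ (νd νo : Measure ℝ) [IsProbabilityMeasure νd] [IsProbabilityMeasure νo],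
      SparseWigner.EntryAssumption νd νo →
      ∀ (Ω : ℕ → Type*) [∀ n, MeasurableSpace (Ω n)]
        (P : ∀ n, Measure (Ω n)) [∀ n, IsProbabilityMeasure (P n)]
        (G Ξ : ∀ n, Ω n → Matrix (Fin n) (Fin n) ℝ),
      (∀ n, SparseWigner.IsSparseModel (P n) νd νo (p n) (G n) (Ξ n)) →
      Tendsto (fun n => SparseWigner.isotropicError κ ε c (p n) (s n) (P n)
        (fun ω => SparseWigner.sparseWigner (p n) (G n ω) (Ξ n ω))) atTop (𝓝 0)) ∧
    (∀ (Ω : ℕ → Type*) [∀ n, MeasurableSpace (Ω n)]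
        (P : ∀ n, Measure (Ω n)) [∀ n, IsProbabilityMeasure (P n)]
        (A : ∀ n, Ω n → Matrix (Fin n) (Fin n) ℝ),
      (∀ n, SparseWigner.IsErdosRenyi (P n) (p n) (A n)) →
      Tendsto (fun n => SparseWigner.isotropicError κ ε c (p n) (s n) (P n)
        (fun ω => (Real.sqrt (n * (p n : ℝ)))⁻¹ • SparseWigner.centred (P n) (A n) ω))
        atTop (𝓝 0)) := by
  have hp := SparseWigner.tendsto_mul_atTop_of_log hp_lower
  refine ⟨fun νd νo _ _ hν Ω _ P _ G Ξ h =>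
    SparseWigner.tendsto_isotropicError_sparseWigner hκ hε.1 hp hs_lower hs_lim hν h,
    fun Ω _ P _ A h => SparseWigner.tendsto_isotropicError_erdosRenyi hκ hε.1 hp
      (SparseWigner.tendsto_zero_of_mul_isLittleO hp_upper) hs_lower hs_lim h⟩
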